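/- **Conventions.** All spaces are locally compact Hausdorff; a Real space is such a space with a continuous involution $x\mapsto\bar x$. A Real groupoid $\mathcal G\rightrightarrows X$ is a locally compact Hausdorff topological groupoid with open range map and a $2$-periodic strict homeomorphism $g\mapsto \bar g$. $\mathrm S$ is a locally compact Hausdorff abelian group with a continuous involutive automorphism $\lambda\mapsto\bar\lambda$ and a fixed element $-1\in\mathrm S$ with $(-1)^2=1$, $\overline{-1}=-1$ (for $\mathrm S=\mathbb S^1$ the usual one). A map is locally split if it is surjective and has continuous local sections near each point of its target; principal bundles (for groups and groupoids) are assumed locally split. A Real open cover of $X$ is an open cover $\mathcal U=(U_j)_{j\in J}$ with an involution $j\mapsto\bar j$ of $J$ such that $U_{\bar j}=\overline{U_j}$. $\mathcal G[\mathcal U]$ is the Real groupoid over $\coprod_j U_j$ of triples $(j_0,g,j_1)$ with $r(g)\in U_{j_0}$, $s(g)\in U_{j_1}$, and $\iota_{\mathcal U}:\mathcal G[\mathcal U]\to\mathcal G$, $(j_0,g,j_1)\mapsto g$. A refinement $\theta:\mathcal V=(V_i)_{i\in I}\to\mathcal U$ is a map $\theta:I\to J$ commuting with the involutions with $V_i\subseteq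 U_{\theta(i)}$; it induces $\mathcal G[\mathcal V]\to\mathcal G[\mathcal U]$. A Real graded $\mathrm S$-twist $(\tilde\Gamma,\delta)$ over a Real groupoid $\Gamma\rightrightarrows Y$ is a Real groupoid $\tilde\Gamma\rightrightarrows Y$ with a Real strict homomorphism $\pi:\tilde\Gamma\to\Gamma$ that is the identity on $Y$, a Real $\mathrm S$-action on $\tilde\Gamma$ with $(\lambda\gamma)(\mu\gamma')=\lambda\mu\,\gamma\gamma'$ making $\pi$ a Real principal $\mathrm S$-bundle, and a continuous homomorphism $\delta:\Gamma\to\mathbb Z_2$ with $\delta(\bar\gamma)=\delta(\gamma)$. The tensor product of $(\tilde\Gamma_1,\delta_1)$, $(\tilde\Gamma_2,\delta_2)$ is $(\tilde\Gamma_1\times_\Gamma\tilde\Gamma_2/(\gamma_1,\gamma_2)\sim(\lambda\gamma_1,\lambda^{-1}\gamma_2),\ \delta_1+\delta_2)$ with product $[\gamma_1,\gamma_2][\gamma_1',\gamma_2']=(-1)^{\delta_2(\gamma_2)\delta_1(\gamma_1')}[\gamma_1\gamma_1',\gamma_2\gamma_2']$. For a Real principal $\mathrm S$-bundle $\Lambda\to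 Y$ one has the twist $(r^*\Lambda\otimes\overline{s^*\Lambda},0)$. $\widehat{\mathrm{ext}R}(\Gamma,\mathrm S)$ is the abelian group (under tensor product) of isomorphism classes of Real graded $\mathrm S$-twists over $\Gamma$, modulo the classes of twists $(r^*\Lambda\otimes\overline{s^*\Lambda},0)$. A Real Morita equivalence $P:\Gamma\to\mathcal G$ is a Real space with commuting Real actions of $\Gamma$ (left) and $\mathcal G$ (right) along continuous open maps $Y\leftarrow P\to X$, such that $P\to Y$ is a principal $\mathcal G$-bundle and $P\to X$ a principal $\Gamma$-bundle. A Real graded $\mathrm S$-central extension of $\mathcal G$ is $(\tilde\Gamma,\Gamma,\delta,P)$ with $(\tilde\Gamma,\delta)$ a Real graded $\mathrm S$-twist over a Real groupoid $\Gamma$ and $P:\Gamma\to\mathcal G$ a Real Morita equivalence. Two of them are equivalent if there is an $\mathrm S$-equivariant Real Morita equivalence $Z:\tilde\Gamma_1\to\tilde\Gamma_2$ such that $P_2\circ(Z/\mathrm S)\cong P_1$ and $\delta_2\circ(Z/\mathrm S)\cong\delta_1$ as Real generalized homomorphisms. $\widehat{\mathrm{Ext}R}(\mathcal G,\mathrm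 S)$ is the set of equivalence classes. The tensor product of two extensions is obtained by pulling both twists back to the groupoid $\mathfrak r^*\Gamma_1\cong\mathfrak s^*\Gamma_2$ over $Z=P_1\times_{\mathcal G}P_2^{-1}$, where $\mathfrak r:Z\to Y_1$ and $\mathfrak s:Z\to Y_2$ are the structure maps, taking their tensor product there, and using the composite $\mathfrak r^*\Gamma_1\to\Gamma_1\xrightarrow{P_1}\mathcal G$. **Proposition.** Let $\mathcal G\rightrightarrows X$ be a Real groupoid. Tensor products of extensions and of twists make $\widehat{\mathrm{Ext}R}(\mathcal G,\mathrm S)$ and all $\widehat{\mathrm{ext}R}(\mathcal G[\mathcal U],\mathrm S)$ abelian groups, pull-back along refinements $\theta$ gives group homomorphisms $\theta^*:\widehat{\mathrm{ext}R}(\mathcal G[\mathcal U],\mathrm S)\to\widehat{\mathrm{ext}R}(\mathcal G[\mathcal V],\mathrm S)$, and there is an isomorphism of abelian groups $$\widehat{\mathrm{Ext}R}(\mathcal G,\mathrm S)\;\cong\;\varinjlim_{\mathcal U}\ \widehat{\mathrm{ext}R}(\mathcal G[\mathcal U],\mathrm S),$$ the direct limit (colimit of abelian groups) being taken over all Real open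 covers of $X$ and all refinements between them. Under the isomorphism the class of a twist $(\tilde\Gamma,\delta)$ over $\mathcal G[\mathcal U]$ corresponds to the class of the extension $(\tilde\Gamma,\mathcal G[\mathcal U],\delta,Z_{\iota_{\mathcal U}})$, where $Z_{\iota_{\mathcal U}}=\{(y,g)\in\coprod_jU_j\times\mathcal G:\iota_{\mathcal U}(y)=r(g)\}$. -/

import Mathlib

universe u

/-- A locally compact Hausdorff Real space: a space with a continuous involution. -/
structure RealSpace : Type (u + 1) where
  carrier : Type u
  [top : TopologicalSpace carrier]
  [t2 : T2Space carrier]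
  [lc : LocallyCompactSpace carrier]
  conj : carrier → carrier
  continuous_conj : Continuous conj
  conj_conj : ∀ x, conj (conj x) = x

instance : CoeSort RealSpace.{u} (Type u) := ⟨RealSpace.carrier⟩

attribute [instance] RealSpace.top RealSpace.t2 RealSpace.lc

/-- A Real groupoid with unit space `X`: a locally compact Hausdorff topological groupoid (with open
range map) together with a `2`-periodic strict homeomorphism. The Real structures on arrows and on
units are `Arr.conj` and `X.conj`. The product `mul g h` is defined when `src g = rng h`. -/
structure RealGroupoid (X : RealSpace.{u}) : Type (u + 1) where
  Arr : RealSpace.{u}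
  rng : Arr → X
  src : Arr → X
  unit : X → Arr
  inv : Arr → Arr
  mul : ∀ g h : Arr, src g = rng h → Arr
  continuous_rng : Continuous rng
  continuous_src : Continuous src
  continuous_unit : Continuous unit
  continuous_inv : Continuous inv
  continuous_mul : Continuous fun p : {p : Arr × Arr // src p.1 = rng p.2} => mul p.1.1 p.1.2 p.2
  isOpenMap_rng : IsOpenMap rng
  rng_unit : ∀ x, rng (unit x) = x
  src_unit : ∀ x, src (unit x) = x
  rng_mul : ∀ g h e, rng (mul g h e) = rng g
  src_mul : ∀ g h e, src (mul g h e) = src h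
  rng_inv : ∀ g, rng (inv g) = src g
  src_inv : ∀ g, src (inv g) = rng g
  unit_mul : ∀ g, mul (unit (rng g)) g (src_unit _) = g
  mul_unit : ∀ g, mul g (unit (src g)) (rng_unit _).symm = g
  mul_assoc : ∀ g h k (e : src g = rng h) (e' : src h = rng k),
    mul (mul g h e) k ((src_mul g h e).trans e') = mul g (mul h k e') (e.trans (rng_mul h k e').symm)
  mul_inv : ∀ g, mul g (inv g) (rng_inv g).symm = unit (rng g)
  inv_mul : ∀ g, mul (inv g) g (src_inv g) = unit (src g)
  rng_conj : ∀ g, rng (Arr.conj g) = X.conj (rng g)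
  src_conj : ∀ g, src (Arr.conj g) = X.conj (src g)
  unit_conj : ∀ x, unit (X.conj x) = Arr.conj (unit x)
  mul_conj : ∀ g h (e : src g = rng h),
    mul (Arr.conj g) (Arr.conj h) (by rw [src_conj, rng_conj, e]) = Arr.conj (mul g h e)

/-- Real strict homomorphisms of Real groupoids. -/
structure RealHom {Y X : RealSpace.{u}} (Γ : RealGroupoid Y) (G : RealGroupoid X) : Type u where
  obj : Y → X
  arr : Γ.Arr → G.Arr
  continuous_obj : Continuous obj
  continuous_arr : Continuous arr
  rng_arr : ∀ g, G.rng (arr g) = obj (Γ.rng g)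
  src_arr : ∀ g, G.src (arr g) = obj (Γ.src g)
  unit_arr : ∀ y, arr (Γ.unit y) = G.unit (obj y)
  mul_arr : ∀ g h (e : Γ.src g = Γ.rng h),
    arr (Γ.mul g h e) = G.mul (arr g) (arr h) (by rw [src_arr, rng_arr, e])
  conj_obj : ∀ y, obj (Y.conj y) = X.conj (obj y)
  conj_arr : ∀ g, arr (Γ.Arr.conj g) = G.Arr.conj (arr g)

/-- `p` is surjective and admits continuous local sections around every point of its target. -/
def LocallySplit {Z Y : Type u} [TopologicalSpace Z] [TopologicalSpace Y] (p : Z → Y) : Prop :=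
  Function.Surjective p ∧
    ∀ y : Y, ∃ V : Set Y, IsOpen V ∧ y ∈ V ∧ ∃ s : V → Z, Continuous s ∧ ∀ v, p (s v) = v

/-- A Real space with commuting Real actions of `Γ` on the left (along the generalized range map
`left`) and of `G` on the right (along the generalized source map `right`). -/
structure RealBibundle {Y X : RealSpace.{u}} (Γ : RealGroupoid Y) (G : RealGroupoid X) :
    Type (u + 1) where
  Total : RealSpace.{u}
  left : Total → Y
  right : Total → X
  lact : ∀ (γ : Γ.Arr) (z : Total), Γ.src γ = left z → Total
  ract : ∀ (z : Total) (g : G.Arr), right z = G.rng g → Total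
  continuous_left : Continuous left
  continuous_right : Continuous right
  isOpenMap_left : IsOpenMap left
  isOpenMap_right : IsOpenMap right
  continuous_lact : Continuous fun p : {p : Γ.Arr × Total // Γ.src p.1 = left p.2} =>
    lact p.1.1 p.1.2 p.2
  continuous_ract : Continuous fun p : {p : Total × G.Arr // right p.1 = G.rng p.2} =>
    ract p.1.1 p.1.2 p.2
  left_lact : ∀ γ z e, left (lact γ z e) = Γ.rng γ
  right_lact : ∀ γ z e, right (lact γ z e) = right z
  left_ract : ∀ z g e, left (ract z g e) = left z
  right_ract : ∀ z g e, right (ract z g e) = G.src g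
  unit_lact : ∀ z, lact (Γ.unit (left z)) z (Γ.src_unit _) = z
  ract_unit : ∀ z, ract z (G.unit (right z)) (G.rng_unit _).symm = z
  mul_lact : ∀ γ γ' z (e : Γ.src γ = Γ.rng γ') (e' : Γ.src γ' = left z),
    lact (Γ.mul γ γ' e) z ((Γ.src_mul _ _ _).trans e') =
      lact γ (lact γ' z e') (e.trans (left_lact _ _ _).symm)
  ract_mul : ∀ z g g' (e : right z = G.rng g) (e' : G.src g = G.rng g'),
    ract z (G.mul g g' e') (e.trans (G.rng_mul _ _ _).symm) =
      ract (ract z g e) g' ((right_ract _ _ _).trans e')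
  lact_ract : ∀ γ z g (e : Γ.src γ = left z) (e' : right z = G.rng g),
    lact γ (ract z g e') (e.trans (left_ract _ _ _).symm) =
      ract (lact γ z e) g ((right_lact _ _ _).trans e')
  left_conj : ∀ z, left (Total.conj z) = Y.conj (left z)
  right_conj : ∀ z, right (Total.conj z) = X.conj (right z)
  lact_conj : ∀ γ z (e : Γ.src γ = left z),
    lact (Γ.Arr.conj γ) (Total.conj z) (by rw [Γ.src_conj, left_conj, e]) = Total.conj (lact γ z e)
  ract_conj : ∀ z g (e : right z = G.rng g),
    ract (Total.conj z) (G.Arr.conj g) (by rw [G.rng_conj, right_conj, e]) = Total.conj (ract z g e)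

namespace RealBibundle

variable {Y X : RealSpace.{u}} {Γ : RealGroupoid Y} {G : RealGroupoid X}

/-- `left : Z → Y` is a principal right `G`-bundle; equivalently `Z` is a Real generalized
homomorphism from `Γ` to `G`. -/
def IsRightPrincipal (Z : RealBibundle Γ G) : Prop :=
  LocallySplit Z.left ∧
    IsHomeomorph fun p : {p : Z.Total × G.Arr // Z.right p.1 = G.rng p.2} =>
      (⟨(p.1.1, Z.ract p.1.1 p.1.2 p.2), (Z.left_ract _ _ _).symm⟩ :
        {q : Z.Total × Z.Total // Z.left q.1 = Z.left q.2})

/-- `right : Z → X` is a principal left `Γ`-bundle. -/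
def IsLeftPrincipal (Z : RealBibundle Γ G) : Prop :=
  LocallySplit Z.right ∧
    IsHomeomorph fun p : {p : Γ.Arr × Z.Total // Γ.src p.1 = Z.left p.2} =>
      (⟨(Z.lact p.1.1 p.1.2 p.2, p.1.2), Z.right_lact _ _ _⟩ :
        {q : Z.Total × Z.Total // Z.right q.1 = Z.right q.2})

/-- Real Morita equivalences from `Γ` to `G`. -/
def IsMorita (Z : RealBibundle Γ G) : Prop := Z.IsRightPrincipal ∧ Z.IsLeftPrincipal

/-- `D` is isomorphic to the bibundle `Y ×_{f, X, r} G` of the Real strict homomorphism `f`. -/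
def IsGraph (f : RealHom Γ G) (D : RealBibundle Γ G) : Prop :=
  ∃ h : {p : Y × G.Arr // f.obj p.1 = G.rng p.2} ≃ₜ D.Total,
    (∀ p, D.left (h p) = p.1.1) ∧
    (∀ p, D.right (h p) = G.src p.1.2) ∧
    (∀ p q, q.1 = (Y.conj p.1.1, G.Arr.conj p.1.2) → h q = D.Total.conj (h p)) ∧
    (∀ γ p q e, q.1 = (Γ.rng γ, G.mul (f.arr γ) p.1.2 e) → ∀ e', D.lact γ (h p) e' = h q) ∧
    (∀ p g q e, q.1 = (p.1.1, G.mul p.1.2 g e) → ∀ e', D.ract (h p) g e' = h q)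

end RealBibundle

section Composition

variable {Y₁ Y₂ X : RealSpace.{u}} {Γ₁ : RealGroupoid Y₁} {Γ₂ : RealGroupoid Y₂}
  {G : RealGroupoid X}

/-- The relation `(z γ, γ⁻¹ p) ∼ (z, p)` on the fibre product `Z ×_{Y₂} P`. -/
def compRel (Z : RealBibundle Γ₁ Γ₂) (P : RealBibundle Γ₂ G)
    (a b : {p : Z.Total × P.Total // Z.right p.1 = P.left p.2}) : Prop :=
  ∃ γ e e', b.1 = (Z.ract a.1.1 γ e, P.lact (Γ₂.inv γ) a.1.2 e')

/-- `Q` is isomorphic to the composite `P ∘ Z = Z ×_{Γ₂} P` as a Real bibundle. -/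
def IsComposite (Z : RealBibundle Γ₁ Γ₂) (P : RealBibundle Γ₂ G) (Q : RealBibundle Γ₁ G) : Prop :=
  ∃ h : Quot (compRel Z P) ≃ₜ Q.Total,
    (∀ a, Q.left (h (Quot.mk _ a)) = Z.left a.1.1) ∧
    (∀ a, Q.right (h (Quot.mk _ a)) = P.right a.1.2) ∧
    (∀ a b, b.1 = (Z.Total.conj a.1.1, P.Total.conj a.1.2) →
      h (Quot.mk _ b) = Q.Total.conj (h (Quot.mk _ a))) ∧
    (∀ γ a b e, b.1 = (Z.lact γ a.1.1 e, a.1.2) →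
      ∀ e', Q.lact γ (h (Quot.mk _ a)) e' = h (Quot.mk _ b)) ∧
    (∀ a g b e, b.1 = (a.1.1, P.ract a.1.2 g e) →
      ∀ e', Q.ract (h (Quot.mk _ a)) g e' = h (Quot.mk _ b))

end Composition

/-- A (locally compact Hausdorff) Real abelian group, together with the Real element `-1` of square
one that provides the signs in graded tensor products (e.g. `-1` in the circle). -/
structure RealAbelianGroup : Type (u + 1) where
  carrier : Type u
  [grp : CommGroup carrier]
  [top : TopologicalSpace carrier]
  [topGrp : IsTopologicalGroup carrier]
  [t2 : T2Space carrier]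
  [lc : LocallyCompactSpace carrier]
  conj : carrier →* carrier
  continuous_conj : Continuous conj
  conj_conj : ∀ c, conj (conj c) = c
  sign : carrier
  sign_mul_sign : sign * sign = 1
  conj_sign : conj sign = sign

instance : CoeSort RealAbelianGroup.{u} (Type u) := ⟨RealAbelianGroup.carrier⟩

attribute [instance] RealAbelianGroup.grp RealAbelianGroup.top RealAbelianGroup.topGrp
  RealAbelianGroup.t2 RealAbelianGroup.lc

/-- `p : E → B` with the `S`-action `a` is a Real principal `S`-bundle. -/
structure IsRealPrincipal (S : RealAbelianGroup.{u}) {E B : RealSpace.{u}} (p : E → B)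
    (a : S → E → E) : Prop where
  continuous_proj : Continuous p
  conj_proj : ∀ v, p (E.conj v) = B.conj (p v)
  continuous_act : Continuous fun q : S × E => a q.1 q.2
  one_act : ∀ v, a 1 v = v
  mul_act : ∀ c d v, a (c * d) v = a c (a d v)
  conj_act : ∀ c v, a (S.conj c) (E.conj v) = E.conj (a c v)
  proj_act : ∀ c v, p (a c v) = p v
  locallySplit : LocallySplit p
  isHomeomorph : IsHomeomorph fun q : S × E =>
    (⟨(a q.1 q.2, q.2), proj_act q.1 q.2⟩ : {w : E × E // p w.1 = p w.2})

/-- A Real graded `S`-twist over `Γ`. -/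
structure RealTwist {Y : RealSpace.{u}} (Γ : RealGroupoid Y) (S : RealAbelianGroup.{u}) :
    Type (u + 1) where
  grpd : RealGroupoid Y
  proj : RealHom grpd Γ
  proj_obj : ∀ y, proj.obj y = y
  act : S → grpd.Arr → grpd.Arr
  principal : IsRealPrincipal S proj.arr act
  act_mul_act : ∀ c d g h e e',
    grpd.mul (act c g) (act d h) e' = act (c * d) (grpd.mul g h e)
  deg : Γ.Arr → ZMod 2
  continuous_deg : Continuous deg
  deg_mul : ∀ g h e, deg (Γ.mul g h e) = deg g + deg h
  deg_conj : ∀ g, deg (Γ.Arr.conj g) = deg g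

section Twists

variable {Y : RealSpace.{u}} {Γ : RealGroupoid Y} {S : RealAbelianGroup.{u}}

/-- The relation `(c γ₁, c⁻¹ γ₂) ∼ (γ₁, γ₂)` on the fibre product of two twists over `Γ`. -/
def baerRel (T₁ T₂ : RealTwist Γ S)
    (a b : {p : T₁.grpd.Arr × T₂.grpd.Arr // T₁.proj.arr p.1 = T₂.proj.arr p.2}) : Prop :=
  ∃ c : S, b.1 = (T₁.act c a.1.1, T₂.act c⁻¹ a.1.2)

/-- `T` is isomorphic to the graded tensor product (Baer sum) of `T₁` and `T₂`. -/
def IsTensor (T₁ T₂ T : RealTwist Γ S) : Prop :=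
  (∀ γ, T.deg γ = T₁.deg γ + T₂.deg γ) ∧
  ∃ h : Quot (baerRel T₁ T₂) ≃ₜ T.grpd.Arr,
    (∀ a, T.proj.arr (h (Quot.mk _ a)) = T₁.proj.arr a.1.1) ∧
    (∀ c a b, b.1 = (T₁.act c a.1.1, a.1.2) →
      h (Quot.mk _ b) = T.act c (h (Quot.mk _ a))) ∧
    (∀ a b, b.1 = (T₁.grpd.Arr.conj a.1.1, T₂.grpd.Arr.conj a.1.2) →
      h (Quot.mk _ b) = T.grpd.Arr.conj (h (Quot.mk _ a))) ∧
    (∀ a b d e₁ e₂, d.1 = (T₁.grpd.mul a.1.1 b.1.1 e₁, T₂.grpd.mul a.1.2 b.1.2 e₂) →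
      ∀ e, T.grpd.mul (h (Quot.mk _ a)) (h (Quot.mk _ b)) e =
        T.act (S.sign ^ (T₂.deg (T₂.proj.arr a.1.2) * T₁.deg (T₁.proj.arr b.1.1)).val)
          (h (Quot.mk _ d)))

/-- The space `r^*Λ × s^*Λ` of triples `(v, γ, w)` with `v` over `r(γ)` and `w` over `s(γ)`. -/
abbrev LinePairs (Γ : RealGroupoid Y) {L : RealSpace.{u}} (J : L → Y) : Type u :=
  {t : L × Γ.Arr × L // J t.1 = Γ.rng t.2.1 ∧ Γ.src t.2.1 = J t.2.2}

/-- The relation defining `r^*Λ ⊗ \overline{s^*Λ}`, in which `c • ♭w = ♭(c⁻¹ • w)`. -/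
def lineRel (Γ : RealGroupoid Y) {L : RealSpace.{u}} (J : L → Y) (a : S → L → L)
    (x y : LinePairs Γ J) : Prop :=
  ∃ c : S, y.1 = (a c x.1.1, x.1.2.1, a c x.1.2.2)

/-- `T` is isomorphic to `(r^*Λ ⊗ \overline{s^*Λ}, 0)` for a Real principal `S`-bundle `Λ` over the
unit space. -/
def IsLineTwist (T : RealTwist Γ S) : Prop :=
  (∀ γ, T.deg γ = 0) ∧
  ∃ (L : RealSpace.{u}) (J : L → Y) (a : S → L → L), IsRealPrincipal S J a ∧
  ∃ h : Quot (lineRel Γ J a) ≃ₜ T.grpd.Arr,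
    (∀ x, T.proj.arr (h (Quot.mk _ x)) = x.1.2.1) ∧
    (∀ c x y, y.1 = (a c x.1.1, x.1.2.1, x.1.2.2) →
      h (Quot.mk _ y) = T.act c (h (Quot.mk _ x))) ∧
    (∀ x y, y.1 = (L.conj x.1.1, Γ.Arr.conj x.1.2.1, L.conj x.1.2.2) →
      h (Quot.mk _ y) = T.grpd.Arr.conj (h (Quot.mk _ x))) ∧
    (∀ x y z e, x.1.2.2 = y.1.1 → z.1 = (x.1.1, Γ.mul x.1.2.1 y.1.2.1 e, y.1.2.2) →
      ∀ e', T.grpd.mul (h (Quot.mk _ x)) (h (Quot.mk _ y)) e' = h (Quot.mk _ z))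

/-- The set `extR(Γ, S)` of Real graded `S`-twists up to isomorphism and up to tensoring with twists
of line bundles. -/
def ExtTw (Γ : RealGroupoid Y) (S : RealAbelianGroup.{u}) : Type (u + 1) :=
  Quot fun T T' : RealTwist Γ S => ∃ L, IsLineTwist L ∧ IsTensor T L T'

/-- The class of a twist in `extR(Γ, S)`. -/
def RealTwist.cls (T : RealTwist Γ S) : ExtTw Γ S := Quot.mk _ T

/-- `T'` is isomorphic to the pull-back `f^*T`, the fibre product of `T` and `Γ'` over `Γ`. -/
def IsPullback {Y' : RealSpace.{u}} {Γ' : RealGroupoid Y'} (f : RealHom Γ' Γ) (T : RealTwist Γ S)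
    (T' : RealTwist Γ' S) : Prop :=
  (∀ γ, T'.deg γ = T.deg (f.arr γ)) ∧
  ∃ h : {p : T.grpd.Arr × Γ'.Arr // T.proj.arr p.1 = f.arr p.2} ≃ₜ T'.grpd.Arr,
    (∀ a, T'.proj.arr (h a) = a.1.2) ∧
    (∀ c a b, b.1 = (T.act c a.1.1, a.1.2) → h b = T'.act c (h a)) ∧
    (∀ a b, b.1 = (T.grpd.Arr.conj a.1.1, Γ'.Arr.conj a.1.2) → h b = T'.grpd.Arr.conj (h a)) ∧
    (∀ a b d e₁ e₂, d.1 = (T.grpd.mul a.1.1 b.1.1 e₁, Γ'.mul a.1.2 b.1.2 e₂) →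
      ∀ e, T'.grpd.mul (h a) (h b) e = h d)

end Twists

/-- The one-point Real space. -/
def RealSpace.point : RealSpace.{u} where
  carrier := PUnit
  conj := id
  continuous_conj := continuous_id
  conj_conj _ := rfl

/-- The group `ℤ/2` with trivial Real structure, as a Real groupoid over the point. -/
def RealGroupoid.Z2 : RealGroupoid RealSpace.point.{u} where
  Arr :=
    { carrier := ULift.{u} (ZMod 2)
      t2 := Homeomorph.ulift.isEmbedding.t2Space
      lc := Homeomorph.ulift.isClosedEmbedding.locallyCompactSpace
      conj := id
      continuous_conj := continuous_id
      conj_conj := fun _ => rfl }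
  rng _ := PUnit.unit
  src _ := PUnit.unit
  unit _ := ULift.up 0
  inv a := ULift.up (-a.down)
  mul a b _ := ULift.up (a.down + b.down)
  continuous_rng := continuous_const
  continuous_src := continuous_const
  continuous_unit := continuous_const
  continuous_inv := continuous_uliftUp.comp (continuous_of_discreteTopology.comp continuous_uliftDown)
  continuous_mul := continuous_uliftUp.comp
    ((continuous_of_discreteTopology (f := fun q : ZMod 2 × ZMod 2 => q.1 + q.2)).comp
      ((continuous_uliftDown.comp (continuous_fst.comp continuous_subtype_val)).prodMk
        (continuous_uliftDown.comp (continuous_snd.comp continuous_subtype_val))))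
  isOpenMap_rng := fun s _ => by
    have : DiscreteTopology (RealSpace.point.{u}).carrier :=
      inferInstanceAs (DiscreteTopology PUnit)
    exact isOpen_discrete _
  rng_unit _ := rfl
  src_unit _ := rfl
  rng_mul _ _ _ := rfl
  src_mul _ _ _ := rfl
  rng_inv _ := rfl
  src_inv _ := rfl
  unit_mul a := congrArg ULift.up (zero_add a.down)
  mul_unit a := congrArg ULift.up (add_zero a.down)
  mul_assoc a b c _ _ := congrArg ULift.up (add_assoc a.down b.down c.down)
  mul_inv a := congrArg ULift.up (add_neg_cancel a.down)
  inv_mul a := congrArg ULift.up (neg_add_cancel a.down)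
  rng_conj _ := rfl
  src_conj _ := rfl
  unit_conj _ := rfl
  mul_conj _ _ _ := rfl

/-- The grading of a twist as a Real strict homomorphism to `ℤ/2`. -/
def RealTwist.degHom {Y : RealSpace.{u}} {Γ : RealGroupoid Y} {S : RealAbelianGroup.{u}}
    (T : RealTwist Γ S) : RealHom Γ RealGroupoid.Z2.{u} where
  obj _ := PUnit.unit
  arr g := ULift.up (T.deg g)
  continuous_obj := continuous_const
  continuous_arr := continuous_uliftUp.comp T.continuous_deg
  rng_arr _ := rfl
  src_arr _ := rfl
  unit_arr y := by
    have h := T.deg_mul (Γ.unit y) (Γ.unit y) (by rw [Γ.src_unit, Γ.rng_unit])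
    have h' : Γ.mul (Γ.unit y) (Γ.unit y) (by rw [Γ.src_unit, Γ.rng_unit]) = Γ.unit y := by
      have := Γ.unit_mul (Γ.unit y)
      simp only [Γ.rng_unit] at this
      exact this
    rw [h'] at h
    exact congrArg ULift.up (left_eq_add.mp h)
  mul_arr g h e := congrArg ULift.up (T.deg_mul g h e)
  conj_obj _ := rfl
  conj_arr g := congrArg ULift.up (T.deg_conj g)

/-- A Real graded `S`-central extension of `G`. -/
structure RealExtension {X : RealSpace.{u}} (G : RealGroupoid X) (S : RealAbelianGroup.{u}) :
    Type (u + 1) where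
  {Y : RealSpace.{u}}
  {Γ : RealGroupoid Y}
  T : RealTwist Γ S
  P : RealBibundle Γ G
  morita : P.IsMorita

section MoritaEquivalenceOfExtensions

variable {Y₁ Y₂ : RealSpace.{u}} {Γ₁ : RealGroupoid Y₁} {Γ₂ : RealGroupoid Y₂}
  {S : RealAbelianGroup.{u}}

/-- `a` is a Real `S`-action making `Z` an `S`-equivariant bibundle between two twists. -/
structure IsSEquivariant (T₁ : RealTwist Γ₁ S) (T₂ : RealTwist Γ₂ S)
    (Z : RealBibundle T₁.grpd T₂.grpd) (a : S → Z.Total → Z.Total) : Prop where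
  continuous_act : Continuous fun q : S × Z.Total => a q.1 q.2
  one_act : ∀ z, a 1 z = z
  mul_act : ∀ c d z, a (c * d) z = a c (a d z)
  conj_act : ∀ c z, a (S.conj c) (Z.Total.conj z) = Z.Total.conj (a c z)
  left_act : ∀ c z, Z.left (a c z) = Z.left z
  right_act : ∀ c z, Z.right (a c z) = Z.right z
  act_left : ∀ c γ₁ z γ₂ e₁ e₂ e₃ e₄,
    Z.ract (Z.lact (T₁.act c γ₁) z e₁) γ₂ e₂ = Z.ract (Z.lact γ₁ (a c z) e₃) γ₂ e₄
  act_right : ∀ c γ₁ z γ₂ e₁ e₂ e₃ e₄,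
    Z.ract (Z.lact γ₁ (a c z) e₁) γ₂ e₂ = Z.ract (Z.lact γ₁ z e₃) (T₂.act c γ₂) e₄

/-- `W`, as a Real bibundle from `Γ₁` to `Γ₂`, is isomorphic to `Z / S`. -/
def IsSQuotient (T₁ : RealTwist Γ₁ S) (T₂ : RealTwist Γ₂ S) (Z : RealBibundle T₁.grpd T₂.grpd)
    (a : S → Z.Total → Z.Total) (W : RealBibundle Γ₁ Γ₂) : Prop :=
  ∃ h : Quot (fun z z' : Z.Total => ∃ c : S, z' = a c z) ≃ₜ W.Total,
    (∀ z, W.left (h (Quot.mk _ z)) = Z.left z) ∧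
    (∀ z, W.right (h (Quot.mk _ z)) = Z.right z) ∧
    (∀ z, h (Quot.mk _ (Z.Total.conj z)) = W.Total.conj (h (Quot.mk _ z))) ∧
    (∀ γ z e e', W.lact (T₁.proj.arr γ) (h (Quot.mk _ z)) e' = h (Quot.mk _ (Z.lact γ z e))) ∧
    (∀ z γ e e', W.ract (h (Quot.mk _ z)) (T₂.proj.arr γ) e' = h (Quot.mk _ (Z.ract z γ e)))

end MoritaEquivalenceOfExtensions

section Extensions

variable {X : RealSpace.{u}} {G : RealGroupoid X} {S : RealAbelianGroup.{u}}

/-- Morita equivalence of Real graded `S`-central extensions: there is an `S`-equivariant Real Morita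
equivalence `Z` with `P₂ ∘ (Z/S) ≅ P₁` and `δ₂ ∘ (Z/S) ≅ δ₁` as Real generalized homomorphisms. -/
def MoritaRel (E₁ E₂ : RealExtension G S) : Prop :=
  ∃ (Z : RealBibundle E₁.T.grpd E₂.T.grpd) (a : S → Z.Total → Z.Total) (W : RealBibundle E₁.Γ E₂.Γ)
    (D₁ : RealBibundle E₁.Γ RealGroupoid.Z2) (D₂ : RealBibundle E₂.Γ RealGroupoid.Z2),
    Z.IsMorita ∧ IsSEquivariant E₁.T E₂.T Z a ∧ IsSQuotient E₁.T E₂.T Z a W ∧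
    IsComposite W E₂.P E₁.P ∧
    RealBibundle.IsGraph E₁.T.degHom D₁ ∧ RealBibundle.IsGraph E₂.T.degHom D₂ ∧
    IsComposite W D₂ D₁

/-- The set of Morita equivalence classes of Real graded `S`-central extensions of `G`. -/
def ExtR (G : RealGroupoid X) (S : RealAbelianGroup.{u}) : Type (u + 1) :=
  Quot (MoritaRel (G := G) (S := S))

/-- The class of an extension in `ExtR(G, S)`. -/
def RealExtension.cls (E : RealExtension G S) : ExtR G S := Quot.mk _ E

/-- `E` is a tensor product of `E₁` and `E₂`: with the Morita equivalence `Z = P₁ ×_G P₂⁻¹` from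
`Γ₁` to `Γ₂` (so `P₂ ∘ Z ≅ P₁`), the groupoid of `E` is the pull-back of `Γ₁` along `Z → Y₁`,
identified with the pull-back of `Γ₂` along `Z → Y₂` by the relation `γ₁ z = z' γ₂`; its twist is
the tensor product of the pull-backs of the two twists, and its Morita equivalence to `G` is the
composite of the projection to `Γ₁` with `P₁`. -/
def IsExtTensor (E₁ E₂ E : RealExtension G S) : Prop :=
  ∃ (Z : RealBibundle E₁.Γ E₂.Γ) (k : E.Y ≃ₜ Z.Total) (q₁ : RealHom E.Γ E₁.Γ)
    (q₂ : RealHom E.Γ E₂.Γ) (T₁ T₂ : RealTwist E.Γ S) (D : RealBibundle E.Γ E₁.Γ),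
    Z.IsMorita ∧ IsComposite Z E₂.P E₁.P ∧
    (∀ y, k (E.Y.conj y) = Z.Total.conj (k y)) ∧
    (∀ y, q₁.obj y = Z.left (k y)) ∧ (∀ y, q₂.obj y = Z.right (k y)) ∧
    (∃ h : E.Γ.Arr ≃ₜ {t : Z.Total × E₁.Γ.Arr × Z.Total //
        Z.left t.1 = E₁.Γ.rng t.2.1 ∧ E₁.Γ.src t.2.1 = Z.left t.2.2},
      ∀ γ, (h γ).1 = (k (E.Γ.rng γ), q₁.arr γ, k (E.Γ.src γ))) ∧
    (∀ γ, ∃ e e', Z.lact (q₁.arr γ) (k (E.Γ.src γ)) e = Z.ract (k (E.Γ.rng γ)) (q₂.arr γ) e') ∧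
    IsPullback q₁ E₁.T T₁ ∧ IsPullback q₂ E₂.T T₂ ∧ IsTensor T₁ T₂ E.T ∧
    RealBibundle.IsGraph q₁ D ∧ IsComposite D E₁.P E.P

end Extensions

/-- Real open covers of `X`, indexed by a set with involution. -/
structure RealCover (X : RealSpace.{u}) : Type (u + 1) where
  Idx : Type u
  bar : Idx → Idx
  bar_bar : ∀ i, bar (bar i) = i
  U : Idx → Set X
  isOpen_U : ∀ i, IsOpen (U i)
  exists_mem : ∀ x, ∃ i, x ∈ U i
  U_bar : ∀ i, U (bar i) = X.conj '' U i

/-- Refinement maps from the finer cover `V` to the cover `U`. -/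
structure RealCover.Refinement {X : RealSpace.{u}} (U V : RealCover X) : Type u where
  idx : V.Idx → U.Idx
  idx_bar : ∀ i, idx (V.bar i) = U.bar (idx i)
  subset : ∀ i, V.U i ⊆ U.U (idx i)

namespace RealCover

variable {X : RealSpace.{u}}

theorem conj_mem (U : RealCover X) {i : U.Idx} {x : X} (h : x ∈ U.U i) : X.conj x ∈ U.U (U.bar i) := by
  rw [U.U_bar]; exact ⟨x, h, rfl⟩

/-- The index set of a cover carries the discrete topology. -/
instance (U : RealCover X) : TopologicalSpace U.Idx := ⊥

instance (U : RealCover X) : DiscreteTopology U.Idx := ⟨rfl⟩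

theorem isOpen_mem (U : RealCover X) {A : Type u} [TopologicalSpace A] {f : A → U.Idx} {g : A → X}
    (hf : Continuous f) (hg : Continuous g) : IsOpen {a | g a ∈ U.U (f a)} := by
  have : {a | g a ∈ U.U (f a)} = ⋃ i : U.Idx, f ⁻¹' {i} ∩ g ⁻¹' (U.U i) := by
    ext a; simp
  rw [this]
  exact isOpen_iUnion fun i => ((isOpen_discrete _).preimage hf).inter ((U.isOpen_U i).preimage hg)

/-- The disjoint union of the members of a Real cover. -/
abbrev space (U : RealCover X) : RealSpace.{u} where
  carrier := {p : U.Idx × X // p.2 ∈ U.U p.1}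
  lc := (U.isOpen_mem continuous_fst continuous_snd).locallyCompactSpace
  conj p := ⟨(U.bar p.1.1, X.conj p.1.2), U.conj_mem p.2⟩
  continuous_conj := by
    refine Continuous.subtype_mk (Continuous.prodMk ?_ ?_) _
    · exact (continuous_of_discreteTopology (f := fun i : U.Idx => U.bar i)).comp
        (continuous_fst.comp continuous_subtype_val)
    · exact X.continuous_conj.comp (continuous_snd.comp continuous_subtype_val)
  conj_conj p := Subtype.ext (Prod.ext (U.bar_bar _) (X.conj_conj _))

/-- The space of arrows `(j₀, g, j₁)`, `r(g) ∈ U_{j₀}`, `s(g) ∈ U_{j₁}`, of the cover groupoid. -/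
abbrev arrows (U : RealCover X) (G : RealGroupoid X) : RealSpace.{u} where
  carrier := {p : U.Idx × G.Arr × U.Idx // G.rng p.2.1 ∈ U.U p.1 ∧ G.src p.2.1 ∈ U.U p.2.2}
  t2 := inferInstanceAs (T2Space (Subtype _))
  lc := ((U.isOpen_mem continuous_fst
      (G.continuous_rng.comp (continuous_fst.comp continuous_snd))).inter
    (U.isOpen_mem (continuous_snd.comp continuous_snd)
      (G.continuous_src.comp (continuous_fst.comp continuous_snd)))).locallyCompactSpace
  conj p := ⟨(U.bar p.1.1, G.Arr.conj p.1.2.1, U.bar p.1.2.2), by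
    have h := p.2
    exact ⟨by rw [G.rng_conj]; exact U.conj_mem h.1, by rw [G.src_conj]; exact U.conj_mem h.2⟩⟩
  continuous_conj := by
    have hb := continuous_of_discreteTopology (f := fun i : U.Idx => U.bar i)
    refine Continuous.subtype_mk (Continuous.prodMk ?_ (Continuous.prodMk ?_ ?_)) _
    · exact hb.comp (continuous_fst.comp continuous_subtype_val)
    · exact G.Arr.continuous_conj.comp
        (continuous_fst.comp (continuous_snd.comp continuous_subtype_val))
    · exact hb.comp (continuous_snd.comp (continuous_snd.comp continuous_subtype_val))
  conj_conj p := Subtype.ext (Prod.ext (U.bar_bar _) (Prod.ext (G.Arr.conj_conj _) (U.bar_bar _)))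

theorem mem_of_eq (U : RealCover X) {i : U.Idx} {x y : X} (e : y = x) (h : x ∈ U.U i) :
    y ∈ U.U i := by rw [e]; exact h

/-- The product `(j₀, g, j₁) (j₁, h, j₂) = (j₀, g h, j₂)`. -/
abbrev arrowsMul (U : RealCover X) (G : RealGroupoid X) (p q : U.arrows G)
    (e : G.src p.1.2.1 = G.rng q.1.2.1) : U.arrows G :=
  ⟨(p.1.1, G.mul p.1.2.1 q.1.2.1 e, q.1.2.2),
    U.mem_of_eq (G.rng_mul _ _ _) p.2.1, U.mem_of_eq (G.src_mul _ _ _) q.2.2⟩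

/-- The Real cover groupoid `G[U]`. -/
def groupoid (U : RealCover X) (G : RealGroupoid X) : RealGroupoid U.space where
  Arr := U.arrows G
  rng p := ⟨(p.1.1, G.rng p.1.2.1), p.2.1⟩
  src p := ⟨(p.1.2.2, G.src p.1.2.1), p.2.2⟩
  unit x := ⟨(x.1.1, G.unit x.1.2, x.1.1),
    U.mem_of_eq (G.rng_unit _) x.2, U.mem_of_eq (G.src_unit _) x.2⟩
  inv p := ⟨(p.1.2.2, G.inv p.1.2.1, p.1.1),
    U.mem_of_eq (G.rng_inv _) p.2.2, U.mem_of_eq (G.src_inv _) p.2.1⟩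
  mul p q e := U.arrowsMul G p q (congrArg (fun x : U.space => x.1.2) e)
  continuous_rng := Continuous.subtype_mk ((continuous_fst.comp continuous_subtype_val).prodMk
    (G.continuous_rng.comp (continuous_fst.comp (continuous_snd.comp continuous_subtype_val)))) _
  continuous_src := Continuous.subtype_mk
    ((continuous_snd.comp (continuous_snd.comp continuous_subtype_val)).prodMk
    (G.continuous_src.comp (continuous_fst.comp (continuous_snd.comp continuous_subtype_val)))) _
  continuous_unit := Continuous.subtype_mk ((continuous_fst.comp continuous_subtype_val).prodMk
    ((G.continuous_unit.comp (continuous_snd.comp continuous_subtype_val)).prodMk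
      (continuous_fst.comp continuous_subtype_val))) _
  continuous_inv := Continuous.subtype_mk
    ((continuous_snd.comp (continuous_snd.comp continuous_subtype_val)).prodMk
      ((G.continuous_inv.comp
        (continuous_fst.comp (continuous_snd.comp continuous_subtype_val))).prodMk
          (continuous_fst.comp continuous_subtype_val))) _
  continuous_mul := by
    apply Continuous.subtype_mk
    refine Continuous.prodMk ?_ (Continuous.prodMk ?_ ?_)
    · exact continuous_fst.comp
        (continuous_subtype_val.comp (continuous_fst.comp continuous_subtype_val))
    · refine G.continuous_mul.comp (g := fun q : {q : G.Arr × G.Arr // G.src q.1 = G.rng q.2} =>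
        G.mul q.1.1 q.1.2 q.2) (Continuous.subtype_mk (Continuous.prodMk ?_ ?_)
        fun p => congrArg (fun x : U.space => x.1.2) p.2)
      · exact continuous_fst.comp (continuous_snd.comp
          (continuous_subtype_val.comp (continuous_fst.comp continuous_subtype_val)))
      · exact continuous_fst.comp (continuous_snd.comp
          (continuous_subtype_val.comp (continuous_snd.comp continuous_subtype_val)))
    · exact continuous_snd.comp (continuous_snd.comp
        (continuous_subtype_val.comp (continuous_snd.comp continuous_subtype_val)))
  isOpenMap_rng := by
    have h1 : IsOpen {p : U.Idx × G.Arr × U.Idx | G.rng p.2.1 ∈ U.U p.1 ∧ G.src p.2.1 ∈ U.U p.2.2} :=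
      (U.isOpen_mem continuous_fst
        (G.continuous_rng.comp (continuous_fst.comp continuous_snd))).inter
      (U.isOpen_mem (continuous_snd.comp continuous_snd)
        (G.continuous_src.comp (continuous_fst.comp continuous_snd)))
    have h2 : IsOpenMap fun p : U.Idx × G.Arr × U.Idx => (p.1, G.rng p.2.1) :=
      IsOpenMap.id.prodMap (G.isOpenMap_rng.comp isOpenMap_fst)
    intro s hs
    have h3 := (h2.comp h1.isOpenMap_subtype_val) s hs
    refine isOpen_induced_iff.mpr ⟨_, h3, ?_⟩
    ext x
    constructor
    · rintro ⟨p, hp, e⟩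
      exact ⟨p, hp, Subtype.ext e⟩
    · rintro ⟨p, hp, rfl⟩
      exact ⟨p, hp, rfl⟩
  rng_unit x := Subtype.ext (Prod.ext rfl (G.rng_unit _))
  src_unit x := Subtype.ext (Prod.ext rfl (G.src_unit _))
  rng_mul p q e := Subtype.ext (Prod.ext rfl (G.rng_mul _ _ _))
  src_mul p q e := Subtype.ext (Prod.ext rfl (G.src_mul _ _ _))
  rng_inv p := Subtype.ext (Prod.ext rfl (G.rng_inv _))
  src_inv p := Subtype.ext (Prod.ext rfl (G.src_inv _))
  unit_mul p := Subtype.ext (Prod.ext rfl (Prod.ext (G.unit_mul _) rfl))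
  mul_unit p := Subtype.ext (Prod.ext rfl (Prod.ext (G.mul_unit _) rfl))
  mul_assoc p q t e e' := Subtype.ext (Prod.ext rfl (Prod.ext (G.mul_assoc _ _ _ _ _) rfl))
  mul_inv p := Subtype.ext (Prod.ext rfl (Prod.ext (G.mul_inv _) rfl))
  inv_mul p := Subtype.ext (Prod.ext rfl (Prod.ext (G.inv_mul _) rfl))
  rng_conj p := Subtype.ext (Prod.ext rfl (G.rng_conj _))
  src_conj p := Subtype.ext (Prod.ext rfl (G.src_conj _))
  unit_conj x := Subtype.ext (Prod.ext rfl (Prod.ext (G.unit_conj _) rfl))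
  mul_conj p q e := Subtype.ext (Prod.ext rfl (Prod.ext (G.mul_conj _ _ _) rfl))

/-- The canonical Real strict homomorphism `G[U] → G`. -/
def toBase (U : RealCover X) (G : RealGroupoid X) : RealHom (U.groupoid G) G where
  obj x := x.1.2
  arr p := p.1.2.1
  continuous_obj := continuous_snd.comp continuous_subtype_val
  continuous_arr := continuous_fst.comp (continuous_snd.comp continuous_subtype_val)
  rng_arr _ := rfl
  src_arr _ := rfl
  unit_arr _ := rfl
  mul_arr _ _ _ := rfl
  conj_obj _ := rfl
  conj_arr _ := rfl

/-- The Real strict homomorphism `G[V] → G[U]` of a refinement. -/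
def Refinement.hom {U V : RealCover X} (θ : U.Refinement V) (G : RealGroupoid X) :
    RealHom (V.groupoid G) (U.groupoid G) where
  obj x := ⟨(θ.idx x.1.1, x.1.2), θ.subset _ x.2⟩
  arr p := ⟨(θ.idx p.1.1, p.1.2.1, θ.idx p.1.2.2), θ.subset _ p.2.1, θ.subset _ p.2.2⟩
  continuous_obj := by
    refine Continuous.subtype_mk (Continuous.prodMk ?_ ?_) _
    · exact (continuous_of_discreteTopology (f := fun i : V.Idx => θ.idx i)).comp
        (continuous_fst.comp continuous_subtype_val)
    · exact continuous_snd.comp continuous_subtype_val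
  continuous_arr := by
    have hb := continuous_of_discreteTopology (f := fun i : V.Idx => θ.idx i)
    refine Continuous.subtype_mk (Continuous.prodMk ?_ (Continuous.prodMk ?_ ?_)) _
    · exact hb.comp (continuous_fst.comp continuous_subtype_val)
    · exact continuous_fst.comp (continuous_snd.comp continuous_subtype_val)
    · exact hb.comp (continuous_snd.comp (continuous_snd.comp continuous_subtype_val))
  rng_arr _ := rfl
  src_arr _ := rfl
  unit_arr _ := rfl
  mul_arr _ _ _ := rfl
  conj_obj x := Subtype.ext (Prod.ext (θ.idx_bar _) rfl)
  conj_arr p := Subtype.ext (Prod.ext (θ.idx_bar _) (Prod.ext rfl (θ.idx_bar _)))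

end RealCover

section DirectLimit

open scoped DirectSum Classical

variable {ι : Type*} {R : ι → ι → Type*} (A : ι → Type*) [∀ i, AddCommGroup (A i)]
  (f : ∀ i j, R i j → A i →+ A j)

/-- The direct limit (colimit of abelian groups) of a system of abelian groups `A i` with transition
homomorphisms `f r : A i → A j`, where several `r` may have the same source and target. -/
def AbDirectLimit : Type _ :=
  (⨁ i, A i) ⧸ AddSubgroup.closure
    {d | ∃ (i j : ι) (r : R i j) (x : A i),
      d = DirectSum.of A j (f i j r x) - DirectSum.of A i x}

noncomputable instance : AddCommGroup (AbDirectLimit A f) :=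
  inferInstanceAs (AddCommGroup ((⨁ i, A i) ⧸ AddSubgroup.closure
    {d | ∃ (i j : ι) (r : R i j) (x : A i),
      d = DirectSum.of A j (f i j r x) - DirectSum.of A i x}))

/-- The canonical homomorphism from a group of the system to its direct limit. -/
noncomputable def AbDirectLimit.of (i : ι) : A i →+ AbDirectLimit A f :=
  (QuotientAddGroup.mk' _).comp (DirectSum.of A i)

end DirectLimit

/-! Both sides are compared with an intermediate set `CoverTw G S`. Its elements are twists over
cover groupoids `G[V]`, identified along refinements and along isomorphisms that may change the
grading by the coboundary of a continuous Real function to `ℤ/2`. This extra freedom in the grading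
is forced by the definition of equivalent extensions, where the gradings only have to agree as
generalized homomorphisms.

From extensions to `CoverTw`: for an extension with Morita equivalence `P`, the map `P → X` is a
locally split principal `Γ`-bundle. It therefore has a continuous Real section `s` over a
sufficiently fine Real cover `V` (`RealCover.exists_section`). The rule `γ · s(src g) = s(rng g) ·
g` turns `s` into a homomorphism `G[V] → Γ`, along which the twist is pulled back. Two sections
differ by a `Γ`-valued function; after refinement it lifts to the twist, and conjugation by the lift
identifies the two pull-backs, the gradings differing by a coboundary
(`RealBibundle.SectionAlong.coverTw_eq`). For equivalent extensions, a section of `Z ×_{Y₂} P₂` over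
a cover induces sections of both `P₁` and `P₂`, and the rule `γ z = z' γ'` in `Z` compares the
pull-backs (`MoritaRel.coverTw_eq`). The inverse sends a twist over `G[U]` to the extension given by
`Z_ι`; it is well defined because a homomorphism of twists covered by a map of Morita equivalences
yields an equivalence of extensions (`TwHom.cls_eq_cls`). This gives `extREquiv`.

From the colimit to `CoverTw`: line twists die, because a principal bundle gets a Real section after
refinement (`CoverTw.mk_line`). Conversely the grading may be changed by a coboundary inside the
colimit (`CoverLimit.mk_eq_of_twHom_id`): listing every member of a cover twice produces one twist
that restricts, along two different refinements, to both gradings. This gives `coverLimitEquiv`.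

The additive structure rests on the graded tensor product, where every sign is a bilinear expression
in the gradings. Homomorphisms of twists over the identity are automatically invertible, since they
are maps of principal bundles, so each isomorphism is obtained from a map in one direction. The
group law on extensions is transported from `CoverTw`. It is the tensor product of extensions
because sections `s₁`, `s₂` of `P₁`, `P₂` give the section `([s₁, s₂], s₁)` of the bundle of the
tensor product (`RealExtension.coverTw_tensor`). -/

open Topology

/-! ### Locally split maps, pull-backs of open maps, open quotients -/

section Topology

/-- To check continuity of `F`, it suffices to do so after lifting a continuous map `f` to the target
of a locally split map `p` along `p`. -/
theorem LocallySplit.continuous_of_lift {Z Y A : Type u} {B : Type*} [TopologicalSpace Z]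
    [TopologicalSpace Y] [TopologicalSpace A] [TopologicalSpace B] {p : Z → Y} (hp : LocallySplit p)
    {f : A → Y} (hf : Continuous f) {F : A → B}
    (H : ∀ (V : Type u) [TopologicalSpace V] (i : V → A) (e : V → Z), Continuous i → Continuous e →
      (∀ v, p (e v) = f (i v)) → Continuous fun v => F (i v)) : Continuous F := by
  rw [continuous_iff_continuousAt]
  intro a
  obtain ⟨V, hV, ha, s, hs, hps⟩ := hp.2 (f a)
  have hO : IsOpen (f ⁻¹' V) := hV.preimage hf
  have := H (f ⁻¹' V) Subtype.val (fun v => s ⟨f v.1, v.2⟩) continuous_subtype_val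
    (hs.comp (Continuous.subtype_mk (hf.comp continuous_subtype_val) _)) (fun v => hps _)
  exact (continuousOn_iff_continuous_domRestrict.mpr this).continuousAt (hO.mem_nhds ha)

theorem LocallySplit.comp {W Z Y : Type u} [TopologicalSpace W]
    [TopologicalSpace Z] [TopologicalSpace Y] {q : Z → Y} {p : W → Z} (hq : LocallySplit q)
    (hp : LocallySplit p) : LocallySplit (q ∘ p) := by
  refine ⟨hq.1.comp hp.1, fun y => ?_⟩
  obtain ⟨V, hV, hy, s, hs, hqs⟩ := hq.2 y
  obtain ⟨V', hV', hy', s', hs', hqs'⟩ := hp.2 (s ⟨y, hy⟩)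
  have hO : IsOpen (Subtype.val '' (s ⁻¹' V')) := hV.isOpenMap_subtype_val _ (hV'.preimage hs)
  have hsub : ∀ v : Subtype.val '' (s ⁻¹' V'), ∃ h : v.1 ∈ V, s ⟨v.1, h⟩ ∈ V' := by
    rintro ⟨_, ⟨v, hv, rfl⟩⟩
    exact ⟨v.2, hv⟩
  refine ⟨_, hO, ⟨⟨y, hy⟩, hy', rfl⟩, fun v => s' ⟨s ⟨v.1, (hsub v).1⟩, (hsub v).2⟩, ?_, ?_⟩
  · exact hs'.comp (Continuous.subtype_mk (hs.comp (Continuous.subtype_mk continuous_subtype_val _)) _)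
  · intro v
    simp only [Function.comp_apply, hqs', hqs]

theorem LocallySplit.of_comp {W Z Y : Type u} [TopologicalSpace W]
    [TopologicalSpace Z] [TopologicalSpace Y] {q : Z → Y} {p : W → Z} (h : LocallySplit (q ∘ p))
    (hp : Continuous p) : LocallySplit q := by
  refine ⟨h.1.of_comp, fun y => ?_⟩
  obtain ⟨V, hV, hy, s, hs, hqs⟩ := h.2 y
  exact ⟨V, hV, hy, p ∘ s, hp.comp hs, hqs⟩

/-- Pull-backs of locally split maps are locally split. -/
theorem LocallySplit.lift {W Z Y A : Type u} [TopologicalSpace W] [TopologicalSpace Z]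
    [TopologicalSpace Y] [TopologicalSpace A] {p : Z → Y} (hp : LocallySplit p) {f : A → Y}
    (hf : Continuous f) {q : W → A} (m : {x : A × Z // f x.1 = p x.2} → W) (hm : Continuous m)
    (hq : ∀ x, q (m x) = x.1.1) : LocallySplit q := by
  have h : LocallySplit fun x : {x : A × Z // f x.1 = p x.2} => x.1.1 := by
    refine ⟨fun a => ?_, fun a => ?_⟩
    · obtain ⟨z, hz⟩ := hp.1 (f a)
      exact ⟨⟨(a, z), hz.symm⟩, rfl⟩
    · obtain ⟨V, hV, hy, s, hs, hqs⟩ := hp.2 (f a)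
      refine ⟨f ⁻¹' V, hV.preimage hf, hy, fun v => ⟨(v.1, s ⟨f v.1, v.2⟩), (hqs ⟨f v.1, v.2⟩).symm⟩, ?_,
        fun v => rfl⟩
      exact Continuous.subtype_mk (continuous_subtype_val.prodMk (hs.comp
        (Continuous.subtype_mk (hf.comp continuous_subtype_val) _))) _
  refine LocallySplit.of_comp (p := m) ?_ hm
  convert h using 1
  exact funext hq

theorem locallySplit_of_section {Z Y : Type u} [TopologicalSpace Z] [TopologicalSpace Y] {p : Z → Y}
    (s : Y → Z) (hs : Continuous s) (h : ∀ y, p (s y) = y) : LocallySplit p :=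
  ⟨fun y => ⟨s y, h y⟩, fun _ => ⟨Set.univ, isOpen_univ, trivial, fun v => s v.1,
    hs.comp continuous_subtype_val, fun _ => h _⟩⟩

/-- Pull-backs of open maps are open. -/
theorem IsOpenMap.fst_pullback {A Z Y : Type*} [TopologicalSpace Z] [TopologicalSpace Y]
    [TopologicalSpace A] {p : Z → Y} (hp : IsOpenMap p) {f : A → Y} (hf : Continuous f) :
    IsOpenMap fun x : {x : A × Z // f x.1 = p x.2} => x.1.1 := by
  intro O hO
  rw [isOpen_iff_mem_nhds]
  rintro _ ⟨⟨⟨a, z⟩, e⟩, hx, rfl⟩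
  obtain ⟨O', hO', rfl⟩ := isOpen_induced_iff.mp hO
  obtain ⟨U, V, hU, hV, ha, hz, hUV⟩ := isOpen_prod_iff.mp hO' a z hx
  refine Filter.mem_of_superset ((hU.inter ((hp V hV).preimage hf)).mem_nhds ⟨ha, z, hz, e.symm⟩) ?_
  rintro a' ⟨ha', z', hz', e'⟩
  exact ⟨⟨(a', z'), e'.symm⟩, hUV ⟨ha', hz'⟩, rfl⟩

theorem IsOpenMap.snd_pullback {A Z Y : Type*} [TopologicalSpace Z] [TopologicalSpace Y]
    [TopologicalSpace A] {p : Z → Y} (hp : IsOpenMap p) {f : A → Y} (hf : Continuous f) :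
    IsOpenMap fun x : {x : Z × A // p x.1 = f x.2} => x.1.2 := by
  let e : {x : Z × A // p x.1 = f x.2} ≃ₜ {x : A × Z // f x.1 = p x.2} :=
    { toFun := fun x => ⟨(x.1.2, x.1.1), x.2.symm⟩
      invFun := fun x => ⟨(x.1.2, x.1.1), x.2.symm⟩
      left_inv := fun _ => rfl
      right_inv := fun _ => rfl
      continuous_toFun := by fun_prop
      continuous_invFun := by fun_prop }
  exact (hp.fst_pullback hf).comp e.isOpenMap

theorem isOpenMap_of_comp_surjective {A B C : Type*} [TopologicalSpace A] [TopologicalSpace B]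
    [TopologicalSpace C] {g : B → C} {f : A → B} (h : IsOpenMap (g ∘ f)) (hf : Continuous f)
    (hs : Function.Surjective f) : IsOpenMap g := by
  intro O hO
  have := h _ (hO.preimage hf)
  rwa [Set.image_comp, Set.image_preimage_eq _ hs] at this

theorem locallyCompactSpace_eq {A C : Type*} [TopologicalSpace A] [LocallyCompactSpace A]
    [TopologicalSpace C] [T2Space C] {f g : A → C} (hf : Continuous f) (hg : Continuous g) :
    LocallyCompactSpace {a : A // f a = g a} :=
  (isClosed_eq hf hg).locallyCompactSpace

/-- Quotients by orbit relations have this property, `ho` being openness of saturations. Unlike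
general quotient maps, open ones are stable under products and restriction to preimages, so
continuity on spaces built from several quotients can be tested on representatives. -/
theorem isOpenQuotientMap_quot {E : Type*} [TopologicalSpace E] {r : E → E → Prop}
    (hr : Equivalence r) (ho : ∀ O : Set E, IsOpen O → IsOpen {x | ∃ y ∈ O, r x y}) :
    IsOpenQuotientMap (Quot.mk r) := by
  refine ⟨Quot.mk_surjective, continuous_quot_mk, fun O hO => ?_⟩
  rw [← isQuotientMap_quot_mk.isOpen_preimage]
  convert ho O hO using 1
  ext x
  simp only [Set.mem_preimage, Set.mem_image, Set.mem_ofPred_eq]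
  exact exists_congr fun y => and_congr_right fun _ =>
    ⟨fun e => hr.symm (hr.eqvGen_iff.mp (Quot.eqvGen_exact e)), fun e => Quot.sound (hr.symm e)⟩

theorem Equivalence.quot_mk_eq {E : Type*} {r : E → E → Prop} (hr : Equivalence r) {x y : E} :
    Quot.mk r x = Quot.mk r y ↔ r x y :=
  ⟨fun e => hr.eqvGen_iff.mp (Quot.eqvGen_exact e), fun e => Quot.sound e⟩

theorem t2Space_quot {E : Type*} [TopologicalSpace E] {r : E → E → Prop}
    (hr : Equivalence r) (hq : IsOpenQuotientMap (Quot.mk r))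
    (hc : IsClosed {q : E × E | r q.1 q.2}) : T2Space (Quot r) := by
  rw [t2Space_iff_of_isOpenQuotientMap hq]
  simpa only [hr.quot_mk_eq] using hc

/-- A subset of `A` cut out by a closed condition that makes sense on a closed subset. -/
theorem isClosed_exists_eq {A B : Type*} [TopologicalSpace A] [TopologicalSpace B] [T2Space B]
    {P : A → Prop} (hP : IsClosed {a | P a}) {f g : {a // P a} → B} (hf : Continuous f)
    (hg : Continuous g) : IsClosed {a | ∃ h : P a, f ⟨a, h⟩ = g ⟨a, h⟩} := by
  have := hP.isClosedEmbedding_subtypeVal.isClosedMap _ (isClosed_eq hf hg)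
  convert this using 1
  ext a
  constructor
  · rintro ⟨h, e⟩
    exact ⟨⟨a, h⟩, e, rfl⟩
  · rintro ⟨⟨a, h⟩, e, rfl⟩
    exact ⟨h, e⟩

end Topology

/-- The fibre product of two Real spaces over a third one. -/
abbrev RealSpace.fprod {A B C : RealSpace.{u}} (f : A → C) (g : B → C) (hf : Continuous f)
    (hg : Continuous g) (hf' : ∀ a, f (A.conj a) = C.conj (f a))
    (hg' : ∀ b, g (B.conj b) = C.conj (g b)) : RealSpace.{u} where
  carrier := {p : A × B // f p.1 = g p.2}
  t2 := inferInstanceAs (T2Space (Subtype _))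
  lc := locallyCompactSpace_eq (hf.comp continuous_fst) (hg.comp continuous_snd)
  conj p := ⟨(A.conj p.1.1, B.conj p.1.2), by rw [hf', hg', p.2]⟩
  continuous_conj := Continuous.subtype_mk ((A.continuous_conj.comp
    (continuous_fst.comp continuous_subtype_val)).prodMk (B.continuous_conj.comp
    (continuous_snd.comp continuous_subtype_val))) _
  conj_conj p := Subtype.ext (Prod.ext (A.conj_conj _) (B.conj_conj _))

/-! ### Principal `S`-bundles and their difference functions -/

section Principal

variable {S : RealAbelianGroup.{u}} {E B : RealSpace.{u}} {p : E → B} {a : S → E → E}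

/-- The difference of two points in the same fibre of a principal bundle: `div x y • y = x`. -/
noncomputable def IsRealPrincipal.div (h : IsRealPrincipal S p a) (x y : E) (e : p x = p y) : S :=
  (h.isHomeomorph.homeomorph.symm ⟨(x, y), e⟩).1

theorem IsRealPrincipal.act_div (h : IsRealPrincipal S p a) (x y : E) (e : p x = p y) :
    a (h.div x y e) y = x := by
  have h1 := h.isHomeomorph.homeomorph.apply_symm_apply ⟨(x, y), e⟩
  have h2 : (h.isHomeomorph.homeomorph.symm ⟨(x, y), e⟩).2 = y :=
    congrArg (fun w => w.1.2) h1
  have h3 : a (h.isHomeomorph.homeomorph.symm ⟨(x, y), e⟩).1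
    (h.isHomeomorph.homeomorph.symm ⟨(x, y), e⟩).2 = x := congrArg (fun w => w.1.1) h1
  rwa [h2] at h3

theorem IsRealPrincipal.free (h : IsRealPrincipal S p a) {c d : S} {x : E} (e : a c x = a d x) :
    c = d :=
  congrArg Prod.fst (h.isHomeomorph.injective (a₁ := (c, x)) (a₂ := (d, x))
    (Subtype.ext (Prod.ext e rfl)))

theorem IsRealPrincipal.div_eq (h : IsRealPrincipal S p a) {x y : E} {c : S} (e : p x = p y)
    (hc : a c y = x) : h.div x y e = c :=
  h.free ((h.act_div x y e).trans hc.symm)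

theorem IsRealPrincipal.continuous_div (h : IsRealPrincipal S p a) :
    Continuous fun w : {w : E × E // p w.1 = p w.2} => h.div w.1.1 w.1.2 w.2 :=
  continuous_fst.comp h.isHomeomorph.homeomorph.symm.continuous

theorem IsRealPrincipal.continuous_div' (h : IsRealPrincipal S p a) {A : Type*}
    [TopologicalSpace A] {f g : A → E} (hf : Continuous f) (hg : Continuous g)
    (e : ∀ x, p (f x) = p (g x)) : Continuous fun x => h.div (f x) (g x) (e x) :=
  h.continuous_div.comp (g := fun w : {w : E × E // p w.1 = p w.2} => h.div w.1.1 w.1.2 w.2)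
    (Continuous.subtype_mk (hf.prodMk hg) e)

theorem IsRealPrincipal.continuous_act' (h : IsRealPrincipal S p a) {A : Type*}
    [TopologicalSpace A] {f : A → S} {g : A → E} (hf : Continuous f) (hg : Continuous g) :
    Continuous fun x => a (f x) (g x) :=
  h.continuous_act.comp (hf.prodMk hg)

theorem IsRealPrincipal.act_left_cancel (h : IsRealPrincipal S p a) {c : S} {x y : E}
    (e : a c x = a c y) : x = y := by
  have := congrArg (a c⁻¹) e
  rwa [← h.mul_act, ← h.mul_act, inv_mul_cancel, h.one_act, h.one_act] at this

/-- A local section, translated by a constant of `S`, passes through any given point `x` over its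
domain. The base points at which the translated section lies in an open neighbourhood of `x` form an
open set. -/
theorem IsRealPrincipal.isOpenMap (h : IsRealPrincipal S p a) : IsOpenMap p := by
  intro O hO
  rw [isOpen_iff_mem_nhds]
  rintro _ ⟨x, hx, rfl⟩
  obtain ⟨V, hV, hy, s, hs, hps⟩ := h.locallySplit.2 (p x)
  let c := h.div x (s ⟨p x, hy⟩) (hps ⟨p x, hy⟩).symm
  have h1 : Continuous fun v => a c (s v) := h.continuous_act' continuous_const hs
  refine Filter.mem_of_superset ((hV.isOpenMap_subtype_val _ (hO.preimage h1)).mem_nhds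
    ⟨⟨p x, hy⟩, ?_, rfl⟩) ?_
  · simpa only [Set.mem_preimage, c, h.act_div] using hx
  · rintro _ ⟨v, hv, rfl⟩
    exact ⟨_, hv, by rw [h.proj_act, hps]⟩

/-- A free action with continuous difference function defines a principal bundle. -/
theorem IsRealPrincipal.of_div
    (continuous_proj : Continuous p)
    (conj_proj : ∀ v, p (E.conj v) = B.conj (p v))
    (continuous_act : Continuous fun q : S × E => a q.1 q.2)
    (one_act : ∀ v, a 1 v = v)
    (mul_act : ∀ c d v, a (c * d) v = a c (a d v))
    (conj_act : ∀ c v, a (S.conj c) (E.conj v) = E.conj (a c v))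
    (proj_act : ∀ c v, p (a c v) = p v)
    (locallySplit : LocallySplit p)
    (dv : {w : E × E // p w.1 = p w.2} → S) (continuous_dv : Continuous dv)
    (act_dv : ∀ w, a (dv w) w.1.2 = w.1.1) (dv_act : ∀ c v e, dv ⟨(a c v, v), e⟩ = c) :
    IsRealPrincipal S p a where
  continuous_proj := continuous_proj
  conj_proj := conj_proj
  continuous_act := continuous_act
  one_act := one_act
  mul_act := mul_act
  conj_act := conj_act
  proj_act := proj_act
  locallySplit := locallySplit
  isHomeomorph := by
    rw [isHomeomorph_iff_exists_inverse]
    refine ⟨(continuous_act.prodMk continuous_snd).subtype_mk _, fun w => (dv w, w.1.2), ?_, ?_,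
      continuous_dv.prodMk (continuous_snd.comp continuous_subtype_val)⟩
    · exact fun q => Prod.ext (dv_act _ _ _) rfl
    · exact fun w => Subtype.ext (Prod.ext (act_dv w) rfl)

end Principal

/-! ### Calculus in Real groupoids -/

section Groupoid

variable {X : RealSpace.{u}} (G : RealGroupoid X)

theorem RealGroupoid.mul_congr {g g' h h' : G.Arr} (e : G.src g = G.rng h) (eg : g = g')
    (eh : h = h') : G.mul g h e = G.mul g' h' (by rw [← eg, ← eh, e]) := by
  subst eg eh; rfl

theorem RealGroupoid.unit_mul' {g u : G.Arr} (e : G.src u = G.rng g) (hu : u = G.unit (G.rng g)) :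
    G.mul u g e = g := by
  subst hu; exact G.unit_mul g

theorem RealGroupoid.mul_unit' {g u : G.Arr} (e : G.src g = G.rng u) (hu : u = G.unit (G.src g)) :
    G.mul g u e = g := by
  subst hu; exact G.mul_unit g

theorem RealGroupoid.continuous_mul' {A : Type*} [TopologicalSpace A] {f g : A → G.Arr}
    (hf : Continuous f) (hg : Continuous g) (e : ∀ x, G.src (f x) = G.rng (g x)) :
    Continuous fun x => G.mul (f x) (g x) (e x) :=
  G.continuous_mul.comp (g := fun p : {p : G.Arr × G.Arr // G.src p.1 = G.rng p.2} =>
    G.mul p.1.1 p.1.2 p.2) (Continuous.subtype_mk (hf.prodMk hg) e)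

theorem RealGroupoid.inv_mul_cancel_left {g h : G.Arr} (e : G.src g = G.rng h) :
    G.mul (G.inv g) (G.mul g h e) (by rw [G.src_inv, G.rng_mul]) = h := by
  rw [← G.mul_assoc _ _ _ (G.src_inv g) e]
  exact G.unit_mul' _ (by rw [G.inv_mul, e])

theorem RealGroupoid.mul_inv_cancel_left {g h : G.Arr} (e : G.rng g = G.rng h) :
    G.mul g (G.mul (G.inv g) h ((G.src_inv g).trans e)) (by rw [G.rng_mul, G.rng_inv]) = h := by
  rw [← G.mul_assoc _ _ _ (G.rng_inv g).symm]
  exact G.unit_mul' _ (by rw [G.mul_inv, e])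

theorem RealGroupoid.mul_inv_cancel_right {g h : G.Arr} (e : G.src g = G.rng h) :
    G.mul (G.mul g h e) (G.inv h) (by rw [G.src_mul, G.rng_inv]) = g := by
  rw [G.mul_assoc _ _ _ e (G.rng_inv h).symm]
  exact G.mul_unit' _ (by rw [G.mul_inv, e])

theorem RealGroupoid.inv_mul_cancel_right {g h : G.Arr} (e : G.src g = G.src h) :
    G.mul (G.mul g (G.inv h) (e.trans (G.rng_inv h).symm)) h (by rw [G.src_mul, G.src_inv]) = g := by
  rw [G.mul_assoc _ _ _ _ (G.src_inv h)]
  exact G.mul_unit' _ (by rw [G.inv_mul, e])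

theorem RealGroupoid.mul_left_cancel {g h h' : G.Arr} (e : G.src g = G.rng h)
    (e' : G.src g = G.rng h') (H : G.mul g h e = G.mul g h' e') : h = h' := by
  rw [← G.inv_mul_cancel_left e, ← G.inv_mul_cancel_left e']
  exact G.mul_congr _ rfl H

theorem RealGroupoid.mul_right_cancel {g g' h : G.Arr} (e : G.src g = G.rng h)
    (e' : G.src g' = G.rng h) (H : G.mul g h e = G.mul g' h e') : g = g' := by
  rw [← G.mul_inv_cancel_right e, ← G.mul_inv_cancel_right e']
  exact G.mul_congr _ H rfl

theorem RealGroupoid.inv_conj (g : G.Arr) : G.inv (G.Arr.conj g) = G.Arr.conj (G.inv g) := by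
  refine G.mul_left_cancel (g := G.Arr.conj g) (G.rng_inv _).symm
    (by rw [G.src_conj, G.rng_conj, G.rng_inv]) ?_
  rw [G.mul_inv, G.mul_conj _ _ (G.rng_inv _).symm, G.mul_inv, G.rng_conj, G.unit_conj]

/-- Used to deduce preservation of units from preservation of products. -/
theorem RealGroupoid.unit_eq_of_mul_self {g : G.Arr} (e : G.src g = G.rng g)
    (h : G.mul g g e = g) : g = G.unit (G.rng g) :=
  G.mul_right_cancel e (G.src_unit _) (h.trans (G.unit_mul g).symm)

theorem RealGroupoid.inv_unit (x : X) : G.inv (G.unit x) = G.unit x :=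
  G.mul_left_cancel (g := G.unit x) (G.rng_inv _).symm (by rw [G.src_unit, G.rng_unit]) <| by
    rw [G.mul_inv, G.mul_unit' _ (by rw [G.src_unit]), G.rng_unit]

theorem RealGroupoid.isOpenMap_src : IsOpenMap G.src := by
  have h : G.src = G.rng ∘ G.inv := funext fun g => (G.rng_inv g).symm
  have hi : ∀ g, G.inv (G.inv g) = g := fun g =>
    G.mul_left_cancel (g := G.inv g) (G.rng_inv _).symm (G.src_inv g)
      (by rw [G.mul_inv, G.inv_mul, G.rng_inv])
  let i : G.Arr ≃ₜ G.Arr := ⟨⟨G.inv, G.inv, hi, hi⟩, G.continuous_inv, G.continuous_inv⟩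
  rw [h]
  exact G.isOpenMap_rng.comp i.isOpenMap

end Groupoid

section Hom

variable {X Y W : RealSpace.{u}}

/-- The identity homomorphism. -/
abbrev RealHom.id (G : RealGroupoid X) : RealHom G G where
  obj x := x
  arr g := g
  continuous_obj := continuous_id
  continuous_arr := continuous_id
  rng_arr _ := rfl
  src_arr _ := rfl
  unit_arr _ := rfl
  mul_arr _ _ _ := rfl
  conj_obj _ := rfl
  conj_arr _ := rfl

/-- The composite of two homomorphisms. -/
abbrev RealHom.comp {G : RealGroupoid X} {H : RealGroupoid Y} {K : RealGroupoid W} (f : RealHom H K)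
    (g : RealHom G H) : RealHom G K where
  obj x := f.obj (g.obj x)
  arr x := f.arr (g.arr x)
  continuous_obj := f.continuous_obj.comp g.continuous_obj
  continuous_arr := f.continuous_arr.comp g.continuous_arr
  rng_arr _ := by rw [f.rng_arr, g.rng_arr]
  src_arr _ := by rw [f.src_arr, g.src_arr]
  unit_arr _ := by rw [g.unit_arr, f.unit_arr]
  mul_arr a b e := by
    rw [f.mul_arr (g.arr a) (g.arr b) (by rw [g.src_arr, g.rng_arr, e]) |>.symm]
    exact congrArg f.arr (g.mul_arr a b e)
  conj_obj _ := by rw [g.conj_obj, f.conj_obj]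
  conj_arr _ := by rw [g.conj_arr, f.conj_arr]

theorem RealHom.inv_arr {G : RealGroupoid X} {H : RealGroupoid Y} (f : RealHom G H) (g : G.Arr) :
    f.arr (G.inv g) = H.inv (f.arr g) := by
  refine H.mul_left_cancel (g := f.arr g) (by rw [f.src_arr, f.rng_arr, G.rng_inv])
    (H.rng_inv _).symm ?_
  rw [← f.mul_arr _ _ (G.rng_inv g).symm, G.mul_inv, H.mul_inv, f.unit_arr, f.rng_arr]

end Hom

/-! ### Signs and elementary rules for twists -/

/-- The sign `±1` of an element of `ℤ/2`. -/
def RealAbelianGroup.eps (S : RealAbelianGroup.{u}) (a : ZMod 2) : S := S.sign ^ a.val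

theorem RealAbelianGroup.eps_add (S : RealAbelianGroup.{u}) (a b : ZMod 2) :
    S.eps (a + b) = S.eps a * S.eps b := by
  rw [eps, eps, eps, ← pow_add, ZMod.val_add]
  exact (pow_eq_pow_mod _ ((sq _).trans S.sign_mul_sign)).symm

@[simp] theorem RealAbelianGroup.eps_zero (S : RealAbelianGroup.{u}) : S.eps 0 = 1 := by
  simp [RealAbelianGroup.eps]

theorem RealAbelianGroup.eps_mul_self (S : RealAbelianGroup.{u}) (a : ZMod 2) :
    S.eps a * S.eps a = 1 := by
  rw [← S.eps_add, CharTwo.add_self_eq_zero, S.eps_zero]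

theorem RealAbelianGroup.conj_eps (S : RealAbelianGroup.{u}) (a : ZMod 2) :
    S.conj (S.eps a) = S.eps a := by
  rw [RealAbelianGroup.eps, map_pow, S.conj_sign]

theorem RealAbelianGroup.continuous_eps (S : RealAbelianGroup.{u}) : Continuous S.eps :=
  continuous_of_discreteTopology

theorem RealAbelianGroup.continuous_eps' (S : RealAbelianGroup.{u}) {A : Type*}
    [TopologicalSpace A] {f : A → ZMod 2} (hf : Continuous f) : Continuous fun x => S.eps (f x) :=
  S.continuous_eps.comp hf

section TwistBasics

variable {Y : RealSpace.{u}} {Γ : RealGroupoid Y} {S : RealAbelianGroup.{u}} (T : RealTwist Γ S)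

theorem RealTwist.rng_proj (t : T.grpd.Arr) : Γ.rng (T.proj.arr t) = T.grpd.rng t := by
  rw [T.proj.rng_arr, T.proj_obj]

theorem RealTwist.src_proj (t : T.grpd.Arr) : Γ.src (T.proj.arr t) = T.grpd.src t := by
  rw [T.proj.src_arr, T.proj_obj]

theorem RealTwist.proj_mul (t t' : T.grpd.Arr) (e : T.grpd.src t = T.grpd.rng t') :
    T.proj.arr (T.grpd.mul t t' e) =
      Γ.mul (T.proj.arr t) (T.proj.arr t') (by rw [T.rng_proj, T.src_proj, e]) :=
  T.proj.mul_arr t t' e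

theorem RealTwist.proj_unit (y : Y) : T.proj.arr (T.grpd.unit y) = Γ.unit y := by
  rw [T.proj.unit_arr, T.proj_obj]

theorem RealTwist.rng_act (c : S) (t : T.grpd.Arr) : T.grpd.rng (T.act c t) = T.grpd.rng t := by
  rw [← T.rng_proj, T.principal.proj_act, T.rng_proj]

theorem RealTwist.src_act (c : S) (t : T.grpd.Arr) : T.grpd.src (T.act c t) = T.grpd.src t := by
  rw [← T.src_proj, T.principal.proj_act, T.src_proj]

theorem RealTwist.act_mul (c : S) (t t' : T.grpd.Arr) (e e') :
    T.grpd.mul (T.act c t) t' e' = T.act c (T.grpd.mul t t' e) := by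
  have := T.act_mul_act c 1 t t' e (by rw [T.src_act, T.rng_act, e])
  rw [mul_one] at this
  rw [← this]
  exact T.grpd.mul_congr _ rfl (T.principal.one_act _).symm

theorem RealTwist.mul_act (c : S) (t t' : T.grpd.Arr) (e e') :
    T.grpd.mul t (T.act c t') e' = T.act c (T.grpd.mul t t' e) := by
  have := T.act_mul_act 1 c t t' e (by rw [T.src_act, T.rng_act, e])
  rw [one_mul] at this
  rw [← this]
  exact T.grpd.mul_congr _ (T.principal.one_act _).symm rfl

theorem RealTwist.deg_inv (g : Γ.Arr) : T.deg (Γ.inv g) = T.deg g := by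
  have := congrArg ULift.down (T.degHom.inv_arr g)
  exact this.trans (ZMod.neg_eq_self_mod_two _)

end TwistBasics

/-! ### Units and inverses of a twist come for free -/

/-- The data of a twist without units and inverses: a Real principal bundle over the arrows with an
associative and bilinear multiplication. -/
structure TwistCore {Y : RealSpace.{u}} (Γ : RealGroupoid Y) (S : RealAbelianGroup.{u}) :
    Type (u + 1) where
  E : RealSpace.{u}
  p : E → Γ.Arr
  act : S → E → E
  principal : IsRealPrincipal S p act
  mul : ∀ x y : E, Γ.src (p x) = Γ.rng (p y) → E
  continuous_mul : Continuous fun w : {w : E × E // Γ.src (p w.1) = Γ.rng (p w.2)} =>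
    mul w.1.1 w.1.2 w.2
  proj_mul : ∀ x y e, p (mul x y e) = Γ.mul (p x) (p y) e
  act_mul_act : ∀ c d x y e e', mul (act c x) (act d y) e' = act (c * d) (mul x y e)
  mul_assoc : ∀ x y z e e' h h', mul (mul x y e) z h = mul x (mul y z e') h'
  mul_conj : ∀ x y e e', mul (E.conj x) (E.conj y) e' = E.conj (mul x y e)
  deg : Γ.Arr → ZMod 2
  continuous_deg : Continuous deg
  deg_mul : ∀ g h e, deg (Γ.mul g h e) = deg g + deg h
  deg_conj : ∀ g, deg (Γ.Arr.conj g) = deg g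

namespace TwistCore

variable {Y : RealSpace.{u}} {Γ : RealGroupoid Y} {S : RealAbelianGroup.{u}} (K : TwistCore Γ S)

theorem mul_congr {x x' y y' : K.E} (e : Γ.src (K.p x) = Γ.rng (K.p y)) (hx : x = x')
    (hy : y = y') : K.mul x y e = K.mul x' y' (by rw [← hx, ← hy, e]) := by
  subst hx hy; rfl

theorem continuous_mul' {A : Type*} [TopologicalSpace A] {f g : A → K.E}
    (hf : Continuous f) (hg : Continuous g) (e : ∀ x, Γ.src (K.p (f x)) = Γ.rng (K.p (g x))) :
    Continuous fun x => K.mul (f x) (g x) (e x) :=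
  K.continuous_mul.comp (g := fun w : {w : K.E × K.E // Γ.src (K.p w.1) = Γ.rng (K.p w.2)} =>
    K.mul w.1.1 w.1.2 w.2) (Continuous.subtype_mk (hf.prodMk hg) e)

theorem act_mul (c : S) (x y : K.E) (e e') : K.mul (K.act c x) y e' = K.act c (K.mul x y e) := by
  have := K.act_mul_act c 1 x y e (by rw [K.principal.proj_act, K.principal.proj_act, e])
  rw [mul_one] at this
  rw [← this]
  exact K.mul_congr _ rfl (K.principal.one_act _).symm

theorem mul_act (c : S) (x y : K.E) (e e') : K.mul x (K.act c y) e' = K.act c (K.mul x y e) := by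
  have := K.act_mul_act 1 c x y e (by rw [K.principal.proj_act, K.principal.proj_act, e])
  rw [one_mul] at this
  rw [← this]
  exact K.mul_congr _ (K.principal.one_act _).symm rfl

theorem composable_unit {x : K.E} {y : Y} (h : K.p x = Γ.unit y) :
    Γ.src (K.p x) = Γ.rng (K.p x) := by rw [h, Γ.src_unit, Γ.rng_unit]

theorem unit_mul_unit (y : Y) :
    Γ.mul (Γ.unit y) (Γ.unit y) (by rw [Γ.src_unit, Γ.rng_unit]) = Γ.unit y :=
  Γ.unit_mul' _ (by rw [Γ.rng_unit])

theorem proj_mul_self {x : K.E} {y : Y} (h : K.p x = Γ.unit y) :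
    K.p (K.mul x x (K.composable_unit h)) = K.p x := by
  rw [K.proj_mul, Γ.mul_congr _ h h, unit_mul_unit, h]

/-- If `x x = c x` with `x` over a unit, then `c⁻¹ x` is idempotent, because rescaling `x` by `c⁻¹`
rescales its square by `c⁻²`. -/
theorem normalize_mul_self {x : K.E} {y : Y} (h : K.p x = Γ.unit y) (e) :
    K.mul (K.act (K.principal.div _ _ (K.proj_mul_self h))⁻¹ x)
      (K.act (K.principal.div _ _ (K.proj_mul_self h))⁻¹ x) e =
      K.act (K.principal.div _ _ (K.proj_mul_self h))⁻¹ x := by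
  rw [K.act_mul_act _ _ _ _ (K.composable_unit h)]
  exact (congrArg (K.act _) (K.principal.act_div _ _ (K.proj_mul_self h)).symm).trans
    (by rw [← K.principal.mul_act, inv_mul_cancel_right])

theorem exists_unit (y : Y) : ∃ x : K.E, K.p x = Γ.unit y ∧ ∀ e, K.mul x x e = x := by
  obtain ⟨x, hx⟩ := K.principal.locallySplit.1 (Γ.unit y)
  exact ⟨_, by rw [K.principal.proj_act, hx], fun e => K.normalize_mul_self hx e⟩

noncomputable def unit (y : Y) : K.E := (K.exists_unit y).choose

theorem proj_unit (y : Y) : K.p (K.unit y) = Γ.unit y := (K.exists_unit y).choose_spec.1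

theorem unit_mul_self (y : Y) (e) : K.mul (K.unit y) (K.unit y) e = K.unit y :=
  (K.exists_unit y).choose_spec.2 e

/-- Two idempotents over the same unit differ by a scalar with `c * c = c`, so `c = 1`. -/
theorem eq_unit {x : K.E} {y : Y} (h : K.p x = Γ.unit y)
    (h' : K.mul x x (K.composable_unit h) = x) : x = K.unit y := by
  have e : K.p x = K.p (K.unit y) := by rw [h, K.proj_unit]
  set c := K.principal.div _ _ e with hc
  have h1 : K.act c (K.unit y) = x := K.principal.act_div _ _ e
  have h2 : K.act (c * c) (K.unit y) = K.act c (K.unit y) := by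
    rw [← K.unit_mul_self y (K.composable_unit (K.proj_unit y)),
      ← K.act_mul_act c c _ _ _ (by
        rw [K.principal.proj_act, K.composable_unit (K.proj_unit y)]), K.unit_mul_self]
    rw [K.mul_congr _ h1 h1]
    exact h'.trans h1.symm
  have h3 : c = 1 := by simpa using K.principal.free h2
  rw [← h1, h3, K.principal.one_act]

/-- By uniqueness of idempotents, the unit is obtained by normalizing any local lift of the units of
`Γ`, and the normalizing scalar is a continuous difference. Inverses are treated below by the same
method. -/
theorem continuous_unit : Continuous K.unit := by
  refine K.principal.locallySplit.continuous_of_lift Γ.continuous_unit ?_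
  intro V _ i e hi he h
  have : (fun v => K.unit (i v)) = fun v => K.act
      (K.principal.div _ _ (K.proj_mul_self (h v)))⁻¹ (e v) := by
    funext v
    refine (K.eq_unit (by rw [K.principal.proj_act, h]) (K.normalize_mul_self (h v) _)).symm
  rw [this]
  exact K.principal.continuous_act' (K.principal.continuous_div'
    (K.continuous_mul' he he fun v => K.composable_unit (h v)) he _).inv he

/-- Writing `u x = c x` for the unit `u`, associativity and `u u = u` give `c² x = u (u x) = (u u) x
= c x`, so `c = 1`. -/
theorem unit_mul (x : K.E) (e) : K.mul (K.unit (Γ.rng (K.p x))) x e = x := by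
  have h : K.p (K.mul (K.unit (Γ.rng (K.p x))) x e) = K.p x := by
    rw [K.proj_mul]
    exact Γ.unit_mul' _ (K.proj_unit _)
  have h1 := K.principal.act_div _ _ h
  set c := K.principal.div _ _ h
  have h2 : K.act (c * c) x = K.act c x := by
    conv_rhs => rw [h1, ← K.mul_congr (by
        rw [K.proj_mul, Γ.src_mul]; exact e) (K.unit_mul_self _ (K.composable_unit
        (K.proj_unit _))) rfl,
      K.mul_assoc _ _ _ _ e _ (by rw [K.proj_mul, Γ.rng_mul, K.proj_unit, Γ.src_unit, Γ.rng_unit]),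
      ← K.mul_congr (by rw [K.principal.proj_act]; exact e) rfl h1, K.mul_act _ _ _ e, ← h1,
      ← K.principal.mul_act]
  have h3 : c = 1 := by simpa using K.principal.free h2
  rw [← h1, h3, K.principal.one_act]

theorem mul_unit (x : K.E) (e) : K.mul x (K.unit (Γ.src (K.p x))) e = x := by
  have h : K.p (K.mul x (K.unit (Γ.src (K.p x))) e) = K.p x := by
    rw [K.proj_mul]
    exact Γ.mul_unit' _ (K.proj_unit _)
  have h1 := K.principal.act_div _ _ h
  set c := K.principal.div _ _ h
  have h2 : K.act (c * c) x = K.act c x := by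
    conv_rhs => rw [h1, ← K.mul_congr (by
        rw [K.proj_mul, Γ.rng_mul]; exact e) rfl (K.unit_mul_self _ (K.composable_unit
        (K.proj_unit _))),
      ← K.mul_assoc _ _ _ e _ (by rw [K.proj_mul, Γ.src_mul, K.proj_unit, Γ.src_unit, Γ.rng_unit]),
      ← K.mul_congr (by rw [K.principal.proj_act]; exact e) h1 rfl, K.act_mul _ _ _ e, ← h1,
      ← K.principal.mul_act]
  have h3 : c = 1 := by simpa using K.principal.free h2
  rw [← h1, h3, K.principal.one_act]

theorem composable_inv {x b : K.E} (hb : K.p b = Γ.inv (K.p x)) :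
    Γ.src (K.p x) = Γ.rng (K.p b) := by rw [hb, Γ.rng_inv]

theorem proj_mul_inv {x b : K.E} (hb : K.p b = Γ.inv (K.p x)) :
    K.p (K.mul x b (K.composable_inv hb)) = K.p (K.unit (Γ.rng (K.p x))) := by
  rw [K.proj_mul, K.proj_unit, Γ.mul_congr _ rfl hb, Γ.mul_inv]

theorem normalize_mul_inv {x b : K.E} (hb : K.p b = Γ.inv (K.p x)) (e) :
    K.mul x (K.act (K.principal.div _ _ (K.proj_mul_inv hb))⁻¹ b) e = K.unit (Γ.rng (K.p x)) := by
  rw [K.mul_act _ _ _ (K.composable_inv hb)]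
  exact (congrArg (K.act _) (K.principal.act_div _ _ (K.proj_mul_inv hb)).symm).trans
    (by rw [← K.principal.mul_act, inv_mul_cancel, K.principal.one_act])

theorem exists_inv (x : K.E) :
    ∃ b : K.E, K.p b = Γ.inv (K.p x) ∧ ∀ e, K.mul x b e = K.unit (Γ.rng (K.p x)) := by
  obtain ⟨b, hb⟩ := K.principal.locallySplit.1 (Γ.inv (K.p x))
  exact ⟨_, by rw [K.principal.proj_act, hb], fun e => K.normalize_mul_inv hb e⟩

noncomputable def inv (x : K.E) : K.E := (K.exists_inv x).choose

theorem proj_inv (x : K.E) : K.p (K.inv x) = Γ.inv (K.p x) := (K.exists_inv x).choose_spec.1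

theorem mul_inv (x : K.E) (e) : K.mul x (K.inv x) e = K.unit (Γ.rng (K.p x)) :=
  (K.exists_inv x).choose_spec.2 e

/-- With `b` the chosen right inverse, `(b x)(b x) = b ((x b) x) = b x` is idempotent over a unit,
hence is the unit. -/
theorem inv_mul (x : K.E) (e) : K.mul (K.inv x) x e = K.unit (Γ.src (K.p x)) := by
  have e2 : Γ.src (K.p x) = Γ.rng (K.p (K.inv x)) := by rw [K.proj_inv, Γ.rng_inv]
  have h1 : K.p (K.mul (K.inv x) x e) = Γ.unit (Γ.src (K.p x)) := by
    rw [K.proj_mul, Γ.mul_congr _ (K.proj_inv x) rfl, Γ.inv_mul]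
  refine K.eq_unit h1 ?_
  have e3 : Γ.src (K.p x) = Γ.rng (K.p (K.mul (K.inv x) x e)) := by rw [h1, Γ.rng_unit]
  rw [K.mul_assoc (K.inv x) x _ e e3 _ (by rw [K.proj_mul, Γ.rng_mul, e])]
  refine K.mul_congr _ rfl ?_
  rw [← K.mul_assoc x (K.inv x) x e2 e (by rw [K.proj_mul, Γ.src_mul, e]),
    K.mul_congr _ (K.mul_inv x _) rfl, K.unit_mul]

theorem eq_inv {x b : K.E} (hb : K.p b = Γ.inv (K.p x))
    (h : K.mul x b (K.composable_inv hb) = K.unit (Γ.rng (K.p x))) : b = K.inv x := by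
  have e : K.p b = K.p (K.inv x) := by rw [hb, K.proj_inv]
  have h1 := K.principal.act_div _ _ e
  set c := K.principal.div _ _ e
  have h2 : K.act c (K.unit (Γ.rng (K.p x))) = K.act 1 (K.unit (Γ.rng (K.p x))) := by
    rw [K.principal.one_act]
    conv_rhs => rw [← h,
      ← K.mul_congr (by rw [K.principal.proj_act]; exact K.composable_inv (K.proj_inv x)) rfl h1,
      K.mul_act _ _ _ (K.composable_inv (K.proj_inv x)), K.mul_inv]
  rw [← h1, K.principal.free h2, K.principal.one_act]

theorem continuous_inv : Continuous K.inv := by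
  refine K.principal.locallySplit.continuous_of_lift
    (Γ.continuous_inv.comp K.principal.continuous_proj) ?_
  intro V _ i e hi he h
  have : (fun v => K.inv (i v)) = fun v => K.act
      (K.principal.div _ _ (K.proj_mul_inv (h v)))⁻¹ (e v) := by
    funext v
    refine (K.eq_inv (by rw [K.principal.proj_act]; exact h v) (K.normalize_mul_inv (h v) _)).symm
  rw [this]
  exact K.principal.continuous_act' (K.principal.continuous_div'
    (K.continuous_mul' hi he fun v => K.composable_inv (h v))
    (K.continuous_unit.comp (Γ.continuous_rng.comp (K.principal.continuous_proj.comp hi))) _).inv he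

/-- The groupoid of a twist core. -/
noncomputable def groupoid : RealGroupoid Y where
  Arr := K.E
  rng x := Γ.rng (K.p x)
  src x := Γ.src (K.p x)
  unit := K.unit
  inv := K.inv
  mul := K.mul
  continuous_rng := Γ.continuous_rng.comp K.principal.continuous_proj
  continuous_src := Γ.continuous_src.comp K.principal.continuous_proj
  continuous_unit := K.continuous_unit
  continuous_inv := K.continuous_inv
  continuous_mul := K.continuous_mul
  isOpenMap_rng := Γ.isOpenMap_rng.comp K.principal.isOpenMap
  rng_unit x := by rw [K.proj_unit, Γ.rng_unit]
  src_unit x := by rw [K.proj_unit, Γ.src_unit]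
  rng_mul g h e := by rw [K.proj_mul, Γ.rng_mul]
  src_mul g h e := by rw [K.proj_mul, Γ.src_mul]
  rng_inv x := by rw [K.proj_inv, Γ.rng_inv]
  src_inv x := by rw [K.proj_inv, Γ.src_inv]
  unit_mul x := K.unit_mul x _
  mul_unit x := K.mul_unit x _
  mul_assoc x y z e e' := K.mul_assoc x y z e e' _ _
  mul_inv x := K.mul_inv x _
  inv_mul x := K.inv_mul x _
  rng_conj x := by rw [K.principal.conj_proj, Γ.rng_conj]
  src_conj x := by rw [K.principal.conj_proj, Γ.src_conj]
  unit_conj y := by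
    have h : K.p (K.E.conj (K.unit y)) = Γ.unit (Y.conj y) := by
      rw [K.principal.conj_proj, K.proj_unit, Γ.unit_conj]
    refine (K.eq_unit h ?_).symm
    rw [K.mul_conj _ _ (K.composable_unit (K.proj_unit y)), K.unit_mul_self]
  mul_conj x y e := K.mul_conj x y e _

/-- The twist of a twist core. -/
noncomputable def twist : RealTwist Γ S where
  grpd := K.groupoid
  proj :=
    { obj := fun y => y
      arr := K.p
      continuous_obj := continuous_id
      continuous_arr := K.principal.continuous_proj
      rng_arr := fun _ => rfl
      src_arr := fun _ => rfl
      unit_arr := K.proj_unit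
      mul_arr := fun _ _ _ => K.proj_mul _ _ _
      conj_obj := fun _ => rfl
      conj_arr := K.principal.conj_proj }
  proj_obj _ := rfl
  act := K.act
  principal := K.principal
  act_mul_act c d x y e e' := K.act_mul_act c d x y e e'
  deg := K.deg
  continuous_deg := K.continuous_deg
  deg_mul := K.deg_mul
  deg_conj := K.deg_conj

end TwistCore

/-! ### Homomorphisms of twists, with gradings up to coboundaries -/

section TwHom

variable {Y Y' Y'' : RealSpace.{u}} {Γ : RealGroupoid Y} {Γ' : RealGroupoid Y'}
  {Γ'' : RealGroupoid Y''} {S : RealAbelianGroup.{u}}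

/-- `F` is an `S`-equivariant Real homomorphism of the underlying ungraded twists over `f`. -/
structure IsTwHom (f : RealHom Γ' Γ) (T' : RealTwist Γ' S) (T : RealTwist Γ S)
    (F : T'.grpd.Arr → T.grpd.Arr) : Prop where
  continuous : Continuous F
  proj : ∀ t, T.proj.arr (F t) = f.arr (T'.proj.arr t)
  act : ∀ c t, F (T'.act c t) = T.act c (F t)
  conj : ∀ t, F (T'.grpd.Arr.conj t) = T.grpd.Arr.conj (F t)
  mul : ∀ t t' e e', F (T'.grpd.mul t t' e) = T.grpd.mul (F t) (F t') e'

/-- `T'` is isomorphic to the pull-back of `T` along `f` as an ungraded twist, and the gradings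
differ by the coboundary of the Real function `c`. -/
structure TwHom (f : RealHom Γ' Γ) (c : Y' → ZMod 2) (T' : RealTwist Γ' S) (T : RealTwist Γ S) :
    Prop where
  exists_hom : ∃ F, IsTwHom f T' T F
  continuous : Continuous c
  conj : ∀ y, c (Y'.conj y) = c y
  deg : ∀ g, T'.deg g = T.deg (f.arr g) + c (Γ'.rng g) + c (Γ'.src g)

theorem TwHom.of_isTwHom {f : RealHom Γ' Γ} {T' : RealTwist Γ' S} {T : RealTwist Γ S}
    {F : T'.grpd.Arr → T.grpd.Arr} (h : IsTwHom f T' T F) (hd : ∀ g, T'.deg g = T.deg (f.arr g)) :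
    TwHom f 0 T' T where
  exists_hom := ⟨F, h⟩
  continuous := continuous_const
  conj _ := rfl
  deg g := by simp [hd]

theorem TwHom.comp {f : RealHom Γ' Γ} {g : RealHom Γ'' Γ'} {c : Y' → ZMod 2} {d : Y'' → ZMod 2}
    {T'' : RealTwist Γ'' S} {T' : RealTwist Γ' S} {T : RealTwist Γ S} (h : TwHom f c T' T)
    (h' : TwHom g d T'' T') : TwHom (f.comp g) (fun y => c (g.obj y) + d y) T'' T where
  exists_hom := by
    obtain ⟨F, hF⟩ := h.exists_hom
    obtain ⟨F', hF'⟩ := h'.exists_hom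
    refine ⟨F ∘ F', hF.continuous.comp hF'.continuous, fun t => ?_, fun c t => ?_, fun t => ?_,
      fun t t' e e' => ?_⟩
    · simp only [Function.comp_apply, hF.proj, hF'.proj]
    · simp only [Function.comp_apply, hF.act, hF'.act]
    · simp only [Function.comp_apply, hF.conj, hF'.conj]
    · have e1 : T'.grpd.src (F' t) = T'.grpd.rng (F' t') := by
        rw [← T'.src_proj, ← T'.rng_proj, hF'.proj, hF'.proj, g.src_arr, g.rng_arr, T''.src_proj,
          T''.rng_proj, e]
      simp only [Function.comp_apply]
      rw [hF'.mul t t' e e1, hF.mul _ _ e1]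
  continuous := (h.continuous.comp g.continuous_obj).add h'.continuous
  conj y := by rw [g.conj_obj, h.conj, h'.conj]
  deg x := by
    rw [h'.deg, h.deg, g.rng_arr, g.src_arr]
    ring

theorem IsTwHom.composable {f : RealHom Γ' Γ} {T' : RealTwist Γ' S} {T : RealTwist Γ S}
    {F : T'.grpd.Arr → T.grpd.Arr} (h : IsTwHom f T' T F) {t t' : T'.grpd.Arr}
    (e : T'.grpd.src t = T'.grpd.rng t') : T.grpd.src (F t) = T.grpd.rng (F t') := by
  rw [← T.src_proj, ← T.rng_proj, h.proj, h.proj, f.src_arr, f.rng_arr, T'.src_proj,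
    T'.rng_proj, e]

theorem IsTwHom.rng {f : RealHom Γ' Γ} {T' : RealTwist Γ' S} {T : RealTwist Γ S}
    {F : T'.grpd.Arr → T.grpd.Arr} (h : IsTwHom f T' T F) (t : T'.grpd.Arr) :
    T.grpd.rng (F t) = f.obj (T'.grpd.rng t) := by
  rw [← T.rng_proj, h.proj, f.rng_arr, T'.rng_proj]

theorem IsTwHom.src {f : RealHom Γ' Γ} {T' : RealTwist Γ' S} {T : RealTwist Γ S}
    {F : T'.grpd.Arr → T.grpd.Arr} (h : IsTwHom f T' T F) (t : T'.grpd.Arr) :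
    T.grpd.src (F t) = f.obj (T'.grpd.src t) := by
  rw [← T.src_proj, h.proj, f.src_arr, T'.src_proj]

/-- A homomorphism of twists as a homomorphism of groupoids. -/
def IsTwHom.realHom {f : RealHom Γ' Γ} {T' : RealTwist Γ' S} {T : RealTwist Γ S}
    {F : T'.grpd.Arr → T.grpd.Arr} (h : IsTwHom f T' T F) : RealHom T'.grpd T.grpd where
  obj := f.obj
  arr := F
  continuous_obj := f.continuous_obj
  continuous_arr := h.continuous
  rng_arr := h.rng
  src_arr := h.src
  unit_arr y := by
    have e1 : T'.grpd.src (T'.grpd.unit y) = T'.grpd.rng (T'.grpd.unit y) := by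
      rw [T'.grpd.src_unit, T'.grpd.rng_unit]
    have e2 := h.composable e1
    -- `IsTwHom` does not mention units. The image of a unit is idempotent, hence a unit.
    have := T.grpd.unit_eq_of_mul_self e2 (by
      rw [← h.mul _ _ e1, T'.grpd.unit_mul' e1 (by rw [T'.grpd.rng_unit])])
    rwa [h.rng, T'.grpd.rng_unit] at this
  mul_arr t t' e := h.mul t t' e _
  conj_obj := f.conj_obj
  conj_arr := h.conj

/-- A homomorphism of twists over the same groupoid is invertible. -/
theorem IsTwHom.exists_inverse {T T' : RealTwist Γ S} {F : T.grpd.Arr → T'.grpd.Arr}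
    (hF : IsTwHom (RealHom.id Γ) T T' F) :
    ∃ I, IsTwHom (RealHom.id Γ) T' T I ∧ (∀ t, F (I t) = t) ∧ ∀ t, I (F t) = t := by
  have inj : ∀ t t', F t = F t' → t = t' := by
    intro t t' e
    have e' : T.proj.arr t = T.proj.arr t' := by rw [← hF.proj, ← hF.proj, e]
    rw [← T.principal.act_div t t' e', hF.act] at e
    have := T'.principal.free (e.trans (T'.principal.one_act _).symm)
    rw [← T.principal.act_div t t' e', this, T.principal.one_act]
  have surj : ∀ t', ∃ t, F t = t' := by
    intro t'
    obtain ⟨t, ht⟩ := T.principal.locallySplit.1 (T'.proj.arr t')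
    have e : T'.proj.arr t' = T'.proj.arr (F t) := by rw [hF.proj, ht]
    exact ⟨T.act (T'.principal.div _ _ e) t, by rw [hF.act, T'.principal.act_div]⟩
  choose I hI using surj
  have hp : ∀ t, T.proj.arr (I t) = T'.proj.arr t := fun t => by
    rw [← hI t, hF.proj, hI]
  have hc : ∀ t t', T'.grpd.src t = T'.grpd.rng t' → T.grpd.src (I t) = T.grpd.rng (I t') :=
    fun t t' e => by rw [← T.src_proj, ← T.rng_proj, hp, hp, T'.src_proj, T'.rng_proj, e]
  refine ⟨I, ⟨?_, hp, fun c t => inj _ _ ?_, fun t => inj _ _ ?_, fun t t' e e' => inj _ _ ?_⟩,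
    hI, fun t => inj _ _ (hI _)⟩
  -- With a local lift `e` of the base point to `T`, the preimage of `t'` is `e` scaled by the
  -- difference of `t'` and `F e`, which is continuous.
  · refine T.principal.locallySplit.continuous_of_lift T'.principal.continuous_proj ?_
    intro V _ i e hi he hv
    have e1 : ∀ v, T'.proj.arr (i v) = T'.proj.arr (F (e v)) := fun v => by rw [hF.proj, hv]
    have : (fun v => I (i v)) = fun v => T.act (T'.principal.div _ _ (e1 v)) (e v) :=
      funext fun v => inj _ _ (by rw [hI, hF.act, T'.principal.act_div])
    rw [this]
    exact T.principal.continuous_act'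
      (T'.principal.continuous_div' hi (hF.continuous.comp he) e1) he
  · rw [hI, hF.act, hI]
  · rw [hI, hF.conj, hI]
  · rw [hI, hF.mul _ _ e' (hF.composable e')]
    exact T'.grpd.mul_congr _ (hI _).symm (hI _).symm

theorem TwHom.symm {c : Y → ZMod 2} {T T' : RealTwist Γ S} (h : TwHom (RealHom.id Γ) c T T') :
    TwHom (RealHom.id Γ) c T' T where
  exists_hom := by
    obtain ⟨F, hF⟩ := h.exists_hom
    obtain ⟨I, hI, -⟩ := hF.exists_inverse
    exact ⟨I, hI⟩
  continuous := h.continuous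
  conj := h.conj
  deg g := by
    rw [h.deg]
    have h1 := CharTwo.add_self_eq_zero (c (Γ.rng g))
    have h2 := CharTwo.add_self_eq_zero (c (Γ.src g))
    linear_combination -h1 - h2

/-- Composition with an isomorphism of graded twists. -/
theorem TwHom.comp_iso {f : RealHom Γ' Γ} {c : Y' → ZMod 2} {T₁ T' : RealTwist Γ' S}
    {T : RealTwist Γ S} (h : TwHom f c T' T) (h' : TwHom (RealHom.id Γ') 0 T₁ T') :
    TwHom f c T₁ T := by
  have := h.comp h'
  simpa using this

theorem TwHom.iso_comp {f : RealHom Γ' Γ} {c : Y' → ZMod 2} {T' : RealTwist Γ' S}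
    {T T₁ : RealTwist Γ S} (h' : TwHom (RealHom.id Γ) 0 T T₁) (h : TwHom f c T' T) :
    TwHom f c T' T₁ := by
  have := h'.comp h
  simpa using this

theorem TwHom.congr {f f' : RealHom Γ' Γ} {c c' : Y' → ZMod 2} {T' : RealTwist Γ' S}
    {T : RealTwist Γ S} (h : TwHom f c T' T) (hf : ∀ g, f.arr g = f'.arr g) (hc : ∀ y, c y = c' y) :
    TwHom f' c' T' T := by
  obtain rfl : c = c' := funext hc
  obtain ⟨F, hF⟩ := h.exists_hom
  exact ⟨⟨F, hF.continuous, fun t => (hF.proj t).trans (hf _), hF.act, hF.conj, hF.mul⟩,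
    h.continuous, h.conj, fun g => by rw [h.deg, hf]⟩

theorem TwHom.refl (T : RealTwist Γ S) : TwHom (RealHom.id Γ) 0 T T :=
  TwHom.of_isTwHom (F := fun t => t)
    ⟨continuous_id, fun _ => rfl, fun _ _ => rfl, fun _ => rfl, fun _ _ _ _ => rfl⟩ fun _ => rfl

end TwHom

/-- Composable pairs and points of a common fibre are subtypes of products of quotients. This allows
continuity on such a subtype to be checked on representatives; openness of `f` is what makes the
restriction a quotient map. -/
theorem IsOpenQuotientMap.continuous_subtype {A B C : Type*} [TopologicalSpace A]
    [TopologicalSpace B] [TopologicalSpace C] {f : A → B} (hf : IsOpenQuotientMap f) {P : B → Prop}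
    {F : {b // P b} → C} (h : Continuous fun a : {a // P (f a)} => F ⟨f a.1, a.2⟩) :
    Continuous F :=
  (hf.restrictPreimage {b | P b}).continuous_comp_iff.mp h

/-! ### The principal bundle underlying the tensor product -/

section Baer

variable {Y : RealSpace.{u}} {Γ : RealGroupoid Y} {S : RealAbelianGroup.{u}}
  (T₁ T₂ : RealTwist Γ S)

/-- The fibre product of two twists. -/
abbrev pairSpace : RealSpace.{u} :=
  RealSpace.fprod T₁.proj.arr T₂.proj.arr T₁.proj.continuous_arr T₂.proj.continuous_arr
    T₁.proj.conj_arr T₂.proj.conj_arr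

theorem baerRel_equivalence : Equivalence (baerRel T₁ T₂) where
  refl a := ⟨1, by rw [inv_one, T₁.principal.one_act, T₂.principal.one_act]⟩
  symm := by
    rintro a b ⟨c, h⟩
    refine ⟨c⁻¹, ?_⟩
    rw [h, ← T₁.principal.mul_act, ← T₂.principal.mul_act]
    simp [T₁.principal.one_act, T₂.principal.one_act]
  trans := by
    rintro a b d ⟨c, h⟩ ⟨c', h'⟩
    refine ⟨c' * c, ?_⟩
    rw [h', h, ← T₁.principal.mul_act, ← T₂.principal.mul_act, mul_inv]

theorem isOpenQuotientMap_baer :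
    IsOpenQuotientMap (Quot.mk (baerRel T₁ T₂) : pairSpace T₁ T₂ → Quot (baerRel T₁ T₂)) := by
  refine isOpenQuotientMap_quot (baerRel_equivalence T₁ T₂) fun O hO => ?_
  have : {x | ∃ y ∈ O, baerRel T₁ T₂ x y} = ⋃ c : S, (fun x : pairSpace T₁ T₂ =>
      (⟨(T₁.act c x.1.1, T₂.act c⁻¹ x.1.2), by
        rw [T₁.principal.proj_act, T₂.principal.proj_act]; exact x.2⟩ : pairSpace T₁ T₂)) ⁻¹' O := by
    ext x
    simp only [Set.mem_iUnion, Set.mem_preimage]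
    constructor
    · rintro ⟨⟨y, e⟩, hy, c, h⟩
      obtain rfl : y = _ := h
      exact ⟨c, hy⟩
    · rintro ⟨c, h⟩
      exact ⟨_, h, c, rfl⟩
  rw [this]
  refine isOpen_iUnion fun c => hO.preimage (Continuous.subtype_mk (Continuous.prodMk ?_ ?_) _)
  · exact T₁.principal.continuous_act' continuous_const (continuous_fst.comp continuous_subtype_val)
  · exact T₂.principal.continuous_act' continuous_const (continuous_snd.comp continuous_subtype_val)

/-- The orbit relation becomes an equality of two continuous differences on the closed set of pairs
with the same base point. Hence it is closed, which gives the Hausdorff property of the quotient. -/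
theorem baerRel_iff (a b : pairSpace T₁ T₂) : baerRel T₁ T₂ a b ↔
    ∃ h : T₁.proj.arr a.1.1 = T₁.proj.arr b.1.1, T₁.principal.div b.1.1 a.1.1 h.symm =
      T₂.principal.div a.1.2 b.1.2 (a.2.symm.trans (h.trans b.2)) := by
  constructor
  · rintro ⟨c, h⟩
    have h1 : b.1.1 = T₁.act c a.1.1 := congrArg Prod.fst h
    have h2 : b.1.2 = T₂.act c⁻¹ a.1.2 := congrArg Prod.snd h
    refine ⟨by rw [h1, T₁.principal.proj_act], ?_⟩
    rw [T₁.principal.div_eq _ h1.symm, T₂.principal.div_eq _ (c := c)]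
    rw [h2, ← T₂.principal.mul_act, mul_inv_cancel, T₂.principal.one_act]
  · rintro ⟨h, e⟩
    refine ⟨T₁.principal.div b.1.1 a.1.1 h.symm, Prod.ext (T₁.principal.act_div _ _ _).symm ?_⟩
    rw [e]
    apply T₂.principal.act_left_cancel (c := T₂.principal.div a.1.2 b.1.2
      (a.2.symm.trans (h.trans b.2)))
    rw [T₂.principal.act_div, ← T₂.principal.mul_act, mul_inv_cancel, T₂.principal.one_act]

/-- The arrow space of the tensor product. -/
abbrev baerSpace : RealSpace.{u} where
  carrier := Quot (baerRel T₁ T₂)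
  t2 := by
    refine t2Space_quot (baerRel_equivalence T₁ T₂) (isOpenQuotientMap_baer T₁ T₂) ?_
    have hP : IsClosed {q : pairSpace T₁ T₂ × pairSpace T₁ T₂ |
        T₁.proj.arr q.1.1.1 = T₁.proj.arr q.2.1.1} :=
      isClosed_eq (T₁.proj.continuous_arr.comp (by fun_prop))
        (T₁.proj.continuous_arr.comp (by fun_prop))
    have := isClosed_exists_eq hP
      (f := fun q => T₁.principal.div q.1.2.1.1 q.1.1.1.1 q.2.symm)
      (g := fun q => T₂.principal.div q.1.1.1.2 q.1.2.1.2
        (q.1.1.2.symm.trans (q.2.trans q.1.2.2)))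
      (T₁.principal.continuous_div' (by fun_prop) (by fun_prop) _)
      (T₂.principal.continuous_div' (by fun_prop) (by fun_prop) _)
    convert this using 3
    rename_i q
    exact baerRel_iff T₁ T₂ q.1 q.2
  lc :=
    have : LocallyCompactSpace {p : T₁.grpd.Arr × T₂.grpd.Arr //
      T₁.proj.arr p.1 = T₂.proj.arr p.2} := (pairSpace T₁ T₂).lc
    (isOpenQuotientMap_baer T₁ T₂).locallyCompactSpace
  conj := Quot.map (pairSpace T₁ T₂).conj (by
    rintro a b ⟨c, h⟩
    refine ⟨S.conj c, ?_⟩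
    have h1 : b.1.1 = T₁.act c a.1.1 := congrArg Prod.fst h
    have h2 : b.1.2 = T₂.act c⁻¹ a.1.2 := congrArg Prod.snd h
    simp only [h1, h2, ← T₁.principal.conj_act, ← T₂.principal.conj_act, map_inv])
  continuous_conj := Continuous.quotient_lift (s := ⟨_, baerRel_equivalence T₁ T₂⟩)
    (continuous_quot_mk.comp (pairSpace T₁ T₂).continuous_conj) _
  conj_conj := by
    rintro ⟨a⟩
    exact congrArg (Quot.mk _) ((pairSpace T₁ T₂).conj_conj a)

def baerProj : baerSpace T₁ T₂ → Γ.Arr := Quot.lift (fun a => T₁.proj.arr a.1.1) (by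
  rintro a b ⟨c, h⟩
  have h1 : b.1.1 = T₁.act c a.1.1 := congrArg Prod.fst h
  rw [h1, T₁.principal.proj_act])

def baerAct (c : S) : baerSpace T₁ T₂ → baerSpace T₁ T₂ :=
  Quot.map (fun a => ⟨(T₁.act c a.1.1, a.1.2), (T₁.principal.proj_act _ _).trans a.2⟩) (by
    rintro a b ⟨d, h⟩
    have h2 : b.1.2 = T₂.act d⁻¹ a.1.2 := congrArg Prod.snd h
    refine ⟨d, Prod.ext ?_ h2⟩
    have h1 : b.1.1 = T₁.act d a.1.1 := congrArg Prod.fst h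
    simp only [h1, ← T₁.principal.mul_act, mul_comm])

theorem baerAct_snd (c : S) (a b : pairSpace T₁ T₂) (h : b.1 = (a.1.1, T₂.act c a.1.2)) :
    baerAct T₁ T₂ c (Quot.mk _ a) = Quot.mk _ b := by
  refine Quot.sound ⟨c⁻¹, ?_⟩
  simp only [h, ← T₁.principal.mul_act, inv_mul_cancel, T₁.principal.one_act, inv_inv]

/-- The difference of two classes is the product of the differences of their components; replacing
`(a, b)` by `(c a, c⁻¹ b)` leaves it unchanged. -/
noncomputable def baerDiv (w : {w : baerSpace T₁ T₂ × baerSpace T₁ T₂ //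
    baerProj T₁ T₂ w.1 = baerProj T₁ T₂ w.2}) : S :=
  have h : baerProj T₁ T₂ (Quot.mk _ w.1.1.out) = baerProj T₁ T₂ (Quot.mk _ w.1.2.out) := by
    rw [Quot.out_eq, Quot.out_eq, w.2]
  T₁.principal.div w.1.1.out.1.1 w.1.2.out.1.1 h *
    T₂.principal.div w.1.1.out.1.2 w.1.2.out.1.2
      (w.1.1.out.2.symm.trans (Eq.trans h w.1.2.out.2))

theorem baerAct_eq (a b : pairSpace T₁ T₂) (h : T₁.proj.arr a.1.1 = T₁.proj.arr b.1.1) :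
    baerAct T₁ T₂ (T₁.principal.div a.1.1 b.1.1 h *
      T₂.principal.div a.1.2 b.1.2 (a.2.symm.trans (Eq.trans h b.2))) (Quot.mk _ b) =
      Quot.mk _ a := by
  refine Quot.sound ⟨(T₂.principal.div a.1.2 b.1.2 (a.2.symm.trans (Eq.trans h b.2)))⁻¹, ?_⟩
  simp only [← T₁.principal.mul_act, inv_inv, T₂.principal.act_div]
  rw [mul_comm, mul_inv_cancel_right, T₁.principal.act_div]

theorem baerAct_free {c d : S} {q : baerSpace T₁ T₂}
    (h : baerAct T₁ T₂ c q = baerAct T₁ T₂ d q) : c = d := by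
  obtain ⟨a⟩ := q
  obtain ⟨e, he⟩ := (baerRel_equivalence T₁ T₂).quot_mk_eq.mp h
  have h1 : T₁.act d a.1.1 = T₁.act e (T₁.act c a.1.1) := congrArg Prod.fst he
  have h2 : a.1.2 = T₂.act e⁻¹ a.1.2 := congrArg Prod.snd he
  have h3 := T₂.principal.free ((T₂.principal.one_act _).trans h2)
  rw [← T₁.principal.mul_act] at h1
  have h4 := T₁.principal.free h1
  rw [h4, inv_eq_one.mp h3.symm, one_mul]

theorem baerAct_mul (c d : S) (q : baerSpace T₁ T₂) :
    baerAct T₁ T₂ (c * d) q = baerAct T₁ T₂ c (baerAct T₁ T₂ d q) := by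
  obtain ⟨a⟩ := q
  exact congrArg (Quot.mk _) (Subtype.ext (Prod.ext (T₁.principal.mul_act c d _) rfl))

/-- Freeness does the work: both scalars carry the class of `b` to that of `a`, so independence of
the chosen representatives needs no separate computation. -/
theorem baerDiv_mk (a b : pairSpace T₁ T₂) (h : T₁.proj.arr a.1.1 = T₁.proj.arr b.1.1) :
    baerDiv T₁ T₂ ⟨(Quot.mk _ a, Quot.mk _ b), h⟩ = T₁.principal.div a.1.1 b.1.1 h *
      T₂.principal.div a.1.2 b.1.2 (a.2.symm.trans (Eq.trans h b.2)) := by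
  apply baerAct_free T₁ T₂ (q := Quot.mk _ b)
  rw [baerAct_eq, baerDiv]
  generalize_proofs h1 h2 h3 h4
  have := baerAct_eq T₁ T₂ _ _ h2
  rwa [Quot.out_eq, Quot.out_eq] at this

theorem locallySplit_pairSpace :
    LocallySplit fun a : pairSpace T₁ T₂ => T₁.proj.arr a.1.1 := by
  refine T₁.principal.locallySplit.comp (T₂.principal.locallySplit.lift (A := T₁.grpd.Arr)
    T₁.proj.continuous_arr (q := fun a : pairSpace T₁ T₂ => a.1.1) (fun x => x) continuous_id
    fun _ => rfl)

theorem baer_principal : IsRealPrincipal S (E := baerSpace T₁ T₂) (baerProj T₁ T₂)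
    (baerAct T₁ T₂) := by
  have hq := isOpenQuotientMap_baer T₁ T₂
  refine IsRealPrincipal.of_div ?_ ?_ ?_ ?_ ?_ ?_ ?_ ?_ (baerDiv T₁ T₂) ?_ ?_ ?_
  · exact hq.continuous_comp_iff.mp (T₁.proj.continuous_arr.comp (by fun_prop))
  · rintro ⟨a⟩
    exact T₁.proj.conj_arr _
  · refine (IsOpenQuotientMap.id.prodMap hq).continuous_comp_iff.mp
      (continuous_quot_mk.comp (Continuous.subtype_mk (Continuous.prodMk ?_ (by fun_prop)) _))
    exact T₁.principal.continuous_act' (by fun_prop) (by fun_prop)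
  · rintro ⟨a⟩
    exact congrArg (Quot.mk _) (Subtype.ext (Prod.ext (T₁.principal.one_act _) rfl))
  · exact baerAct_mul T₁ T₂
  · rintro c ⟨a⟩
    exact congrArg (Quot.mk _) (Subtype.ext (Prod.ext (T₁.principal.conj_act c _) rfl))
  · rintro c ⟨a⟩
    exact T₁.principal.proj_act _ _
  · exact LocallySplit.of_comp (p := Quot.mk _) (locallySplit_pairSpace T₁ T₂) hq.continuous
  · refine (hq.prodMap hq).continuous_subtype ?_
    have : (fun a : {a : pairSpace T₁ T₂ × pairSpace T₁ T₂ //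
        T₁.proj.arr a.1.1.1 = T₁.proj.arr a.2.1.1} =>
        baerDiv T₁ T₂ ⟨(Quot.mk _ a.1.1, Quot.mk _ a.1.2), a.2⟩) = _ :=
      funext fun a => baerDiv_mk T₁ T₂ a.1.1 a.1.2 a.2
    refine this ▸ ?_
    exact (T₁.principal.continuous_div' (by fun_prop) (by fun_prop) _).mul
      (T₂.principal.continuous_div' (by fun_prop) (by fun_prop) _)
  · rintro ⟨⟨⟨a⟩, ⟨b⟩⟩, h⟩
    have h' : T₁.proj.arr a.1.1 = T₁.proj.arr b.1.1 := h
    exact (congrArg (fun c => baerAct T₁ T₂ c _) (baerDiv_mk T₁ T₂ a b h')).trans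
      (baerAct_eq T₁ T₂ a b h')
  · rintro c q e
    apply baerAct_free T₁ T₂ (q := q)
    obtain ⟨b⟩ := q
    have h' : T₁.proj.arr (T₁.act c b.1.1) = T₁.proj.arr b.1.1 := e
    have := baerDiv_mk T₁ T₂ ⟨(T₁.act c b.1.1, b.1.2), h'.trans b.2⟩ b h'
    have h2 := baerAct_eq T₁ T₂ ⟨(T₁.act c b.1.1, b.1.2), h'.trans b.2⟩ b h'
    rw [← this] at h2
    exact h2

/-- The projection onto a quotient by a principal action is locally split. -/
theorem locallySplit_baer :
    LocallySplit (Quot.mk (baerRel T₁ T₂) : pairSpace T₁ T₂ → baerSpace T₁ T₂) := by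
  refine ⟨Quot.mk_surjective, fun q => ?_⟩
  -- A section of the fibre product over the arrows of `Γ` hits the class `q` only up to a scalar.
  -- Scaling its first component by the continuous difference corrects this.
  obtain ⟨V, hV, hy, s, hs, hps⟩ := (locallySplit_pairSpace T₁ T₂).2 (baerProj T₁ T₂ q)
  have hpr := baer_principal T₁ T₂
  have e : ∀ v : baerProj T₁ T₂ ⁻¹' V, baerProj T₁ T₂ v.1 =
      baerProj T₁ T₂ (Quot.mk _ (s ⟨_, v.2⟩)) := fun v => (hps ⟨_, v.2⟩).symm
  have hcont : Continuous fun v : baerProj T₁ T₂ ⁻¹' V => s ⟨_, v.2⟩ := hs.comp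
    (Continuous.subtype_mk (hpr.continuous_proj.comp continuous_subtype_val) _)
  refine ⟨_, hV.preimage hpr.continuous_proj, hy, fun v =>
    ⟨(T₁.act (hpr.div v.1 (Quot.mk _ (s ⟨_, v.2⟩)) (e v)) (s ⟨_, v.2⟩).1.1, (s ⟨_, v.2⟩).1.2),
      (T₁.principal.proj_act _ _).trans (s ⟨_, v.2⟩).2⟩, ?_, fun v => hpr.act_div _ _ (e v)⟩
  refine Continuous.subtype_mk (Continuous.prodMk ?_ ?_) _
  · exact T₁.principal.continuous_act' (hpr.continuous_div' continuous_subtype_val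
      (continuous_quot_mk.comp hcont) _) (continuous_fst.comp (continuous_subtype_val.comp hcont))
  · exact continuous_snd.comp (continuous_subtype_val.comp hcont)

end Baer

/-! ### The graded tensor product -/

section Tensor

variable {Y : RealSpace.{u}} {Γ : RealGroupoid Y} {S : RealAbelianGroup.{u}}

/-- The multiplication of a twist core, modified by the bilinear sign given by two gradings. -/
def TwistCore.signed (K : TwistCore Γ S) (A B : RealTwist Γ S) : TwistCore Γ S where
  E := K.E
  p := K.p
  act := K.act
  principal := K.principal
  mul x y e := K.act (S.eps (A.deg (K.p x) * B.deg (K.p y))) (K.mul x y e)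
  continuous_mul := by
    refine K.principal.continuous_act' (S.continuous_eps' ?_) K.continuous_mul
    exact (A.continuous_deg.comp (K.principal.continuous_proj.comp (by fun_prop))).mul
      (B.continuous_deg.comp (K.principal.continuous_proj.comp (by fun_prop)))
  proj_mul x y e := by rw [K.principal.proj_act, K.proj_mul]
  act_mul_act c d x y e e' := by
    rw [K.act_mul_act c d x y e, ← K.principal.mul_act, ← K.principal.mul_act,
      K.principal.proj_act, K.principal.proj_act, mul_comm]
  -- The two bracketings carry the exponents `A(x)B(y) + A(xy)B(z)` and `A(y)B(z) + A(x)B(yz)`,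
  -- which agree because the degrees are additive: a bilinear sign is a `2`-cocycle.
  mul_assoc x y z e e' h h' := by
    have h1 : Γ.src (K.p (K.mul x y e)) = Γ.rng (K.p z) := by rw [K.proj_mul, Γ.src_mul, e']
    have h2 : Γ.src (K.p x) = Γ.rng (K.p (K.mul y z e')) := by rw [K.proj_mul, Γ.rng_mul, e]
    rw [K.act_mul _ _ _ h1, K.mul_act _ _ _ h2, K.mul_assoc x y z e e' h1 h2,
      ← K.principal.mul_act, ← K.principal.mul_act, ← S.eps_add, ← S.eps_add,
      K.principal.proj_act, K.principal.proj_act, K.proj_mul, K.proj_mul, A.deg_mul, B.deg_mul]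
    congr 2
    ring
  mul_conj x y e e' := by
    rw [K.mul_conj x y e, ← K.principal.conj_act, S.conj_eps, K.principal.conj_proj,
      K.principal.conj_proj, A.deg_conj, B.deg_conj]
  deg := K.deg
  continuous_deg := K.continuous_deg
  deg_mul := K.deg_mul
  deg_conj := K.deg_conj

variable (T₁ T₂ : RealTwist Γ S)

/-- The componentwise product of pairs. -/
def pairMul (a b : pairSpace T₁ T₂) (h : Γ.src (T₁.proj.arr a.1.1) = Γ.rng (T₁.proj.arr b.1.1)) :
    pairSpace T₁ T₂ :=
  ⟨(T₁.grpd.mul a.1.1 b.1.1 (by rw [← T₁.src_proj, ← T₁.rng_proj, h]),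
    T₂.grpd.mul a.1.2 b.1.2 (by rw [← T₂.src_proj, ← T₂.rng_proj, ← a.2, ← b.2, h])), by
    rw [T₁.proj_mul, T₂.proj_mul]
    exact Γ.mul_congr _ a.2 b.2⟩

/-- Changing the two factors by scalars `c` and `d` changes the product of pairs by `c * d`, which
is why multiplication descends to classes. -/
theorem mk_pairMul_congr {a b a' b' : pairSpace T₁ T₂}
    (h : Γ.src (T₁.proj.arr a.1.1) = Γ.rng (T₁.proj.arr b.1.1))
    (h' : Γ.src (T₁.proj.arr a'.1.1) = Γ.rng (T₁.proj.arr b'.1.1))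
    (ha : (Quot.mk (baerRel T₁ T₂) a) = Quot.mk (baerRel T₁ T₂) a')
    (hb : (Quot.mk (baerRel T₁ T₂) b) = Quot.mk (baerRel T₁ T₂) b') :
    Quot.mk (baerRel T₁ T₂) (pairMul T₁ T₂ a b h) = Quot.mk _ (pairMul T₁ T₂ a' b' h') := by
  obtain ⟨a', ea'⟩ := a'
  obtain ⟨b', eb'⟩ := b'
  obtain ⟨c, rfl⟩ := (baerRel_equivalence T₁ T₂).quot_mk_eq.mp ha
  obtain ⟨d, rfl⟩ := (baerRel_equivalence T₁ T₂).quot_mk_eq.mp hb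
  refine Quot.sound ⟨c * d, Prod.ext ?_ ?_⟩
  · exact T₁.act_mul_act _ _ _ _ _ _
  · exact (T₂.act_mul_act _ _ _ _ _ _).trans (by rw [mul_inv]; rfl)

noncomputable def baerMul (x y : baerSpace T₁ T₂)
    (h : Γ.src (baerProj T₁ T₂ x) = Γ.rng (baerProj T₁ T₂ y)) : baerSpace T₁ T₂ :=
  Quot.mk _ (pairMul T₁ T₂ x.out y.out (by
    rw [← Quot.out_eq x, ← Quot.out_eq y] at h
    exact h))

theorem baerMul_mk (a b : pairSpace T₁ T₂)
    (h : Γ.src (T₁.proj.arr a.1.1) = Γ.rng (T₁.proj.arr b.1.1)) :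
    baerMul T₁ T₂ (Quot.mk _ a) (Quot.mk _ b) h = Quot.mk _ (pairMul T₁ T₂ a b h) :=
  mk_pairMul_congr T₁ T₂ _ _ (Quot.out_eq _) (Quot.out_eq _)

theorem continuous_pairMul : Continuous fun w : {w : pairSpace T₁ T₂ × pairSpace T₁ T₂ //
    Γ.src (T₁.proj.arr w.1.1.1) = Γ.rng (T₁.proj.arr w.2.1.1)} =>
      pairMul T₁ T₂ w.1.1 w.1.2 w.2 :=
  Continuous.subtype_mk ((T₁.grpd.continuous_mul' (by fun_prop) (by fun_prop) _).prodMk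
    (T₂.grpd.continuous_mul' (by fun_prop) (by fun_prop) _)) _

/-- The ungraded tensor product. -/
noncomputable def plainTensorCore : TwistCore Γ S where
  E := baerSpace T₁ T₂
  p := baerProj T₁ T₂
  act := baerAct T₁ T₂
  principal := baer_principal T₁ T₂
  mul := baerMul T₁ T₂
  continuous_mul := by
    have hq := isOpenQuotientMap_baer T₁ T₂
    refine (hq.prodMap hq).continuous_subtype ?_
    have : (fun a : {w : pairSpace T₁ T₂ × pairSpace T₁ T₂ //
        Γ.src (T₁.proj.arr w.1.1.1) = Γ.rng (T₁.proj.arr w.2.1.1)} =>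
        baerMul T₁ T₂ (Quot.mk _ a.1.1) (Quot.mk _ a.1.2) a.2) = _ :=
      funext fun a => baerMul_mk T₁ T₂ a.1.1 a.1.2 a.2
    refine this ▸ ?_
    exact continuous_quot_mk.comp (continuous_pairMul T₁ T₂)
  proj_mul := by
    rintro ⟨a⟩ ⟨b⟩ e
    refine (congrArg (baerProj T₁ T₂) (baerMul_mk T₁ T₂ a b e)).trans ?_
    exact T₁.proj_mul _ _ _
  act_mul_act := by
    rintro c d ⟨a⟩ ⟨b⟩ e e'
    refine (baerMul_mk T₁ T₂ ⟨(T₁.act c a.1.1, a.1.2), (T₁.principal.proj_act _ _).trans a.2⟩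
      ⟨(T₁.act d b.1.1, b.1.2), (T₁.principal.proj_act _ _).trans b.2⟩ e').trans
      (Eq.trans ?_ (congrArg (baerAct T₁ T₂ (c * d)) (baerMul_mk T₁ T₂ a b e)).symm)
    exact congrArg (Quot.mk _) (Subtype.ext (Prod.ext (T₁.act_mul_act _ _ _ _ _ _) rfl))
  mul_assoc := by
    rintro ⟨a⟩ ⟨b⟩ ⟨c⟩ e e' h h'
    have h1 : Γ.src (T₁.proj.arr (pairMul T₁ T₂ a b e).1.1) = Γ.rng (T₁.proj.arr c.1.1) :=
      (congrArg Γ.src (T₁.proj_mul _ _ _)).trans ((Γ.src_mul _ _ _).trans e')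
    have h2 : Γ.src (T₁.proj.arr a.1.1) = Γ.rng (T₁.proj.arr (pairMul T₁ T₂ b c e').1.1) :=
      Eq.trans e ((congrArg Γ.rng (T₁.proj_mul _ _ _)).trans (Γ.rng_mul _ _ _)).symm
    -- Multiplication takes a proof of composability that depends on its arguments, so the inner
    -- product is first replaced by a variable `z` and then substituted.
    have hl : ∀ (z : baerSpace T₁ T₂) (hz) (_ : z = Quot.mk _ (pairMul T₁ T₂ a b e)),
        baerMul T₁ T₂ z (Quot.mk _ c) hz = Quot.mk _ (pairMul T₁ T₂ _ c h1) := by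
      rintro z hz rfl
      exact baerMul_mk T₁ T₂ _ c h1
    have hr : ∀ (z : baerSpace T₁ T₂) (hz) (_ : z = Quot.mk _ (pairMul T₁ T₂ b c e')),
        baerMul T₁ T₂ (Quot.mk _ a) z hz = Quot.mk _ (pairMul T₁ T₂ a _ h2) := by
      rintro z hz rfl
      exact baerMul_mk T₁ T₂ a _ h2
    refine (hl _ h (baerMul_mk T₁ T₂ a b e)).trans
      (Eq.trans ?_ (hr _ h' (baerMul_mk T₁ T₂ b c e')).symm)
    exact congrArg (Quot.mk _) (Subtype.ext (Prod.ext (T₁.grpd.mul_assoc _ _ _ _ _)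
      (T₂.grpd.mul_assoc _ _ _ _ _)))
  mul_conj := by
    rintro ⟨a⟩ ⟨b⟩ e e'
    refine (baerMul_mk T₁ T₂ ((pairSpace T₁ T₂).conj a) ((pairSpace T₁ T₂).conj b) e').trans
      (Eq.trans ?_ (congrArg (baerSpace T₁ T₂).conj (baerMul_mk T₁ T₂ a b e)).symm)
    exact congrArg (Quot.mk _) (Subtype.ext (Prod.ext (T₁.grpd.mul_conj _ _ _)
      (T₂.grpd.mul_conj _ _ _)))
  deg g := T₁.deg g + T₂.deg g
  continuous_deg := T₁.continuous_deg.add T₂.continuous_deg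
  deg_mul g h e := by rw [T₁.deg_mul, T₂.deg_mul]; ring
  deg_conj g := by rw [T₁.deg_conj, T₂.deg_conj]

/-- The graded tensor product of two twists. -/
noncomputable def tensor : RealTwist Γ S := ((plainTensorCore T₁ T₂).signed T₂ T₁).twist

/-- The class of a pair in the tensor product. -/
def tmk (a : T₁.grpd.Arr) (b : T₂.grpd.Arr) (h : T₁.proj.arr a = T₂.proj.arr b) :
    (tensor T₁ T₂).grpd.Arr := Quot.mk (baerRel T₁ T₂) ⟨(a, b), h⟩

theorem tensor_deg (g : Γ.Arr) : (tensor T₁ T₂).deg g = T₁.deg g + T₂.deg g := rfl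

theorem tensor_proj (a b h) : (tensor T₁ T₂).proj.arr (tmk T₁ T₂ a b h) = T₁.proj.arr a := rfl

theorem tensor_act (c : S) (a b h) : (tensor T₁ T₂).act c (tmk T₁ T₂ a b h) =
    tmk T₁ T₂ (T₁.act c a) b ((T₁.principal.proj_act _ _).trans h) := rfl

theorem tensor_act' (c : S) (a b h) : (tensor T₁ T₂).act c (tmk T₁ T₂ a b h) =
    tmk T₁ T₂ a (T₂.act c b) (h.trans (T₂.principal.proj_act _ _).symm) :=
  baerAct_snd T₁ T₂ c _ _ rfl

theorem tensor_conj (a b h) : (tensor T₁ T₂).grpd.Arr.conj (tmk T₁ T₂ a b h) =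
    tmk T₁ T₂ (T₁.grpd.Arr.conj a) (T₂.grpd.Arr.conj b)
      (by rw [T₁.proj.conj_arr, T₂.proj.conj_arr, h]) := rfl

theorem tensor_mul (a b h a' b' h') (e e₁ e₂) :
    (tensor T₁ T₂).grpd.mul (tmk T₁ T₂ a b h) (tmk T₁ T₂ a' b' h') e =
    (tensor T₁ T₂).act (S.eps (T₂.deg (T₁.proj.arr a) * T₁.deg (T₁.proj.arr a')))
      (tmk T₁ T₂ (T₁.grpd.mul a a' e₁) (T₂.grpd.mul b b' e₂)
      (by rw [T₁.proj_mul, T₂.proj_mul]; exact Γ.mul_congr _ h h')) := by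
  have := baerMul_mk T₁ T₂ ⟨(a, b), h⟩ ⟨(a', b'), h'⟩ (by
    rw [T₁.src_proj, T₁.rng_proj, e₁])
  exact congrArg (baerAct T₁ T₂ _) this

theorem tmk_surjective (q : (tensor T₁ T₂).grpd.Arr) : ∃ a b h, q = tmk T₁ T₂ a b h := by
  obtain ⟨⟨⟨a, b⟩, h⟩, rfl⟩ := Quot.mk_surjective (r := baerRel T₁ T₂) q
  exact ⟨a, b, h, rfl⟩

theorem tensor_rng (a b h) : (tensor T₁ T₂).grpd.rng (tmk T₁ T₂ a b h) = T₁.grpd.rng a :=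
  T₁.rng_proj a

theorem tensor_src (a b h) : (tensor T₁ T₂).grpd.src (tmk T₁ T₂ a b h) = T₁.grpd.src a :=
  T₁.src_proj a

theorem isTensor_tensor : IsTensor T₁ T₂ (tensor T₁ T₂) := by
  refine ⟨fun _ => rfl, Homeomorph.refl _, fun _ => rfl, ?_, ?_, ?_⟩
  · rintro c ⟨⟨a, b⟩, h⟩ ⟨⟨a', b'⟩, h'⟩ e
    obtain ⟨rfl, rfl⟩ := Prod.mk.inj e
    rfl
  · rintro ⟨⟨a, b⟩, h⟩ ⟨⟨a', b'⟩, h'⟩ e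
    obtain ⟨rfl, rfl⟩ := Prod.mk.inj e
    rfl
  · rintro ⟨⟨a, b⟩, h⟩ ⟨⟨a', b'⟩, h'⟩ ⟨⟨a'', b''⟩, h''⟩ e₁ e₂ e e'
    obtain ⟨rfl, rfl⟩ := Prod.mk.inj e
    refine (tensor_mul T₁ T₂ a b h a' b' h' e' e₁ e₂).trans ?_
    -- `IsTensor` reads the degree of the second factor through `b`, the construction through `a`;
    -- both lie over the same arrow.
    have h1 : T₁.proj.arr a = T₂.proj.arr b := h
    have h2 : T₂.deg (T₂.proj.arr b) = T₂.deg (T₁.proj.arr a) := by rw [h1]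
    simp only [h2]
    rfl

end Tensor

/-! ### Functoriality and symmetry of the tensor product -/

section TensorMaps

variable {Y Y' : RealSpace.{u}} {Γ : RealGroupoid Y} {Γ' : RealGroupoid Y'}
  {S : RealAbelianGroup.{u}}

/-- Homomorphisms out of a tensor product. -/
theorem tensor_lift {f : RealHom Γ' Γ} {T₁ T₂ : RealTwist Γ' S} {T : RealTwist Γ S}
    (m : ∀ a b, T₁.proj.arr a = T₂.proj.arr b → T.grpd.Arr)
    (cont : Continuous fun p : pairSpace T₁ T₂ => m p.1.1 p.1.2 p.2)
    (proj : ∀ a b h, T.proj.arr (m a b h) = f.arr (T₁.proj.arr a))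
    (act₁ : ∀ c a b h h', m (T₁.act c a) b h' = T.act c (m a b h))
    (act₂ : ∀ c a b h h', m a (T₂.act c b) h' = T.act c (m a b h))
    (conj : ∀ a b h h', m (T₁.grpd.Arr.conj a) (T₂.grpd.Arr.conj b) h' =
      T.grpd.Arr.conj (m a b h))
    (mul : ∀ a b h a' b' h' e₁ e₂ h'' e, m (T₁.grpd.mul a a' e₁) (T₂.grpd.mul b b' e₂) h'' =
      T.act (S.eps (T₂.deg (T₁.proj.arr a) * T₁.deg (T₁.proj.arr a')))
        (T.grpd.mul (m a b h) (m a' b' h') e)) :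
    ∃ F, IsTwHom f (tensor T₁ T₂) T F ∧ ∀ a b h, F (tmk T₁ T₂ a b h) = m a b h := by
  let F : (tensor T₁ T₂).grpd.Arr → T.grpd.Arr :=
    Quot.lift (fun p : pairSpace T₁ T₂ => m p.1.1 p.1.2 p.2) (by
      rintro ⟨⟨a, b⟩, h⟩ ⟨⟨a', b'⟩, h'⟩ ⟨c, e⟩
      obtain ⟨rfl, rfl⟩ := Prod.mk.inj e
      have h1 : T₁.proj.arr a = T₂.proj.arr (T₂.act c⁻¹ b) := by
        rw [T₂.principal.proj_act]; exact h
      simp only [act₁ c a _ h1, act₂ c⁻¹ a b h, ← T.principal.mul_act, mul_inv_cancel,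
        T.principal.one_act])
  have hF : ∀ a b h, F (tmk T₁ T₂ a b h) = m a b h := fun _ _ _ => rfl
  refine ⟨F, ⟨?_, ?_, ?_, ?_, ?_⟩, hF⟩
  · exact (isOpenQuotientMap_baer T₁ T₂).continuous_comp_iff.mp cont
  · intro t
    obtain ⟨a, b, h, rfl⟩ := tmk_surjective T₁ T₂ t
    rw [hF, proj, tensor_proj]
  · intro c t
    obtain ⟨a, b, h, rfl⟩ := tmk_surjective T₁ T₂ t
    rw [tensor_act, hF, hF, act₁]
  · intro t
    obtain ⟨a, b, h, rfl⟩ := tmk_surjective T₁ T₂ t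
    rw [tensor_conj, hF, hF, conj]
  · intro t t' e e'
    obtain ⟨a, b, h, rfl⟩ := tmk_surjective T₁ T₂ t
    obtain ⟨a', b', h', rfl⟩ := tmk_surjective T₁ T₂ t'
    have e₁ : T₁.grpd.src a = T₁.grpd.rng a' := by rwa [tensor_src, tensor_rng] at e
    have e₂ : T₂.grpd.src b = T₂.grpd.rng b' := by
      rw [← T₂.src_proj, ← T₂.rng_proj, ← h, ← h', T₁.src_proj, T₁.rng_proj, e₁]
    -- The graded product contributes the sign that already occurs in the hypothesis `mul`, and
    -- signs square to one.
    rw [tensor_mul T₁ T₂ a b h a' b' h' e e₁ e₂, tensor_act, hF,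
      act₁ _ _ _ (by rw [T₁.proj_mul, T₂.proj_mul]; exact Γ'.mul_congr _ h h'),
      mul a b h a' b' h' e₁ e₂ _ e', ← T.principal.mul_act, S.eps_mul_self, T.principal.one_act]
    rfl

theorem tmk_congr {T₁ T₂ : RealTwist Γ S} {a a' b b'} (h : T₁.proj.arr a = T₂.proj.arr b)
    (ha : a = a') (hb : b = b') : tmk T₁ T₂ a b h = tmk T₁ T₂ a' b' (by rw [← ha, ← hb, h]) := by
  subst ha hb; rfl

theorem continuous_tmk {T₁ T₂ : RealTwist Γ S} {A : Type*} [TopologicalSpace A]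
    {f : A → T₁.grpd.Arr} {g : A → T₂.grpd.Arr} (hf : Continuous f) (hg : Continuous g)
    (h : ∀ x, T₁.proj.arr (f x) = T₂.proj.arr (g x)) :
    Continuous fun x => tmk T₁ T₂ (f x) (g x) (h x) :=
  (isOpenQuotientMap_baer T₁ T₂).continuous.comp (Continuous.subtype_mk (hf.prodMk hg) h)

/-- The tensor product is functorial. -/
theorem tensor_map {f : RealHom Γ' Γ} {T₁ T₂ : RealTwist Γ' S} {U₁ U₂ : RealTwist Γ S}
    (h₁ : TwHom f 0 T₁ U₁) (h₂ : TwHom f 0 T₂ U₂) :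
    TwHom f 0 (tensor T₁ T₂) (tensor U₁ U₂) := by
  obtain ⟨F, hF⟩ := h₁.exists_hom
  obtain ⟨F', hF'⟩ := h₂.exists_hom
  have hp : ∀ a b, T₁.proj.arr a = T₂.proj.arr b → U₁.proj.arr (F a) = U₂.proj.arr (F' b) :=
    fun a b h => by rw [hF.proj, hF'.proj, h]
  obtain ⟨H, hH, -⟩ := tensor_lift (f := f) (T₁ := T₁) (T₂ := T₂) (T := tensor U₁ U₂)
    (fun a b h => tmk U₁ U₂ (F a) (F' b) (hp a b h))
    (continuous_tmk (hF.continuous.comp (by fun_prop)) (hF'.continuous.comp (by fun_prop)) _)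
    (fun a b h => by rw [tensor_proj, hF.proj])
    (fun c a b h h' => by rw [tensor_act]; exact tmk_congr _ (hF.act _ _) rfl)
    (fun c a b h h' => by rw [tensor_act']; exact tmk_congr _ rfl (hF'.act _ _))
    (fun a b h h' => by rw [tensor_conj]; exact tmk_congr _ (hF.conj _) (hF'.conj _))
    (fun a b h a' b' h' e₁ e₂ h'' e => by
      rw [tensor_mul U₁ U₂ _ _ _ _ _ _ _ (hF.composable e₁) (hF'.composable e₂),
        ← (tensor U₁ U₂).principal.mul_act]
      have d1 := h₁.deg (T₁.proj.arr a')
      have d2 := h₂.deg (T₁.proj.arr a)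
      simp only [Pi.zero_apply, add_zero] at d1 d2
      have hs : S.eps (U₂.deg (U₁.proj.arr (F a)) * U₁.deg (U₁.proj.arr (F a'))) =
          S.eps (T₂.deg (T₁.proj.arr a) * T₁.deg (T₁.proj.arr a')) := by
        rw [hF.proj, hF.proj, d1, d2]
      rw [hs, S.eps_mul_self, (tensor U₁ U₂).principal.one_act]
      exact tmk_congr _ (hF.mul _ _ _ _) (hF'.mul _ _ _ _))
  refine TwHom.of_isTwHom hH fun g => ?_
  rw [tensor_deg, tensor_deg, h₁.deg, h₂.deg]
  simp

/-- Changing the first factor of a tensor product by a homomorphism with coboundary `c`. -/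
theorem tensor_map_left {c : Y → ZMod 2} {T₁ U₁ : RealTwist Γ S} (T₂ : RealTwist Γ S)
    (h₁ : TwHom (RealHom.id Γ) c T₁ U₁) :
    TwHom (RealHom.id Γ) c (tensor T₁ T₂) (tensor U₁ T₂) := by
  obtain ⟨F, hF⟩ := h₁.exists_hom
  have hp : ∀ a b, T₁.proj.arr a = T₂.proj.arr b → U₁.proj.arr (F a) = T₂.proj.arr b :=
    fun a b h => by rw [hF.proj, h]
  -- Changing the first grading by the coboundary of `c` multiplies the sign of a product `γ γ'` by
  -- the exponent `δ₂(γ)(c(r γ') + c(s γ'))`. Since `r γ' = s γ`, this equals `x(γ) + x(γ') + x(γ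
  -- γ')` modulo two, so rescaling by the sign of `x` restores multiplicativity.
  let x : Γ.Arr → ZMod 2 := fun g => T₂.deg g * c (Γ.src g)
  have hx : Continuous x := T₂.continuous_deg.mul (h₁.continuous.comp Γ.continuous_src)
  obtain ⟨H, hH, -⟩ := tensor_lift (f := RealHom.id Γ) (T₁ := T₁) (T₂ := T₂) (T := tensor U₁ T₂)
    (fun a b h => (tensor U₁ T₂).act (S.eps (x (T₁.proj.arr a))) (tmk U₁ T₂ (F a) b (hp a b h)))
    ((tensor U₁ T₂).principal.continuous_act'
      (S.continuous_eps' (hx.comp (T₁.proj.continuous_arr.comp (by fun_prop))))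
      (continuous_tmk (hF.continuous.comp (by fun_prop)) (by fun_prop) _))
    (fun a b h => by rw [(tensor U₁ T₂).principal.proj_act, tensor_proj, hF.proj])
    (fun d a b h h' => by
      rw [T₁.principal.proj_act, ← (tensor U₁ T₂).principal.mul_act, mul_comm,
        (tensor U₁ T₂).principal.mul_act, tensor_act U₁ T₂ d]
      exact congrArg _ (tmk_congr _ (hF.act _ _) rfl))
    (fun d a b h h' => by
      rw [← (tensor U₁ T₂).principal.mul_act, mul_comm,
        (tensor U₁ T₂).principal.mul_act, tensor_act' U₁ T₂ d])
    (fun a b h h' => by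
      rw [← (tensor U₁ T₂).principal.conj_act, S.conj_eps, tensor_conj]
      have : x (T₁.proj.arr (T₁.grpd.Arr.conj a)) = x (T₁.proj.arr a) := by
        simp only [x, T₁.proj.conj_arr, T₂.deg_conj, Γ.src_conj, h₁.conj]
      rw [this]
      exact congrArg _ (tmk_congr _ (hF.conj _) rfl))
    (fun a b h a' b' h' e₁ e₂ h'' e => by
      have e3 : (tensor U₁ T₂).grpd.src (tmk U₁ T₂ (F a) b (hp a b h)) =
          (tensor U₁ T₂).grpd.rng (tmk U₁ T₂ (F a') b' (hp a' b' h')) := by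
        rw [tensor_src, tensor_rng, hF.composable e₁]
      rw [(tensor U₁ T₂).act_mul_act _ _ _ _ e3,
        tensor_mul U₁ T₂ _ _ _ _ _ _ _ (hF.composable e₁) e₂,
        ← (tensor U₁ T₂).principal.mul_act, ← (tensor U₁ T₂).principal.mul_act,
        tmk_congr _ (hF.mul _ _ e₁ (hF.composable e₁)) rfl]
      congr 1
      rw [← S.eps_add, ← S.eps_add, ← S.eps_add]
      congr 1
      have d1 := h₁.deg (T₁.proj.arr a')
      have hc : c (Γ.rng (T₁.proj.arr a')) = c (Γ.src (T₁.proj.arr a)) := by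
        rw [T₁.rng_proj, T₁.src_proj, e₁]
      rw [hF.proj, hF.proj, d1]
      simp only [x, T₁.proj_mul, T₂.deg_mul, Γ.src_mul, hc]
      have h2 := CharTwo.add_self_eq_zero (T₂.deg (T₁.proj.arr a) * U₁.deg (T₁.proj.arr a'))
      have h3 := CharTwo.add_self_eq_zero (T₂.deg (T₁.proj.arr a) * c (Γ.src (T₁.proj.arr a)))
      linear_combination -h2 - h3)
  refine ⟨⟨H, hH⟩, h₁.continuous, h₁.conj, fun g => ?_⟩
  rw [tensor_deg, tensor_deg, h₁.deg]
  ring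

/-- The flip is corrected by the Koszul sign with exponent `δ₁ δ₂`. The failure of this quadratic
function to be additive is `δ₁(γ)δ₂(γ') + δ₂(γ)δ₁(γ')`, which is the discrepancy between the two
product signs. -/
theorem tensor_comm (T₁ T₂ : RealTwist Γ S) :
    TwHom (RealHom.id Γ) 0 (tensor T₁ T₂) (tensor T₂ T₁) := by
  let x : Γ.Arr → ZMod 2 := fun g => T₁.deg g * T₂.deg g
  have hx : Continuous x := T₁.continuous_deg.mul T₂.continuous_deg
  let W := tensor T₂ T₁
  obtain ⟨H, hH, -⟩ := tensor_lift (f := RealHom.id Γ) (T₁ := T₁) (T₂ := T₂) (T := W)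
    (fun a b h => W.act (S.eps (x (T₁.proj.arr a))) (tmk T₂ T₁ b a h.symm))
    (W.principal.continuous_act'
      (S.continuous_eps' (hx.comp (T₁.proj.continuous_arr.comp (by fun_prop))))
      (continuous_tmk (by fun_prop) (by fun_prop) _))
    (fun a b h => by rw [W.principal.proj_act, tensor_proj, h])
    (fun d a b h h' => by
      have : x (T₁.proj.arr (T₁.act d a)) = x (T₁.proj.arr a) := by
        rw [T₁.principal.proj_act]
      rw [this, ← W.principal.mul_act, mul_comm, W.principal.mul_act, tensor_act' T₂ T₁ d])
    (fun d a b h h' => by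
      rw [← W.principal.mul_act, mul_comm, W.principal.mul_act, tensor_act T₂ T₁ d])
    (fun a b h h' => by
      rw [← W.principal.conj_act, S.conj_eps, tensor_conj]
      have : x (T₁.proj.arr (T₁.grpd.Arr.conj a)) = x (T₁.proj.arr a) := by
        simp only [x, T₁.proj.conj_arr, T₂.deg_conj, T₁.deg_conj]
      rw [this])
    (fun a b h a' b' h' e₁ e₂ h'' e => by
      have e3 : W.grpd.src (tmk T₂ T₁ b a h.symm) = W.grpd.rng (tmk T₂ T₁ b' a' h'.symm) := by
        rw [tensor_src, tensor_rng, e₂]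
      rw [W.act_mul_act _ _ _ _ e3, tensor_mul T₂ T₁ _ _ _ _ _ _ _ e₂ e₁,
        ← W.principal.mul_act, ← W.principal.mul_act]
      congr 1
      rw [← S.eps_add, ← S.eps_add, ← S.eps_add]
      congr 1
      rw [← h, ← h']
      simp only [x, T₁.proj_mul, T₂.deg_mul, T₁.deg_mul]
      ring)
  refine TwHom.of_isTwHom hH fun g => ?_
  rw [tensor_deg, tensor_deg, add_comm]

end TensorMaps

/-! ### Associativity, and homomorphisms versus isomorphisms of tensor products -/

section Constructions

variable {Y Y' Y'' : RealSpace.{u}} {Γ : RealGroupoid Y} {Γ' : RealGroupoid Y'}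
  {Γ'' : RealGroupoid Y''} {S : RealAbelianGroup.{u}}

theorem tmk_eq_iff {T₁ T₂ : RealTwist Γ S} {a b h a' b' h'} :
    tmk T₁ T₂ a b h = tmk T₁ T₂ a' b' h' ↔ ∃ c, a' = T₁.act c a ∧ b' = T₂.act c⁻¹ b :=
  (baerRel_equivalence T₁ T₂).quot_mk_eq.trans (exists_congr fun _ => Prod.mk_inj)

theorem locallySplit_tmk (T₁ T₂ : RealTwist Γ S) :
    LocallySplit fun p : pairSpace T₁ T₂ => tmk T₁ T₂ p.1.1 p.1.2 p.2 :=
  locallySplit_baer T₁ T₂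

/-- Rebracketing needs no correcting sign: on both sides the total exponent is `δ₂(γ)δ₁(γ') +
δ₃(γ)δ₁(γ') + δ₃(γ)δ₂(γ')`. -/
theorem tensor_assoc (T₁ T₂ T₃ : RealTwist Γ S) :
    TwHom (RealHom.id Γ) 0 (tensor (tensor T₁ T₂) T₃) (tensor T₁ (tensor T₂ T₃)) := by
  -- The image of `([a, b], c)` is characterized simultaneously for all representatives of the inner
  -- class, so that the chosen function `m` can be evaluated on any of them.
  have key : ∀ q c, (tensor T₁ T₂).proj.arr q = T₃.proj.arr c →
      ∃ w, ∀ a b hab hbc habc, q = tmk T₁ T₂ a b hab →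
        w = tmk T₁ (tensor T₂ T₃) a (tmk T₂ T₃ b c hbc) habc := by
    intro q c h
    obtain ⟨a, b, hab, rfl⟩ := tmk_surjective T₁ T₂ q
    have hbc : T₂.proj.arr b = T₃.proj.arr c := by rw [← hab, ← h, tensor_proj]
    have habc : T₁.proj.arr a = (tensor T₂ T₃).proj.arr (tmk T₂ T₃ b c hbc) := by
      rw [tensor_proj, hab]
    refine ⟨tmk T₁ (tensor T₂ T₃) a (tmk T₂ T₃ b c hbc) habc, ?_⟩
    intro a' b' hab' hbc' habc' e
    obtain ⟨d, rfl, rfl⟩ := tmk_eq_iff.mp e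
    exact tmk_eq_iff.mpr ⟨d, rfl, rfl⟩
  choose m hm using key
  have hm' : ∀ a b c hab hbc habc h, m (tmk T₁ T₂ a b hab) c h =
      tmk T₁ (tensor T₂ T₃) a (tmk T₂ T₃ b c hbc) habc :=
    fun a b c hab hbc habc h => hm _ c h a b hab hbc habc rfl
  have aux : ∀ {a b c hab}, (tensor T₁ T₂).proj.arr (tmk T₁ T₂ a b hab) = T₃.proj.arr c →
      ∃ hbc : T₂.proj.arr b = T₃.proj.arr c,
        T₁.proj.arr a = (tensor T₂ T₃).proj.arr (tmk T₂ T₃ b c hbc) := by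
    intro a b c hab h
    have hbc : T₂.proj.arr b = T₃.proj.arr c := by rw [← hab, ← h, tensor_proj]
    exact ⟨hbc, by rw [tensor_proj, hab]⟩
  let W := tensor T₁ (tensor T₂ T₃)
  obtain ⟨H, hH, -⟩ := tensor_lift (f := RealHom.id Γ) (T := W) m
    (by
      refine (locallySplit_tmk T₁ T₂).continuous_of_lift
        (f := fun p : pairSpace (tensor T₁ T₂) T₃ => p.1.1) (by fun_prop) ?_
      intro V _ i e hi he hv
      have h3 : ∀ v, T₂.proj.arr (e v).1.2 = T₃.proj.arr (i v).1.2 := fun v => by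
        rw [← (e v).2, ← (i v).2, ← hv v, tensor_proj]
      have : (fun v => m (i v).1.1 (i v).1.2 (i v).2) = fun v =>
          tmk T₁ (tensor T₂ T₃) (e v).1.1 (tmk T₂ T₃ (e v).1.2 (i v).1.2 (h3 v))
            (by rw [tensor_proj]; exact (e v).2) :=
        funext fun v => hm _ _ _ _ _ _ _ _ (hv v).symm
      rw [this]
      exact continuous_tmk (by fun_prop) (continuous_tmk (by fun_prop) (by fun_prop) _) _)
    (by
      intro q c h
      obtain ⟨a, b, hab, rfl⟩ := tmk_surjective T₁ T₂ q
      obtain ⟨hbc, habc⟩ := aux h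
      rw [hm' a b c hab hbc habc, tensor_proj, tensor_proj])
    (by
      intro d q c h h'
      obtain ⟨a, b, hab, rfl⟩ := tmk_surjective T₁ T₂ q
      obtain ⟨hbc, habc⟩ := aux h
      rw [hm' a b c hab hbc habc]
      exact hm' (T₁.act d a) b c ((T₁.principal.proj_act _ _).trans hab) hbc
        (by rw [T₁.principal.proj_act]; exact habc) h')
    (by
      intro d q c h h'
      obtain ⟨a, b, hab, rfl⟩ := tmk_surjective T₁ T₂ q
      obtain ⟨hbc, habc⟩ := aux h
      have hbc' : T₂.proj.arr b = T₃.proj.arr (T₃.act d c) := by rw [T₃.principal.proj_act, hbc]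
      rw [hm' a b c hab hbc habc, tensor_act' T₁ _ d,
        hm' a b (T₃.act d c) hab hbc' (by rw [tensor_proj, hab])]
      exact tmk_congr _ rfl (tensor_act' T₂ T₃ d _ _ _).symm)
    (by
      intro q c h h'
      obtain ⟨a, b, hab, rfl⟩ := tmk_surjective T₁ T₂ q
      obtain ⟨hbc, habc⟩ := aux h
      rw [hm' a b c hab hbc habc]
      exact hm' _ _ _ _ (by rw [T₂.proj.conj_arr, T₃.proj.conj_arr, hbc])
        (by rw [tensor_proj, T₂.proj.conj_arr, T₁.proj.conj_arr, hab]) _)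
    (by
      intro q c h q' c' h' e₁ e₂ h'' e
      obtain ⟨a, b, hab, rfl⟩ := tmk_surjective T₁ T₂ q
      obtain ⟨a', b', hab', rfl⟩ := tmk_surjective T₁ T₂ q'
      obtain ⟨hbc, habc⟩ := aux h
      obtain ⟨hbc', habc'⟩ := aux h'
      have f₁ : T₁.grpd.src a = T₁.grpd.rng a' := by rwa [tensor_src, tensor_rng] at e₁
      have f₂ : T₂.grpd.src b = T₂.grpd.rng b' := by
        rw [← T₂.src_proj, ← T₂.rng_proj, ← hab, ← hab', T₁.src_proj, T₁.rng_proj, f₁]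
      have f₃ : (tensor T₂ T₃).grpd.src (tmk T₂ T₃ b c hbc) =
        (tensor T₂ T₃).grpd.rng (tmk T₂ T₃ b' c' hbc') := by rw [tensor_src, tensor_rng, f₂]
      have g : T₂.proj.arr (T₂.grpd.mul b b' f₂) = T₃.proj.arr (T₃.grpd.mul c c' e₂) := by
        rw [T₂.proj_mul, T₃.proj_mul]; exact Γ.mul_congr _ hbc hbc'
      have g' : T₁.proj.arr (T₁.grpd.mul a a' f₁) = T₂.proj.arr (T₂.grpd.mul b b' f₂) := by
        rw [T₁.proj_mul, T₂.proj_mul]; exact Γ.mul_congr _ hab hab'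
      have l : m ((tensor T₁ T₂).grpd.mul (tmk T₁ T₂ a b hab) (tmk T₁ T₂ a' b' hab') e₁)
          (T₃.grpd.mul c c' e₂) h'' = W.act (S.eps (T₂.deg (T₁.proj.arr a) *
            T₁.deg (T₁.proj.arr a'))) (tmk T₁ (tensor T₂ T₃) (T₁.grpd.mul a a' f₁)
            (tmk T₂ T₃ (T₂.grpd.mul b b' f₂) (T₃.grpd.mul c c' e₂) g) g') := by
        exact hm _ _ _ (T₁.act (S.eps (T₂.deg (T₁.proj.arr a) * T₁.deg (T₁.proj.arr a'))) _) _
          ((T₁.principal.proj_act _ _).trans g') g ((T₁.principal.proj_act _ _).trans g')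
          (tensor_mul T₁ T₂ _ _ _ _ _ _ _ f₁ f₂)
      have r : W.grpd.mul (m (tmk T₁ T₂ a b hab) c h) (m (tmk T₁ T₂ a' b' hab') c' h') e =
          W.act (S.eps ((tensor T₂ T₃).deg (T₁.proj.arr a) * T₁.deg (T₁.proj.arr a')))
          (W.act (S.eps (T₃.deg (T₁.proj.arr a) * T₂.deg (T₁.proj.arr a')))
            (tmk T₁ (tensor T₂ T₃) (T₁.grpd.mul a a' f₁)
            (tmk T₂ T₃ (T₂.grpd.mul b b' f₂) (T₃.grpd.mul c c' e₂) g) g')) := by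
        rw [W.grpd.mul_congr _ (hm' a b c hab hbc habc h) (hm' a' b' c' hab' hbc' habc' h'),
          tensor_mul T₁ (tensor T₂ T₃) _ _ _ _ _ _ _ f₁ f₃]
        refine congrArg _ (Eq.trans (tmk_congr _ rfl ?_)
          (tensor_act' T₁ (tensor T₂ T₃) _ _ _ g').symm)
        rw [tensor_mul T₂ T₃ _ _ _ _ _ _ _ f₂ e₂, hab, hab']
      rw [l, r, ← W.principal.mul_act, ← W.principal.mul_act, tensor_proj, tensor_proj, tensor_deg,
        tensor_deg, ← S.eps_add, ← S.eps_add]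
      congr 2
      have h2 := CharTwo.add_self_eq_zero (T₃.deg (T₁.proj.arr a) * T₁.deg (T₁.proj.arr a'))
      have h3 := CharTwo.add_self_eq_zero (T₃.deg (T₁.proj.arr a) * T₂.deg (T₁.proj.arr a'))
      linear_combination -h2 - h3)
  refine TwHom.of_isTwHom hH fun g => ?_
  simp only [tensor_deg, add_assoc]

/-- A homomorphism over the identity is invertible, so a map in one direction already realizes the
required homeomorphism. With the converse below, `IsTensor` can be handled entirely through `TwHom`.
-/
theorem isTensor_of_twHom {T₁ T₂ T : RealTwist Γ S}
    (h : TwHom (RealHom.id Γ) 0 (tensor T₁ T₂) T) : IsTensor T₁ T₂ T := by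
  obtain ⟨F, hF⟩ := h.exists_hom
  obtain ⟨I, hI, h1, h2⟩ := hF.exists_inverse
  refine ⟨fun γ => ?_, ⟨⟨F, I, h2, h1⟩, hF.continuous, hI.continuous⟩, fun a => hF.proj _, ?_, ?_,
    ?_⟩
  · have := h.deg γ
    simpa [tensor_deg] using this.symm
  · rintro c ⟨⟨a, b⟩, h⟩ ⟨⟨a', b'⟩, h'⟩ e
    obtain ⟨rfl, rfl⟩ := Prod.mk.inj e
    exact hF.act c (tmk T₁ T₂ a _ h)
  · rintro ⟨⟨a, b⟩, h⟩ ⟨⟨a', b'⟩, h'⟩ e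
    obtain ⟨rfl, rfl⟩ := Prod.mk.inj e
    exact hF.conj (tmk T₁ T₂ a b h)
  · rintro ⟨⟨a, b⟩, h⟩ ⟨⟨a', b'⟩, h'⟩ ⟨⟨a'', b''⟩, h''⟩ e₁ e₂ e e'
    obtain ⟨rfl, rfl⟩ := Prod.mk.inj e
    have e3 : (tensor T₁ T₂).grpd.src (tmk T₁ T₂ a b h) =
      (tensor T₁ T₂).grpd.rng (tmk T₁ T₂ a' b' h') := by rw [tensor_src, tensor_rng]; exact e₁
    refine (hF.mul (tmk T₁ T₂ a b h) (tmk T₁ T₂ a' b' h') e3 e').symm.trans ?_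
    rw [tensor_mul T₁ T₂ a b h a' b' h' e3 e₁ e₂, hF.act]
    have h1 : T₁.proj.arr a = T₂.proj.arr b := h
    have h2 : T₂.deg (T₂.proj.arr b) = T₂.deg (T₁.proj.arr a) := by rw [h1]
    simp only [h2]
    rfl

theorem twHom_of_isTensor {T₁ T₂ T : RealTwist Γ S} (h : IsTensor T₁ T₂ T) :
    TwHom (RealHom.id Γ) 0 (tensor T₁ T₂) T := by
  obtain ⟨hd, φ, hp, ha, hc, hm⟩ := h
  refine TwHom.of_isTwHom (F := φ) ⟨φ.continuous, ?_, ?_, ?_, ?_⟩ fun g => (hd g).symm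
  · rintro ⟨a⟩
    exact hp a
  · rintro c ⟨a⟩
    exact ha c a _ rfl
  · rintro ⟨a⟩
    exact hc a _ rfl
  · intro t t' e e'
    obtain ⟨a, b, h, rfl⟩ := tmk_surjective T₁ T₂ t
    obtain ⟨a', b', h', rfl⟩ := tmk_surjective T₁ T₂ t'
    have e₁ : T₁.grpd.src a = T₁.grpd.rng a' := by rwa [tensor_src, tensor_rng] at e
    have e₂ : T₂.grpd.src b = T₂.grpd.rng b' := by
      rw [← T₂.src_proj, ← T₂.rng_proj, ← h, ← h', T₁.src_proj, T₁.rng_proj, e₁]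
    have h3 : T₁.proj.arr (T₁.grpd.mul a a' e₁) = T₂.proj.arr (T₂.grpd.mul b b' e₂) := by
      rw [T₁.proj_mul, T₂.proj_mul]; exact Γ.mul_congr _ h h'
    have key := hm ⟨(a, b), h⟩ ⟨(a', b'), h'⟩ ⟨_, h3⟩ e₁ e₂ rfl e'
    refine Eq.trans ?_ key.symm
    have h2 : T₂.deg (T₂.proj.arr b) = T₂.deg (T₁.proj.arr a) := by rw [h]
    rw [tensor_mul T₁ T₂ a b h a' b' h' e e₁ e₂]
    simp only [h2]
    have h3 : T₁.proj.arr (T₁.act (S.eps (T₂.deg (T₁.proj.arr a) * T₁.deg (T₁.proj.arr a')))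
        (T₁.grpd.mul a a' e₁)) = T₂.proj.arr (T₂.grpd.mul b b' e₂) := by
      rw [T₁.principal.proj_act, h3]
    exact ha _ _ ⟨_, h3⟩ rfl

end Constructions

/-! ### Unit, inverses, pull-backs and line twists -/

section TrivialTwist

variable {Y : RealSpace.{u}} (Γ : RealGroupoid Y) (S : RealAbelianGroup.{u})

/-- The trivial twist. -/
noncomputable def trivialTwist : RealTwist Γ S := TwistCore.twist
  { E :=
      { carrier := S × Γ.Arr
        conj := fun x => (S.conj x.1, Γ.Arr.conj x.2)
        continuous_conj := (S.continuous_conj.comp continuous_fst).prodMk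
          (Γ.Arr.continuous_conj.comp continuous_snd)
        conj_conj := fun x => Prod.ext (S.conj_conj _) (Γ.Arr.conj_conj _) }
    p := fun x => x.2
    act := fun c x => (c * x.1, x.2)
    principal := IsRealPrincipal.of_div continuous_snd (fun _ => rfl) (by fun_prop)
      (fun v => by rw [one_mul]) (fun c d v => by rw [mul_assoc])
      (fun c v => Prod.ext (map_mul _ _ _).symm rfl) (fun _ _ => rfl)
      (locallySplit_of_section (fun g => (1, g)) (by fun_prop) fun _ => rfl)
      (fun w => w.1.1.1 * (w.1.2.1)⁻¹) (by fun_prop)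
      (fun w => Prod.ext (inv_mul_cancel_right _ _) w.2.symm)
      (fun c v e => mul_inv_cancel_right _ _)
    mul := fun x y e => (x.1 * y.1, Γ.mul x.2 y.2 e)
    continuous_mul := (by fun_prop : Continuous fun w : {w : (S × Γ.Arr) × (S × Γ.Arr) //
      Γ.src w.1.2 = Γ.rng w.2.2} => w.1.1.1 * w.1.2.1).prodMk
        (Γ.continuous_mul' (by fun_prop) (by fun_prop) _)
    proj_mul := fun _ _ _ => rfl
    act_mul_act := fun c d x y e e' => Prod.ext (mul_mul_mul_comm _ _ _ _) rfl
    mul_assoc := fun x y z e e' h h' => Prod.ext (mul_assoc _ _ _) (Γ.mul_assoc _ _ _ _ _)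
    mul_conj := fun x y e e' => Prod.ext (map_mul _ _ _).symm (Γ.mul_conj _ _ _)
    deg := fun _ => 0
    continuous_deg := continuous_const
    deg_mul := fun _ _ _ => (add_zero 0).symm
    deg_conj := fun _ => rfl }

end TrivialTwist

section Constructions

variable {Y Y' Y'' : RealSpace.{u}} {Γ : RealGroupoid Y} {Γ' : RealGroupoid Y'}
  {Γ'' : RealGroupoid Y''} {S : RealAbelianGroup.{u}}

theorem tensor_trivial (T : RealTwist Γ S) :
    TwHom (RealHom.id Γ) 0 (tensor T (trivialTwist Γ S)) T := by
  obtain ⟨H, hH, -⟩ := tensor_lift (f := RealHom.id Γ) (T₁ := T) (T₂ := trivialTwist Γ S) (T := T)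
    (fun a b _ => T.act b.1 a)
    (T.principal.continuous_act' (continuous_fst.comp (by fun_prop)) (by fun_prop))
    (fun a b h => T.principal.proj_act _ _)
    (fun c a b h h' => by rw [← T.principal.mul_act, ← T.principal.mul_act, mul_comm])
    (fun c a b h h' => by rw [← T.principal.mul_act]; rfl)
    (fun a b h h' => T.principal.conj_act b.1 a)
    (fun a b h a' b' h' e₁ e₂ h'' e => by
      rw [T.act_mul_act _ _ _ _ e₁]
      have : (trivialTwist Γ S).deg (T.proj.arr a) = 0 := rfl
      rw [this, zero_mul, S.eps_zero, T.principal.one_act]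
      rfl)
  refine TwHom.of_isTwHom hH fun g => ?_
  rw [tensor_deg]
  exact add_zero _

/-- The inverse of a twist up to isomorphism. -/
noncomputable def negTwist (T : RealTwist Γ S) : RealTwist Γ S := TwistCore.twist <|
  -- The sign with exponent `δ(γ) δ(γ')` is inserted so as to cancel the one that the graded tensor
  -- product with `T` introduces.
  TwistCore.signed (A := T) (B := T)
  { E := T.grpd.Arr
    p := T.proj.arr
    -- The inverse class is carried by the same arrows with the inverse scalar action, while the
    -- grading stays `δ`, since `-δ = δ` in `ℤ/2`.
    act := fun c => T.act c⁻¹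
    principal := IsRealPrincipal.of_div T.principal.continuous_proj T.principal.conj_proj
      (T.principal.continuous_act' (by fun_prop) (by fun_prop))
      (fun v => by rw [inv_one, T.principal.one_act])
      (fun c d v => by rw [mul_inv, T.principal.mul_act])
      (fun c v => by rw [← map_inv, T.principal.conj_act])
      (fun c v => T.principal.proj_act _ _) T.principal.locallySplit
      (fun w => (T.principal.div w.1.1 w.1.2 w.2)⁻¹) T.principal.continuous_div.inv
      (fun w => by rw [inv_inv, T.principal.act_div])
      (fun c v e => by rw [T.principal.div_eq e rfl, inv_inv])
    mul := fun x y e => T.grpd.mul x y (by rw [← T.src_proj, ← T.rng_proj, e])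
    continuous_mul := T.grpd.continuous_mul' (by fun_prop) (by fun_prop) _
    proj_mul := fun _ _ _ => T.proj_mul _ _ _
    act_mul_act := fun c d x y e e' => by rw [mul_inv]; exact T.act_mul_act _ _ _ _ _ _
    mul_assoc := fun x y z e e' h h' => T.grpd.mul_assoc _ _ _ _ _
    mul_conj := fun x y e e' => T.grpd.mul_conj _ _ _
    deg := T.deg
    continuous_deg := T.continuous_deg
    deg_mul := T.deg_mul
    deg_conj := T.deg_conj }

theorem IsRealPrincipal.div_act_left {E B : RealSpace.{u}} {p : E → B} {a : S → E → E}
    (h : IsRealPrincipal S p a) (c : S) (x y : E) (e : p x = p y) (e') :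
    h.div (a c x) y e' = c * h.div x y e :=
  h.div_eq _ (by rw [h.mul_act, h.act_div])

theorem IsRealPrincipal.div_act_right {E B : RealSpace.{u}} {p : E → B} {a : S → E → E}
    (h : IsRealPrincipal S p a) (c : S) (x y : E) (e : p x = p y) (e') :
    h.div x (a c⁻¹ y) e' = c * h.div x y e :=
  h.div_eq _ (by rw [← h.mul_act, mul_right_comm, mul_inv_cancel, one_mul, h.act_div])

theorem IsRealPrincipal.div_conj {E B : RealSpace.{u}} {p : E → B} {a : S → E → E}
    (h : IsRealPrincipal S p a) (x y : E) (e : p x = p y) (e') :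
    h.div (E.conj x) (E.conj y) e' = S.conj (h.div x y e) :=
  h.div_eq _ (by rw [h.conj_act, h.act_div])

theorem RealTwist.div_mul (T : RealTwist Γ S) (x y x' y' : T.grpd.Arr) (e e' e₁ e₂ e₃) :
    T.principal.div (T.grpd.mul x x' e₁) (T.grpd.mul y y' e₂) e₃ =
      T.principal.div x y e * T.principal.div x' y' e' :=
  T.principal.div_eq _ (by
    rw [← T.act_mul_act _ _ _ _ _ (by rw [T.src_act, T.rng_act, e₂])]
    exact T.grpd.mul_congr _ (T.principal.act_div _ _ _) (T.principal.act_div _ _ _))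

theorem RealTwist.div_act_inv_mul (T : RealTwist Γ S) (c : S) (x y x' y' : T.grpd.Arr)
    (e e' e₁ e₂ e₃) : T.principal.div (T.grpd.mul x x' e₁) (T.act c⁻¹ (T.grpd.mul y y' e₂)) e₃ =
      c * (T.principal.div x y e * T.principal.div x' y' e') := by
  rw [← T.div_mul x y x' y' e e' e₁ e₂ (by rw [e₃, T.principal.proj_act])]
  exact T.principal.div_act_right _ _ _ _ _

/-- Two points of the same fibre have a difference in `S`; this trivializes the tensor product. It
is equivariant in both variables because the scalars act inversely on the first, and multiplicative
because the two signs cancel. -/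
theorem tensor_neg (T : RealTwist Γ S) :
    TwHom (RealHom.id Γ) 0 (tensor (negTwist T) T) (trivialTwist Γ S) := by
  have hc : Continuous fun p : {p : T.grpd.Arr × T.grpd.Arr // T.proj.arr p.1 = T.proj.arr p.2} =>
      (T.principal.div p.1.2 p.1.1 p.2.symm, T.proj.arr p.1.2) :=
    (T.principal.continuous_div' (by fun_prop) (by fun_prop) _).prodMk
      (T.proj.continuous_arr.comp (by fun_prop))
  obtain ⟨H, hH, -⟩ := tensor_lift (f := RealHom.id Γ) (T₁ := negTwist T) (T₂ := T)
    (T := trivialTwist Γ S)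
    (fun a b h => (T.principal.div b a h.symm, T.proj.arr b))
    hc
    (fun a b h => h.symm)
    (fun c a b h h' => Prod.ext (T.principal.div_act_right c b a h.symm h'.symm) rfl)
    (fun c a b h h' => Prod.ext (T.principal.div_act_left c b a h.symm h'.symm)
      (T.principal.proj_act _ _))
    (fun a b h h' => Prod.ext (T.principal.div_conj b a h.symm h'.symm) (T.proj.conj_arr _))
    (fun a b h a' b' h' e₁ e₂ h'' e => Prod.ext
      (T.div_act_inv_mul (S.eps (T.deg (T.proj.arr a) * T.deg (T.proj.arr a'))) b a b' a' h.symm h'.symm e₂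
        ((T.src_proj _).symm.trans (Eq.trans e₁ (T.rng_proj _))) h''.symm)
      (T.proj_mul _ _ _))
  refine TwHom.of_isTwHom hH fun g => ?_
  rw [tensor_deg]
  exact CharTwo.add_self_eq_zero _

/-- The pull-back of a twist along a homomorphism. -/
noncomputable def pullback (f : RealHom Γ' Γ) (T : RealTwist Γ S) : RealTwist Γ' S := TwistCore.twist
  { E := RealSpace.fprod (A := T.grpd.Arr) (B := Γ'.Arr) T.proj.arr f.arr T.proj.continuous_arr
      f.continuous_arr T.proj.conj_arr f.conj_arr
    p := fun x => x.1.2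
    act := fun c x => ⟨(T.act c x.1.1, x.1.2), (T.principal.proj_act _ _).trans x.2⟩
    principal := IsRealPrincipal.of_div (by fun_prop) (fun _ => rfl)
      (Continuous.subtype_mk ((T.principal.continuous_act' (by fun_prop) (by fun_prop)).prodMk
        (by fun_prop)) _)
      (fun v => Subtype.ext (Prod.ext (T.principal.one_act _) rfl))
      (fun c d v => Subtype.ext (Prod.ext (T.principal.mul_act _ _ _) rfl))
      (fun c v => Subtype.ext (Prod.ext (T.principal.conj_act _ _) rfl))
      (fun _ _ => rfl)
      (T.principal.locallySplit.lift f.continuous_arr (fun x => ⟨(x.1.2, x.1.1), x.2.symm⟩)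
        (by fun_prop) fun _ => rfl)
      (fun w => T.principal.div w.1.1.1.1 w.1.2.1.1
        (w.1.1.2.trans ((congrArg f.arr w.2).trans w.1.2.2.symm)))
      (T.principal.continuous_div' (by fun_prop) (by fun_prop) _)
      (fun w => Subtype.ext (Prod.ext (T.principal.act_div _ _ _) w.2.symm))
      (fun c v e => T.principal.div_eq _ rfl)
    mul := fun x y e => ⟨(T.grpd.mul x.1.1 y.1.1 (by
      rw [← T.src_proj, ← T.rng_proj, x.2, y.2, f.src_arr, f.rng_arr, e]), Γ'.mul x.1.2 y.1.2 e), by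
      simp only [T.proj_mul, f.mul_arr]
      exact Γ.mul_congr _ x.2 y.2⟩
    continuous_mul := Continuous.subtype_mk ((T.grpd.continuous_mul' (by fun_prop) (by fun_prop)
      _).prodMk (Γ'.continuous_mul' (by fun_prop) (by fun_prop) _)) _
    proj_mul := fun _ _ _ => rfl
    act_mul_act := fun c d x y e e' => Subtype.ext (Prod.ext (T.act_mul_act _ _ _ _ _ _) rfl)
    mul_assoc := fun x y z e e' h h' =>
      Subtype.ext (Prod.ext (T.grpd.mul_assoc _ _ _ _ _) (Γ'.mul_assoc _ _ _ _ _))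
    mul_conj := fun x y e e' =>
      Subtype.ext (Prod.ext (T.grpd.mul_conj _ _ _) (Γ'.mul_conj _ _ _))
    deg := fun g => T.deg (f.arr g)
    continuous_deg := T.continuous_deg.comp f.continuous_arr
    deg_mul := fun _ _ _ => by rw [f.mul_arr, T.deg_mul]
    deg_conj := fun _ => by rw [f.conj_arr, T.deg_conj] }

theorem isPullback_pullback (f : RealHom Γ' Γ) (T : RealTwist Γ S) :
    IsPullback f T (pullback f T) := by
  refine ⟨fun _ => rfl, Homeomorph.refl _, fun _ => rfl, ?_, ?_, ?_⟩
  · rintro c ⟨a, h⟩ ⟨b, h'⟩ e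
    obtain rfl : b = _ := e
    rfl
  · rintro ⟨a, h⟩ ⟨b, h'⟩ e
    obtain rfl : b = _ := e
    rfl
  · rintro ⟨a, h⟩ ⟨b, h'⟩ ⟨d, h''⟩ e₁ e₂ e e'
    obtain rfl : d = _ := e
    rfl

theorem twHom_pullback (f : RealHom Γ' Γ) (T : RealTwist Γ S) : TwHom f 0 (pullback f T) T :=
  TwHom.of_isTwHom (F := fun t => t.1.1) ⟨by exact continuous_fst.comp continuous_subtype_val,
    fun t => t.2, fun _ _ => rfl, fun _ => rfl, fun _ _ _ _ => rfl⟩ fun _ => rfl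

/-- The universal property of the pull-back. -/
theorem TwHom.to_pullback {f : RealHom Γ' Γ} {g : RealHom Γ'' Γ'} {h : RealHom Γ'' Γ}
    {c : Y'' → ZMod 2} {T : RealTwist Γ S} {T' : RealTwist Γ'' S} (H : TwHom h c T' T)
    (hfg : ∀ x, h.arr x = f.arr (g.arr x)) : TwHom g c T' (pullback f T) := by
  obtain ⟨F, hF⟩ := H.exists_hom
  have hp : ∀ t, T.proj.arr (F t) = f.arr (g.arr (T'.proj.arr t)) :=
    fun t => (hF.proj t).trans (hfg _)
  refine ⟨⟨fun t => ⟨(F t, g.arr (T'.proj.arr t)), hp t⟩, ?_, fun t => rfl, fun c t => ?_,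
    fun t => ?_, fun t t' e e' => ?_⟩, H.continuous, H.conj, fun x => ?_⟩
  · exact Continuous.subtype_mk (hF.continuous.prodMk
      (g.continuous_arr.comp T'.proj.continuous_arr)) _
  · exact Subtype.ext (Prod.ext (hF.act c t) (congrArg g.arr (T'.principal.proj_act c t)))
  · exact Subtype.ext (Prod.ext (hF.conj t)
      ((congrArg g.arr (T'.proj.conj_arr t)).trans (g.conj_arr _)))
  · exact Subtype.ext (Prod.ext (hF.mul _ _ _ _)
      ((congrArg g.arr (T'.proj_mul _ _ _)).trans (g.mul_arr _ _ _)))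
  · rw [H.deg, hfg]
    rfl

theorem TwHom.iso_pullback {f : RealHom Γ' Γ} {c : Y' → ZMod 2} {T : RealTwist Γ S}
    {T' : RealTwist Γ' S} (H : TwHom f c T' T) : TwHom (RealHom.id Γ') c T' (pullback f T) :=
  H.to_pullback fun _ => rfl

theorem pullback_tensor (f : RealHom Γ' Γ) (T₁ T₂ : RealTwist Γ S) :
    TwHom (RealHom.id Γ') 0 (tensor (pullback f T₁) (pullback f T₂))
      (pullback f (tensor T₁ T₂)) :=
  (tensor_map (twHom_pullback f T₁) (twHom_pullback f T₂)).iso_pullback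

/-- A twist that receives a compatible map from pairs of points of a principal bundle. -/
theorem isLineTwist_of_map {T : RealTwist Γ S} (hd : ∀ γ, T.deg γ = 0) {L : RealSpace.{u}}
    {J : L → Y} {a : S → L → L} (hL : IsRealPrincipal S J a) (m : LinePairs Γ J → T.grpd.Arr)
    (cont : Continuous m) (proj : ∀ x, T.proj.arr (m x) = x.1.2.1)
    (act : ∀ c d x y, y.1 = (a c x.1.1, x.1.2.1, a d x.1.2.2) → m y = T.act (c * d⁻¹) (m x))
    (conj : ∀ x y, y.1 = (L.conj x.1.1, Γ.Arr.conj x.1.2.1, L.conj x.1.2.2) →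
      m y = T.grpd.Arr.conj (m x))
    (mul : ∀ x y z e, x.1.2.2 = y.1.1 → z.1 = (x.1.1, Γ.mul x.1.2.1 y.1.2.1 e, y.1.2.2) →
      ∀ e', T.grpd.mul (m x) (m y) e' = m z) : IsLineTwist T := by
  have hr : Equivalence (lineRel Γ J a) :=
    ⟨fun x => ⟨1, by rw [hL.one_act, hL.one_act]⟩, by
      rintro x y ⟨c, h⟩
      refine ⟨c⁻¹, ?_⟩
      simp only [h, ← hL.mul_act, inv_mul_cancel, hL.one_act], by
      rintro x y z ⟨c, h⟩ ⟨d, h'⟩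
      exact ⟨d * c, by simp only [h', h, ← hL.mul_act]⟩⟩
  have hres : ∀ x y, lineRel Γ J a x y → m x = m y := by
    rintro x y ⟨c, h⟩
    rw [act c c x y h, mul_inv_cancel, T.principal.one_act]
  let φ : Quot (lineRel Γ J a) → T.grpd.Arr := Quot.lift m hres
  have inj : Function.Injective φ := by
    rintro ⟨x⟩ ⟨y⟩ e
    have e : m x = m y := e
    have e1 : x.1.2.1 = y.1.2.1 := by rw [← proj, ← proj, e]
    have e2 : J y.1.1 = J x.1.1 := by rw [x.2.1, y.2.1, e1]
    have e3 : J y.1.2.2 = J x.1.2.2 := by rw [← x.2.2, ← y.2.2, e1]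
    have e4 : y.1 = (a (hL.div _ _ e2) x.1.1, x.1.2.1, a (hL.div _ _ e3) x.1.2.2) := by
      rw [hL.act_div, hL.act_div, e1]
    have e5 := act _ _ x y e4
    rw [← e] at e5
    have e6 := T.principal.free ((T.principal.one_act _).trans e5)
    have e7 := (mul_inv_eq_one.mp e6.symm)
    exact Quot.sound ⟨_, by rw [e4, e7]⟩
  have lift : ∀ t (v w : L), J v = T.grpd.rng t → T.grpd.src t = J w →
      ∃ h, ∃ h', t = T.act (T.principal.div t (m ⟨(v, T.proj.arr t, w), h⟩) h')
        (m ⟨(v, T.proj.arr t, w), h⟩) := by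
    intro t v w hv hw
    have h : J v = Γ.rng (T.proj.arr t) ∧ Γ.src (T.proj.arr t) = J w :=
      ⟨by rw [T.rng_proj, hv], by rw [T.src_proj, hw]⟩
    exact ⟨h, (proj ⟨(v, T.proj.arr t, w), h⟩).symm, (T.principal.act_div _ _ _).symm⟩
  have lift' : ∀ t (v w : L) h h', φ (Quot.mk _ ⟨(a (T.principal.div t
      (m ⟨(v, T.proj.arr t, w), h⟩) h') v, T.proj.arr t, w),
        ⟨(hL.proj_act _ _).trans h.1, h.2⟩⟩) = t := by
    intro t v w h h'
    refine (act (T.principal.div t _ h') 1 ⟨(v, T.proj.arr t, w), h⟩ _ (by rw [hL.one_act])).trans ?_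
    rw [inv_one, mul_one, T.principal.act_div]
  have surj : Function.Surjective φ := by
    intro t
    obtain ⟨v, hv⟩ := hL.locallySplit.1 (T.grpd.rng t)
    obtain ⟨w, hw⟩ := hL.locallySplit.1 (T.grpd.src t)
    obtain ⟨h, h', e⟩ := lift t v w hv hw.symm
    exact ⟨Quot.mk _ ⟨(a (T.principal.div t (m ⟨(v, T.proj.arr t, w), h⟩) h') v, T.proj.arr t, w),
      ⟨(hL.proj_act _ _).trans h.1, h.2⟩⟩, lift' t v w h h'⟩
  let E := Equiv.ofBijective φ ⟨inj, surj⟩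
  have hcont : Continuous φ := cont.quotient_lift (s := ⟨_, hr⟩) hres
  -- Local sections of `L` at the range and at the source of an arrow give a preimage up to a
  -- scalar; the scalar is a continuous difference and is absorbed into the first end point.
  have hinv : Continuous E.symm := by
    refine hL.locallySplit.continuous_of_lift T.grpd.continuous_rng ?_
    intro V _ i v hi hv hiv
    refine hL.locallySplit.continuous_of_lift (T.grpd.continuous_src.comp hi) ?_
    intro V' _ i' w hi' hw hiw
    choose h h' e using fun x => lift (i (i' x)) (v (i' x)) (w x) (hiv _) (hiw x).symm
    have : (fun x => E.symm (i (i' x))) = fun x => Quot.mk _ ⟨(a (T.principal.div (i (i' x))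
      (m ⟨(v (i' x), T.proj.arr (i (i' x)), w x), h x⟩) (h' x)) (v (i' x)),
        T.proj.arr (i (i' x)), w x), ⟨(hL.proj_act _ _).trans (h x).1, (h x).2⟩⟩ :=
      funext fun x => (Equiv.symm_apply_eq _).mpr (lift' _ _ _ _ _).symm
    rw [this]
    have c1 : Continuous fun x => T.proj.arr (i (i' x)) :=
      T.proj.continuous_arr.comp (hi.comp hi')
    refine continuous_quot_mk.comp (Continuous.subtype_mk (Continuous.prodMk
      (hL.continuous_act' (T.principal.continuous_div' (hi.comp hi') (cont.comp
        (Continuous.subtype_mk ((hv.comp hi').prodMk (c1.prodMk hw)) _)) _) (hv.comp hi'))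
      (c1.prodMk hw)) _)
  refine ⟨hd, L, J, a, hL, ⟨E, hcont, hinv⟩, proj, ?_, conj, ?_⟩
  · intro c x y h
    refine (act c 1 x y (by rw [h, hL.one_act])).trans ?_
    rw [inv_one, mul_one]
    rfl
  · exact mul

/-- The trivial Real principal bundle. -/
abbrev trivialLine (Y : RealSpace.{u}) (S : RealAbelianGroup.{u}) : RealSpace.{u} where
  carrier := S × Y
  conj x := (S.conj x.1, Y.conj x.2)
  continuous_conj := (S.continuous_conj.comp continuous_fst).prodMk
    (Y.continuous_conj.comp continuous_snd)
  conj_conj x := Prod.ext (S.conj_conj _) (Y.conj_conj _)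

/-- The trivial bundle works: a pair of scalars over the two ends of an arrow is sent to their
quotient, which telescopes along composable arrows. -/
theorem isLineTwist_trivial : IsLineTwist (trivialTwist Γ S) := by
  have l₁ : ∀ c d a b : S, c * a * (d * b)⁻¹ = c * d⁻¹ * (a * b⁻¹) := fun c d a b => by
    rw [mul_inv, mul_mul_mul_comm]
  have l₂ : ∀ a b : S, S.conj a * (S.conj b)⁻¹ = S.conj (a * b⁻¹) := fun a b => by
    rw [map_mul, map_inv]
  have l₃ : ∀ a b c : S, a * b⁻¹ * (b * c⁻¹) = a * c⁻¹ := fun a b c => by group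
  refine isLineTwist_of_map (L := trivialLine Y S) (J := fun x => x.2)
    (a := fun c x => (c * x.1, x.2)) (fun _ => rfl) ?_
    (fun x => (x.1.1.1 * x.1.2.2.1⁻¹, x.1.2.1)) ?_ (fun _ => rfl) ?_ ?_ ?_
  · exact IsRealPrincipal.of_div continuous_snd (fun _ => rfl) (by fun_prop)
      (fun v => by rw [one_mul]) (fun c d v => by rw [mul_assoc])
      (fun c v => Prod.ext (map_mul _ _ _).symm rfl) (fun _ _ => rfl)
      (locallySplit_of_section (fun g => (1, g)) (by fun_prop) fun _ => rfl)
      (fun w => w.1.1.1 * (w.1.2.1)⁻¹) (by fun_prop)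
      (fun w => Prod.ext (inv_mul_cancel_right _ _) w.2.symm)
      (fun c v e => mul_inv_cancel_right _ _)
  · exact (by fun_prop : Continuous fun x : LinePairs Γ (L := trivialLine Y S) (fun x => x.2) =>
      (x.1.1.1 * x.1.2.2.1⁻¹, x.1.2.1))
  · rintro c d ⟨x, hx⟩ ⟨y, hy⟩ h
    obtain rfl : y = _ := h
    exact Prod.ext (l₁ _ _ _ _) rfl
  · rintro ⟨x, hx⟩ ⟨y, hy⟩ h
    obtain rfl : y = _ := h
    exact Prod.ext (l₂ _ _) rfl
  · rintro ⟨⟨x, g, y⟩, hx⟩ ⟨⟨x', g', y'⟩, hy⟩ ⟨z, hz⟩ e h h' e'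
    obtain rfl : z = _ := h'
    obtain rfl : y = x' := h
    exact Prod.ext (l₃ _ _ _) rfl

/-- The pull-back of a Real principal bundle along a Real map. -/
abbrev pullbackLine (f : RealHom Γ' Γ) {L : RealSpace.{u}} {J : L → Y} {a : S → L → L}
    (hL : IsRealPrincipal S J a) : RealSpace.{u} :=
  RealSpace.fprod (A := Y') (B := L) f.obj J f.continuous_obj hL.continuous_proj f.conj_obj
    hL.conj_proj

/-- The pulled-back twist belongs to the bundle pulled back along the map of units. -/
theorem isLineTwist_pullback (f : RealHom Γ' Γ) {T : RealTwist Γ S} (hT : IsLineTwist T) :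
    IsLineTwist (pullback f T) := by
  obtain ⟨hd, L, J, a, hL, φ, hp, ha, hc, hm⟩ := hT
  let J' : pullbackLine f hL → Y' := fun x => x.1.1
  let b : S → pullbackLine f hL → pullbackLine f hL :=
    fun c x => ⟨(x.1.1, a c x.1.2), x.2.trans (hL.proj_act _ _).symm⟩
  have hb : IsRealPrincipal S J' b := by
    refine IsRealPrincipal.of_div (by fun_prop) (fun _ => rfl)
      (Continuous.subtype_mk ((by fun_prop :
        Continuous fun q : S × pullbackLine f hL => q.2.1.1).prodMk
        (hL.continuous_act' (by fun_prop) (by fun_prop))) _)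
      (fun v => Subtype.ext (Prod.ext rfl (hL.one_act _)))
      (fun c d v => Subtype.ext (Prod.ext rfl (hL.mul_act _ _ _)))
      (fun c v => Subtype.ext (Prod.ext rfl (hL.conj_act _ _))) (fun _ _ => rfl)
      (hL.locallySplit.lift f.continuous_obj (fun x => x) continuous_id fun _ => rfl)
      (fun w => hL.div w.1.1.1.2 w.1.2.1.2
        (w.1.1.2.symm.trans ((congrArg f.obj w.2).trans w.1.2.2)))
      (hL.continuous_div' (by fun_prop) (by fun_prop) _)
      (fun w => Subtype.ext (Prod.ext w.2.symm (hL.act_div _ _ _)))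
      (fun c v e => hL.div_eq _ rfl)
  have hq : ∀ x : LinePairs Γ' J',
      J x.1.1.1.2 = Γ.rng (f.arr x.1.2.1) ∧ Γ.src (f.arr x.1.2.1) = J x.1.2.2.1.2 := fun x =>
    ⟨x.1.1.2.symm.trans ((congrArg f.obj x.2.1).trans (f.rng_arr _).symm),
      (f.src_arr _).trans ((congrArg f.obj x.2.2).trans x.1.2.2.2)⟩
  let n : LinePairs Γ' J' → LinePairs Γ J :=
    fun x => ⟨(x.1.1.1.2, f.arr x.1.2.1, x.1.2.2.1.2), hq x⟩
  have hn : Continuous n := Continuous.subtype_mk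
    ((by fun_prop : Continuous fun x : LinePairs Γ' J' => x.1.1.1.2).prodMk
      ((f.continuous_arr.comp (by fun_prop)).prodMk (by fun_prop))) _
  -- Acting diagonally by `d⁻¹` does not change the class and removes the scalar `d` from the second
  -- end point.
  have hact : ∀ (c d : S) (x y : LinePairs Γ J), y.1 = (a c x.1.1, x.1.2.1, a d x.1.2.2) →
      φ (Quot.mk _ y) = T.act (c * d⁻¹) (φ (Quot.mk _ x)) := by
    intro c d x y h
    refine Eq.trans (congrArg φ (Quot.sound ⟨d⁻¹, rfl⟩)) (ha (c * d⁻¹) x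
      ⟨(a d⁻¹ y.1.1, y.1.2.1, a d⁻¹ y.1.2.2), ⟨(hL.proj_act _ _).trans y.2.1,
        y.2.2.trans (hL.proj_act _ _).symm⟩⟩ ?_)
    simp only [h, ← hL.mul_act, inv_mul_cancel, hL.one_act, mul_comm d⁻¹ c]
  refine isLineTwist_of_map (J := J') (fun _ => hd _) hb
    (fun x => ⟨(φ (Quot.mk _ (n x)), x.1.2.1), hp (n x)⟩) ?_ (fun _ => rfl) ?_ ?_ ?_
  · exact Continuous.subtype_mk ((φ.continuous.comp (continuous_quot_mk.comp hn)).prodMk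
      (by fun_prop)) _
  · rintro c d x ⟨y, hy⟩ h
    obtain rfl : y = _ := h
    exact Subtype.ext (Prod.ext (hact c d (n x) _ rfl) rfl)
  · rintro x ⟨y, hy⟩ h
    obtain rfl : y = _ := h
    exact Subtype.ext (Prod.ext (hc (n x) _ (Prod.ext rfl (Prod.ext (f.conj_arr _) rfl))) rfl)
  · rintro ⟨⟨x, g, y⟩, hx⟩ ⟨⟨x', g', y'⟩, hy⟩ ⟨z, hz⟩ e h h' e'
    obtain rfl : z = _ := h'
    obtain rfl : y = x' := h
    exact Subtype.ext (Prod.ext (hm (n _) (n _) (n ⟨(x, Γ'.mul g g' e, y'), hz⟩) ((f.src_arr _).trans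
      ((congrArg f.obj e).trans (f.rng_arr _).symm)) rfl
      (Prod.ext rfl (Prod.ext (f.mul_arr _ _ e) rfl)) _) rfl)

end Constructions

/-- An abelian group from an operation that satisfies the usual laws. -/
@[reducible] noncomputable def AddCommGroup.ofLaws {A : Type*} (add : A → A → A) (zero : A)
    (add_assoc : ∀ x y z, add (add x y) z = add x (add y z)) (add_comm : ∀ x y, add x y = add y x)
    (add_zero : ∀ x, add x zero = x) (exists_neg : ∀ x, ∃ y, add y x = zero) : AddCommGroup A :=
  letI : Add A := ⟨add⟩
  letI : Zero A := ⟨zero⟩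
  letI : Neg A := ⟨fun x => (exists_neg x).choose⟩
  { AddGroup.ofLeftAxioms (G := A) add_assoc (fun x => (add_comm _ _).trans (add_zero x))
      (fun x => (exists_neg x).choose_spec) with
    add_comm := add_comm }

/-! ### The groups of twists and their pull-back homomorphisms -/

section ExtGroup

variable {Y Y' : RealSpace.{u}} {Γ : RealGroupoid Y} {Γ' : RealGroupoid Y'}
  {S : RealAbelianGroup.{u}}

theorem TwHom.trans {T T' T'' : RealTwist Γ S} (h : TwHom (RealHom.id Γ) 0 T T')
    (h' : TwHom (RealHom.id Γ) 0 T' T'') : TwHom (RealHom.id Γ) 0 T T'' :=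
  h'.comp_iso h

/-- Isomorphic twists are not identified directly by the relation defining `ExtTw`; they are related
by tensoring with the trivial twist, which is a line twist. -/
theorem TwHom.cls_eq {T T' : RealTwist Γ S} (h : TwHom (RealHom.id Γ) 0 T T') : T.cls = T'.cls :=
  Quot.sound ⟨_, isLineTwist_trivial, isTensor_of_twHom ((tensor_trivial T).trans h)⟩

theorem tensor_map_id {T₁ T₂ U₁ U₂ : RealTwist Γ S} (h₁ : TwHom (RealHom.id Γ) 0 T₁ U₁)
    (h₂ : TwHom (RealHom.id Γ) 0 T₂ U₂) :
    TwHom (RealHom.id Γ) 0 (tensor T₁ T₂) (tensor U₁ U₂) :=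
  tensor_map h₁ h₂

/-- The sum on `extR(Γ, S)`. -/
noncomputable def ExtTw.add : ExtTw Γ S → ExtTw Γ S → ExtTw Γ S :=
  Quot.map₂ tensor
    (fun T₁ _ _ ⟨L, hL, h⟩ => ⟨L, hL, isTensor_of_twHom ((tensor_assoc T₁ _ L).trans
      (tensor_map_id (TwHom.refl T₁) (twHom_of_isTensor h)))⟩)
    -- The unchanged factor `T₂` is moved to the front by symmetry, so that associativity brings `L`
    -- next to the factor being changed.
    (fun _ _ T₂ ⟨L, hL, h⟩ => ⟨L, hL, isTensor_of_twHom (((tensor_map_id (tensor_comm _ T₂)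
      (TwHom.refl L)).trans (tensor_assoc T₂ _ L)).trans ((tensor_map_id (TwHom.refl T₂)
      (twHom_of_isTensor h)).trans (tensor_comm T₂ _)))⟩)

noncomputable instance : AddCommGroup (ExtTw Γ S) :=
  AddCommGroup.ofLaws ExtTw.add (trivialTwist Γ S).cls
    (by rintro ⟨T₁⟩ ⟨T₂⟩ ⟨T₃⟩; exact (tensor_assoc T₁ T₂ T₃).cls_eq)
    (by rintro ⟨T₁⟩ ⟨T₂⟩; exact (tensor_comm T₁ T₂).cls_eq)
    (by rintro ⟨T⟩; exact (tensor_trivial T).cls_eq)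
    (by rintro ⟨T⟩; exact ⟨(negTwist T).cls, (tensor_neg T).cls_eq⟩)

theorem RealTwist.cls_add_cls (T₁ T₂ : RealTwist Γ S) :
    T₁.cls + T₂.cls = (tensor T₁ T₂).cls := rfl

/-- The pull-back homomorphism of groups of twists. -/
noncomputable def ExtTw.pullback (f : RealHom Γ' Γ) : ExtTw Γ S →+ ExtTw Γ' S :=
  AddMonoidHom.mk' (Quot.map (_root_.pullback f) fun T T' ⟨L, hL, h⟩ =>
    ⟨_root_.pullback f L, isLineTwist_pullback f hL, isTensor_of_twHom ((pullback_tensor f T L).trans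
      ((twHom_of_isTensor h).iso_comp (twHom_pullback f (tensor T L))).iso_pullback)⟩)
    (by rintro ⟨T₁⟩ ⟨T₂⟩; exact (pullback_tensor f T₁ T₂).cls_eq.symm)

theorem ExtTw.pullback_cls (f : RealHom Γ' Γ) (T : RealTwist Γ S) :
    ExtTw.pullback f T.cls = (_root_.pullback f T).cls := rfl

end ExtGroup

/-! ### Real covers, refinements and Real local sections -/

namespace RealCover

variable {X : RealSpace.{u}}

theorem isOpenEmbedding_slice (U : RealCover X) (i : U.Idx) :
    IsOpenEmbedding fun x : {x : X // x ∈ U.U i} => (⟨(i, x.1), x.2⟩ : U.space) := by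
  refine ⟨⟨⟨?_⟩, fun x y e => Subtype.ext (congrArg (fun z : U.space => z.1.2) e)⟩, ?_⟩
  · refine le_antisymm (continuous_iff_le_induced.mp
      (Continuous.subtype_mk (continuous_const.prodMk continuous_subtype_val) _)) ?_
    have h : Continuous fun z : U.space => z.1.2 := by fun_prop
    have h' := induced_mono (g := fun x : {x : X // x ∈ U.U i} => (⟨(i, x.1), x.2⟩ : U.space))
      (continuous_iff_le_induced.mp h)
    rwa [induced_compose] at h'
  · have : Set.range (fun x : {x : X // x ∈ U.U i} => (⟨(i, x.1), x.2⟩ : U.space)) =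
        (fun z : U.space => z.1.1) ⁻¹' {i} := by
      ext ⟨⟨j, x⟩, h⟩
      constructor
      · rintro ⟨y, e⟩
        exact (congrArg (fun z : U.space => z.1.1) e).symm
      · intro e
        obtain rfl : j = i := e
        exact ⟨⟨x, h⟩, rfl⟩
    rw [this]
    exact (isOpen_discrete _).preimage (by fun_prop)

/-- Continuity on the disjoint union of a cover is continuity on each of its members. -/
theorem continuous_of_slices (U : RealCover X) {B : Type*} [TopologicalSpace B] {F : U.space → B}
    (h : ∀ i, Continuous fun x : {x : X // x ∈ U.U i} => F ⟨(i, x.1), x.2⟩) : Continuous F := by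
  rw [continuous_iff_continuousAt]
  rintro ⟨⟨i, x⟩, hx⟩
  exact (U.isOpenEmbedding_slice i).continuousAt_iff.mp ((h i).continuousAt (x := ⟨x, hx⟩))

theorem isOpenMap_base (U : RealCover X) : IsOpenMap fun z : U.space => z.1.2 :=
  isOpenMap_snd.comp (U.isOpen_mem continuous_fst continuous_snd).isOpenMap_subtype_val

/-- The cover by the whole space. -/
def univ (X : RealSpace.{u}) : RealCover X where
  Idx := PUnit
  bar i := i
  bar_bar _ := rfl
  U _ := Set.univ
  isOpen_U _ := isOpen_univ
  exists_mem _ := ⟨PUnit.unit, trivial⟩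
  U_bar _ := (Set.image_univ_of_surjective fun x => ⟨X.conj x, X.conj_conj x⟩).symm

/-- The common refinement of two covers by the intersections of their members. -/
def prod (U V : RealCover X) : RealCover X where
  Idx := U.Idx × V.Idx
  bar i := (U.bar i.1, V.bar i.2)
  bar_bar i := Prod.ext (U.bar_bar _) (V.bar_bar _)
  U i := U.U i.1 ∩ V.U i.2
  isOpen_U i := (U.isOpen_U _).inter (V.isOpen_U _)
  exists_mem x := by
    obtain ⟨i, hi⟩ := U.exists_mem x
    obtain ⟨j, hj⟩ := V.exists_mem x
    exact ⟨(i, j), hi, hj⟩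
  U_bar i := by
    rw [U.U_bar, V.U_bar, Set.image_inter (Function.Involutive.injective X.conj_conj)]

/-- The identical refinement. -/
def Refinement.id (U : RealCover X) : U.Refinement U where
  idx i := i
  idx_bar _ := rfl
  subset _ := subset_rfl

/-- Composition of refinements. -/
def Refinement.comp {U V W : RealCover X} (θ : U.Refinement V) (θ' : V.Refinement W) :
    U.Refinement W where
  idx i := θ.idx (θ'.idx i)
  idx_bar i := by rw [θ'.idx_bar, θ.idx_bar]
  subset i := (θ'.subset i).trans (θ.subset _)

/-- The refinement of the whole space by a cover. -/
def Refinement.univ (U : RealCover X) : (RealCover.univ X).Refinement U where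
  idx := fun _ => PUnit.unit
  idx_bar := fun _ => rfl
  subset _ := Set.subset_univ _

/-- The first projection of a common refinement. -/
def Refinement.fst (U V : RealCover X) : U.Refinement (U.prod V) where
  idx i := i.1
  idx_bar _ := rfl
  subset _ := Set.inter_subset_left

/-- The second projection of a common refinement. -/
def Refinement.snd (U V : RealCover X) : V.Refinement (U.prod V) where
  idx i := i.2
  idx_bar _ := rfl
  subset _ := Set.inter_subset_right

/-- The universal property of the common refinement. -/
def Refinement.lift {U V W : RealCover X} (θ : U.Refinement W) (θ' : V.Refinement W) :
    (U.prod V).Refinement W where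
  idx i := (θ.idx i, θ'.idx i)
  idx_bar i := Prod.ext (θ.idx_bar _) (θ'.idx_bar _)
  subset i := Set.subset_inter (θ.subset i) (θ'.subset i)

/-- The map of disjoint unions of a refinement. -/
def Refinement.map {U V : RealCover X} (θ : U.Refinement V) (x : V.space) : U.space :=
  ⟨(θ.idx x.1.1, x.1.2), θ.subset _ x.2⟩

theorem Refinement.continuous_map {U V : RealCover X} (θ : U.Refinement V) : Continuous θ.map :=
  Continuous.subtype_mk (((continuous_of_discreteTopology (f := fun i : V.Idx => θ.idx i)).comp
    (by fun_prop)).prodMk (by fun_prop)) _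

theorem Refinement.map_conj {U V : RealCover X} (θ : U.Refinement V) (x : V.space) :
    θ.map (V.space.conj x) = U.space.conj (θ.map x) :=
  Subtype.ext (Prod.ext (θ.idx_bar _) rfl)

/-- Real locally split maps have Real sections after a refinement. -/
theorem exists_section (U : RealCover X) {Q : RealSpace.{u}} {q : Q → U.space}
    (hq : LocallySplit q) (hc : ∀ z, q (Q.conj z) = U.space.conj (q z)) :
    ∃ (V : RealCover X) (θ : U.Refinement V) (s : V.space → Q), Continuous s ∧
      (∀ y, s (V.space.conj y) = Q.conj (s y)) ∧ ∀ y, q (s y) = θ.map y := by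
  choose O hO hm s hs hqs using hq.2
  -- Only the part of the domain `O y` in the same sheet as `y` is kept, so that it can be viewed as
  -- an open subset of `X` inside one member of `U`.
  let M : U.space → Set X := fun y => {x | ∃ h : x ∈ U.U y.1.1, (⟨(y.1.1, x), h⟩ : U.space) ∈ O y}
  have hM : ∀ y, IsOpen (M y) := by
    intro y
    have := U.isOpenMap_base _ ((hO y).inter ((isOpen_discrete {y.1.1}).preimage
      (by fun_prop : Continuous fun z : U.space => z.1.1)))
    convert this using 1
    ext x
    constructor
    · rintro ⟨h, h'⟩
      exact ⟨_, ⟨h', rfl⟩, rfl⟩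
    · rintro ⟨⟨⟨i, x⟩, h⟩, ⟨h', rfl⟩, rfl⟩
      exact ⟨h, h'⟩
  have cc : ∀ A : Set X, X.conj '' (X.conj '' A) = A := fun A => by
    rw [← Set.image_comp, (funext X.conj_conj : X.conj ∘ X.conj = _root_.id), Set.image_id]
  have ci : ∀ A : Set X, X.conj '' A = X.conj ⁻¹' A := fun A =>
    congrFun (Set.image_eq_preimage_of_inverse X.conj_conj X.conj_conj) A
  -- Each domain and its conjugate become separate members exchanged by the involution. No index is
  -- fixed by the involution, so a section may be chosen freely on one of the two and transported to
  -- the other; this also covers fixed points of `X`.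
  let V : RealCover X :=
    { Idx := U.space × Bool
      bar := fun i => (i.1, !i.2)
      bar_bar := fun i => Prod.ext rfl (Bool.not_not _)
      U := fun i => if i.2 then M i.1 else X.conj '' M i.1
      isOpen_U := by
        rintro ⟨y, _ | _⟩
        · change IsOpen (X.conj '' M y)
          rw [ci]
          exact (hM y).preimage X.continuous_conj
        · exact hM y
      exists_mem := fun x => by
        obtain ⟨i, hi⟩ := U.exists_mem x
        exact ⟨(⟨(i, x), hi⟩, true), hi, hm _⟩
      U_bar := by
        rintro ⟨y, _ | _⟩
        · exact (cc _).symm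
        · rfl }
  let θ : U.Refinement V :=
    { idx := fun i => if i.2 then i.1.1.1 else U.bar i.1.1.1
      idx_bar := by
        rintro ⟨y, _ | _⟩
        · exact (U.bar_bar _).symm
        · rfl
      subset := by
        rintro ⟨y, _ | _⟩ x
        · rintro ⟨x, ⟨h, -⟩, rfl⟩
          exact U.conj_mem h
        · rintro ⟨h, -⟩
          exact h }
  have h2 : ∀ y (x : X), x ∈ V.U (y, false) → X.conj x ∈ M y := by
    rintro y _ ⟨x, h, rfl⟩
    rwa [X.conj_conj]
  -- On the conjugate member the section is `conj ∘ s ∘ conj`.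
  let σ : ∀ i (x : X), x ∈ V.U i → Q
    | (y, true), x, h => s y ⟨⟨(y.1.1, x), h.1⟩, h.2⟩
    | (y, false), x, h => Q.conj (s y ⟨⟨(y.1.1, X.conj x), (h2 y x h).1⟩, (h2 y x h).2⟩)
  refine ⟨V, θ, fun z => σ z.1.1 z.1.2 z.2, V.continuous_of_slices ?_, ?_, ?_⟩
  · rintro ⟨y, _ | _⟩
    · exact Q.continuous_conj.comp ((hs y).comp (Continuous.subtype_mk (Continuous.subtype_mk
        (continuous_const.prodMk (X.continuous_conj.comp continuous_subtype_val)) _) _))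
    · exact (hs y).comp (Continuous.subtype_mk (Continuous.subtype_mk
        (continuous_const.prodMk continuous_subtype_val) _) _)
  · rintro ⟨⟨⟨y, _ | _⟩, x⟩, h⟩
    · exact (Q.conj_conj _).symm
    · refine congrArg (fun w => Q.conj (s y w)) ?_
      exact Subtype.ext (Subtype.ext (Prod.ext rfl (X.conj_conj x)))
  · rintro ⟨⟨⟨y, _ | _⟩, x⟩, h⟩
    · refine (hc _).trans ((congrArg _ (hqs y _)).trans ?_)
      exact Subtype.ext (Prod.ext rfl (X.conj_conj x))
    · exact hqs y _

/-- Real locally split maps to the base have Real sections over a cover. -/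
theorem exists_base_section {Q : RealSpace.{u}} {q : Q → X} (hq : LocallySplit q)
    (hc : ∀ z, q (Q.conj z) = X.conj (q z)) :
    ∃ (V : RealCover X) (s : V.space → Q), Continuous s ∧
      (∀ y, s (V.space.conj y) = Q.conj (s y)) ∧ ∀ y, q (s y) = y.1.2 := by
  -- This is the previous result for the cover with the single member `X`.
  obtain ⟨V, θ, s, hs, hs', h⟩ := (univ X).exists_section (Q := Q)
    (q := fun z => ⟨(PUnit.unit, q z), trivial⟩)
    (hq.lift (f := fun x : (univ X).space => x.1.2) (by fun_prop) (fun x => x.1.2) (by fun_prop)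
      fun x => Subtype.ext (Prod.ext rfl x.2.symm))
    fun z => Subtype.ext (Prod.ext rfl (hc z))
  exact ⟨V, s, hs, hs', fun y => congrArg (fun z : (univ X).space => z.1.2) (h y)⟩

end RealCover

/-! ### Twists over covers, up to refinement and coboundaries -/

section CoverTwists

variable {Y Y' : RealSpace.{u}} {Γ : RealGroupoid Y} {Γ' : RealGroupoid Y'}
  {S : RealAbelianGroup.{u}}

/-- Coboundaries are handled in the first factor only, by `tensor_map_left`. Hence the first factor
is changed, the factors are swapped, the other factor is changed, and after passing along `f` they
are swapped back. -/
theorem TwHom.exists_tensor {f : RealHom Γ' Γ} {c c' : Y' → ZMod 2} {T₁ T₂ : RealTwist Γ' S}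
    {U₁ U₂ : RealTwist Γ S} (h₁ : TwHom f c T₁ U₁) (h₂ : TwHom f c' T₂ U₂) :
    ∃ d, TwHom f d (tensor T₁ T₂) (tensor U₁ U₂) := by
  have a := tensor_map_left T₂ h₁.iso_pullback
  have b := (tensor_map_left (pullback f U₁) h₂.iso_pullback).comp_iso
    (tensor_comm (pullback f U₁) T₂)
  have d := tensor_map (twHom_pullback f U₂) (twHom_pullback f U₁)
  have e := (tensor_comm U₂ U₁).iso_comp d
  exact ⟨_, (e.comp (b.comp a)).congr (fun _ => rfl) fun _ => rfl⟩

theorem twHom_trivial (f : RealHom Γ' Γ) : TwHom f 0 (trivialTwist Γ' S) (trivialTwist Γ S) :=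
  TwHom.of_isTwHom (F := fun x => (x.1, f.arr x.2))
    ⟨continuous_fst.prodMk (f.continuous_arr.comp continuous_snd), fun _ => rfl, fun _ _ => rfl,
      fun _ => Prod.ext rfl (f.conj_arr _), fun _ _ _ _ => Prod.ext rfl (f.mul_arr _ _ _)⟩
    fun _ => rfl

variable {X : RealSpace.{u}} {G : RealGroupoid X}

/-- The classes of twists over the cover groupoids of `G`, up to refinement and up to coboundaries
of Real functions to `ℤ/2`. -/
def CoverTw {X : RealSpace.{u}} (G : RealGroupoid X) (S : RealAbelianGroup.{u}) : Type (u + 1) :=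
  Quot fun x y : Σ V : RealCover X, RealTwist (V.groupoid G) S =>
    ∃ (θ : x.1.Refinement y.1) (c : y.1.space → ZMod 2), TwHom (θ.hom G) c y.2 x.2

/-- The class of a twist over a cover groupoid. -/
def CoverTw.mk (V : RealCover X) (T : RealTwist (V.groupoid G) S) : CoverTw G S :=
  Quot.mk _ ⟨V, T⟩

theorem CoverTw.sound {U V : RealCover X} {θ : U.Refinement V} {c : V.space → ZMod 2}
    {T : RealTwist (U.groupoid G) S} {T' : RealTwist (V.groupoid G) S}
    (h : TwHom (θ.hom G) c T' T) : CoverTw.mk U T = CoverTw.mk V T' :=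
  Quot.sound ⟨θ, c, h⟩

theorem CoverTw.mk_pullback {U V : RealCover X} (θ : U.Refinement V)
    (T : RealTwist (U.groupoid G) S) : CoverTw.mk V (pullback (θ.hom G) T) = CoverTw.mk U T :=
  (CoverTw.sound (twHom_pullback _ _)).symm

theorem CoverTw.mk_eq_of_twHom_id {V : RealCover X} {c : V.space → ZMod 2}
    {T T' : RealTwist (V.groupoid G) S} (h : TwHom (RealHom.id _) c T' T) :
    CoverTw.mk V T = CoverTw.mk V T' :=
  CoverTw.sound (θ := RealCover.Refinement.id V) (h.congr (fun _ => rfl) fun _ => rfl)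

/-- The sum of classes is the tensor product on a common refinement. -/
noncomputable def CoverTw.add : CoverTw G S → CoverTw G S → CoverTw G S :=
  Quot.map₂ (fun x y => ⟨x.1.prod y.1,
      tensor (pullback ((RealCover.Refinement.fst x.1 y.1).hom G) x.2)
        (pullback ((RealCover.Refinement.snd x.1 y.1).hom G) y.2)⟩)
    (by
      rintro ⟨U, T⟩ ⟨V, T₁⟩ ⟨V', T₂⟩ ⟨θ, c, h⟩
      -- A refinement `V'` of `V` induces a refinement of common refinements, and the universal
      -- property of the pull-back produces the two component homomorphisms over it.
      let ρ := ((RealCover.Refinement.fst U V').lift (θ.comp (.snd U V')))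
      refine ⟨ρ, (TwHom.to_pullback (g := ρ.hom G) (twHom_pullback _ _) ?_).exists_tensor
        (TwHom.to_pullback (g := ρ.hom G) (h.comp (twHom_pullback _ _)) ?_)⟩
      · exact fun _ => rfl
      · exact fun _ => rfl)
    (by
      rintro ⟨V, T₁⟩ ⟨V', T₂⟩ ⟨U, T⟩ ⟨θ, c, h⟩
      let ρ := ((θ.comp (.fst V' U)).lift (RealCover.Refinement.snd V' U))
      refine ⟨ρ, (TwHom.to_pullback (g := ρ.hom G) (h.comp (twHom_pullback _ _)) ?_).exists_tensor
        (TwHom.to_pullback (g := ρ.hom G) (twHom_pullback _ _) ?_)⟩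
      · exact fun _ => rfl
      · exact fun _ => rfl)

/-- The diagonal index map exhibits `V` as a refinement of the product cover `V.prod V`, over which
the sum is defined. -/
theorem CoverTw.add_mk {V : RealCover X} (T T' : RealTwist (V.groupoid G) S) :
    CoverTw.add (CoverTw.mk V T) (CoverTw.mk V T') = CoverTw.mk V (tensor T T') := by
  let ρ := (RealCover.Refinement.id V).lift (RealCover.Refinement.id V)
  obtain ⟨c, h⟩ := (TwHom.to_pullback (g := ρ.hom G) (f := (RealCover.Refinement.fst V V).hom G)
      (h := RealHom.id _) (TwHom.refl T) fun _ => rfl).exists_tensor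
    (TwHom.to_pullback (g := ρ.hom G) (f := (RealCover.Refinement.snd V V).hom G)
      (h := RealHom.id _) (TwHom.refl T') fun _ => rfl)
  exact CoverTw.sound h

theorem CoverTw.exists_common (x y : CoverTw G S) : ∃ V T T', x = CoverTw.mk V T ∧
    y = CoverTw.mk V T' := by
  obtain ⟨⟨U, T⟩⟩ := x
  obtain ⟨⟨V, T'⟩⟩ := y
  exact ⟨U.prod V, _, _, (CoverTw.mk_pullback (.fst U V) T).symm,
    (CoverTw.mk_pullback (.snd U V) T').symm⟩

noncomputable instance : AddCommGroup (CoverTw G S) :=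
  AddCommGroup.ofLaws CoverTw.add (CoverTw.mk (RealCover.univ X) (trivialTwist _ S))
    (by
      intro x y z
      obtain ⟨V, T₁, T₂, rfl, rfl⟩ := CoverTw.exists_common x y
      obtain ⟨⟨V', T₃⟩⟩ := z
      rw [CoverTw.add_mk]
      change CoverTw.add _ (CoverTw.mk V' T₃) = CoverTw.add _ (CoverTw.add _ (CoverTw.mk V' T₃))
      let a := RealCover.Refinement.fst V V'
      let b := RealCover.Refinement.snd V V'
      rw [← CoverTw.mk_pullback a, ← CoverTw.mk_pullback a T₁, ← CoverTw.mk_pullback a T₂,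
        ← CoverTw.mk_pullback b T₃, CoverTw.add_mk, CoverTw.add_mk, CoverTw.add_mk]
      exact CoverTw.mk_eq_of_twHom_id (((tensor_map_id (pullback_tensor _ _ _)
        (TwHom.refl _)).symm.trans (tensor_assoc _ _ _)).symm))
    (by
      intro x y
      obtain ⟨V, T₁, T₂, rfl, rfl⟩ := CoverTw.exists_common x y
      rw [CoverTw.add_mk, CoverTw.add_mk]
      exact CoverTw.mk_eq_of_twHom_id (tensor_comm _ _))
    (by
      rintro ⟨⟨V, T⟩⟩
      have h : CoverTw.mk (RealCover.univ X) (trivialTwist _ S) =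
          CoverTw.mk V (trivialTwist (V.groupoid G) S) :=
        CoverTw.sound (twHom_trivial ((RealCover.Refinement.univ V).hom G))
      rw [h]
      exact (CoverTw.add_mk _ _).trans (CoverTw.mk_eq_of_twHom_id (tensor_trivial T)).symm)
    (by
      rintro ⟨⟨V, T⟩⟩
      have h : CoverTw.mk (RealCover.univ X) (trivialTwist _ S) =
          CoverTw.mk V (trivialTwist (V.groupoid G) S) :=
        CoverTw.sound (twHom_trivial ((RealCover.Refinement.univ V).hom G))
      exact ⟨CoverTw.mk V (negTwist T), (CoverTw.add_mk _ _).trans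
        ((CoverTw.mk_eq_of_twHom_id (tensor_neg T)).symm.trans h.symm)⟩)

theorem CoverTw.mk_add_mk {V : RealCover X} (T T' : RealTwist (V.groupoid G) S) :
    CoverTw.mk V T + CoverTw.mk V T' = CoverTw.mk V (tensor T T') :=
  CoverTw.add_mk T T'

end CoverTwists

/-! ### The colimit of abelian groups -/

section DirectLimitLemmas

open scoped DirectSum Classical

variable {ι : Type*} {R : ι → ι → Type*} {A : ι → Type*} [∀ i, AddCommGroup (A i)]
  {f : ∀ i j, R i j → A i →+ A j}

theorem AbDirectLimit.of_map {i j : ι} (r : R i j) (x : A i) :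
    AbDirectLimit.of A f j (f i j r x) = AbDirectLimit.of A f i x := by
  refine (QuotientAddGroup.eq.mpr ?_).symm
  rw [neg_add_eq_sub]
  exact AddSubgroup.subset_closure ⟨i, j, r, x, rfl⟩

/-- The universal property of the direct limit. -/
noncomputable def AbDirectLimit.lift {B : Type*} [AddCommGroup B] (φ : ∀ i, A i →+ B)
    (h : ∀ i j (r : R i j) x, φ j (f i j r x) = φ i x) : AbDirectLimit A f →+ B :=
  QuotientAddGroup.lift _ (DirectSum.toAddMonoid φ) (by
    rw [AddSubgroup.closure_le]
    rintro _ ⟨i, j, r, x, rfl⟩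
    change DirectSum.toAddMonoid φ _ = 0
    rw [map_sub, DirectSum.toAddMonoid_of, DirectSum.toAddMonoid_of, h, sub_self])

theorem AbDirectLimit.lift_of {B : Type*} [AddCommGroup B] (φ : ∀ i, A i →+ B)
    (h : ∀ i j (r : R i j) x, φ j (f i j r x) = φ i x) (i : ι) (x : A i) :
    AbDirectLimit.lift φ h (AbDirectLimit.of A f i x) = φ i x :=
  DirectSum.toAddMonoid_of φ i x

/-- Upper bounds of pairs of indices suffice to collect a finite sum over one index. Parallel
transition maps need not be coequalized within the system, since the colimit relations identify
their values. -/
theorem AbDirectLimit.exists_of [Nonempty ι] (hR : ∀ i j, ∃ k, Nonempty (R i k) ∧ Nonempty (R j k))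
    (z : AbDirectLimit A f) : ∃ i x, z = AbDirectLimit.of A f i x := by
  obtain ⟨w, rfl⟩ := QuotientAddGroup.mk_surjective z
  induction w using DirectSum.induction_on with
  | zero => exact ⟨Classical.arbitrary ι, 0, (map_zero (AbDirectLimit.of A f _)).symm⟩
  | of i x => exact ⟨i, x, rfl⟩
  | add a b ha hb =>
    obtain ⟨i, x, hx⟩ := ha
    obtain ⟨j, y, hy⟩ := hb
    obtain ⟨k, ⟨r⟩, ⟨r'⟩⟩ := hR i j
    refine ⟨k, f i k r x + f j k r' y, ?_⟩
    rw [map_add, AbDirectLimit.of_map, AbDirectLimit.of_map, ← hx, ← hy]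
    rfl

end DirectLimitLemmas

/-! ### Regrading, and trivialization by sections -/

section Regrade

variable {Y Y' : RealSpace.{u}} {Γ : RealGroupoid Y} {Γ' : RealGroupoid Y'}
  {S : RealAbelianGroup.{u}}

/-- The twist with grading changed by the coboundary of a Real function. -/
def RealTwist.regrade (T : RealTwist Γ S) (a : Y → ZMod 2) (ha : Continuous a)
    (hc : ∀ y, a (Y.conj y) = a y) : RealTwist Γ S :=
  { T with
    deg := fun g => T.deg g + a (Γ.rng g) + a (Γ.src g)
    continuous_deg := (T.continuous_deg.add (ha.comp Γ.continuous_rng)).add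
      (ha.comp Γ.continuous_src)
    deg_mul := fun g h e => by
      rw [T.deg_mul, Γ.rng_mul, Γ.src_mul, e]
      linear_combination -CharTwo.add_self_eq_zero (a (Γ.rng h))
    deg_conj := fun g => by rw [T.deg_conj, Γ.rng_conj, Γ.src_conj, hc, hc] }

theorem TwHom.regrade {f : RealHom Γ' Γ} {c : Y' → ZMod 2} {T' : RealTwist Γ' S}
    {T : RealTwist Γ S} (h : TwHom f c T' T) {a : Y → ZMod 2} (ha : Continuous a)
    (hc : ∀ y, a (Y.conj y) = a y) :
    TwHom f (fun y => c y + a (f.obj y)) T' (T.regrade a ha hc) := by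
  obtain ⟨F, hF⟩ := h.exists_hom
  refine ⟨⟨F, hF.continuous, hF.proj, hF.act, hF.conj, hF.mul⟩,
    h.continuous.add (ha.comp f.continuous_obj), fun y => by rw [h.conj, f.conj_obj, hc], fun g => ?_⟩
  change _ = T.deg (f.arr g) + a (Γ.rng (f.arr g)) + a (Γ.src (f.arr g)) + _ + _
  rw [h.deg, f.rng_arr, f.src_arr]
  linear_combination -CharTwo.add_self_eq_zero (a (f.obj (Γ'.rng g))) -
    CharTwo.add_self_eq_zero (a (f.obj (Γ'.src g)))

/-- A section of the line bundle trivializes its twist. -/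
theorem twHom_trivial_of_section {f : RealHom Γ' Γ} {T : RealTwist Γ S} (hd : ∀ γ, T.deg γ = 0)
    {L : RealSpace.{u}} {J : L → Y} {a : S → L → L}
    (φ : Quot (lineRel Γ J a) ≃ₜ T.grpd.Arr)
    (hp : ∀ x, T.proj.arr (φ (Quot.mk _ x)) = x.1.2.1)
    (hc : ∀ x y, y.1 = (L.conj x.1.1, Γ.Arr.conj x.1.2.1, L.conj x.1.2.2) →
      φ (Quot.mk _ y) = T.grpd.Arr.conj (φ (Quot.mk _ x)))
    (hm : ∀ x y z e, x.1.2.2 = y.1.1 → z.1 = (x.1.1, Γ.mul x.1.2.1 y.1.2.1 e, y.1.2.2) →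
      ∀ e', T.grpd.mul (φ (Quot.mk _ x)) (φ (Quot.mk _ y)) e' = φ (Quot.mk _ z))
    (s : Y' → L) (hs : Continuous s) (hs' : ∀ y, s (Y'.conj y) = L.conj (s y))
    (hJ : ∀ y, J (s y) = f.obj y) : TwHom f 0 (trivialTwist Γ' S) T := by
  -- An arrow `g` is sent to the class of `s(r g)` and `s(s g)`. The middle terms cancel in
  -- products, so this is a multiplicative lift of `f`.
  let m : Γ'.Arr → LinePairs Γ J := fun g => ⟨(s (Γ'.rng g), f.arr g, s (Γ'.src g)),
    (hJ _).trans (f.rng_arr g).symm, (f.src_arr g).trans (hJ _).symm⟩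
  have hmc : Continuous m := Continuous.subtype_mk ((hs.comp Γ'.continuous_rng).prodMk
    (f.continuous_arr.prodMk (hs.comp Γ'.continuous_src))) _
  refine TwHom.of_isTwHom (F := fun x => T.act x.1 (φ (Quot.mk _ (m x.2))))
    ⟨T.principal.continuous_act' continuous_fst (φ.continuous.comp (continuous_quot_mk.comp
      (hmc.comp continuous_snd))), fun t => ?_, fun c t => ?_, fun t => ?_, fun t t' e e' => ?_⟩
    fun g => (hd _).symm
  · exact (T.principal.proj_act _ _).trans (hp _)
  · exact T.principal.mul_act c t.1 _
  · refine Eq.trans (congrArg (T.act (S.conj t.1)) (hc (m t.2) _ ?_)) (T.principal.conj_act _ _)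
    exact Prod.ext ((congrArg s (Γ'.rng_conj _)).trans (hs' _)) (Prod.ext (f.conj_arr _)
      ((congrArg s (Γ'.src_conj _)).trans (hs' _)))
  · have e1 : Γ'.src t.2 = Γ'.rng t'.2 := by
      rw [← (trivialTwist Γ' S).src_proj, ← (trivialTwist Γ' S).rng_proj] at e
      exact e
    have e2 : Γ.src (m t.2).1.2.1 = Γ.rng (m t'.2).1.2.1 := by
      change Γ.src (f.arr _) = Γ.rng (f.arr _)
      rw [f.src_arr, f.rng_arr, e1]
    have e3 : T.grpd.src (φ (Quot.mk _ (m t.2))) = T.grpd.rng (φ (Quot.mk _ (m t'.2))) := by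
      rw [← T.src_proj, ← T.rng_proj, hp, hp, e2]
    refine Eq.trans ?_ (T.act_mul_act t.1 t'.1 _ _ e3 e').symm
    refine congrArg (T.act (t.1 * t'.1)) (hm (m t.2) (m t'.2) (m (Γ'.mul t.2 t'.2 e1)) e2
      (congrArg s e1) ?_ e3).symm
    exact Prod.ext (congrArg s (Γ'.rng_mul _ _ _)) (Prod.ext (f.mul_arr _ _ _)
      (congrArg s (Γ'.src_mul _ _ _)))

end Regrade

/-! ### Comparison of the colimit with twists over covers -/

section Limit

variable {X : RealSpace.{u}} {G : RealGroupoid X} {S : RealAbelianGroup.{u}}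

theorem CoverTw.mk_trivial (V : RealCover X) : CoverTw.mk V (trivialTwist (V.groupoid G) S) = 0 :=
  (CoverTw.sound (twHom_trivial ((RealCover.Refinement.univ V).hom G))).symm

/-- The line bundle acquires a Real section after refinement, and the section trivializes its twist.
This is why the quotient by line twists need not be imposed in `CoverTw`. -/
theorem CoverTw.mk_line {U : RealCover X} {T : RealTwist (U.groupoid G) S} (hT : IsLineTwist T) :
    CoverTw.mk U T = 0 := by
  obtain ⟨hd, L, J, a, hL, φ, hp, -, hc, hm⟩ := hT
  obtain ⟨V, θ, s, hs, hs', hJ⟩ := U.exists_section hL.locallySplit hL.conj_proj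
  rw [← CoverTw.mk_trivial (G := G) V]
  exact CoverTw.sound (θ := θ) (twHom_trivial_of_section hd φ hp hc hm s hs hs' hJ)

variable (G S) in
/-- The class of a twist over a fixed cover groupoid depends only on its class in `extR`. -/
noncomputable def ExtTw.toCoverTw (U : RealCover X) : ExtTw (U.groupoid G) S →+ CoverTw G S :=
  AddMonoidHom.mk' (Quot.lift (CoverTw.mk U) (by
      rintro T T' ⟨L, hL, h⟩
      rw [CoverTw.mk_eq_of_twHom_id (twHom_of_isTensor h), ← CoverTw.mk_add_mk,
        CoverTw.mk_line hL, add_zero]))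
    (by rintro ⟨T⟩ ⟨T'⟩; exact (CoverTw.mk_add_mk T T').symm)

variable (G S) in
/-- The direct limit of the groups `extR(G[U], S)`. -/
abbrev CoverLimit : Type (u + 1) :=
  AbDirectLimit (fun U : RealCover X => ExtTw (U.groupoid G) S)
    fun _ _ (θ : RealCover.Refinement _ _) => ExtTw.pullback (θ.hom G)

/-- The class of a twist in the direct limit. -/
noncomputable def CoverLimit.mk (U : RealCover X) (T : RealTwist (U.groupoid G) S) :
    CoverLimit G S :=
  AbDirectLimit.of (fun U : RealCover X => ExtTw (U.groupoid G) S) _ U T.cls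

theorem CoverLimit.sound {U V : RealCover X} {θ : U.Refinement V} {T : RealTwist (U.groupoid G) S}
    {T' : RealTwist (V.groupoid G) S} (h : TwHom (θ.hom G) 0 T' T) :
    CoverLimit.mk U T = CoverLimit.mk V T' := by
  refine (AbDirectLimit.of_map (A := fun U : RealCover X => ExtTw (U.groupoid G) S)
    (f := fun _ _ (θ : RealCover.Refinement _ _) => ExtTw.pullback (θ.hom G)) θ T.cls).symm.trans ?_
  exact congrArg (AbDirectLimit.of (fun U : RealCover X => ExtTw (U.groupoid G) S) _ V)
    h.iso_pullback.symm.cls_eq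

/-- The double of a cover. -/
def RealCover.double (V : RealCover X) : RealCover X where
  Idx := V.Idx × ZMod 2
  bar := fun i => (V.bar i.1, i.2)
  bar_bar i := Prod.ext (V.bar_bar _) rfl
  U i := V.U i.1
  isOpen_U i := V.isOpen_U _
  exists_mem x := (V.exists_mem x).imp' (fun i => (i, 0)) fun _ h => h
  U_bar i := V.U_bar _

/-- The cover by the level sets of a function to `ℤ/2`. -/
def RealCover.levels (V : RealCover X) (c : V.space → ZMod 2) (hc : Continuous c)
    (hc' : ∀ y, c (V.space.conj y) = c y) : RealCover X where
  Idx := V.Idx × ZMod 2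
  bar := fun i => (V.bar i.1, i.2)
  bar_bar i := Prod.ext (V.bar_bar _) rfl
  U i := {x | ∃ h : x ∈ V.U i.1, c ⟨(i.1, x), h⟩ = i.2}
  isOpen_U i := by
    have := V.isOpenMap_base _ (((isOpen_discrete {i.2}).preimage hc).inter
      ((isOpen_discrete {i.1}).preimage (by fun_prop : Continuous fun z : V.space => z.1.1)))
    convert this using 1
    ext x
    constructor
    · rintro ⟨h, h'⟩
      exact ⟨_, ⟨h', rfl⟩, rfl⟩
    · rintro ⟨⟨⟨j, x⟩, h⟩, ⟨h', e⟩, rfl⟩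
      obtain rfl : j = i.1 := e
      exact ⟨h, h'⟩
  exists_mem x := by
    obtain ⟨i, hi⟩ := V.exists_mem x
    exact ⟨(i, c ⟨(i, x), hi⟩), hi, rfl⟩
  U_bar i := by
    ext x
    constructor
    · rintro ⟨h, h'⟩
      have h2 : X.conj x ∈ V.U i.1 := by simpa only [V.bar_bar] using V.conj_mem h
      refine ⟨X.conj x, ⟨h2, ?_⟩, X.conj_conj x⟩
      rw [← h', ← hc']
      exact congrArg c (Subtype.ext (Prod.ext rfl (X.conj_conj x)))
    · rintro ⟨x, ⟨h, h'⟩, rfl⟩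
      exact ⟨V.conj_mem h, (hc' ⟨(i.1, x), h⟩).trans h'⟩

/-- Coboundary changes of the grading are absorbed by the colimit because it runs over all
refinements, several between the same covers included. A single twist `D` over the doubled cover
restricts to both gradings along two refinements of that cover. -/
theorem CoverLimit.mk_eq_of_twHom_id {V : RealCover X} {c : V.space → ZMod 2}
    {T T' : RealTwist (V.groupoid G) S} (h : TwHom (RealHom.id _) c T' T) :
    CoverLimit.mk V T = CoverLimit.mk V T' := by
  let p : V.Refinement V.double := ⟨fun i => i.1, fun _ => rfl, fun _ => subset_rfl⟩
  -- The label of the sheet. `D` is the pull-back of `T` regraded by its coboundary, which vanishes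
  -- between sheets with equal labels.
  let a : V.double.space → ZMod 2 := fun z => z.1.1.2
  have ha : Continuous a :=
    (continuous_of_discreteTopology (f := fun i : V.double.Idx => i.2)).comp (by fun_prop)
  let D : RealTwist (V.double.groupoid G) S := (pullback (p.hom G) T).regrade a ha fun _ => rfl
  let W := V.levels c h.continuous h.conj
  let q : V.Refinement W := ⟨fun i => i.1, fun _ => rfl, fun _ _ hx => hx.1⟩
  -- On the level sets of `c` the label equals the value of `c`, so this refinement turns the
  -- coboundary of the label into that of `c`, the grading change from `T` to `T'`. The refinement
  -- `z` below stays in the sheet with label `0` and returns `T`.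
  let ρ : V.double.Refinement W := ⟨fun i => i, fun _ => rfl, fun _ _ hx => hx.1⟩
  let z : V.double.Refinement V := ⟨fun i => (i, 0), fun _ => rfl, fun _ => subset_rfl⟩
  have h₁ : TwHom (z.hom G) 0 T D :=
    ((TwHom.to_pullback (f := p.hom G) (g := z.hom G) (TwHom.refl T) fun _ => rfl).regrade ha
      fun _ => rfl).congr (fun _ => rfl) fun y => add_zero 0
  have h₂ : TwHom (ρ.hom G) 0 (pullback (q.hom G) T') D := by
    refine ((TwHom.to_pullback (f := p.hom G) (g := ρ.hom G) (h.comp (twHom_pullback (q.hom G) T'))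
      fun _ => rfl).regrade ha fun _ => rfl).congr (fun _ => rfl) ?_
    rintro ⟨⟨i, x⟩, hx, hx'⟩
    change c ⟨(i.1, x), hx⟩ + 0 + i.2 = 0
    rw [hx', add_zero, CharTwo.add_self_eq_zero]
  exact (CoverLimit.sound h₁).symm.trans ((CoverLimit.sound h₂).trans
    (CoverLimit.sound (twHom_pullback (q.hom G) T')).symm)

variable (G S) in
/-- The homomorphism from the direct limit that is the class map on each of its groups. -/
noncomputable def CoverLimit.toCoverTw : CoverLimit G S →+ CoverTw G S :=
  AbDirectLimit.lift (ExtTw.toCoverTw G S) (fun _ _ θ x =>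
    Quot.inductionOn x fun T => CoverTw.mk_pullback θ T)

theorem CoverLimit.toCoverTw_mk (U : RealCover X) (T : RealTwist (U.groupoid G) S) :
    CoverLimit.toCoverTw G S (CoverLimit.mk U T) = CoverTw.mk U T :=
  AbDirectLimit.lift_of (ExtTw.toCoverTw G S) _ U T.cls

theorem CoverLimit.exists_mk (z : CoverLimit G S) : ∃ U T, z = CoverLimit.mk U T := by
  have : Nonempty (RealCover X) := ⟨RealCover.univ X⟩
  obtain ⟨U, x, rfl⟩ := AbDirectLimit.exists_of
    (fun U V => ⟨U.prod V, ⟨.fst U V⟩, ⟨.snd U V⟩⟩) z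
  exact Quot.inductionOn x fun T => ⟨U, T, rfl⟩

variable (G S) in
/-- The direct limit of the groups of twists over cover groupoids. -/
noncomputable def coverLimitEquiv : CoverLimit G S ≃+ CoverTw G S where
  toFun := CoverLimit.toCoverTw G S
  invFun := Quot.lift (fun x => CoverLimit.mk x.1 x.2) (by
    rintro ⟨U, T⟩ ⟨V, T'⟩ ⟨θ, c, h⟩
    -- The relation is split into a pull-back along `θ` and a coboundary change over a fixed cover.
    exact (CoverLimit.sound (twHom_pullback (θ.hom G) T)).trans
      (CoverLimit.mk_eq_of_twHom_id h.iso_pullback))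
  left_inv z := by
    obtain ⟨U, T, rfl⟩ := CoverLimit.exists_mk z
    rw [CoverLimit.toCoverTw_mk]
    rfl
  right_inv z := by
    obtain ⟨⟨U, T⟩⟩ := z
    exact CoverLimit.toCoverTw_mk U T
  map_add' := map_add _

theorem coverLimitEquiv_symm_mk (U : RealCover X) (T : RealTwist (U.groupoid G) S) :
    (coverLimitEquiv G S).symm (CoverTw.mk U T) = CoverLimit.mk U T := rfl

end Limit

/-! ### Bibundles, principality, graphs and composites -/

namespace RealBibundle

section Actions

variable {Y X : RealSpace.{u}} {Γ : RealGroupoid Y} {G : RealGroupoid X} (P : RealBibundle Γ G)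

theorem lact_congr {γ γ' : Γ.Arr} {z z' : P.Total} (hγ : γ = γ') (hz : z = z') (e e') :
    P.lact γ z e = P.lact γ' z' e' := by
  subst hγ hz; rfl

theorem ract_congr {z z' : P.Total} {g g' : G.Arr} (hz : z = z') (hg : g = g') (e e') :
    P.ract z g e = P.ract z' g' e' := by
  subst hg hz; rfl

theorem continuous_lact' {A : Type*} [TopologicalSpace A] {f : A → Γ.Arr} {g : A → P.Total}
    (hf : Continuous f) (hg : Continuous g) (e : ∀ x, Γ.src (f x) = P.left (g x)) :
    Continuous fun x => P.lact (f x) (g x) (e x) :=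
  P.continuous_lact.comp (g := fun p : {p : Γ.Arr × P.Total // Γ.src p.1 = P.left p.2} =>
    P.lact p.1.1 p.1.2 p.2) (Continuous.subtype_mk (hf.prodMk hg) e)

theorem continuous_ract' {A : Type*} [TopologicalSpace A] {f : A → P.Total} {g : A → G.Arr}
    (hf : Continuous f) (hg : Continuous g) (e : ∀ x, P.right (f x) = G.rng (g x)) :
    Continuous fun x => P.ract (f x) (g x) (e x) :=
  P.continuous_ract.comp (g := fun p : {p : P.Total × G.Arr // P.right p.1 = G.rng p.2} =>
    P.ract p.1.1 p.1.2 p.2) (Continuous.subtype_mk (hf.prodMk hg) e)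

theorem unit_lact' {γ : Γ.Arr} {z : P.Total} (e) (h : γ = Γ.unit (P.left z)) :
    P.lact γ z e = z := by
  subst h; exact P.unit_lact z

theorem ract_unit' {g : G.Arr} {z : P.Total} (e) (h : g = G.unit (P.right z)) :
    P.ract z g e = z := by
  subst h; exact P.ract_unit z

theorem inv_lact_lact (γ : Γ.Arr) (z : P.Total) (e e') :
    P.lact (Γ.inv γ) (P.lact γ z e) e' = z := by
  rw [← P.mul_lact _ _ _ (Γ.src_inv γ) e]
  exact P.unit_lact' _ (by rw [Γ.inv_mul, e])

theorem lact_inv_lact (γ : Γ.Arr) (z : P.Total) (e e') :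
    P.lact γ (P.lact (Γ.inv γ) z e) e' = z := by
  rw [← P.mul_lact _ _ _ (Γ.rng_inv γ).symm e]
  exact P.unit_lact' _ (by rw [Γ.mul_inv, ← e, Γ.src_inv])

theorem ract_ract_inv (z : P.Total) (g : G.Arr) (e e') :
    P.ract (P.ract z g e) (G.inv g) e' = z := by
  rw [← P.ract_mul _ _ _ e (G.rng_inv g).symm]
  exact P.ract_unit' _ (by rw [G.mul_inv, e])

theorem ract_inv_ract (z : P.Total) (g : G.Arr) (e e') :
    P.ract (P.ract z (G.inv g) e) g e' = z := by
  rw [← P.ract_mul _ _ _ e (G.src_inv g)]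
  exact P.ract_unit' _ (by rw [G.inv_mul, e, G.rng_inv])

end Actions

section Principal

variable {Y X : RealSpace.{u}} {Γ : RealGroupoid Y} {G : RealGroupoid X} {P : RealBibundle Γ G}

/-- The difference `γ` of two points `q = γ p` in the same fibre of a left principal bundle. -/
noncomputable def IsLeftPrincipal.div (h : P.IsLeftPrincipal) (q p : P.Total)
    (e : P.right q = P.right p) : Γ.Arr :=
  (h.2.homeomorph.symm ⟨(q, p), e⟩).1.1

theorem IsLeftPrincipal.exists_div (h : P.IsLeftPrincipal) (q p : P.Total)
    (e : P.right q = P.right p) : ∃ e', P.lact (h.div q p e) p e' = q := by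
  have h1 := h.2.homeomorph.apply_symm_apply ⟨(q, p), e⟩
  have h2 : (h.2.homeomorph.symm ⟨(q, p), e⟩).1.2 = p := congrArg (fun w => w.1.2) h1
  have h3 : P.lact (h.2.homeomorph.symm ⟨(q, p), e⟩).1.1 (h.2.homeomorph.symm ⟨(q, p), e⟩).1.2
    (h.2.homeomorph.symm ⟨(q, p), e⟩).2 = q := congrArg (fun w => w.1.1) h1
  exact ⟨(h.2.homeomorph.symm ⟨(q, p), e⟩).2.trans (congrArg P.left h2),
    (P.lact_congr rfl h2.symm _ _).trans h3⟩

theorem IsLeftPrincipal.src_div (h : P.IsLeftPrincipal) (q p e) :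
    Γ.src (h.div q p e) = P.left p := (h.exists_div q p e).1

theorem IsLeftPrincipal.lact_div (h : P.IsLeftPrincipal) (q p e e') :
    P.lact (h.div q p e) p e' = q := (h.exists_div q p e).2

theorem IsLeftPrincipal.rng_div (h : P.IsLeftPrincipal) (q p e) :
    Γ.rng (h.div q p e) = P.left q := by
  have := P.left_lact _ _ (h.src_div q p e)
  rwa [h.lact_div, eq_comm] at this

theorem IsLeftPrincipal.free (h : P.IsLeftPrincipal) {γ γ' : Γ.Arr} {p : P.Total} {e e'}
    (H : P.lact γ p e = P.lact γ' p e') : γ = γ' :=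
  congrArg (fun w => w.1.1) (h.2.injective (a₁ := ⟨(γ, p), e⟩) (a₂ := ⟨(γ', p), e'⟩)
    (Subtype.ext (Prod.ext H rfl)))

theorem IsLeftPrincipal.div_eq (h : P.IsLeftPrincipal) {q p e} {γ : Γ.Arr} {e'}
    (H : P.lact γ p e' = q) : h.div q p e = γ :=
  h.free ((h.lact_div q p e (h.src_div q p e)).trans H.symm)

theorem IsLeftPrincipal.continuous_div (h : P.IsLeftPrincipal) {A : Type*} [TopologicalSpace A]
    {f g : A → P.Total} (hf : Continuous f) (hg : Continuous g)
    (e : ∀ x, P.right (f x) = P.right (g x)) : Continuous fun x => h.div (f x) (g x) (e x) :=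
  (continuous_fst.comp continuous_subtype_val).comp (h.2.homeomorph.symm.continuous.comp
    (Continuous.subtype_mk (hf.prodMk hg) e))

theorem IsLeftPrincipal.div_conj (h : P.IsLeftPrincipal) (q p e e') :
    h.div (P.Total.conj q) (P.Total.conj p) e' = Γ.Arr.conj (h.div q p e) :=
  h.div_eq (by rw [P.lact_conj _ _ (h.src_div q p e), h.lact_div])

theorem isLeftPrincipal_of_div (hs : LocallySplit P.right)
    (d : {q : P.Total × P.Total // P.right q.1 = P.right q.2} → Γ.Arr) (hd : Continuous d)
    (hsrc : ∀ q, Γ.src (d q) = P.left q.1.2) (hact : ∀ q, P.lact (d q) q.1.2 (hsrc q) = q.1.1)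
    (huniq : ∀ γ p e e', d ⟨(P.lact γ p e, p), e'⟩ = γ) : P.IsLeftPrincipal := by
  refine ⟨hs, ?_⟩
  rw [isHomeomorph_iff_exists_inverse]
  refine ⟨Continuous.subtype_mk (P.continuous_lact.prodMk
    (continuous_snd.comp continuous_subtype_val)) _, fun q => ⟨(d q, q.1.2), hsrc q⟩, ?_, ?_,
    Continuous.subtype_mk (hd.prodMk (continuous_snd.comp continuous_subtype_val)) _⟩
  · exact fun q => Subtype.ext (Prod.ext (huniq _ _ _ _) rfl)
  · exact fun q => Subtype.ext (Prod.ext (hact _) rfl)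

/-- The difference `g` of two points `q = p g` in the same fibre of a right principal bundle. -/
noncomputable def IsRightPrincipal.div (h : P.IsRightPrincipal) (p q : P.Total)
    (e : P.left p = P.left q) : G.Arr :=
  (h.2.homeomorph.symm ⟨(p, q), e⟩).1.2

theorem IsRightPrincipal.exists_div (h : P.IsRightPrincipal) (p q : P.Total)
    (e : P.left p = P.left q) : ∃ e', P.ract p (h.div p q e) e' = q := by
  have h1 := h.2.homeomorph.apply_symm_apply ⟨(p, q), e⟩
  have h2 : (h.2.homeomorph.symm ⟨(p, q), e⟩).1.1 = p := congrArg (fun w => w.1.1) h1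
  have h3 : P.ract (h.2.homeomorph.symm ⟨(p, q), e⟩).1.1 (h.2.homeomorph.symm ⟨(p, q), e⟩).1.2
    (h.2.homeomorph.symm ⟨(p, q), e⟩).2 = q := congrArg (fun w => w.1.2) h1
  exact ⟨(congrArg P.right h2).symm.trans (h.2.homeomorph.symm ⟨(p, q), e⟩).2,
    (P.ract_congr h2.symm rfl _ _).trans h3⟩

theorem IsRightPrincipal.rng_div (h : P.IsRightPrincipal) (p q e) :
    P.right p = G.rng (h.div p q e) := (h.exists_div p q e).1

theorem IsRightPrincipal.ract_div (h : P.IsRightPrincipal) (p q e e') :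
    P.ract p (h.div p q e) e' = q := (h.exists_div p q e).2

theorem IsRightPrincipal.src_div (h : P.IsRightPrincipal) (p q e) :
    G.src (h.div p q e) = P.right q := by
  have := P.right_ract _ _ (h.rng_div p q e)
  rwa [h.ract_div, eq_comm] at this

theorem IsRightPrincipal.free (h : P.IsRightPrincipal) {g g' : G.Arr} {p : P.Total} {e e'}
    (H : P.ract p g e = P.ract p g' e') : g = g' :=
  congrArg (fun w => w.1.2) (h.2.injective (a₁ := ⟨(p, g), e⟩) (a₂ := ⟨(p, g'), e'⟩)
    (Subtype.ext (Prod.ext rfl H)))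

theorem IsRightPrincipal.div_eq (h : P.IsRightPrincipal) {p q e} {g : G.Arr} {e'}
    (H : P.ract p g e' = q) : h.div p q e = g :=
  h.free ((h.ract_div p q e (h.rng_div p q e)).trans H.symm)

theorem IsRightPrincipal.continuous_div (h : P.IsRightPrincipal) {A : Type*} [TopologicalSpace A]
    {f g : A → P.Total} (hf : Continuous f) (hg : Continuous g)
    (e : ∀ x, P.left (f x) = P.left (g x)) : Continuous fun x => h.div (f x) (g x) (e x) :=
  (continuous_snd.comp continuous_subtype_val).comp (h.2.homeomorph.symm.continuous.comp
    (Continuous.subtype_mk (hf.prodMk hg) e))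

theorem IsRightPrincipal.div_conj (h : P.IsRightPrincipal) (p q e e') :
    h.div (P.Total.conj p) (P.Total.conj q) e' = G.Arr.conj (h.div p q e) :=
  h.div_eq (by rw [P.ract_conj _ _ (h.rng_div p q e), h.ract_div])

theorem isRightPrincipal_of_div (hs : LocallySplit P.left)
    (d : {q : P.Total × P.Total // P.left q.1 = P.left q.2} → G.Arr) (hd : Continuous d)
    (hrng : ∀ q, P.right q.1.1 = G.rng (d q)) (hact : ∀ q, P.ract q.1.1 (d q) (hrng q) = q.1.2)
    (huniq : ∀ p g e e', d ⟨(p, P.ract p g e), e'⟩ = g) : P.IsRightPrincipal := by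
  refine ⟨hs, ?_⟩
  rw [isHomeomorph_iff_exists_inverse]
  refine ⟨Continuous.subtype_mk ((continuous_fst.comp continuous_subtype_val).prodMk
    P.continuous_ract) _, fun q => ⟨(q.1.1, d q), hrng q⟩, ?_, ?_,
    Continuous.subtype_mk ((continuous_fst.comp continuous_subtype_val).prodMk hd) _⟩
  · exact fun q => Subtype.ext (Prod.ext rfl (huniq _ _ _ _))
  · exact fun q => Subtype.ext (Prod.ext rfl (hact _))

end Principal

end RealBibundle

/-- A locally split map whose fibres are orbits of a groupoid action is open. -/
theorem RealGroupoid.isOpenMap_of_orbits {Y : RealSpace.{u}} (Γ : RealGroupoid Y) {Z X : Type u}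
    [TopologicalSpace Z] [TopologicalSpace X] {left : Z → Y} (hleft : Continuous left)
    (act : ∀ (γ : Γ.Arr) (z : Z), Γ.src γ = left z → Z)
    (hact : Continuous fun p : {p : Γ.Arr × Z // Γ.src p.1 = left p.2} => act p.1.1 p.1.2 p.2)
    {q : Z → X} (hq : LocallySplit q) (hqa : ∀ γ z e, q (act γ z e) = q z)
    (ht : ∀ z z', q z = q z' → ∃ γ e, act γ z e = z') : IsOpenMap q := by
  intro O hO
  rw [isOpen_iff_mem_nhds]
  rintro _ ⟨z, hz, rfl⟩
  obtain ⟨V, hV, hy, s, hs, hqs⟩ := hq.2 (q z)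
  obtain ⟨γ, e, hγ⟩ := ht (s ⟨q z, hy⟩) z (hqs ⟨q z, hy⟩)
  have hc : Continuous fun x : {x : Γ.Arr × V // Γ.src x.1 = left (s x.2)} =>
      act x.1.1 (s x.1.2) x.2 :=
    hact.comp (g := fun p : {p : Γ.Arr × Z // Γ.src p.1 = left p.2} => act p.1.1 p.1.2 p.2)
      (Continuous.subtype_mk ((continuous_fst.comp continuous_subtype_val).prodMk
        (hs.comp (continuous_snd.comp continuous_subtype_val))) fun x => x.2)
  -- Pairs `(γ', v)` with `γ' s(v)` in `O` form an open set, and its projection to `V` is open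
  -- because the source map of `Γ` is open.
  have ho := hV.isOpenMap_subtype_val _
    (Γ.isOpenMap_src.snd_pullback (hleft.comp hs) _ (hO.preimage hc))
  refine Filter.mem_of_superset (ho.mem_nhds ⟨⟨q z, hy⟩, ⟨⟨(γ, ⟨q z, hy⟩), e⟩, ?_, rfl⟩, rfl⟩) ?_
  · change act γ _ e ∈ O
    rwa [hγ]
  · rintro _ ⟨_, ⟨⟨⟨γ', v⟩, e'⟩, hv, rfl⟩, rfl⟩
    exact ⟨_, hv, (hqa _ _ _).trans (hqs _)⟩

namespace RealBibundle

section Constructions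

variable {Y Y' X : RealSpace.{u}} {Γ : RealGroupoid Y} {Γ' : RealGroupoid Y'} {G : RealGroupoid X}

variable (G) in
/-- A groupoid as a bibundle over itself. -/
abbrev unitBibundle : RealBibundle G G where
  Total := G.Arr
  left := G.rng
  right := G.src
  lact g z e := G.mul g z e
  ract z g e := G.mul z g e
  continuous_left := G.continuous_rng
  continuous_right := G.continuous_src
  isOpenMap_left := G.isOpenMap_rng
  isOpenMap_right := G.isOpenMap_src
  continuous_lact := G.continuous_mul
  continuous_ract := G.continuous_mul
  left_lact := G.rng_mul
  right_lact := G.src_mul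
  left_ract := G.rng_mul
  right_ract := G.src_mul
  unit_lact := G.unit_mul
  ract_unit := G.mul_unit
  mul_lact γ γ' z e e' := G.mul_assoc γ γ' z e e'
  ract_mul z g g' e e' := (G.mul_assoc z g g' e e').symm
  lact_ract γ z g e e' := (G.mul_assoc γ z g e e').symm
  left_conj := G.rng_conj
  right_conj := G.src_conj
  lact_conj := G.mul_conj
  ract_conj := G.mul_conj

theorem isMorita_unitBibundle : (unitBibundle G).IsMorita := by
  refine ⟨isRightPrincipal_of_div
    (locallySplit_of_section G.unit G.continuous_unit G.rng_unit)
    (fun q => G.mul (G.inv q.1.1) q.1.2 ((G.src_inv _).trans q.2))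
    (G.continuous_mul' (G.continuous_inv.comp (by fun_prop)) (by fun_prop) _)
    (fun q => ((G.rng_mul _ _ _).trans (G.rng_inv _)).symm)
    (fun q => G.mul_inv_cancel_left q.2) fun p g e e' => G.inv_mul_cancel_left _,
    isLeftPrincipal_of_div
    (locallySplit_of_section G.unit G.continuous_unit G.src_unit)
    (fun q => G.mul q.1.1 (G.inv q.1.2) (q.2.trans (G.rng_inv _).symm))
    (G.continuous_mul' (by fun_prop) (G.continuous_inv.comp (by fun_prop)) _)
    (fun q => (G.src_mul _ _ _).trans (G.src_inv _))
    (fun q => G.inv_mul_cancel_right q.2) fun γ p e e' => G.mul_inv_cancel_right _⟩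

/-- The restriction of a bibundle along a homomorphism to its left groupoid. -/
abbrev restrict (σ : RealHom Γ' Γ) (P : RealBibundle Γ G)
    (ho : IsOpenMap fun z : {z : Y' × P.Total // σ.obj z.1 = P.left z.2} => P.right z.1.2) :
    RealBibundle Γ' G where
  Total := RealSpace.fprod σ.obj P.left σ.continuous_obj P.continuous_left σ.conj_obj P.left_conj
  left z := z.1.1
  right z := P.right z.1.2
  lact γ z e := ⟨(Γ'.rng γ, P.lact (σ.arr γ) z.1.2 (by rw [σ.src_arr, e, z.2])), by
    rw [P.left_lact, σ.rng_arr]⟩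
  ract z g e := ⟨(z.1.1, P.ract z.1.2 g e), by rw [P.left_ract, z.2]⟩
  continuous_left := by fun_prop
  continuous_right := P.continuous_right.comp (by fun_prop)
  isOpenMap_left := P.isOpenMap_left.fst_pullback σ.continuous_obj
  -- Openness on this side can fail for a general homomorphism. It is proved later for essential
  -- equivalences, and is automatic when the target is a point.
  isOpenMap_right := ho
  continuous_lact := Continuous.subtype_mk ((Γ'.continuous_rng.comp (by fun_prop)).prodMk
    (P.continuous_lact' (σ.continuous_arr.comp (by fun_prop)) (by fun_prop) _)) _
  continuous_ract := Continuous.subtype_mk (Continuous.prodMk (by fun_prop)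
    (P.continuous_ract' (by fun_prop) (by fun_prop) _)) _
  left_lact _ _ _ := rfl
  right_lact _ _ _ := P.right_lact _ _ _
  left_ract _ _ _ := rfl
  right_ract _ _ _ := P.right_ract _ _ _
  unit_lact z := Subtype.ext (Prod.ext (Γ'.rng_unit _) (P.unit_lact' _ (by rw [σ.unit_arr, z.2])))
  ract_unit z := Subtype.ext (Prod.ext rfl (P.ract_unit _))
  mul_lact γ γ' z e e' := Subtype.ext (Prod.ext (Γ'.rng_mul _ _ _)
    ((P.lact_congr (σ.mul_arr _ _ _) rfl _ (by
      rw [Γ.src_mul, σ.src_arr, e', z.2])).trans (P.mul_lact _ _ _ _ _)))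
  ract_mul z g g' e e' := Subtype.ext (Prod.ext rfl (P.ract_mul _ _ _ _ _))
  lact_ract γ z g e e' := Subtype.ext (Prod.ext rfl (P.lact_ract _ _ _ _ _))
  left_conj _ := rfl
  right_conj _ := P.right_conj _
  lact_conj γ z e := Subtype.ext (Prod.ext (Γ'.rng_conj _)
    ((P.lact_congr (σ.conj_arr _) rfl _ (by
      rw [Γ.src_conj, P.left_conj, σ.src_arr, e, z.2])).trans (P.lact_conj _ _ _)))
  ract_conj z g e := Subtype.ext (Prod.ext rfl (P.ract_conj _ _ _))

theorem IsRightPrincipal.restrict {P : RealBibundle Γ G} (hP : P.IsRightPrincipal)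
    (σ : RealHom Γ' Γ) (ho) : (RealBibundle.restrict σ P ho).IsRightPrincipal :=
  isRightPrincipal_of_div
    (hP.1.lift σ.continuous_obj (fun x => x) continuous_id fun _ => rfl)
    (fun q => hP.div q.1.1.1.2 q.1.2.1.2 (q.1.1.2.symm.trans ((congrArg σ.obj q.2).trans q.1.2.2)))
    (hP.continuous_div (by fun_prop) (by fun_prop) _)
    (fun q => hP.rng_div _ _ _)
    (fun q => Subtype.ext (Prod.ext q.2 (hP.ract_div _ _ _ _)))
    fun p g e e' => hP.div_eq rfl

/-- The bibundle of a homomorphism. -/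
abbrev graph (σ : RealHom Γ' Γ)
    (ho : IsOpenMap fun z : {z : Y' × Γ.Arr // σ.obj z.1 = Γ.rng z.2} => Γ.src z.1.2) :
    RealBibundle Γ' Γ :=
  restrict σ (unitBibundle Γ) ho

theorem isGraph_graph (σ : RealHom Γ' Γ) (ho) : IsGraph σ (graph σ ho) := by
  refine ⟨Homeomorph.refl _, fun _ => rfl, fun _ => rfl, ?_, ?_, ?_⟩
  · rintro p ⟨q, hq⟩ e
    exact Subtype.ext e
  · rintro γ p ⟨q, hq⟩ e e' e''
    exact Subtype.ext e'.symm
  · rintro p g ⟨q, hq⟩ e e' e''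
    exact Subtype.ext e'.symm

/-- A map of principal bundles over a homomorphism exhibits a composite. -/
theorem isComposite_of_map {σ : RealHom Γ' Γ} {P : RealBibundle Γ G} {P' : RealBibundle Γ' G} (ho)
    (hP : P.IsRightPrincipal) (hP' : P'.IsRightPrincipal) (φ : P'.Total → P.Total)
    (hφ : Continuous φ) (left : ∀ p, P.left (φ p) = σ.obj (P'.left p))
    (right : ∀ p, P.right (φ p) = P'.right p) (conj : ∀ p, φ (P'.Total.conj p) = P.Total.conj (φ p))
    (lact : ∀ γ p e e', φ (P'.lact γ p e) = P.lact (σ.arr γ) (φ p) e')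
    (ract : ∀ p g e e', φ (P'.ract p g e) = P.ract (φ p) g e') :
    IsComposite (graph σ ho) P P' := by
  -- Two points over the same unit differ by an arrow of `G`; if their images under `φ` agree,
  -- freeness of the action on `P` makes this arrow a unit.
  have uniq : ∀ p p', P'.left p = P'.left p' → φ p = φ p' → p = p' := by
    intro p p' h h'
    have e1 := hP'.rng_div p p' h
    have e2 : P.right (φ p) = G.rng (hP'.div p p' h) := (right p).trans e1
    have h2 : P.ract (φ p) (hP'.div p p' h) e2 = P.ract (φ p) (G.unit (P.right (φ p)))
        (G.rng_unit _).symm := by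
      rw [← ract _ _ e1, hP'.ract_div, P.ract_unit, h']
    rw [← hP'.ract_div p p' h e1]
    exact (P'.ract_unit' _ ((hP.free h2).trans (congrArg G.unit (right p)))).symm
  -- The class of `((y, γ), p)` in the composite corresponds to the point of `P'` over `y` that `φ`
  -- sends to `γ p`.
  have ex : ∀ a : {p : (graph σ ho).Total × P.Total // (graph σ ho).right p.1 = P.left p.2}, ∃ p',
      P'.left p' = a.1.1.1.1 ∧ φ p' = P.lact a.1.1.1.2 a.1.2 a.2 := by
    rintro ⟨⟨⟨⟨y, γ⟩, h⟩, p⟩, h'⟩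
    obtain ⟨p₀, rfl⟩ := hP'.1.1 y
    have e : P.left (φ p₀) = P.left (P.lact γ p h') := by rw [left, P.left_lact]; exact h
    exact ⟨P'.ract p₀ (hP.div _ _ e) ((right _).symm.trans (hP.rng_div _ _ e)), P'.left_ract _ _ _,
      by rw [ract _ _ _ (hP.rng_div _ _ e), hP.ract_div]⟩
  choose ψ hψ hψ' using ex
  have hrel : ∀ a b, compRel (graph σ ho) P a b → ψ a = ψ b := by
    rintro ⟨⟨⟨⟨y, γ⟩, h⟩, p⟩, h'⟩ ⟨b, hb⟩ ⟨η, e, e', rfl⟩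
    refine uniq _ _ ((hψ _).trans (Eq.trans (b := y) rfl (hψ ⟨_, hb⟩).symm))
      ((hψ' _).trans (Eq.trans ?_ (hψ' _).symm))
    change P.lact γ p h' = P.lact (Γ.mul γ η e) (P.lact (Γ.inv η) p e') _
    rw [P.mul_lact _ _ _ e (by rw [P.left_lact, Γ.rng_inv])]
    exact P.lact_congr rfl (P.lact_inv_lact _ _ _ _).symm _ _
  have hc : Continuous ψ := by
    refine hP'.1.continuous_of_lift (f := fun a => a.1.1.1.1) (by fun_prop) ?_
    intro V _ i e hi he hei
    have e1 : ∀ v, P.left (φ (e v)) = P.left (P.lact (i v).1.1.1.2 (i v).1.2 (i v).2) := fun v => by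
      rw [left, P.left_lact, hei]
      exact (i v).1.1.2
    have : (fun v => ψ (i v)) = fun v => P'.ract (e v) (hP.div _ _ (e1 v))
        ((right _).symm.trans (hP.rng_div _ _ (e1 v))) := funext fun v =>
      uniq _ _ (by rw [hψ, P'.left_ract, hei])
        (by rw [hψ', ract _ _ _ (hP.rng_div _ _ (e1 v)), hP.ract_div])
    rw [this]
    exact P'.continuous_ract' he (hP.continuous_div (hφ.comp he)
      (P.continuous_lact' (by fun_prop) (by fun_prop) _) _) _
  -- The inverse pairs `φ p` with the unit arrow at its left end.
  let ι : P'.Total → {p : (graph σ ho).Total × P.Total // (graph σ ho).right p.1 = P.left p.2} := fun p =>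
    ⟨(⟨(P'.left p, Γ.unit (σ.obj (P'.left p))), (Γ.rng_unit _).symm⟩, φ p),
      (Γ.src_unit _).trans (left p).symm⟩
  have hι : Continuous ι := Continuous.subtype_mk ((Continuous.subtype_mk
    (P'.continuous_left.prodMk (Γ.continuous_unit.comp (σ.continuous_obj.comp P'.continuous_left)))
    _).prodMk hφ) _
  let H : Quot (compRel (graph σ ho) P) ≃ₜ P'.Total :=
    { toFun := Quot.lift ψ hrel
      invFun := fun p => Quot.mk _ (ι p)
      left_inv := by
        rintro ⟨⟨⟨⟨⟨y, γ⟩, h⟩, p⟩, h'⟩⟩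
        have h : σ.obj y = Γ.rng γ := h
        have h' : Γ.src γ = P.left p := h'
        have h1 := hψ ⟨(⟨(y, γ), h⟩, p), h'⟩
        have h2 := hψ' ⟨(⟨(y, γ), h⟩, p), h'⟩
        refine Quot.sound ⟨γ, ?_, ?_, Prod.ext (Subtype.ext (Prod.ext h1.symm ?_)) ?_⟩
        · exact (Γ.src_unit _).trans ((congrArg σ.obj h1).trans h)
        · exact (Γ.src_inv _).trans ((h.symm.trans (congrArg σ.obj h1).symm).trans (left _).symm)
        · exact (Γ.unit_mul' _ (congrArg Γ.unit ((congrArg σ.obj h1).trans h))).symm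
        · exact ((P.lact_congr rfl h2 _ ((Γ.src_inv _).trans (P.left_lact _ _ _).symm)).trans
            (P.inv_lact_lact _ _ _ _)).symm
      right_inv := fun p => uniq _ _ (hψ _) ((hψ' _).trans (P.unit_lact' _
        (congrArg Γ.unit (left p).symm)))
      continuous_toFun := continuous_quot_lift hrel hc
      continuous_invFun := continuous_quot_mk.comp hι }
  refine ⟨H, hψ, ?_, ?_, ?_, ?_⟩
  · intro a
    change P'.right (ψ a) = _
    rw [← right, hψ', P.right_lact]
  · rintro ⟨⟨⟨⟨y, γ⟩, h⟩, p⟩, h'⟩ ⟨b, hb⟩ rfl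
    exact uniq _ _ ((hψ _).trans ((P'.left_conj _).trans
      (congrArg Y'.conj (hψ ⟨(⟨(y, γ), h⟩, p), h'⟩))).symm)
      ((hψ' _).trans ((conj _).trans ((congrArg P.Total.conj (hψ' ⟨(⟨(y, γ), h⟩, p), h'⟩)).trans
        (P.lact_conj _ _ _).symm)).symm)
  · rintro η ⟨⟨⟨⟨y, γ⟩, h⟩, p⟩, h'⟩ ⟨b, hb⟩ e rfl e'
    have h' : Γ.src γ = P.left p := h'
    refine uniq _ _ ((P'.left_lact _ _ _).trans (hψ ⟨_, hb⟩).symm) ?_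
    have e2 : Γ.src (σ.arr η) = Γ.rng γ := by
      rw [σ.src_arr]; exact (congrArg σ.obj e).trans h
    refine (lact _ _ _ (e2.trans ((congrArg P.left
      (hψ' ⟨(⟨(y, γ), h⟩, p), h'⟩)).trans (P.left_lact _ _ _)).symm)).trans (Eq.trans ?_ (hψ' _).symm)
    exact (P.lact_congr rfl (hψ' _) _ (e2.trans (P.left_lact _ _ _).symm)).trans
      (P.mul_lact _ _ _ e2 h').symm
  · rintro ⟨⟨⟨⟨y, γ⟩, h⟩, p⟩, h'⟩ g ⟨b, hb⟩ e rfl e'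
    have h' : Γ.src γ = P.left p := h'
    refine uniq _ _ ((P'.left_ract _ _ _).trans ((hψ _).trans (hψ ⟨_, hb⟩).symm)) ?_
    have e2 : P.right (φ (ψ ⟨(⟨(y, γ), h⟩, p), h'⟩)) = G.rng g := (right _).trans e'
    refine (ract _ _ _ e2).trans (Eq.trans ?_ (hψ' _).symm)
    exact (P.ract_congr (hψ' _) rfl _ ((P.right_lact _ _ _).trans e)).trans
      (P.lact_ract _ _ _ h' e).symm

end Constructions

end RealBibundle

/-! ### Essential equivalences -/

section Essential

variable {Y Y' X : RealSpace.{u}} {Γ : RealGroupoid Y} {Γ' : RealGroupoid Y'} {G : RealGroupoid X}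
  {S : RealAbelianGroup.{u}}

theorem LocallySplit.congr {Z W : Type u} [TopologicalSpace Z] [TopologicalSpace W] {p p' : Z → W}
    (h : LocallySplit p) (e : ∀ x, p x = p' x) : LocallySplit p' :=
  funext e ▸ h

/-- Arrows of `Γ` with lifts of their range and source to `Y'`. -/
abbrev RealHom.LiftData (σ : RealHom Γ' Γ) : Type u :=
  {t : Y' × Γ.Arr × Y' // σ.obj t.1 = Γ.rng t.2.1 ∧ Γ.src t.2.1 = σ.obj t.2.2}

/-- `Γ'` is the pull-back of `Γ` along the map of unit spaces, and every unit of `Γ` is locally and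
continuously isomorphic to one that comes from `Γ'`. -/
structure RealHom.IsEssential (σ : RealHom Γ' Γ) : Prop where
  faithful : ∀ γ γ', Γ'.rng γ = Γ'.rng γ' → Γ'.src γ = Γ'.src γ' → σ.arr γ = σ.arr γ' → γ = γ'
  exists_lift : ∃ l : σ.LiftData → Γ'.Arr, Continuous l ∧
    ∀ t, Γ'.rng (l t) = t.1.1 ∧ Γ'.src (l t) = t.1.2.2 ∧ σ.arr (l t) = t.1.2.1
  locallySplit : LocallySplit fun z : {z : Y' × Γ.Arr // σ.obj z.1 = Γ.rng z.2} => Γ.src z.1.2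

namespace RealHom.IsEssential

open RealBibundle

variable {σ : RealHom Γ' Γ} (hσ : σ.IsEssential) {P : RealBibundle Γ G}

-- A point of `P` need not lie over the image of `Y'`, but locally some arrow of `Γ` moves it there,
-- and moving it does not change its image in `X`.
include hσ in
theorem locallySplit_restrict (hP : P.IsLeftPrincipal) :
    LocallySplit fun z : {z : Y' × P.Total // σ.obj z.1 = P.left z.2} => P.right z.1.2 := by
  have h1 : LocallySplit fun x : {x : {z : Y' × Γ.Arr // σ.obj z.1 = Γ.rng z.2} × P.Total //
      Γ.src x.1.1.2 = P.left x.2} => x.1.2 :=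
    hσ.locallySplit.lift P.continuous_left (fun x => ⟨(x.1.2, x.1.1), x.2.symm⟩)
      (by fun_prop) fun _ => rfl
  let μ : {x : {z : Y' × Γ.Arr // σ.obj z.1 = Γ.rng z.2} × P.Total // Γ.src x.1.1.2 = P.left x.2} →
      {z : Y' × P.Total // σ.obj z.1 = P.left z.2} := fun x =>
    ⟨(x.1.1.1.1, P.lact x.1.1.1.2 x.1.2 x.2), by rw [P.left_lact, x.1.1.2]⟩
  have hμ : Continuous μ := Continuous.subtype_mk (Continuous.prodMk (by fun_prop)
    (P.continuous_lact' (by fun_prop) (by fun_prop) _)) _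
  refine LocallySplit.of_comp (p := μ) ?_ hμ
  exact (hP.1.comp h1).congr fun x => (P.right_lact _ _ _).symm

-- By lifting arrows along `σ`, the fibres over `X` are orbits of `Γ'`, so local sections together
-- with openness of the source map give openness.
include hσ in
theorem isOpenMap_restrict (hP : P.IsLeftPrincipal) :
    IsOpenMap fun z : {z : Y' × P.Total // σ.obj z.1 = P.left z.2} => P.right z.1.2 := by
  obtain ⟨l, hl, hl'⟩ := hσ.exists_lift
  refine Γ'.isOpenMap_of_orbits (left := fun z => z.1.1) (by fun_prop)
    (fun γ z e => ⟨(Γ'.rng γ, P.lact (σ.arr γ) z.1.2 (by rw [σ.src_arr, e, z.2])), by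
      rw [P.left_lact, σ.rng_arr]⟩) ?_
    (hσ.locallySplit_restrict hP) (fun γ z e => P.right_lact _ _ _) ?_
  · exact Continuous.subtype_mk (Continuous.prodMk (Γ'.continuous_rng.comp (by fun_prop))
      (P.continuous_lact' (σ.continuous_arr.comp (by fun_prop)) (by fun_prop) _)) _
  intro z z' e
  have ht := hl' ⟨(z'.1.1, hP.div z'.1.2 z.1.2 e.symm, z.1.1),
    z'.2.trans (hP.rng_div _ _ _).symm, (hP.src_div _ _ _).trans z.2.symm⟩
  refine ⟨_, ht.2.1, Subtype.ext (Prod.ext ht.1 ?_)⟩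
  exact (P.lact_congr ht.2.2 rfl _ (hP.src_div _ _ _)).trans (hP.lact_div _ _ _ _)

-- The left difference is the lift to `Γ'`, with the prescribed end points, of the difference in
-- `P`; its uniqueness is faithfulness of `σ`.
include hσ in
theorem isMorita_restrict (hP : P.IsMorita) (ho) : (restrict σ P ho).IsMorita := by
  obtain ⟨l, hl, hl'⟩ := hσ.exists_lift
  refine ⟨hP.1.restrict σ ho, isLeftPrincipal_of_div (hσ.locallySplit_restrict hP.2)
    (fun q => l ⟨(q.1.1.1.1, hP.2.div q.1.1.1.2 q.1.2.1.2 q.2, q.1.2.1.1),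
      q.1.1.2.trans (hP.2.rng_div _ _ _).symm, (hP.2.src_div _ _ _).trans q.1.2.2.symm⟩)
    (hl.comp (Continuous.subtype_mk (Continuous.prodMk (by fun_prop) (Continuous.prodMk
      (hP.2.continuous_div (by fun_prop) (by fun_prop) _) (by fun_prop))) _))
    (fun q => (hl' _).2.1) (fun q => ?_) (fun γ p e e' => ?_)⟩
  · exact Subtype.ext (Prod.ext (hl' _).1 ((P.lact_congr (hl' _).2.2 rfl _
      (hP.2.src_div _ _ _)).trans (hP.2.lact_div _ _ _ _)))
  · exact hσ.faithful _ _ (hl' _).1 ((hl' _).2.1.trans e.symm)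
      ((hl' _).2.2.trans (hP.2.div_eq rfl))

include hσ in
theorem isOpenMap_graph :
    IsOpenMap fun z : {z : Y' × Γ.Arr // σ.obj z.1 = Γ.rng z.2} => Γ.src z.1.2 :=
  hσ.isOpenMap_restrict (P := unitBibundle Γ) isMorita_unitBibundle.2

include hσ in
theorem isMorita_graph (ho) : (graph σ ho).IsMorita :=
  hσ.isMorita_restrict isMorita_unitBibundle ho

/-- A homomorphism of twists over an essential equivalence is an essential equivalence. -/
theorem of_isTwHom {T' : RealTwist Γ' S} {T : RealTwist Γ S} (hσ : σ.IsEssential)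
    {F : T'.grpd.Arr → T.grpd.Arr} (hF : IsTwHom σ T' T F) : hF.realHom.IsEssential := by
  refine ⟨fun t t' h1 h2 h3 => ?_, ?_, ?_⟩
  · have h3 : F t = F t' := h3
    have hp : T'.proj.arr t = T'.proj.arr t' := hσ.faithful _ _
      (by rw [T'.rng_proj, T'.rng_proj, h1]) (by rw [T'.src_proj, T'.src_proj, h2])
      (by rw [← hF.proj, ← hF.proj, h3])
    have h4 := T'.principal.act_div t t' hp
    rw [← h4, hF.act] at h3
    rw [← h4, T.principal.free (h3.trans (T.principal.one_act _).symm), T'.principal.one_act]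
  -- `T'` is isomorphic to the pull-back of `T`. Hence an arrow of `T` is lifted by lifting its
  -- projection to `Γ'` and applying the inverse isomorphism to the resulting pair.
  · obtain ⟨l, hl, hl'⟩ := hσ.exists_lift
    have hJ : IsTwHom (RealHom.id Γ') T' (pullback σ T)
        fun t => ⟨(F t, T'.proj.arr t), hF.proj t⟩ :=
      ⟨Continuous.subtype_mk (hF.continuous.prodMk T'.proj.continuous_arr) _, fun _ => rfl,
        fun c t => Subtype.ext (Prod.ext (hF.act c t) (T'.principal.proj_act c t)),
        fun t => Subtype.ext (Prod.ext (hF.conj t) (T'.proj.conj_arr t)),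
        fun t t' e e' => Subtype.ext (Prod.ext (hF.mul _ _ _ _) (T'.proj_mul _ _ _))⟩
    obtain ⟨I, hI, hI', -⟩ := hJ.exists_inverse
    have aux : ∀ t : hF.realHom.LiftData, σ.obj t.1.1 = Γ.rng (T.proj.arr t.1.2.1) ∧
        Γ.src (T.proj.arr t.1.2.1) = σ.obj t.1.2.2 := fun t => by
      rw [T.rng_proj, T.src_proj]; exact t.2
    let m : hF.realHom.LiftData → Γ'.Arr := fun t =>
      l ⟨(t.1.1, T.proj.arr t.1.2.1, t.1.2.2), aux t⟩
    have hm : Continuous m := hl.comp (Continuous.subtype_mk (Continuous.prodMk (by fun_prop)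
      ((T.proj.continuous_arr.comp (by fun_prop)).prodMk (by fun_prop))) _)
    have hml : ∀ t, T.proj.arr t.1.2.1 = σ.arr (m t) := fun t =>
      (hl' ⟨(t.1.1, T.proj.arr t.1.2.1, t.1.2.2), aux t⟩).2.2.symm
    refine ⟨fun t => I ⟨(t.1.2.1, m t), hml t⟩, hI.continuous.comp
      (Continuous.subtype_mk (Continuous.prodMk (by fun_prop) hm) _), fun t => ?_⟩
    have hp : T'.proj.arr (I ⟨(t.1.2.1, m t), hml t⟩) = m t := hI.proj _
    refine ⟨?_, ?_, congrArg (fun z => z.1.1) (hI' ⟨(t.1.2.1, m t), hml t⟩)⟩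
    · rw [← T'.rng_proj, hp]; exact (hl' _).1
    · rw [← T'.src_proj, hp]; exact (hl' _).2.1
  · have h1 : LocallySplit fun z : {z : Y' × T.grpd.Arr // σ.obj z.1 = T.grpd.rng z.2} =>
        (⟨(z.1.1, T.proj.arr z.1.2), z.2.trans (T.rng_proj _).symm⟩ :
          {z : Y' × Γ.Arr // σ.obj z.1 = Γ.rng z.2}) :=
      T.principal.locallySplit.lift (f := fun z => z.1.2) (by fun_prop)
        (fun x => ⟨(x.1.1.1.1, x.1.2), by rw [← T.rng_proj, ← x.2]; exact x.1.1.2⟩) (by fun_prop)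
        fun x => Subtype.ext (Prod.ext rfl x.2.symm)
    exact (hσ.locallySplit.comp h1).congr fun x => T.src_proj _

end RealHom.IsEssential

theorem RealCover.isEssential_toBase (U : RealCover X) : (U.toBase G).IsEssential := by
  refine ⟨?_, ⟨fun t => ⟨(t.1.1.1.1, t.1.2.1, t.1.2.2.1.1), ?_, ?_⟩, ?_, ?_⟩, ?_⟩
  · rintro ⟨⟨i, g, j⟩, h⟩ ⟨⟨i', g', j'⟩, h'⟩ h1 h2 h3
    exact Subtype.ext (Prod.ext (congrArg (fun z : U.space => z.1.1) h1) (Prod.ext h3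
      (congrArg (fun z : U.space => z.1.1) h2)))
  · rw [← t.2.1]; exact t.1.1.2
  · rw [t.2.2]; exact t.1.2.2.2
  · exact Continuous.subtype_mk (by fun_prop) _
  · exact fun t => ⟨Subtype.ext (Prod.ext rfl t.2.1.symm), Subtype.ext (Prod.ext rfl t.2.2), rfl⟩
  · refine ⟨fun x => ?_, fun x => ?_⟩
    · obtain ⟨i, hi⟩ := U.exists_mem x
      exact ⟨⟨(⟨(i, x), hi⟩, G.unit x), (G.rng_unit x).symm⟩, G.src_unit x⟩
    · obtain ⟨i, hi⟩ := U.exists_mem x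
      refine ⟨U.U i, U.isOpen_U i, hi, fun v => ⟨(⟨(i, v.1), v.2⟩, G.unit v.1),
        (G.rng_unit _).symm⟩, ?_, fun v => G.src_unit _⟩
      exact Continuous.subtype_mk ((Continuous.subtype_mk (by fun_prop) _).prodMk
        (G.continuous_unit.comp continuous_subtype_val)) _

open RealBibundle

/-- Arrows with lifts of their range and source to a bibundle. -/
abbrev RealHom.LiftPoints (σ : RealHom Γ' Γ) (P' : RealBibundle Γ' G) : Type u :=
  {x : σ.LiftData × P'.Total × P'.Total // x.1.1.1 = P'.left x.2.1 ∧ x.1.1.2.2 = P'.left x.2.2}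

/-- A homomorphism covered by a map of Morita equivalences is an essential equivalence. -/
theorem RealHom.isEssential_of_map {σ : RealHom Γ' Γ} {P : RealBibundle Γ G}
    {P' : RealBibundle Γ' G} (hP : P.IsMorita) (hP' : P'.IsMorita) (φ : P'.Total → P.Total)
    (hφ : Continuous φ) (left : ∀ p, P.left (φ p) = σ.obj (P'.left p))
    (right : ∀ p, P.right (φ p) = P'.right p)
    (lact : ∀ γ p e e', φ (P'.lact γ p e) = P.lact (σ.arr γ) (φ p) e')
    (ract : ∀ p g e e', φ (P'.ract p g e) = P.ract (φ p) g e') : σ.IsEssential := by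
  -- Applied to a point `p`, both arrows give points over the same unit with the same image under
  -- `φ`. By freeness on `P` the points agree, and then so do the arrows by freeness on `P'`.
  have faithful : ∀ γ γ', Γ'.rng γ = Γ'.rng γ' → Γ'.src γ = Γ'.src γ' → σ.arr γ = σ.arr γ' →
      γ = γ' := by
    intro γ γ' h1 h2 h3
    obtain ⟨p, hp⟩ := hP'.1.1.1 (Γ'.src γ)
    have e1 : Γ.src (σ.arr γ) = P.left (φ p) := by rw [σ.src_arr, left, hp]
    have e2 : P'.left (P'.lact γ p hp.symm) = P'.left (P'.lact γ' p (h2.symm.trans hp.symm)) := by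
      rw [P'.left_lact, P'.left_lact, h1]
    have e3 := hP'.1.ract_div _ _ e2 (hP'.1.rng_div _ _ e2)
    have e4 : P.right (φ (P'.lact γ p hp.symm)) = G.rng (hP'.1.div _ _ e2) :=
      (right _).trans (hP'.1.rng_div _ _ e2)
    have e5 : P.ract (φ (P'.lact γ p hp.symm)) (hP'.1.div _ _ e2) e4 =
        P.ract (φ (P'.lact γ p hp.symm)) (G.unit (P.right _)) (G.rng_unit _).symm := by
      rw [← ract _ _ (hP'.1.rng_div _ _ e2), e3, P.ract_unit, lact γ p _ e1, lact γ' p _ (h3 ▸ e1)]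
      exact P.lact_congr h3.symm rfl _ _
    have e6 := hP.1.free e5
    rw [P'.ract_unit' _ (e6.trans (congrArg G.unit (right _)))] at e3
    exact hP'.2.free e3
  refine ⟨faithful, ?_, ?_⟩
  -- To lift `γ` between the units below `p` and `p'`, take `g` with `φ(p) g = γ φ(p')`. The lift is
  -- then the arrow carrying `p'` to `p g`. By faithfulness it does not depend on `p` and `p'`, so
  -- continuity can be checked with local sections.
  · have k1 : ∀ x : σ.LiftPoints P', Γ.src x.1.1.1.2.1 = P.left (φ x.1.2.2) := fun x => by
      rw [left, ← x.2.2]; exact x.1.1.2.2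
    have k2 : ∀ x : σ.LiftPoints P', P.left (φ x.1.2.1) = P.left (P.lact x.1.1.1.2.1 (φ x.1.2.2) (k1 x)) :=
      fun x => by rw [P.left_lact, left, ← x.2.1]; exact x.1.1.2.1
    let g : σ.LiftPoints P' → G.Arr := fun x => hP.1.div _ _ (k2 x)
    have hg : ∀ x, P'.right x.1.2.1 = G.rng (g x) := fun x =>
      (right _).symm.trans (hP.1.rng_div _ _ (k2 x))
    have hgc : Continuous g := hP.1.continuous_div (hφ.comp (by fun_prop))
      (P.continuous_lact' (by fun_prop) (hφ.comp (by fun_prop)) _) _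
    have k3 : ∀ x : σ.LiftPoints P', P'.right (P'.ract x.1.2.1 (g x) (hg x)) = P'.right x.1.2.2 := fun x => by
      rw [P'.right_ract, hP.1.src_div, P.right_lact, right]
    let m : σ.LiftPoints P' → Γ'.Arr := fun x => hP'.2.div _ _ (k3 x)
    have hmc : Continuous m := hP'.2.continuous_div (P'.continuous_ract' (by fun_prop) hgc _)
      (by fun_prop) _
    have hm : ∀ x : σ.LiftPoints P', Γ'.rng (m x) = x.1.1.1.1 ∧ Γ'.src (m x) = x.1.1.1.2.2 ∧
        σ.arr (m x) = x.1.1.1.2.1 := by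
      intro x
      have s1 : Γ'.src (m x) = P'.left x.1.2.2 := hP'.2.src_div _ _ (k3 x)
      have s2 : Γ.src (σ.arr (m x)) = P.left (φ x.1.2.2) := by rw [σ.src_arr, s1, left]
      refine ⟨?_, ?_, ?_⟩
      · rw [hP'.2.rng_div, P'.left_ract, x.2.1]
      · rw [s1, x.2.2]
      · refine hP.2.free (p := φ x.1.2.2) (e := s2) (e' := k1 x) ?_
        rw [← lact _ _ s1, hP'.2.lact_div, ract _ _ _ (hP.1.rng_div _ _ (k2 x)), hP.1.ract_div]
    have ex : ∀ a : σ.LiftData, ∃ γ, Γ'.rng γ = a.1.1 ∧ Γ'.src γ = a.1.2.2 ∧ σ.arr γ = a.1.2.1 := by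
      intro a
      obtain ⟨p, hp⟩ := hP'.1.1.1 a.1.1
      obtain ⟨p', hp'⟩ := hP'.1.1.1 a.1.2.2
      exact ⟨_, hm ⟨(a, p, p'), hp.symm, hp'.symm⟩⟩
    choose l hl using ex
    refine ⟨l, ?_, hl⟩
    refine hP'.1.1.continuous_of_lift (f := fun a => a.1.1) (by fun_prop) ?_
    intro V _ i e hi he hei
    refine hP'.1.1.continuous_of_lift (f := fun v => (i v).1.2.2) (by fun_prop) ?_
    intro V' _ i' e' hi' he' hei'
    let b : V' → σ.LiftPoints P' := fun v => ⟨(i (i' v), e (i' v), e' v), (hei _).symm, (hei' _).symm⟩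
    have hb : Continuous b := Continuous.subtype_mk (by fun_prop) _
    have : (fun v => l (i (i' v))) = fun v => m (b v) := funext fun v =>
      faithful _ _ ((hl _).1.trans (hm (b v)).1.symm) ((hl _).2.1.trans (hm (b v)).2.1.symm)
        ((hl _).2.2.trans (hm (b v)).2.2.symm)
    rw [this]
    exact hmc.comp hb
  -- A unit of `Γ` is lifted to `p` in `P`, then `p'` in `P'` is chosen over the same point of `X`;
  -- the arrow carrying `p` to `φ(p')` joins that unit to one from `Y'`.
  · have h1 : LocallySplit fun x : {x : P.Total × P'.Total // P.right x.1 = P'.right x.2} => x.1.1 :=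
      hP'.2.1.lift P.continuous_right (fun x => x) continuous_id fun _ => rfl
    have k : ∀ x : {x : P.Total × P'.Total // P.right x.1 = P'.right x.2},
        P.right (φ x.1.2) = P.right x.1.1 := fun x => (right _).trans x.2.symm
    refine LocallySplit.of_comp (p := fun x : {x : P.Total × P'.Total //
      P.right x.1 = P'.right x.2} => ⟨(P'.left x.1.2, hP.2.div _ _ (k x)),
        (left _).symm.trans (hP.2.rng_div _ _ _).symm⟩) ?_ ?_
    · exact (hP.1.1.comp h1).congr fun x => (hP.2.src_div _ _ _).symm
    · exact Continuous.subtype_mk ((P'.continuous_left.comp (by fun_prop)).prodMk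
        (hP.2.continuous_div (hφ.comp (by fun_prop)) (by fun_prop) _)) _

end Essential

/-! ### Equivalences of extensions from homomorphisms of twists -/

section MoritaOfMap

open RealBibundle

variable {Y Y' X : RealSpace.{u}} {Γ : RealGroupoid Y} {Γ' : RealGroupoid Y'} {G : RealGroupoid X}
  {S : RealAbelianGroup.{u}}

theorem isOpenMap_to_point {A : Type u} [TopologicalSpace A] (f : A → RealSpace.point.{u}) :
    IsOpenMap f := fun O _ => by
  have : DiscreteTopology (RealSpace.point.{u}).carrier :=
    inferInstanceAs (DiscreteTopology PUnit)
  exact isOpen_discrete _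

/-- The bibundle of the grading of a twist. -/
abbrev RealTwist.degGraph (T : RealTwist Γ S) : RealBibundle Γ RealGroupoid.Z2.{u} :=
  graph T.degHom (isOpenMap_to_point _)

theorem RealTwist.isRightPrincipal_degGraph (T : RealTwist Γ S) : T.degGraph.IsRightPrincipal :=
  isMorita_unitBibundle.1.restrict _ _

/-- The function `c` is an isomorphism of `ℤ/2`-bundles: `(y, ε)` is sent to `(σ y, ε + c y)`, and
equivariance under `Γ'` is the coboundary identity for the gradings. -/
theorem TwHom.isComposite_degGraph {σ : RealHom Γ' Γ} {c : Y' → ZMod 2} {T' : RealTwist Γ' S}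
    {T : RealTwist Γ S} (h : TwHom σ c T' T) (ho) :
    IsComposite (graph σ ho) T.degGraph T'.degGraph := by
  refine isComposite_of_map ho T.isRightPrincipal_degGraph T'.isRightPrincipal_degGraph
    (fun z => ⟨(σ.obj z.1.1, ULift.up (z.1.2.down + c z.1.1)), rfl⟩) ?_ (fun _ => rfl)
    (fun _ => rfl) ?_ ?_ ?_
  · refine Continuous.subtype_mk ((σ.continuous_obj.comp (by fun_prop)).prodMk
      (continuous_uliftUp.comp (Continuous.add ?_ (h.continuous.comp (by fun_prop))))) _
    exact continuous_uliftDown.comp (continuous_snd.comp continuous_subtype_val)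
  · intro z
    exact Subtype.ext (Prod.ext (σ.conj_obj _) (congrArg ULift.up
      (congrArg (z.1.2.down + ·) (h.conj _))))
  · rintro γ ⟨⟨y, ε⟩, hz⟩ e e'
    obtain rfl : Γ'.src γ = y := e
    refine Subtype.ext (Prod.ext (σ.rng_arr _).symm (congrArg ULift.up ?_))
    change T'.deg γ + ε.down + c (Γ'.rng γ) = T.deg (σ.arr γ) + (ε.down + c (Γ'.src γ))
    rw [h.deg]
    linear_combination CharTwo.add_self_eq_zero (c (Γ'.rng γ))
  · rintro ⟨⟨y, ε⟩, hz⟩ g e e'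
    refine Subtype.ext (Prod.ext rfl (congrArg ULift.up ?_))
    change ε.down + g.down + c y = ε.down + c y + g.down
    ring

/-- The `S`-action on the bibundle of a homomorphism of twists. -/
def IsTwHom.graphAct {σ : RealHom Γ' Γ} {T' : RealTwist Γ' S} {T : RealTwist Γ S}
    {F : T'.grpd.Arr → T.grpd.Arr} (hF : IsTwHom σ T' T F) (ho) (c : S)
    (z : (graph hF.realHom ho).Total) : (graph hF.realHom ho).Total :=
  ⟨(z.1.1, T.act c z.1.2), z.2.trans (T.rng_act _ _).symm⟩

theorem IsTwHom.isSEquivariant_graph {σ : RealHom Γ' Γ} {T' : RealTwist Γ' S} {T : RealTwist Γ S}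
    {F : T'.grpd.Arr → T.grpd.Arr} (hF : IsTwHom σ T' T F) (ho) :
    IsSEquivariant T' T (graph hF.realHom ho) (hF.graphAct ho) where
  continuous_act := Continuous.subtype_mk ((by fun_prop :
    Continuous fun q : S × (graph hF.realHom ho).Total => q.2.1.1).prodMk
      (T.principal.continuous_act' (by fun_prop) (by fun_prop))) _
  one_act _ := Subtype.ext (Prod.ext rfl (T.principal.one_act _))
  mul_act _ _ _ := Subtype.ext (Prod.ext rfl (T.principal.mul_act _ _ _))
  conj_act _ _ := Subtype.ext (Prod.ext rfl (T.principal.conj_act _ _))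
  left_act _ _ := rfl
  right_act _ _ := T.src_act _ _
  act_left := by
    rintro c t ⟨⟨y, z⟩, hz⟩ t' e₁ e₂ e₃ e₄
    have k : T.grpd.src (F t) = T.grpd.rng z := (hF.src t).trans ((congrArg σ.obj e₃).trans hz)
    refine Subtype.ext (Prod.ext (T'.rng_act _ _) (T.grpd.mul_congr _ ?_ rfl))
    refine (T.grpd.mul_congr (h' := z) _ (hF.act c t) rfl).trans ?_
    exact (T.act_mul c (F t) z k _).trans (T.mul_act c (F t) z k _).symm
  act_right := by
    rintro c t ⟨⟨y, z⟩, hz⟩ t' e₁ e₂ e₃ e₄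
    have k : T.grpd.src (F t) = T.grpd.rng z := (hF.src t).trans ((congrArg σ.obj e₃).trans hz)
    refine Subtype.ext (Prod.ext rfl ?_)
    have e₄ : T.grpd.src (T.grpd.mul (F t) z k) = T.grpd.rng (T.act c t') := e₄
    have e₅ : T.grpd.src (T.grpd.mul (F t) z k) = T.grpd.rng t' := by rw [e₄, T.rng_act]
    exact ((T.grpd.mul_congr _ (T.mul_act c (F t) z k _) rfl).trans
      (T.act_mul c _ t' e₅ ((T.src_act _ _).trans e₅))).trans (T.mul_act c _ t' e₅ e₄).symm

theorem IsTwHom.isSQuotient_graph {σ : RealHom Γ' Γ} {T' : RealTwist Γ' S} {T : RealTwist Γ S}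
    {F : T'.grpd.Arr → T.grpd.Arr} (hF : IsTwHom σ T' T F) (ho) (ho') :
    IsSQuotient T' T (graph hF.realHom ho) (hF.graphAct ho) (graph σ ho') := by
  let q : (graph hF.realHom ho).Total → (graph σ ho').Total := fun z =>
    ⟨(z.1.1, T.proj.arr z.1.2), z.2.trans (T.rng_proj _).symm⟩
  have hqc : Continuous q := Continuous.subtype_mk ((by fun_prop :
    Continuous fun z : (graph hF.realHom ho).Total => z.1.1).prodMk
      (T.proj.continuous_arr.comp (by fun_prop))) _
  have hq : ∀ z z', (∃ c : S, z' = hF.graphAct ho c z) → q z = q z' := by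
    rintro z _ ⟨c, rfl⟩
    exact Subtype.ext (Prod.ext rfl (T.principal.proj_act _ _).symm)
  let r := fun z z' : (graph hF.realHom ho).Total => ∃ c : S, z' = hF.graphAct ho c z
  have inj : ∀ z z', q z = q z' → Quot.mk r z = Quot.mk r z' := by
    rintro ⟨⟨y, z⟩, h⟩ ⟨⟨y', z'⟩, h'⟩ e
    obtain rfl : y = y' := congrArg (fun w => w.1.1) e
    have e : T.proj.arr z = T.proj.arr z' := congrArg (fun w => w.1.2) e
    exact Quot.sound ⟨T.principal.div _ _ e.symm, Subtype.ext (Prod.ext rfl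
      (T.principal.act_div _ _ e.symm).symm)⟩
  have surj : Function.Surjective (Quot.lift q hq) := by
    rintro ⟨⟨y, γ⟩, h⟩
    obtain ⟨t, rfl⟩ := T.principal.locallySplit.1 γ
    exact ⟨Quot.mk _ ⟨(y, t), h.trans (T.rng_proj t)⟩, rfl⟩
  let E := Equiv.ofBijective (Quot.lift q hq)
    ⟨by rintro ⟨z⟩ ⟨z'⟩ e; exact inj z z' e, surj⟩
  have hinv : Continuous E.symm := by
    refine T.principal.locallySplit.continuous_of_lift
      (f := fun w : (graph σ ho').Total => w.1.2) (by fun_prop) ?_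
    intro V _ i e hi he hei
    have k : ∀ v, hF.realHom.obj (i v).1.1 = T.grpd.rng (e v) := fun v => by
      rw [← T.rng_proj, hei]; exact (i v).2
    have : (fun v => E.symm (i v)) = fun v => Quot.mk _ ⟨((i v).1.1, e v), k v⟩ :=
      funext fun v => (Equiv.symm_apply_eq _).mpr (Subtype.ext (Prod.ext rfl (hei v).symm))
    rw [this]
    exact continuous_quot_mk.comp (Continuous.subtype_mk (Continuous.prodMk (by fun_prop) he) _)
  refine ⟨⟨E, continuous_quot_lift hq hqc, hinv⟩, fun _ => rfl, fun z => T.src_proj _, fun z => ?_,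
    fun t z e e' => ?_, fun z t e e' => ?_⟩
  · exact Subtype.ext (Prod.ext rfl (T.proj.conj_arr _))
  · refine Subtype.ext (Prod.ext (T'.rng_proj _) ?_)
    exact (Γ.mul_congr _ (hF.proj t).symm rfl).trans (T.proj_mul _ _ _).symm
  · exact Subtype.ext (Prod.ext rfl (T.proj_mul _ _ _).symm)

/-- A homomorphism of twists that is covered by a map of Morita equivalences induces a Morita
equivalence of extensions. -/
theorem TwHom.cls_eq_cls {T' : RealTwist Γ' S} {T : RealTwist Γ S} {P' : RealBibundle Γ' G}
    {P : RealBibundle Γ G} {σ : RealHom Γ' Γ} {c : Y' → ZMod 2} (h : TwHom σ c T' T)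
    (hP' : P'.IsMorita) (hP : P.IsMorita) (φ : P'.Total → P.Total)
    (hφ : Continuous φ) (left : ∀ p, P.left (φ p) = σ.obj (P'.left p))
    (right : ∀ p, P.right (φ p) = P'.right p) (conj : ∀ p, φ (P'.Total.conj p) = P.Total.conj (φ p))
    (lact : ∀ γ p e e', φ (P'.lact γ p e) = P.lact (σ.arr γ) (φ p) e')
    (ract : ∀ p g e e', φ (P'.ract p g e) = P.ract (φ p) g e') :
    (RealExtension.mk T' P' hP').cls = (RealExtension.mk T P hP).cls := by
  obtain ⟨F, hF⟩ := h.exists_hom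
  have hσ : σ.IsEssential := RealHom.isEssential_of_map hP hP' φ hφ left right lact ract
  have hσF := hσ.of_isTwHom hF
  exact Quot.sound ⟨graph hF.realHom hσF.isOpenMap_graph, hF.graphAct _,
    graph σ hσ.isOpenMap_graph, T'.degGraph, T.degGraph, hσF.isMorita_graph _,
    hF.isSEquivariant_graph _, hF.isSQuotient_graph _ _,
    isComposite_of_map _ hP.1 hP'.1 φ hφ left right conj lact ract, isGraph_graph _ _,
    isGraph_graph _ _, h.isComposite_degGraph _⟩

end MoritaOfMap

/-! ### Homomorphisms and twists induced by sections -/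

section Sections

variable {Y Z Z' X : RealSpace.{u}} {Γ : RealGroupoid Y} {H : RealGroupoid Z}
  {H' : RealGroupoid Z'} {G : RealGroupoid X} {S : RealAbelianGroup.{u}}

/-- A Real section of `right : P → X` along a homomorphism. -/
structure RealBibundle.SectionAlong (P : RealBibundle Γ G) (τ : RealHom H G) : Type u where
  toFun : Z → P.Total
  continuous : Continuous toFun
  conj : ∀ y, toFun (Z.conj y) = P.Total.conj (toFun y)
  right : ∀ y, P.right (toFun y) = τ.obj y

namespace RealBibundle.SectionAlong

variable {P : RealBibundle Γ G} {τ : RealHom H G}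

theorem ract_composable (s : P.SectionAlong τ) (h : H.Arr) :
    P.right (s.toFun (H.rng h)) = G.rng (τ.arr h) :=
  (s.right _).trans (τ.rng_arr _).symm

theorem right_ract (s : P.SectionAlong τ) (h : H.Arr) :
    P.right (P.ract (s.toFun (H.rng h)) (τ.arr h) (s.ract_composable h)) =
      P.right (s.toFun (H.src h)) := by
  rw [P.right_ract, s.right, τ.src_arr]

theorem div_eq_of_lact (s : P.SectionAlong τ) (hP : P.IsLeftPrincipal) {h : H.Arr} {γ : Γ.Arr} {e}
    (hγ : P.lact γ (s.toFun (H.src h)) e =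
      P.ract (s.toFun (H.rng h)) (τ.arr h) (s.ract_composable h)) :
    hP.div _ _ (s.right_ract h) = γ :=
  hP.div_eq hγ

/-- The homomorphism to the left groupoid of a principal bundle that is induced by a section. -/
noncomputable def hom (s : P.SectionAlong τ) (hP : P.IsLeftPrincipal) : RealHom H Γ where
  obj y := P.left (s.toFun y)
  -- The image of `h` is the arrow `γ` with `γ · s(src h) = s(rng h) · τ(h)`.
  arr h := hP.div _ _ (s.right_ract h)
  continuous_obj := P.continuous_left.comp s.continuous
  continuous_arr := hP.continuous_div (P.continuous_ract' (s.continuous.comp H.continuous_rng)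
    τ.continuous_arr _) (s.continuous.comp H.continuous_src) _
  rng_arr h := by rw [hP.rng_div, P.left_ract]
  src_arr h := hP.src_div _ _ _
  unit_arr y := by
    have e : Γ.src (Γ.unit (P.left (s.toFun y))) = P.left (s.toFun (H.src (H.unit y))) := by
      rw [Γ.src_unit, H.src_unit]
    refine s.div_eq_of_lact hP (e := e) ?_
    rw [P.unit_lact' e (by rw [H.src_unit]), P.ract_unit' _ (by
      rw [τ.unit_arr, s.right, H.rng_unit]), H.src_unit, H.rng_unit]
  mul_arr g h e := by
    have e1 : s.toFun (H.src g) = s.toFun (H.rng h) := by rw [e]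
    have e2 : Γ.src (hP.div _ _ (s.right_ract h)) = P.left (s.toFun (H.src h)) := hP.src_div _ _ _
    have e3 : Γ.src (hP.div _ _ (s.right_ract g)) = Γ.rng (hP.div _ _ (s.right_ract h)) := by
      rw [hP.src_div, hP.rng_div, P.left_ract, e1]
    have e4 : Γ.src (Γ.mul _ _ e3) = P.left (s.toFun (H.src (H.mul g h e))) := by
      rw [Γ.src_mul, H.src_mul, e2]
    have e5 : Γ.src (hP.div _ _ (s.right_ract g)) = P.left (s.toFun (H.rng h)) := by
      rw [hP.src_div, e1]
    have e6 : G.src (τ.arr g) = G.rng (τ.arr h) := by rw [τ.src_arr, τ.rng_arr, e]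
    refine s.div_eq_of_lact hP (e := e4) ?_
    calc P.lact (Γ.mul _ _ e3) (s.toFun (H.src (H.mul g h e))) e4
        = P.lact (Γ.mul _ _ e3) (s.toFun (H.src h)) ((Γ.src_mul _ _ _).trans e2) :=
          P.lact_congr rfl (by rw [H.src_mul]) _ _
      _ = P.lact _ (P.lact _ (s.toFun (H.src h)) e2) _ := P.mul_lact _ _ _ e3 e2
      _ = P.lact (hP.div _ _ (s.right_ract g)) (P.ract (s.toFun (H.rng h)) (τ.arr h)
            (s.ract_composable h)) (e5.trans (P.left_ract _ _ _).symm) :=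
          P.lact_congr rfl (hP.lact_div _ _ _ _) _ _
      _ = P.ract (P.lact (hP.div _ _ (s.right_ract g)) (s.toFun (H.rng h)) e5) (τ.arr h)
            ((P.right_lact _ _ _).trans (s.ract_composable h)) := P.lact_ract _ _ _ e5 _
      _ = P.ract (P.ract (s.toFun (H.rng g)) (τ.arr g) (s.ract_composable g)) (τ.arr h)
            ((P.right_ract _ _ _).trans e6) :=
          P.ract_congr ((P.lact_congr rfl e1.symm _ (hP.src_div _ _ _)).trans
            (hP.lact_div _ _ _ _)) rfl _ _
      _ = P.ract (s.toFun (H.rng g)) (G.mul (τ.arr g) (τ.arr h) e6)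
            ((s.ract_composable g).trans (G.rng_mul _ _ _).symm) := (P.ract_mul _ _ _ _ _).symm
      _ = _ := P.ract_congr (by rw [H.rng_mul]) (τ.mul_arr _ _ _).symm _ _
  conj_obj y := by rw [s.conj, P.left_conj]
  conj_arr h := by
    rw [← hP.div_conj _ _ _ (by rw [P.right_conj, P.right_conj, s.right_ract])]
    congr 1
    · rw [← P.ract_conj]
      exact P.ract_congr (by rw [H.rng_conj, s.conj]) (τ.conj_arr _) _ _
    · rw [H.src_conj, s.conj]

theorem lact_hom (s : P.SectionAlong τ) (hP : P.IsLeftPrincipal) (h : H.Arr) (e) (e') :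
    P.lact ((s.hom hP).arr h) (s.toFun (H.src h)) e = P.ract (s.toFun (H.rng h)) (τ.arr h) e' :=
  hP.lact_div _ _ _ _

/-- Freeness makes the defining equation characterize the induced arrow; this is how induced
homomorphisms are computed below. -/
theorem hom_eq (s : P.SectionAlong τ) (hP : P.IsLeftPrincipal) {h : H.Arr} {γ : Γ.Arr} {e} {e'}
    (hγ : P.lact γ (s.toFun (H.src h)) e = P.ract (s.toFun (H.rng h)) (τ.arr h) e') :
    (s.hom hP).arr h = γ :=
  hP.div_eq hγ

end RealBibundle.SectionAlong

variable (G) in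
/-- The conjugate `a t b⁻¹`. -/
def RealGroupoid.conjugate (a t b : G.Arr) (e : G.src a = G.rng t) (e' : G.src t = G.src b) :
    G.Arr :=
  G.mul (G.mul a t e) (G.inv b) ((G.src_mul _ _ _).trans (e'.trans (G.rng_inv _).symm))

theorem RealGroupoid.conjugate_congr {a a' t t' b b' : G.Arr} (ha : a = a') (ht : t = t')
    (hb : b = b') (e₁ e₁' e₂ e₂') : G.conjugate a t b e₁ e₁' = G.conjugate a' t' b' e₂ e₂' := by
  subst ha ht hb; rfl

theorem RealGroupoid.conjugate_mul_conjugate {a t b t' c : G.Arr} (e₁ e₂ e₃ e₄) (e e' e'') :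
    G.mul (G.conjugate a t b e₁ e₂) (G.conjugate b t' c e₃ e₄) e =
      G.conjugate a (G.mul t t' e') c e'' ((G.src_mul _ _ _).trans e₄) := by
  have k1 : G.src (G.mul a t e₁) = G.rng t' := by rw [G.src_mul, e']
  have k2 : G.src t' = G.rng (G.inv c) := by rw [G.rng_inv, e₄]
  have k3 : G.src (G.mul a t e₁) = G.rng (G.inv b) := by rw [G.src_mul, G.rng_inv, e₂]
  have k4 : G.src b = G.rng (G.mul t' (G.inv c) k2) := by rw [G.rng_mul, e₃]
  have h1 : G.conjugate b t' c e₃ e₄ = G.mul b (G.mul t' (G.inv c) k2) k4 :=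
    G.mul_assoc _ _ _ e₃ k2
  have h2 : G.conjugate a (G.mul t t' e') c e'' ((G.src_mul _ _ _).trans e₄) =
      G.mul (G.mul a t e₁) (G.mul t' (G.inv c) k2) (k1.trans (G.rng_mul _ _ _).symm) := by
    rw [← G.mul_assoc _ _ _ k1 k2]
    exact G.mul_congr _ (G.mul_assoc _ _ _ e₁ e').symm rfl
  rw [h2, G.mul_congr e rfl h1]
  refine (G.mul_assoc _ _ _ k3 ?_).trans (G.mul_congr _ rfl (G.inv_mul_cancel_left k4))
  rw [G.src_inv, G.rng_mul]

theorem RealGroupoid.continuous_conjugate {A : Type*} [TopologicalSpace A] {a t b : A → G.Arr}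
    (ha : Continuous a) (ht : Continuous t) (hb : Continuous b)
    (e : ∀ x, G.src (a x) = G.rng (t x)) (e' : ∀ x, G.src (t x) = G.src (b x)) :
    Continuous fun x => G.conjugate (a x) (t x) (b x) (e x) (e' x) :=
  G.continuous_mul' (G.continuous_mul' ha ht _) (G.continuous_inv.comp hb) _

theorem RealGroupoid.conjugate_conj (a t b : G.Arr) (e e' k k') :
    G.conjugate (G.Arr.conj a) (G.Arr.conj t) (G.Arr.conj b) k k' =
      G.Arr.conj (G.conjugate a t b e e') := by
  refine Eq.trans ?_ (G.mul_conj _ _ _)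
  exact G.mul_congr _ (G.mul_conj _ _ _) (G.inv_conj _)

/-- A lift to the twist of the difference of two sections identifies the induced twists. -/
theorem RealBibundle.SectionAlong.twHom_of_lift {P : RealBibundle Γ G} {τ : RealHom H G}
    (s s' : P.SectionAlong τ) (hP : P.IsLeftPrincipal) (T : RealTwist Γ S) (d : Z → T.grpd.Arr)
    (hd : Continuous d) (hdc : ∀ y, d (Z.conj y) = T.grpd.Arr.conj (d y))
    (hdp : ∀ y, T.proj.arr (d y) = hP.div (s'.toFun y) (s.toFun y) ((s'.right y).trans
      (s.right y).symm)) :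
    TwHom (RealHom.id H) (fun y => T.deg (T.proj.arr (d y))) (pullback (s.hom hP) T)
      (pullback (s'.hom hP) T) := by
  let T' := pullback (s.hom hP) T
  have hsrc : ∀ y, T.grpd.src (d y) = P.left (s.toFun y) := fun y => by
    rw [← T.src_proj, hdp, hP.src_div]
  have tp : ∀ x : T'.grpd.Arr, T.proj.arr x.1.1 = (s.hom hP).arr x.1.2 := fun x => x.2
  have trng : ∀ x : T'.grpd.Arr, T.grpd.src (d (H.rng x.1.2)) = T.grpd.rng x.1.1 := fun x => by
    rw [← T.rng_proj, tp, (s.hom hP).rng_arr, hsrc]; rfl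
  have tsrc : ∀ x : T'.grpd.Arr, T.grpd.src x.1.1 = T.grpd.src (d (H.src x.1.2)) := fun x => by
    rw [← T.src_proj, tp, (s.hom hP).src_arr, hsrc]; rfl
  -- Conjugation by the lift of the difference: `t ↦ d(r) t d(s)⁻¹`.
  let F : T'.grpd.Arr → T.grpd.Arr := fun x =>
    T.grpd.conjugate (d (H.rng x.1.2)) x.1.1 (d (H.src x.1.2)) (trng x) (tsrc x)
  -- In `Γ` the homomorphism of `s'` is that of `s` conjugated by the difference of the sections, so
  -- conjugation in the twist lies over the right map.
  have key : ∀ h : H.Arr, ∀ e e', (s'.hom hP).arr h = Γ.conjugate (T.proj.arr (d (H.rng h)))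
      ((s.hom hP).arr h) (T.proj.arr (d (H.src h))) e e' := by
    intro h e e'
    have k1 : Γ.src ((s.hom hP).arr h) = P.left (s.toFun (H.src h)) := (s.hom hP).src_arr h
    have k2 : Γ.src (T.proj.arr (d (H.src h))) = P.left (s.toFun (H.src h)) := by
      rw [T.src_proj, hsrc]
    have k3 : Γ.src (T.proj.arr (d (H.rng h))) = P.left (s.toFun (H.rng h)) := by
      rw [T.src_proj, hsrc]
    have k4 : Γ.src (Γ.inv (T.proj.arr (d (H.src h)))) = P.left (s'.toFun (H.src h)) := by
      rw [Γ.src_inv, hdp, hP.rng_div]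
    have hl : ∀ y e, P.lact (T.proj.arr (d y)) (s.toFun y) e = s'.toFun y := fun y e =>
      (P.lact_congr (hdp y) rfl _ (hP.src_div _ _ _)).trans (hP.lact_div _ _ _ _)
    have k5 : P.lact (Γ.inv (T.proj.arr (d (H.src h)))) (s'.toFun (H.src h)) k4 =
        s.toFun (H.src h) :=
      (P.lact_congr rfl (hl _ k2).symm _ (by rw [Γ.src_inv, P.left_lact])).trans
        (P.inv_lact_lact _ _ _ _)
    refine s'.hom_eq hP (e := (Γ.src_mul _ _ _).trans k4) (e' := s'.ract_composable h) ?_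
    refine (P.mul_lact _ _ _ _ k4).trans ?_
    refine (P.lact_congr rfl k5 _ ((Γ.src_mul _ _ _).trans k1)).trans ?_
    refine (P.mul_lact _ _ _ e k1).trans ?_
    refine (P.lact_congr rfl (s.lact_hom hP h k1 (s.ract_composable h)) _
      (k3.trans (P.left_ract _ _ _).symm)).trans ?_
    refine (P.lact_ract _ _ _ k3 (s.ract_composable h)).trans ?_
    exact P.ract_congr (hl _ _) rfl _ _
  have hF : IsTwHom (s'.hom hP) T' T F := by
    refine ⟨?_, fun x => ?_, fun c x => ?_, fun x => ?_, fun x x' e e' => ?_⟩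
    · have c1 : Continuous fun x : T'.grpd.Arr => x.1.1 :=
        continuous_fst.comp continuous_subtype_val
      have c2 : Continuous fun x : T'.grpd.Arr => x.1.2 :=
        continuous_snd.comp continuous_subtype_val
      exact T.grpd.continuous_conjugate (hd.comp (H.continuous_rng.comp c2)) c1
        (hd.comp (H.continuous_src.comp c2)) _ _
    · have e1 : Γ.src (T.proj.arr (d (H.rng x.1.2))) = Γ.rng (T.proj.arr x.1.1) := by
        rw [T.src_proj, T.rng_proj, trng]
      have e2 : Γ.src (T.proj.arr x.1.1) = Γ.src (T.proj.arr (d (H.src x.1.2))) := by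
        rw [T.src_proj, T.src_proj, tsrc]
      have e3 : T.proj.arr (F x) = Γ.conjugate _ _ _ e1 e2 :=
        (T.proj_mul _ _ _).trans (Γ.mul_congr _ (T.proj_mul _ _ _) (T.proj.inv_arr _))
      rw [e3]
      exact (Γ.conjugate_congr rfl (tp x) rfl _ _ (tp x ▸ e1) (tp x ▸ e2)).trans
        (key x.1.2 _ _).symm
    · refine (T.grpd.mul_congr _ (T.mul_act c _ _ (trng x) _) rfl).trans ?_
      exact T.act_mul c _ _ _ _
    · refine Eq.trans ?_ (T.grpd.conjugate_conj _ _ _ _ _ (by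
        rw [T.grpd.src_conj, T.grpd.rng_conj, trng]) (by
        rw [T.grpd.src_conj, T.grpd.src_conj, tsrc]))
      refine T.grpd.conjugate_congr ?_ rfl ?_ _ _ _ _
      · exact (congrArg d (H.rng_conj _)).trans (hdc _)
      · exact (congrArg d (H.src_conj _)).trans (hdc _)
    · have e1 : H.src x.1.2 = H.rng x'.1.2 := e
      have e2 : T.grpd.src x.1.1 = T.grpd.rng x'.1.1 := by rw [tsrc, ← trng, e1]
      have e3 : T.grpd.src (d (H.src x.1.2)) = T.grpd.rng x'.1.1 := by rw [e1, trng]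
      have e4 : F x' = T.grpd.conjugate (d (H.src x.1.2)) x'.1.1 (d (H.src x'.1.2)) e3 (tsrc x') :=
        T.grpd.conjugate_congr (by rw [e1]) rfl rfl _ _ _ _
      have e5 : T.grpd.src (d (H.rng x.1.2)) = T.grpd.rng (T.grpd.mul x.1.1 x'.1.1 e2) := by
        rw [T.grpd.rng_mul, trng]
      refine Eq.trans ?_ ((T.grpd.mul_congr e' rfl e4).trans
        (T.grpd.conjugate_mul_conjugate _ _ _ _ _ e2 e5)).symm
      exact T.grpd.conjugate_congr (congrArg d (H.rng_mul _ _ _)) rfl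
        (congrArg d (H.src_mul _ _ _)) _ _ _ _
  refine TwHom.iso_pullback ⟨⟨F, hF⟩, T.continuous_deg.comp (T.proj.continuous_arr.comp hd),
    fun y => by rw [hdc, T.proj.conj_arr, T.deg_conj], fun g => ?_⟩
  have e1 : Γ.src (T.proj.arr (d (H.rng g))) = Γ.rng ((s.hom hP).arr g) := by
    rw [T.src_proj, hsrc, (s.hom hP).rng_arr]; rfl
  have e2 : Γ.src ((s.hom hP).arr g) = Γ.src (T.proj.arr (d (H.src g))) := by
    rw [T.src_proj, hsrc, (s.hom hP).src_arr]; rfl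
  change T.deg ((s.hom hP).arr g) = _
  rw [key g e1 e2]
  simp only [RealGroupoid.conjugate, T.deg_mul, T.deg_inv]
  -- Degrees are additive and invariant under inversion, so conjugation by `d` changes the grading
  -- by the coboundary of the degree of `d`.
  linear_combination -CharTwo.add_self_eq_zero (T.deg (T.proj.arr (d (H.rng g)))) -
    CharTwo.add_self_eq_zero (T.deg (T.proj.arr (d (H.src g))))

end Sections

/-! ### The class of an extension over covers -/

section CoverClass

variable {Y X : RealSpace.{u}} {Γ : RealGroupoid Y} {G : RealGroupoid X} {S : RealAbelianGroup.{u}}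
  {P : RealBibundle Γ G}

namespace RealBibundle.SectionAlong

/-- The restriction of a section to a finer cover. -/
def refine {U V : RealCover X} (s : P.SectionAlong (U.toBase G)) (θ : U.Refinement V) :
    P.SectionAlong (V.toBase G) where
  toFun y := s.toFun (θ.map y)
  continuous := s.continuous.comp θ.continuous_map
  conj y := by rw [θ.map_conj, s.conj]
  right y := s.right _

/-- The class of the twist that is induced by a section over a cover. -/
noncomputable def coverTw {V : RealCover X} (s : P.SectionAlong (V.toBase G))
    (hP : P.IsLeftPrincipal) (T : RealTwist Γ S) : CoverTw G S :=
  CoverTw.mk V (pullback (s.hom hP) T)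

theorem coverTw_refine {U V : RealCover X} (s : P.SectionAlong (U.toBase G))
    (hP : P.IsLeftPrincipal) (T : RealTwist Γ S) (θ : U.Refinement V) :
    (s.refine θ).coverTw hP T = s.coverTw hP T :=
  (CoverTw.sound (θ := θ) (TwHom.to_pullback (twHom_pullback ((s.refine θ).hom hP) T)
    fun _ => rfl)).symm

/-- The class of the induced twist does not depend on the section. -/
theorem coverTw_eq {U V : RealCover X} (s : P.SectionAlong (U.toBase G))
    (s' : P.SectionAlong (V.toBase G)) (hP : P.IsLeftPrincipal) (T : RealTwist Γ S) :
    s.coverTw hP T = s'.coverTw hP T := by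
  -- Both sections are moved to a common refinement, where they can be compared pointwise.
  rw [← s.coverTw_refine hP T (.fst U V), ← s'.coverTw_refine hP T (.snd U V)]
  generalize s.refine (.fst U V) = s
  generalize s'.refine (.snd U V) = s'
  have e : ∀ y, P.right (s'.toFun y) = P.right (s.toFun y) := fun y =>
    (s'.right y).trans (s.right y).symm
  let d : (U.prod V).space → Γ.Arr := fun y => hP.div (s'.toFun y) (s.toFun y) (e y)
  have hd : Continuous d := hP.continuous_div s'.continuous s.continuous _
  have hdc : ∀ y, d ((U.prod V).space.conj y) = Γ.Arr.conj (d y) := fun y => by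
    refine Eq.trans ?_ (hP.div_conj _ _ (e y) (by rw [P.right_conj, P.right_conj, e]))
    simp only [d, s.conj, s'.conj]
  -- The difference `d` has values in `Γ`. The pull-back of the twist along `d` is a principal
  -- bundle over the cover space, and a Real section of it after refinement is a lift of `d`.
  obtain ⟨W, θ, t, ht, htc, hq⟩ := (U.prod V).exists_section
    (Q := RealSpace.fprod d T.proj.arr hd T.proj.continuous_arr hdc T.proj.conj_arr)
    (q := fun z => z.1.1)
    (T.principal.locallySplit.lift hd (fun z => z) continuous_id fun _ => rfl) fun _ => rfl
  rw [← s.coverTw_refine hP T θ, ← s'.coverTw_refine hP T θ]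
  refine (CoverTw.mk_eq_of_twHom_id ((s.refine θ).twHom_of_lift (s'.refine θ) hP T
    (fun y => (t y).1.2) (continuous_snd.comp (continuous_subtype_val.comp ht))
    (fun y => by rw [htc]) fun y => ?_)).symm
  rw [← (t y).2, hq]
  rfl

end RealBibundle.SectionAlong

theorem RealBibundle.exists_sectionAlong (P : RealBibundle Γ G) (hP : P.IsLeftPrincipal) :
    ∃ V : RealCover X, Nonempty (P.SectionAlong (V.toBase G)) := by
  obtain ⟨V, s, hs, hsc, h⟩ := RealCover.exists_base_section hP.1 P.right_conj
  exact ⟨V, ⟨s, hs, hsc, h⟩⟩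

/-- The class of twists over cover groupoids that is determined by an extension. -/
noncomputable def RealExtension.coverTw (E : RealExtension G S) : CoverTw G S :=
  (E.P.exists_sectionAlong E.morita.2).choose_spec.some.coverTw E.morita.2 E.T

theorem RealExtension.coverTw_eq (E : RealExtension G S) {V : RealCover X}
    (s : E.P.SectionAlong (V.toBase G)) : E.coverTw = s.coverTw E.morita.2 E.T :=
  RealBibundle.SectionAlong.coverTw_eq _ _ _ _

end CoverClass

/-! ### Equivalent extensions have the same class -/

section MoritaInvariance

variable {Y₁ Y₂ X Z : RealSpace.{u}} {Γ₁ : RealGroupoid Y₁} {Γ₂ : RealGroupoid Y₂}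
  {G : RealGroupoid X} {H : RealGroupoid Z} {S : RealAbelianGroup.{u}}

theorem RealGroupoid.inv_mul_rev {g h : G.Arr} (e : G.src g = G.rng h)
    (e' : G.src (G.inv h) = G.rng (G.inv g)) :
    G.inv (G.mul g h e) = G.mul (G.inv h) (G.inv g) e' := by
  refine G.mul_left_cancel (g := G.mul g h e) (G.rng_inv _).symm
    (by rw [G.src_mul, G.rng_mul, G.rng_inv]) ?_
  rw [G.mul_inv, G.rng_mul, G.mul_assoc _ _ _ e (by rw [G.rng_mul, G.rng_inv])]
  refine ((G.mul_congr _ rfl (G.mul_inv_cancel_left (e.symm.trans (G.rng_inv g).symm))).trans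
    (G.mul_inv g)).symm

/-- Makes equality of classes in the composite equivalent to the existence of a single connecting
arrow. -/
theorem compRel_equivalence (W : RealBibundle Γ₁ Γ₂) (P : RealBibundle Γ₂ G) :
    Equivalence (compRel W P) where
  refl a := by
    refine ⟨Γ₂.unit (W.right a.1.1), (Γ₂.rng_unit _).symm, ?_, Prod.ext (W.ract_unit _).symm ?_⟩
    · rw [Γ₂.src_inv, Γ₂.rng_unit, a.2]
    · exact (P.unit_lact' _ (by rw [Γ₂.inv_unit, a.2])).symm
  symm := by
    rintro ⟨⟨w, p⟩, h⟩ ⟨b, h'⟩ ⟨γ, e, e', rfl⟩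
    have k : Γ₂.src (Γ₂.inv (Γ₂.inv γ)) = P.left (P.lact (Γ₂.inv γ) p e') := by
      rw [Γ₂.src_inv, P.left_lact]
    exact ⟨Γ₂.inv γ, (W.right_ract _ _ _).trans (Γ₂.rng_inv _).symm, k, Prod.ext
      (W.ract_ract_inv _ _ _ _).symm (P.inv_lact_lact _ _ _ _).symm⟩
  trans := by
    rintro ⟨⟨w, p⟩, h⟩ ⟨b, h'⟩ ⟨b', h''⟩ ⟨γ, e, e', rfl⟩ ⟨γ', f, f', rfl⟩
    have k : Γ₂.src γ = Γ₂.rng γ' := (W.right_ract w γ e).symm.trans f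
    have k1 : Γ₂.src (Γ₂.inv γ') = Γ₂.rng (Γ₂.inv γ) := by rw [Γ₂.src_inv, Γ₂.rng_inv, k]
    have k2 : Γ₂.inv (Γ₂.mul γ γ' k) = Γ₂.mul (Γ₂.inv γ') (Γ₂.inv γ) k1 := Γ₂.inv_mul_rev _ _
    have k3 : Γ₂.src (Γ₂.mul (Γ₂.inv γ') (Γ₂.inv γ) k1) = P.left p := (Γ₂.src_mul _ _ _).trans e'
    refine ⟨Γ₂.mul γ γ' k, e.trans (Γ₂.rng_mul _ _ _).symm, k2 ▸ k3, Prod.ext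
      (W.ract_mul _ _ _ e k).symm ?_⟩
    exact (P.mul_lact _ _ _ k1 e').symm.trans (P.lact_congr k2.symm rfl _ _)

/-- The right action on `Z / S` is free. -/
theorem IsSQuotient.free {T₁ : RealTwist Γ₁ S} {T₂ : RealTwist Γ₂ S}
    {Z : RealBibundle T₁.grpd T₂.grpd} {a : S → Z.Total → Z.Total} {W : RealBibundle Γ₁ Γ₂}
    (hZ : Z.IsMorita) (ha : IsSEquivariant T₁ T₂ Z a) (hW : IsSQuotient T₁ T₂ Z a W)
    {w : W.Total} {γ : Γ₂.Arr} {e} (h : W.ract w γ e = w) : γ = Γ₂.unit (W.right w) := by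
  obtain ⟨q, hl, hr, hc, hla, hra⟩ := hW
  obtain ⟨⟨z⟩, rfl⟩ := q.surjective w
  obtain ⟨t, rfl⟩ := T₂.principal.locallySplit.1 γ
  have e1 : Z.right z = T₂.grpd.rng t := by rw [← T₂.rng_proj, ← e]; exact (hr z).symm
  rw [hra z t e1] at h
  have heq : Equivalence fun z z' : Z.Total => ∃ c : S, z' = a c z :=
    ⟨fun z => ⟨1, (ha.one_act z).symm⟩, by
      rintro x _ ⟨c, rfl⟩
      exact ⟨c⁻¹, by rw [← ha.mul_act, inv_mul_cancel, ha.one_act]⟩, by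
      rintro x _ _ ⟨c, rfl⟩ ⟨d, rfl⟩
      exact ⟨d * c, by rw [ha.mul_act]⟩⟩
  -- Fixing the class of `z` means `z t = c z` for some scalar `c`. Since `c z` is also `z` times
  -- the unit scaled by `c`, freeness on `Z` shows that `t` is a scaled unit and projects to a unit.
  obtain ⟨c, hc'⟩ := heq.quot_mk_eq.mp (q.injective h.symm)
  have u1 : T₁.grpd.src (T₁.grpd.unit (Z.left z)) = Z.left z := T₁.grpd.src_unit _
  have u2 : Z.right z = T₂.grpd.rng (T₂.grpd.unit (Z.right z)) := (T₂.grpd.rng_unit _).symm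
  have k1 : Z.right (Z.lact (T₁.grpd.unit (Z.left z)) z u1) = T₂.grpd.rng (T₂.grpd.unit
    (Z.right z)) := (Z.right_lact _ _ _).trans u2
  have u3 : T₁.grpd.src (T₁.grpd.unit (Z.left z)) = Z.left (a c z) := u1.trans (ha.left_act _ _).symm
  have key := ha.act_right c (T₁.grpd.unit (Z.left z)) z (T₂.grpd.unit (Z.right z)) u3
    ((Z.right_lact _ _ _).trans ((ha.right_act _ _).trans u2)) u1
    (k1.trans (T₂.rng_act _ _).symm)
  have k2 : Z.ract z (T₂.act c (T₂.grpd.unit (Z.right z))) (u2.trans (T₂.rng_act _ _).symm) =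
      a c z := by
    refine (Z.ract_congr (Z.unit_lact z).symm rfl _ _).trans (key.symm.trans ?_)
    refine (Z.ract_unit' _ ?_).trans (Z.unit_lact' _ ?_)
    · rw [Z.right_lact, ha.right_act]
    · rw [ha.left_act]
  have k3 : t = T₂.act c (T₂.grpd.unit (Z.right z)) := hZ.1.free (hc'.trans k2.symm)
  rw [k3, T₂.principal.proj_act, T₂.proj_unit]
  exact congrArg Γ₂.unit (hr z).symm

/-- The equivariance conditions compare scalars only between a left and a right factor. Taking the
right factor to be a unit lets a scalar pass from a left arrow to the right side. -/
theorem IsSEquivariant.lact_act {T₁ : RealTwist Γ₁ S} {T₂ : RealTwist Γ₂ S}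
    {Z : RealBibundle T₁.grpd T₂.grpd} {a : S → Z.Total → Z.Total} (ha : IsSEquivariant T₁ T₂ Z a)
    (c : S) (t : T₁.grpd.Arr) (z : Z.Total) (e e' e'') :
    Z.lact (T₁.act c t) z e = Z.ract (Z.lact t z e') (T₂.act c (T₂.grpd.unit (Z.right z))) e'' := by
  have u2 : Z.right z = T₂.grpd.rng (T₂.grpd.unit (Z.right z)) := (T₂.grpd.rng_unit _).symm
  have u3 : T₁.grpd.src t = Z.left (a c z) := e'.trans (ha.left_act _ _).symm
  have k1 : Z.right (Z.lact t (a c z) u3) = T₂.grpd.rng (T₂.grpd.unit (Z.right z)) := by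
    rw [Z.right_lact, ha.right_act, ← u2]
  refine (Z.ract_unit' ((Z.right_lact _ _ _).trans u2) (by rw [Z.right_lact])).symm.trans ?_
  exact (ha.act_left c t z _ e _ u3 k1).trans (ha.act_right c t z _ u3 k1 e' e'')

/-- An isomorphism of the gradings is a function that compares the two actions. -/
theorem exists_grading {T₁ : RealTwist Γ₁ S} {T₂ : RealTwist Γ₂ S} {W : RealBibundle Γ₁ Γ₂}
    {D₁ : RealBibundle Γ₁ RealGroupoid.Z2.{u}} {D₂ : RealBibundle Γ₂ RealGroupoid.Z2.{u}}
    (h₁ : RealBibundle.IsGraph T₁.degHom D₁) (h₂ : RealBibundle.IsGraph T₂.degHom D₂)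
    (h : IsComposite W D₂ D₁) : ∃ b : W.Total → ZMod 2, Continuous b ∧
      (∀ w, b (W.Total.conj w) = b w) ∧ (∀ γ w e, b (W.lact γ w e) = T₁.deg γ + b w) ∧
      ∀ w γ e, b (W.ract w γ e) = b w + T₂.deg γ := by
  obtain ⟨k₁, l₁, r₁, c₁, la₁, ra₁⟩ := h₁
  obtain ⟨k₂, l₂, r₂, c₂, la₂, ra₂⟩ := h₂
  obtain ⟨m, ml, mr, mc, mla, mra⟩ := h
  let u : Y₂ → {p : Y₂ × RealGroupoid.Z2.{u}.Arr // T₂.degHom.obj p.1 = RealGroupoid.Z2.rng p.2} :=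
    fun y => ⟨(y, ULift.up 0), rfl⟩
  let v : Y₁ → ZMod 2 →
      {p : Y₁ × RealGroupoid.Z2.{u}.Arr // T₁.degHom.obj p.1 = RealGroupoid.Z2.rng p.2} :=
    fun y ε => ⟨(y, ULift.up ε), rfl⟩
  let j : W.Total → {p : W.Total × D₂.Total // W.right p.1 = D₂.left p.2} :=
    fun w => ⟨(w, k₂ (u (W.right w))), (l₂ (u (W.right w))).symm⟩
  -- Each `w` is paired with the point of degree `0` in the second grading bundle. The
  -- `ℤ/2`-coordinate of its image in the first one is `b w`.
  let f : W.Total → D₁.Total := fun w => m (Quot.mk _ (j w))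
  let b : W.Total → ZMod 2 := fun w => (k₁.symm (f w)).1.2.down
  have hb : ∀ w, f w = k₁ (v (W.left w) (b w)) := by
    intro w
    rw [← k₁.symm_apply_eq]
    refine Subtype.ext (Prod.ext ?_ rfl)
    rw [← l₁, k₁.apply_symm_apply]
    exact ml (j w)
  have hb' : ∀ w y ε, f w = k₁ (v y ε) → b w = ε := by
    intro w y ε e
    exact congrArg (fun p => p.1.2.down) ((k₁.symm_apply_eq).mpr e)
  have hf : Continuous f := m.continuous.comp (continuous_quot_mk.comp (Continuous.subtype_mk
    (continuous_id.prodMk (k₂.continuous.comp (Continuous.subtype_mk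
      (W.continuous_right.prodMk continuous_const) _))) _))
  refine ⟨b, ?_, fun w => ?_, fun γ w e => ?_, fun w γ e => ?_⟩
  · have hv : Continuous fun p : {p : Y₁ × RealGroupoid.Z2.{u}.Arr //
        T₁.degHom.obj p.1 = RealGroupoid.Z2.rng p.2} => p.1.2.down :=
      continuous_uliftDown.comp (continuous_snd.comp continuous_subtype_val)
    exact hv.comp (k₁.symm.continuous.comp hf)
  · refine hb' _ (Y₁.conj (W.left w)) _ ?_
    have e1 : k₂ (u (W.right (W.Total.conj w))) = D₂.Total.conj (k₂ (u (W.right w))) :=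
      c₂ _ _ (Prod.ext (W.right_conj w) rfl)
    refine (mc (j w) (j (W.Total.conj w)) (Prod.ext rfl e1)).trans ?_
    exact (congrArg D₁.Total.conj (hb w)).trans (c₁ _ _ rfl).symm
  · refine hb' _ (Γ₁.rng γ) _ ?_
    have e1 : Γ₁.src γ = D₁.left (f w) := e.trans (ml (j w)).symm
    refine (mla γ (j w) (j (W.lact γ w e)) e (Prod.ext rfl (congrArg (fun y => k₂ (u y))
      (W.right_lact γ w e))) e1).symm.trans ?_
    refine (D₁.lact_congr rfl (hb w) _ (hb w ▸ e1)).trans ?_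
    exact la₁ γ _ _ rfl rfl _
  · refine hb' _ (W.left w) _ ?_
    have e1 : Γ₂.src γ = D₂.left (k₂ (u (Γ₂.src γ))) := (l₂ (u (Γ₂.src γ))).symm
    have e2 : D₂.lact γ (k₂ (u (Γ₂.src γ))) e1 = k₂ ⟨(Γ₂.rng γ, ULift.up (T₂.deg γ + 0)), rfl⟩ :=
      la₂ γ _ _ rfl rfl _
    have e3 : W.right w = D₂.left (k₂ ⟨(Γ₂.rng γ, ULift.up (T₂.deg γ + 0)), rfl⟩) :=
      e.trans (l₂ ⟨(Γ₂.rng γ, ULift.up (T₂.deg γ + 0)), rfl⟩).symm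
    -- In the composite the arrow `γ` is moved from `w` to the grading bundle, where it shifts the
    -- coordinate by its degree.
    have e4 : f (W.ract w γ e) = m (Quot.mk _ ⟨(w, k₂ ⟨(Γ₂.rng γ, ULift.up (T₂.deg γ + 0)), rfl⟩),
        e3⟩) := by
      refine congrArg m (Quot.sound ⟨γ, e, ?_, Prod.ext rfl ?_⟩).symm
      · exact (Γ₂.src_inv γ).trans (l₂ ⟨(Γ₂.rng γ, ULift.up (T₂.deg γ + 0)), rfl⟩).symm
      · refine (congrArg (fun y => k₂ (u y)) (W.right_ract w γ e)).trans ?_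
        exact (D₂.inv_lact_lact γ _ e1 (by rw [Γ₂.src_inv, D₂.left_lact])).symm.trans
          (D₂.lact_congr rfl e2 _ _)
    have e5 : D₂.right (k₂ (u (W.right w))) = RealGroupoid.Z2.rng (ULift.up (T₂.deg γ)) := rfl
    have e6 : D₂.ract (k₂ (u (W.right w))) (ULift.up (T₂.deg γ)) e5 =
        k₂ ⟨(Γ₂.rng γ, ULift.up (T₂.deg γ + 0)), rfl⟩ :=
      ra₂ _ _ _ rfl (Prod.ext e.symm (congrArg ULift.up (add_comm _ _))) _
    have e7 : D₁.right (f w) = RealGroupoid.Z2.rng (ULift.up (T₂.deg γ)) := rfl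
    refine e4.trans ((mra (j w) (ULift.up (T₂.deg γ)) _ e5 (Prod.ext rfl e6.symm) e7).symm.trans ?_)
    refine (D₁.ract_congr (hb w) rfl _ rfl).trans ?_
    exact ra₁ _ _ _ rfl rfl _

/-- A section `(z, p)` of `Z ×_{Y₂} P₂` over a cover gives the section `p` of `P₂` and, through `P₁
≅ W ×_{Γ₂} P₂`, the section `[z, p]` of `P₁`. For these the equation `γ z = z' γ'` in `Z` defines a
homomorphism between the two pulled-back twists, and `b` from `exists_grading` compares the
gradings. -/
theorem MoritaRel.coverTw_eq {E₁ E₂ : RealExtension G S} (h : MoritaRel E₁ E₂) :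
    E₁.coverTw = E₂.coverTw := by
  obtain ⟨Z, a, W, D₁, D₂, hZ, ha, hW, hP, hD₁, hD₂, hD⟩ := h
  obtain ⟨b, hb, hbc, hbl, hbr⟩ := exists_grading hD₁ hD₂ hD
  have hfree := fun {w γ e} => hW.free hZ ha (w := w) (γ := γ) (e := e)
  obtain ⟨q, hql, hqr, hqc, hqla, hqra⟩ := hW
  obtain ⟨k, hkl, hkr, hkc, hkla, hkra⟩ := hP
  have hP₁ := E₁.morita.2
  have hP₂ := E₂.morita.2
  obtain ⟨V, t, ht, htc, hq⟩ := RealCover.exists_base_section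
    (Q := RealSpace.fprod Z.right E₂.P.left Z.continuous_right E₂.P.continuous_left Z.right_conj
      E₂.P.left_conj) (q := fun x => E₂.P.right x.1.2)
    (hP₂.1.comp (hZ.2.1.lift E₂.P.continuous_left (q := fun x : {x : Z.Total × E₂.P.Total //
      Z.right x.1 = E₂.P.left x.2} => x.1.2) (fun x => ⟨(x.1.2, x.1.1), x.2.symm⟩)
      (by fun_prop) fun _ => rfl)) (fun z => E₂.P.right_conj _)
  let z : V.space → Z.Total := fun y => (t y).1.1
  let p : V.space → E₂.P.Total := fun y => (t y).1.2
  let w : V.space → W.Total := fun y => q (Quot.mk _ (z y))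
  have hz : Continuous z := continuous_fst.comp (continuous_subtype_val.comp ht)
  have hp : Continuous p := continuous_snd.comp (continuous_subtype_val.comp ht)
  have hw : Continuous w := q.continuous.comp (continuous_quot_mk.comp hz)
  have hzc : ∀ y, z (V.space.conj y) = Z.Total.conj (z y) := fun y => by simp only [z, htc]
  have hpc : ∀ y, p (V.space.conj y) = E₂.P.Total.conj (p y) := fun y => by simp only [p, htc]
  have hwc : ∀ y, w (V.space.conj y) = W.Total.conj (w y) := fun y => by
    simp only [w, hzc, hqc]
  have hwp : ∀ y, W.right (w y) = E₂.P.left (p y) := fun y => (hqr _).trans (t y).2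
  let s₂ : E₂.P.SectionAlong (V.toBase G) := ⟨p, hp, hpc, hq⟩
  let s₁ : E₁.P.SectionAlong (V.toBase G) :=
    { toFun := fun y => k (Quot.mk _ ⟨(w y, p y), hwp y⟩)
      continuous := k.continuous.comp (continuous_quot_mk.comp
        (Continuous.subtype_mk (hw.prodMk hp) _))
      conj := fun y => hkc _ _ (Prod.ext (hwc y) (hpc y))
      right := fun y => (hkr _).trans (hq y) }
  have hs₁ : ∀ y, E₁.P.left (s₁.toFun y) = Z.left (z y) := fun y => (hkl _).trans (hql _)
  rw [E₁.coverTw_eq s₁, E₂.coverTw_eq s₂]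
  let H := V.groupoid G
  let T' := pullback (s₁.hom hP₁) E₁.T
  have tp : ∀ x : T'.grpd.Arr, E₁.T.proj.arr x.1.1 = (s₁.hom hP₁).arr x.1.2 := fun x => x.2
  have tsrc : ∀ x : T'.grpd.Arr, E₁.T.grpd.src x.1.1 = Z.left (z (H.src x.1.2)) := fun x => by
    rw [← E₁.T.src_proj, tp, (s₁.hom hP₁).src_arr]; exact hs₁ _
  have trng : ∀ x : T'.grpd.Arr, E₁.T.grpd.rng x.1.1 = Z.left (z (H.rng x.1.2)) := fun x => by
    rw [← E₁.T.rng_proj, tp, (s₁.hom hP₁).rng_arr]; exact hs₁ _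
  have tl : ∀ x : T'.grpd.Arr, Z.left (z (H.rng x.1.2)) =
      Z.left (Z.lact x.1.1 (z (H.src x.1.2)) (tsrc x)) := fun x => by rw [Z.left_lact, trng]
  -- The arrow `γ'` with `γ z = z' γ'`, for `z` and `z'` the values of the section at source and
  -- range.
  let F : T'.grpd.Arr → E₂.T.grpd.Arr := fun x => hZ.1.div _ _ (tl x)
  have Fr : ∀ x, Z.right (z (H.rng x.1.2)) = E₂.T.grpd.rng (F x) := fun x => hZ.1.rng_div _ _ _
  have Fz : ∀ x, Z.ract (z (H.rng x.1.2)) (F x) (Fr x) =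
    Z.lact x.1.1 (z (H.src x.1.2)) (tsrc x) := fun x => hZ.1.ract_div _ _ _ _
  have Fs : ∀ x, E₂.T.grpd.src (F x) = Z.right (z (H.src x.1.2)) := fun x =>
    (hZ.1.src_div _ _ _).trans (Z.right_lact _ _ _)
  have Wr : ∀ x : T'.grpd.Arr, W.right (w (H.rng x.1.2)) = E₂.Γ.rng (E₂.T.proj.arr (F x)) :=
    fun x => (hqr _).trans ((Fr x).trans (E₂.T.rng_proj _).symm)
  have Wl : ∀ x : T'.grpd.Arr, E₁.Γ.src (E₁.T.proj.arr x.1.1) = W.left (w (H.src x.1.2)) :=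
    fun x => (E₁.T.src_proj _).trans ((tsrc x).trans (hql _).symm)
  have hW : ∀ x : T'.grpd.Arr, W.lact (E₁.T.proj.arr x.1.1) (w (H.src x.1.2)) (Wl x) =
      W.ract (w (H.rng x.1.2)) (E₂.T.proj.arr (F x)) (Wr x) := fun x =>
    (hqla _ _ (tsrc x) _).trans ((congrArg (fun v => q (Quot.mk _ v)) (Fz x).symm).trans
      (hqra _ _ (Fr x) _).symm)
  have pl : ∀ x : T'.grpd.Arr, E₂.Γ.src (E₂.T.proj.arr (F x)) = E₂.P.left (p (H.src x.1.2)) :=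
    fun x => (E₂.T.src_proj _).trans ((Fs x).trans (t _).2)
  have Fp : ∀ x : T'.grpd.Arr, E₂.T.proj.arr (F x) = (s₂.hom hP₂).arr x.1.2 := by
    intro x
    symm
    refine s₂.hom_eq hP₂ (e := pl x) (e' := s₂.ract_composable _) ?_
    have e1 : W.right (w (H.rng x.1.2)) = E₂.P.left (E₂.P.lact (E₂.T.proj.arr (F x))
        (p (H.src x.1.2)) (pl x)) := (Wr x).trans (E₂.P.left_lact _ _ _).symm
    have e2 : W.right (w (H.rng x.1.2)) = E₂.P.left (E₂.P.ract (p (H.rng x.1.2))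
        ((V.toBase G).arr x.1.2) (s₂.ract_composable _)) :=
      (hwp _).trans (E₂.P.left_ract _ _ _).symm
    have e3 : W.right (W.ract (w (H.rng x.1.2)) (E₂.T.proj.arr (F x)) (Wr x)) =
        E₂.P.left (p (H.src x.1.2)) := (W.right_ract _ _ _).trans (pl x)
    have e4 : E₁.Γ.src ((s₁.hom hP₁).arr x.1.2) = E₁.P.left (s₁.toFun (H.src x.1.2)) :=
      (s₁.hom hP₁).src_arr _
    -- With `w`, `w'` the classes of `z`, `z'` and `p'` the value at the range: in the composite
    -- `[w' γ', p] = [γ w, p] = γ [w, p]`, which by definition of the induced homomorphism is `[w',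
    -- p'] g = [w', p' g]`.
    have h1 : k (Quot.mk _ ⟨(_, _), e3⟩) = k (Quot.mk _ ⟨(_, _), e2⟩) := by
      refine Eq.trans ?_ ((s₁.lact_hom hP₁ x.1.2 e4 (s₁.ract_composable _)).trans
        (hkra _ _ _ (s₂.ract_composable x.1.2) rfl _))
      refine Eq.trans (hkla _ ⟨(w (H.src x.1.2), p (H.src x.1.2)), hwp _⟩ _ (Wl x)
        (Prod.ext (hW x).symm rfl) ((Wl x).trans
          (hkl ⟨(w (H.src x.1.2), p (H.src x.1.2)), hwp _⟩).symm)).symm ?_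
      exact E₁.P.lact_congr (tp x) rfl _ _
    have h2 : Quot.mk (compRel W E₂.P) ⟨(_, _), e1⟩ = Quot.mk _ ⟨(_, _), e3⟩ :=
      Quot.sound ⟨E₂.T.proj.arr (F x), Wr x, (E₂.Γ.src_inv _).trans (E₂.P.left_lact _ _ _).symm,
        Prod.ext rfl (E₂.P.inv_lact_lact _ _ _ _).symm⟩
    obtain ⟨γ, f, f', h3⟩ := (compRel_equivalence W E₂.P).quot_mk_eq.mp
      (h2.trans (k.injective h1))
    -- The connecting arrow fixes the first component, so by freeness on `W` it is a unit, and the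
    -- second components agree: `γ' p = p' g`.
    have h4 := hfree (congrArg Prod.fst h3).symm
    refine Eq.symm ((congrArg Prod.snd h3).trans (E₂.P.unit_lact' _ ?_))
    rw [h4, E₂.Γ.inv_unit]
    exact congrArg _ e1
  have hF : IsTwHom (s₂.hom hP₂) T' E₂.T F := by
    have c1 : Continuous fun x : T'.grpd.Arr => x.1.1 :=
      continuous_fst.comp continuous_subtype_val
    have c2 : Continuous fun x : T'.grpd.Arr => x.1.2 :=
      continuous_snd.comp continuous_subtype_val
    refine ⟨?_, Fp, fun c x => ?_, fun x => ?_, fun x x' e e' => ?_⟩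
    · exact hZ.1.continuous_div (hz.comp (H.continuous_rng.comp c2))
        (Z.continuous_lact' c1 (hz.comp (H.continuous_src.comp c2)) _) _
    -- Scaling `F x` is right multiplication by a scaled unit, the form in which
    -- `IsSEquivariant.lact_act` transfers scalars across `Z`.
    · have u1 : E₂.T.grpd.src (F x) = E₂.T.grpd.rng (E₂.T.grpd.unit (Z.right (z (H.src x.1.2)))) :=
        (Fs x).trans (E₂.T.grpd.rng_unit _).symm
      have u2 : E₂.T.grpd.src (F x) = E₂.T.grpd.rng (E₂.T.act c (E₂.T.grpd.unit (Z.right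
        (z (H.src x.1.2))))) := u1.trans (E₂.T.rng_act _ _).symm
      have u3 : E₂.T.grpd.mul (F x) (E₂.T.act c (E₂.T.grpd.unit (Z.right (z (H.src x.1.2))))) u2 =
          E₂.T.act c (F x) := (E₂.T.mul_act c _ _ u1 _).trans
            (congrArg _ (E₂.T.grpd.mul_unit' _ (congrArg _ (Fs x).symm)))
      refine hZ.1.div_eq (e' := (Fr x).trans (E₂.T.rng_act _ _).symm) ?_
      refine (Z.ract_congr rfl u3.symm _ ((Fr x).trans (E₂.T.grpd.rng_mul _ _ _).symm)).trans ?_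
      refine (Z.ract_mul _ _ _ (Fr x) u2).trans ?_
      refine (Z.ract_congr (Fz x) rfl _ ?_).trans (ha.lact_act c _ _ _ _ _).symm
      rw [Z.right_lact, E₂.T.rng_act, E₂.T.grpd.rng_unit]
    · have e1 : z (H.rng (H.Arr.conj x.1.2)) = Z.Total.conj (z (H.rng x.1.2)) :=
        (congrArg z (H.rng_conj _)).trans (hzc _)
      have e2 : z (H.src (H.Arr.conj x.1.2)) = Z.Total.conj (z (H.src x.1.2)) :=
        (congrArg z (H.src_conj _)).trans (hzc _)
      have e3 : Z.right (Z.Total.conj (z (H.rng x.1.2))) =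
          E₂.T.grpd.rng (E₂.T.grpd.Arr.conj (F x)) := by
        rw [Z.right_conj, E₂.T.grpd.rng_conj, Fr]
      refine hZ.1.div_eq (e' := (congrArg Z.right e1).trans e3) ?_
      refine (Z.ract_congr e1 rfl _ e3).trans ((Z.ract_conj _ _ (Fr x)).trans ?_)
      refine (congrArg Z.Total.conj (Fz x)).trans ((Z.lact_conj _ _ (tsrc x)).symm.trans ?_)
      exact Z.lact_congr rfl e2.symm _ _
    · have e1 : H.src x.1.2 = H.rng x'.1.2 := e
      have e2 : E₁.T.grpd.src x.1.1 = E₁.T.grpd.rng x'.1.1 := by rw [tsrc, trng, e1]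
      have e3 : E₁.T.grpd.src x.1.1 = Z.left (z (H.rng x'.1.2)) := e2.trans (trng _)
      refine hZ.1.div_eq (e' := (congrArg (fun y => Z.right (z y)) (H.rng_mul _ _ e1)).trans
        ((Fr x).trans (E₂.T.grpd.rng_mul _ _ _).symm)) ?_
      refine (Z.ract_congr (congrArg z (H.rng_mul _ _ e1)) rfl _ ((Fr x).trans
        (E₂.T.grpd.rng_mul _ _ _).symm)).trans ?_
      refine (Z.ract_mul _ _ _ (Fr x) e').trans ?_
      have e4 : Z.right (Z.lact x.1.1 (z (H.rng x'.1.2)) e3) = E₂.T.grpd.rng (F x') :=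
        (Z.right_lact _ _ _).trans (Fr x')
      refine (Z.ract_congr ((Fz x).trans (Z.lact_congr rfl (congrArg z e1) _ e3)) rfl _ e4).trans ?_
      refine (Z.lact_ract _ _ _ e3 (Fr x')).symm.trans ?_
      refine (Z.lact_congr rfl (Fz x') _ (e2.trans (Z.left_lact _ _ _).symm)).trans ?_
      refine (Z.mul_lact _ _ _ e2 (tsrc x')).symm.trans ?_
      exact Z.lact_congr rfl (congrArg z (H.src_mul _ _ e1)).symm _ _
  refine CoverTw.mk_eq_of_twHom_id (c := fun y => b (w y)) (TwHom.iso_pullback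
    ⟨⟨F, hF⟩, hb.comp hw, fun y => ?_, fun g => ?_⟩) |>.symm
  · rw [hwc, hbc]
  · obtain ⟨x, rfl⟩ := T'.principal.locallySplit.1 g
    -- Applying `b` to `γ w = w' γ'` gives `δ₁(γ) + b(w) = b(w') + δ₂(γ')`, so the gradings differ
    -- by the coboundary of `b ∘ w`.
    have h1 := congrArg b (hW x)
    rw [hbl, hbr, tp, Fp] at h1
    change E₁.T.deg ((s₁.hom hP₁).arr x.1.2) = E₂.T.deg ((s₂.hom hP₂).arr x.1.2) +
      b (w (H.rng x.1.2)) + b (w (H.src x.1.2))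
    linear_combination h1 - CharTwo.add_self_eq_zero (b (w (H.src x.1.2)))

end MoritaInvariance

/-! ### The bijection between extension classes and twists over covers -/

section ExtensionClasses

variable {X : RealSpace.{u}} {G : RealGroupoid X} {S : RealAbelianGroup.{u}}

/-- The bibundle `Z_ι` of the homomorphism `G[U] → G`. -/
abbrev RealCover.baseGraph (U : RealCover X) (G : RealGroupoid X) : RealBibundle (U.groupoid G) G :=
  RealBibundle.graph (U.toBase G) U.isEssential_toBase.isOpenMap_graph

theorem RealCover.isMorita_baseGraph (U : RealCover X) (G : RealGroupoid X) :
    (U.baseGraph G).IsMorita :=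
  U.isEssential_toBase.isMorita_graph _

/-- The extension of `G` that is given by a twist over a cover groupoid. -/
abbrev RealTwist.extension {U : RealCover X} (T : RealTwist (U.groupoid G) S) : RealExtension G S :=
  RealExtension.mk T (U.baseGraph G) (U.isMorita_baseGraph G)

/-- A refinement maps the bundles `Z_ι` of the two covers to each other by acting on the cover
component only, so the twist homomorphism is covered by a map of Morita equivalences. -/
theorem TwHom.extension_cls {U V : RealCover X} {θ : U.Refinement V} {c : V.space → ZMod 2}
    {T : RealTwist (U.groupoid G) S} {T' : RealTwist (V.groupoid G) S}
    (h : TwHom (θ.hom G) c T' T) : T.extension.cls = T'.extension.cls :=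
  (h.cls_eq_cls (V.isMorita_baseGraph G) (U.isMorita_baseGraph G)
    (fun z => ⟨(θ.map z.1.1, z.1.2), z.2⟩)
    (Continuous.subtype_mk ((θ.continuous_map.comp (by fun_prop)).prodMk (by fun_prop)) _)
    (fun _ => rfl) (fun _ => rfl)
    (fun _ => Subtype.ext (Prod.ext (θ.map_conj _) rfl)) (fun _ _ _ _ => rfl)
    fun _ _ _ _ => rfl).symm

/-- The section of `Z_ι` that is given by the units. -/
def RealCover.unitSection (V : RealCover X) (G : RealGroupoid X) :
    (V.baseGraph G).SectionAlong (V.toBase G) where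
  toFun y := ⟨(y, G.unit y.1.2), (G.rng_unit _).symm⟩
  continuous := Continuous.subtype_mk (continuous_id.prodMk (G.continuous_unit.comp (by fun_prop))) _
  conj y := Subtype.ext (Prod.ext rfl (G.unit_conj _))
  right y := G.src_unit _

/-- The homomorphism induced by the unit section is the identity of `G[V]`, so the twist is pulled
back to itself. -/
theorem RealTwist.coverTw_extension {V : RealCover X} (T : RealTwist (V.groupoid G) S) :
    T.extension.coverTw = CoverTw.mk V T := by
  rw [RealExtension.coverTw_eq _ (V.unitSection G)]
  refine (CoverTw.mk_eq_of_twHom_id (c := 0) ((twHom_pullback ((V.unitSection G).hom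
    (V.isMorita_baseGraph G).2) T).congr (fun γ => ?_) fun _ => rfl)).symm
  refine (V.unitSection G).hom_eq (V.isMorita_baseGraph G).2 (e := rfl)
    (e' := G.src_unit _) ?_
  exact Subtype.ext (Prod.ext rfl ((G.mul_unit _).trans (G.unit_mul _).symm))

/-- The section defines the map `(y, g) ↦ s(y) g` from `Z_ι` to `E.P` over the induced homomorphism;
equivariance on the left is the equation defining that homomorphism. -/
theorem RealExtension.extension_cls_eq (E : RealExtension G S) {V : RealCover X}
    (s : E.P.SectionAlong (V.toBase G)) :
    (pullback (s.hom E.morita.2) E.T).extension.cls = E.cls := by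
  refine (twHom_pullback (s.hom E.morita.2) E.T).cls_eq_cls (V.isMorita_baseGraph G) E.morita
    (fun z => E.P.ract (s.toFun z.1.1) z.1.2 ((s.right _).trans z.2))
    (E.P.continuous_ract' (s.continuous.comp (by fun_prop)) (by fun_prop) _)
    (fun z => E.P.left_ract _ _ _) (fun z => E.P.right_ract _ _ _) (fun z => ?_)
    (fun γ z e e' => ?_) fun z g e e' => ?_
  · refine (E.P.ract_congr (s.conj _) rfl _ ?_).trans (E.P.ract_conj _ _ _)
    rw [E.P.right_conj, s.right, G.rng_conj]
    exact congrArg X.conj z.2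
  · have e1 : E.P.right (s.toFun ((V.groupoid G).src γ)) = G.rng z.1.2 :=
      (s.right _).trans ((congrArg _ e).trans z.2)
    have e2 : E.Γ.src ((s.hom E.morita.2).arr γ) = E.P.left (s.toFun ((V.groupoid G).src γ)) :=
      (s.hom E.morita.2).src_arr _
    have e3 : G.src ((V.toBase G).arr γ) = G.rng z.1.2 := (congrArg (fun y => y.1.2) e).trans z.2
    refine (E.P.ract_mul _ _ _ (s.ract_composable γ) e3).trans ?_
    refine (E.P.ract_congr (s.lact_hom E.morita.2 γ e2 (s.ract_composable γ)).symm rfl _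
      ((E.P.right_lact _ _ _).trans e1)).trans ?_
    refine (E.P.lact_ract _ _ _ e2 e1).symm.trans ?_
    exact E.P.lact_congr rfl (E.P.ract_congr (congrArg s.toFun e) rfl _ _) _ _
  · exact E.P.ract_mul _ _ _ _ _

/-- The class of extensions that is given by a class of twists over cover groupoids. -/
def CoverTw.toExtR : CoverTw G S → ExtR G S :=
  Quot.lift (fun x => x.2.extension.cls) fun _ _ ⟨_, _, h⟩ => h.extension_cls

variable (G S) in
/-- Extensions correspond to twists over cover groupoids. -/
noncomputable def extREquiv : ExtR G S ≃ CoverTw G S where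
  toFun := Quot.lift RealExtension.coverTw fun _ _ h => h.coverTw_eq
  invFun := CoverTw.toExtR
  left_inv := by
    rintro ⟨E⟩
    obtain ⟨V, ⟨s⟩⟩ := E.P.exists_sectionAlong E.morita.2
    change CoverTw.toExtR E.coverTw = E.cls
    rw [E.coverTw_eq s]
    exact E.extension_cls_eq s
  right_inv := by
    rintro ⟨V, T⟩
    exact T.coverTw_extension

theorem extREquiv_cls (E : RealExtension G S) : extREquiv G S E.cls = E.coverTw := rfl

end ExtensionClasses

/-! ### Pull-back of a groupoid along an open map of units -/

section PullBackGroupoid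

variable {W Y : RealSpace.{u}}

/-- The arrows of the pull-back of a groupoid along a map to its unit space. -/
abbrev RealGroupoid.pullArr (Γ : RealGroupoid Y) (j : W → Y) (hj : Continuous j)
    (hjc : ∀ w, j (W.conj w) = Y.conj (j w)) : RealSpace.{u} where
  carrier := {t : W × Γ.Arr × W // j t.1 = Γ.rng t.2.1 ∧ Γ.src t.2.1 = j t.2.2}
  t2 := inferInstanceAs (T2Space (Subtype _))
  lc := by
    have h1 : IsClosed {t : W × Γ.Arr × W | j t.1 = Γ.rng t.2.1} :=
      isClosed_eq (hj.comp continuous_fst) (Γ.continuous_rng.comp (by fun_prop))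
    have h2 : IsClosed {t : W × Γ.Arr × W | Γ.src t.2.1 = j t.2.2} :=
      isClosed_eq (Γ.continuous_src.comp (by fun_prop)) (hj.comp (by fun_prop))
    exact (h1.inter h2).locallyCompactSpace
  conj t := ⟨(W.conj t.1.1, Γ.Arr.conj t.1.2.1, W.conj t.1.2.2),
    (hjc _).trans ((congrArg Y.conj t.2.1).trans (Γ.rng_conj _).symm),
    (Γ.src_conj _).trans ((congrArg Y.conj t.2.2).trans (hjc _).symm)⟩
  continuous_conj := by
    refine Continuous.subtype_mk (Continuous.prodMk ?_ (Continuous.prodMk ?_ ?_)) _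
    · exact W.continuous_conj.comp (by fun_prop)
    · exact Γ.Arr.continuous_conj.comp (by fun_prop)
    · exact W.continuous_conj.comp (by fun_prop)
  conj_conj t := Subtype.ext (Prod.ext (W.conj_conj _) (Prod.ext (Γ.Arr.conj_conj _)
    (W.conj_conj _)))

variable (Γ : RealGroupoid Y) (j : W → Y) (hj : Continuous j)
  (hjc : ∀ w, j (W.conj w) = Y.conj (j w)) (ho : IsOpenMap j)

/-- The pull-back of a Real groupoid along an open Real map to its unit space. -/
abbrev RealGroupoid.pull : RealGroupoid W where
  Arr := Γ.pullArr j hj hjc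
  rng t := t.1.1
  src t := t.1.2.2
  unit w := ⟨(w, Γ.unit (j w), w), (Γ.rng_unit _).symm, Γ.src_unit _⟩
  inv t := ⟨(t.1.2.2, Γ.inv t.1.2.1, t.1.1), ((Γ.rng_inv _).trans t.2.2).symm,
    (Γ.src_inv _).trans t.2.1.symm⟩
  mul t t' e := ⟨(t.1.1, Γ.mul t.1.2.1 t'.1.2.1 (t.2.2.trans ((congrArg j e).trans t'.2.1)), t'.1.2.2),
    t.2.1.trans (Γ.rng_mul _ _ _).symm, (Γ.src_mul _ _ _).trans t'.2.2⟩
  continuous_rng := by fun_prop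
  continuous_src := by fun_prop
  continuous_unit := Continuous.subtype_mk (continuous_id.prodMk
    ((Γ.continuous_unit.comp hj).prodMk continuous_id)) _
  continuous_inv := Continuous.subtype_mk (Continuous.prodMk (by fun_prop)
    ((Γ.continuous_inv.comp (by fun_prop)).prodMk (by fun_prop))) _
  continuous_mul := Continuous.subtype_mk (Continuous.prodMk (by fun_prop)
    ((Γ.continuous_mul' (by fun_prop) (by fun_prop) _).prodMk (by fun_prop))) _
  isOpenMap_rng := by
    -- The range map is the pull-back along `j` of `(γ, w) ↦ r(γ)`. The latter is open as the
    -- pull-back of the open map `j` followed by the range map of `Γ`.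
    have h1 : IsOpenMap fun x : {x : Γ.Arr × W // Γ.src x.1 = j x.2} => Γ.rng x.1.1 :=
      Γ.isOpenMap_rng.comp (ho.fst_pullback Γ.continuous_src)
    exact isOpenMap_of_comp_surjective (f := fun x : {x : W × {x : Γ.Arr × W //
      Γ.src x.1 = j x.2} // j x.1 = Γ.rng x.2.1.1} => (⟨(x.1.1, x.1.2.1.1, x.1.2.1.2), x.2, x.1.2.2⟩ :
        Γ.pullArr j hj hjc)) (h1.fst_pullback hj) (by fun_prop)
      fun t => ⟨⟨(t.1.1, ⟨(t.1.2.1, t.1.2.2), t.2.2⟩), t.2.1⟩, rfl⟩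
  rng_unit _ := rfl
  src_unit _ := rfl
  rng_mul _ _ _ := rfl
  src_mul _ _ _ := rfl
  rng_inv _ := rfl
  src_inv _ := rfl
  unit_mul t := Subtype.ext (Prod.ext rfl (Prod.ext (Γ.unit_mul' _ (congrArg Γ.unit t.2.1)) rfl))
  mul_unit t := Subtype.ext (Prod.ext rfl (Prod.ext (Γ.mul_unit' _ (congrArg Γ.unit t.2.2.symm)) rfl))
  mul_assoc t t' t'' e e' := Subtype.ext (Prod.ext rfl (Prod.ext (Γ.mul_assoc _ _ _ _ _) rfl))
  mul_inv t := Subtype.ext (Prod.ext rfl (Prod.ext ((Γ.mul_inv _).trans (congrArg Γ.unit t.2.1.symm)) rfl))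
  inv_mul t := Subtype.ext (Prod.ext rfl (Prod.ext ((Γ.inv_mul _).trans (congrArg Γ.unit t.2.2)) rfl))
  rng_conj _ := rfl
  src_conj _ := rfl
  unit_conj w := Subtype.ext (Prod.ext rfl (Prod.ext ((congrArg Γ.unit (hjc w)).trans
    (Γ.unit_conj _)) rfl))
  mul_conj t t' e := Subtype.ext (Prod.ext rfl (Prod.ext (Γ.mul_conj _ _ _) rfl))

/-- The projection of the pull-back of a groupoid. -/
abbrev RealGroupoid.pullHom : RealHom (Γ.pull j hj hjc ho) Γ where
  obj := j
  arr t := t.1.2.1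
  continuous_obj := hj
  continuous_arr := by fun_prop
  rng_arr t := t.2.1.symm
  src_arr t := t.2.2
  unit_arr _ := rfl
  mul_arr _ _ _ := rfl
  conj_obj := hjc
  conj_arr _ := rfl

theorem RealGroupoid.isEssential_pullHom (hs : LocallySplit j) :
    (Γ.pullHom j hj hjc ho).IsEssential where
  faithful t t' h1 h2 h3 := Subtype.ext (Prod.ext h1 (Prod.ext h3 h2))
  exists_lift := ⟨fun t => t, continuous_id, fun _ => ⟨rfl, rfl, rfl⟩⟩
  locallySplit := LocallySplit.comp
    (locallySplit_of_section Γ.unit Γ.continuous_unit Γ.src_unit)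
    (hs.lift Γ.continuous_rng (q := fun x : {x : W × Γ.Arr // j x.1 = Γ.rng x.2} => x.1.2)
      (fun x => ⟨(x.1.2, x.1.1), x.2.symm⟩) (by fun_prop) fun _ => rfl)

end PullBackGroupoid

/-! ### Composites recognized by balanced pairings -/

section Pairing

variable {Y₁ Y₂ X : RealSpace.{u}} {Γ₁ : RealGroupoid Y₁} {Γ₂ : RealGroupoid Y₂}
  {G : RealGroupoid X} {Z : RealBibundle Γ₁ Γ₂} {P : RealBibundle Γ₂ G} {Q : RealBibundle Γ₁ G}

/-- A balanced biequivariant map `Z ×_{Y₂} P → Q` of principal bundles identifies `Q` with the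
composite. -/
theorem isComposite_of_pairing (hZ : Z.IsRightPrincipal) (hP : P.IsRightPrincipal)
    (hQ : Q.IsRightPrincipal) (m : {p : Z.Total × P.Total // Z.right p.1 = P.left p.2} → Q.Total)
    (hm : Continuous m) (left : ∀ a, Q.left (m a) = Z.left a.1.1)
    (right : ∀ a, Q.right (m a) = P.right a.1.2)
    (conj : ∀ a b, b.1 = (Z.Total.conj a.1.1, P.Total.conj a.1.2) → m b = Q.Total.conj (m a))
    (lact : ∀ γ a b e, b.1 = (Z.lact γ a.1.1 e, a.1.2) → ∀ e', Q.lact γ (m a) e' = m b)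
    (ract : ∀ a g b e, b.1 = (a.1.1, P.ract a.1.2 g e) → ∀ e', Q.ract (m a) g e' = m b)
    (balanced : ∀ z γ p e e' e₁ e₂, m ⟨(Z.ract z γ e, p), e₁⟩ = m ⟨(z, P.lact γ p e'), e₂⟩) :
    IsComposite Z P Q := by
  have hr : ∀ a b, compRel Z P a b → m a = m b := by
    rintro ⟨⟨z, p⟩, h⟩ ⟨_, h'⟩ ⟨γ, e, e', rfl⟩
    have e1 : Γ₂.src γ = P.left (P.lact (Γ₂.inv γ) p e') := by rw [P.left_lact, Γ₂.rng_inv]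
    have e2 : P.lact γ (P.lact (Γ₂.inv γ) p e') e1 = p := P.lact_inv_lact _ _ _ _
    refine Eq.symm ((balanced z γ _ e e1 h' (by rw [e2, h])).trans ?_)
    exact congrArg m (Subtype.ext (Prod.ext rfl e2))
  -- By balancing, the first components can be made equal. Then the second components differ by an
  -- arrow of `G`, which fixes the common image in `Q` and is a unit by freeness there.
  have hinj : ∀ a b, m a = m b → Quot.mk (compRel Z P) a = Quot.mk _ b := by
    rintro ⟨⟨z, p⟩, h⟩ ⟨⟨z', p'⟩, h'⟩ hab
    have hl : Z.left z = Z.left z' := by rw [← left ⟨(z, p), h⟩, hab, left]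
    have e1 := hZ.rng_div z z' hl
    have e2 : Γ₂.src (hZ.div z z' hl) = P.left p' := (hZ.src_div z z' hl).trans h'
    have e3 : Z.right z = P.left (P.lact (hZ.div z z' hl) p' e2) :=
      e1.trans (P.left_lact _ _ _).symm
    have e4 : Z.right (Z.ract z (hZ.div z z' hl) e1) = P.left p' :=
      (Z.right_ract _ _ _).trans e2
    have e5 : m ⟨(z', p'), h'⟩ = m ⟨(z, P.lact (hZ.div z z' hl) p' e2), e3⟩ := by
      rw [← balanced _ _ _ e1 e2 e4]
      exact congrArg m (Subtype.ext (Prod.ext (hZ.ract_div _ _ _ _).symm rfl))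
    have e6 : P.left p = P.left (P.lact (hZ.div z z' hl) p' e2) := h.symm.trans e3
    have e7 := hP.rng_div _ _ e6
    have e8 : Q.right (m ⟨(z, p), h⟩) = G.rng (hP.div _ _ e6) := (right _).trans e7
    have e9 : Q.ract (m ⟨(z, p), h⟩) (hP.div _ _ e6) e8 =
        Q.ract (m ⟨(z, p), h⟩) (G.unit (Q.right (m ⟨(z, p), h⟩))) (G.rng_unit _).symm := by
      refine (ract _ _ ⟨(z, P.lact (hZ.div z z' hl) p' e2), e3⟩ e7
        (Prod.ext rfl (hP.ract_div _ _ _ _).symm) e8).trans ?_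
      rw [Q.ract_unit, ← e5, hab]
    have e10 : P.lact (hZ.div z z' hl) p' e2 = p := by
      rw [← hP.ract_div _ _ e6 e7]
      exact P.ract_unit' _ ((hQ.free e9).trans (congrArg G.unit (right _)))
    refine Quot.sound ⟨hZ.div z z' hl, e1, ?_, Prod.ext (hZ.ract_div _ _ _ _).symm ?_⟩
    · exact (Γ₂.src_inv _).trans (e1.symm.trans h)
    · refine (P.inv_lact_lact _ _ e2 ((Γ₂.src_inv _).trans (P.left_lact _ _ _).symm)).symm.trans ?_
      exact P.lact_congr rfl e10 _ _
  have hdiv : ∀ (a : {p : Z.Total × P.Total // Z.right p.1 = P.left p.2}) (x : Q.Total)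
      (e : Z.left a.1.1 = Q.left x), P.right a.1.2 = G.rng (hQ.div (m a) x ((left a).trans e)) :=
    fun a x e => (right a).symm.trans (hQ.rng_div _ _ _)
  -- Any pair over the left unit of `x` becomes a preimage of `x` after its second component is
  -- moved by the difference in `Q`.
  let n : ∀ (a : {p : Z.Total × P.Total // Z.right p.1 = P.left p.2}) (x : Q.Total),
      Z.left a.1.1 = Q.left x → {p : Z.Total × P.Total // Z.right p.1 = P.left p.2} := fun a x e =>
    ⟨(a.1.1, P.ract a.1.2 _ (hdiv a x e)), a.2.trans (P.left_ract _ _ _).symm⟩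
  have hn : ∀ a x e, m (n a x e) = x := fun a x e =>
    (ract a _ (n a x e) (hdiv a x e) rfl (hQ.rng_div _ _ _)).symm.trans (hQ.ract_div _ _ _ _)
  have hs : LocallySplit fun a : {p : Z.Total × P.Total // Z.right p.1 = P.left p.2} =>
      Z.left a.1.1 :=
    hZ.1.comp (hP.1.lift Z.continuous_right (fun x => x) continuous_id fun _ => rfl)
  let E : Quot (compRel Z P) ≃ Q.Total := Equiv.ofBijective (Quot.lift m hr) ⟨by
    rintro ⟨a⟩ ⟨b⟩ h
    exact hinj a b h, fun x => by
    obtain ⟨a, ha⟩ := hs.1 (Q.left x)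
    exact ⟨Quot.mk _ (n a x ha), hn a x ha⟩⟩
  have hE : Continuous E.symm := by
    refine hs.continuous_of_lift Q.continuous_left ?_
    intro V _ i e hi he hei
    have : (fun v => E.symm (i v)) = fun v => Quot.mk _ (n (e v) (i v) (hei v)) :=
      funext fun v => (Equiv.symm_apply_eq _).mpr (hn (e v) (i v) (hei v)).symm
    rw [this]
    exact continuous_quot_mk.comp (Continuous.subtype_mk (Continuous.prodMk (by fun_prop)
      (P.continuous_ract' (by fun_prop) (hQ.continuous_div (hm.comp he) hi _) _)) _)
  exact ⟨⟨E, continuous_quot_lift hr hm, hE⟩, left, right, conj, lact, ract⟩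

end Pairing

theorem RealGroupoid.inv_inv {Y : RealSpace.{u}} (G : RealGroupoid Y) (g : G.Arr) :
    G.inv (G.inv g) = g :=
  G.mul_left_cancel (G.rng_inv _).symm (G.src_inv g) ((G.mul_inv _).trans
    ((congrArg G.unit (G.rng_inv g)).trans (G.inv_mul g).symm))

/-! ### The correspondence `P₁ ×_G P₂⁻¹` -/

section Correspondence

variable {Y₁ Y₂ X : RealSpace.{u}} {Γ₁ : RealGroupoid Y₁} {Γ₂ : RealGroupoid Y₂}
  {G : RealGroupoid X} (P₁ : RealBibundle Γ₁ G) (P₂ : RealBibundle Γ₂ G)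

namespace RealBibundle

/-- The fibre product `P₁ ×_X P₂`. -/
abbrev pairs : RealSpace.{u} :=
  RealSpace.fprod P₁.right P₂.right P₁.continuous_right P₂.continuous_right P₁.right_conj
    P₂.right_conj

/-- The orbit relation of the diagonal action on `P₁ ×_X P₂`. -/
def diagRel (a b : pairs P₁ P₂) : Prop :=
  ∃ g e e', b.1 = (P₁.ract a.1.1 g e, P₂.ract a.1.2 g e')

theorem diagRel_equivalence : Equivalence (diagRel P₁ P₂) where
  refl a := ⟨G.unit (P₁.right a.1.1), (G.rng_unit _).symm, a.2.symm.trans (G.rng_unit _).symm,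
    Prod.ext (P₁.ract_unit _).symm (P₂.ract_unit' _ (congrArg G.unit a.2)).symm⟩
  symm := by
    rintro ⟨⟨p, p'⟩, h⟩ ⟨b, h'⟩ ⟨g, e, e', rfl⟩
    exact ⟨G.inv g, (P₁.right_ract _ _ _).trans (G.rng_inv _).symm,
      (P₂.right_ract _ _ _).trans (G.rng_inv _).symm,
      Prod.ext (P₁.ract_ract_inv _ _ _ _).symm (P₂.ract_ract_inv _ _ _ _).symm⟩
  trans := by
    rintro ⟨⟨p, p'⟩, h⟩ ⟨b, h'⟩ ⟨b', h''⟩ ⟨g, e, e', rfl⟩ ⟨g', f, f', rfl⟩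
    have k : G.src g = G.rng g' := (P₁.right_ract _ _ _).symm.trans f
    exact ⟨G.mul g g' k, e.trans (G.rng_mul _ _ _).symm, e'.trans (G.rng_mul _ _ _).symm,
      Prod.ext (P₁.ract_mul _ _ _ e k).symm (P₂.ract_mul _ _ _ e' k).symm⟩

/-- The saturation of `O` is the projection of an open set of pairs with a composable arrow, and
this projection is open as a pull-back of the range map of `G`. -/
theorem isOpenQuotientMap_diag : IsOpenQuotientMap (Quot.mk (diagRel P₁ P₂)) := by
  refine isOpenQuotientMap_quot (diagRel_equivalence P₁ P₂) fun O hO => ?_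
  let m : {x : pairs P₁ P₂ × G.Arr // P₁.right x.1.1.1 = G.rng x.2} → pairs P₁ P₂ := fun x =>
    ⟨(P₁.ract x.1.1.1.1 x.1.2 x.2, P₂.ract x.1.1.1.2 x.1.2 (x.1.1.2.symm.trans x.2)),
      (P₁.right_ract _ _ _).trans (P₂.right_ract _ _ _).symm⟩
  have hm : Continuous m := Continuous.subtype_mk ((P₁.continuous_ract' (by fun_prop) (by fun_prop)
    _).prodMk (P₂.continuous_ract' (by fun_prop) (by fun_prop) _)) _
  convert G.isOpenMap_rng.fst_pullback (f := fun x : pairs P₁ P₂ => P₁.right x.1.1)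
    (P₁.continuous_right.comp (by fun_prop)) _ (hO.preimage hm) using 1
  ext x
  constructor
  · rintro ⟨⟨y, hy⟩, hO, g, e, e', rfl⟩
    exact ⟨⟨(x, g), e⟩, hO, rfl⟩
  · rintro ⟨⟨⟨x, g⟩, e⟩, hO, rfl⟩
    exact ⟨_, hO, g, e, x.2.symm.trans e, rfl⟩

-- As for tensor products of twists, the orbit relation is an equality of continuous differences on
-- a closed set, which yields the Hausdorff property.
variable {P₁ P₂} in
theorem diagRel_iff (h₁ : P₁.IsRightPrincipal) (h₂ : P₂.IsRightPrincipal) (a b : pairs P₁ P₂) :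
    diagRel P₁ P₂ a b ↔ ∃ h : P₁.left a.1.1 = P₁.left b.1.1 ∧ P₂.left a.1.2 = P₂.left b.1.2,
      h₁.div _ _ h.1 = h₂.div _ _ h.2 := by
  constructor
  · rintro ⟨g, e, e', h⟩
    have h1 : P₁.ract a.1.1 g e = b.1.1 := (congrArg Prod.fst h).symm
    have h2 : P₂.ract a.1.2 g e' = b.1.2 := (congrArg Prod.snd h).symm
    exact ⟨⟨by rw [← h1, P₁.left_ract], by rw [← h2, P₂.left_ract]⟩,
      (h₁.div_eq h1).trans (h₂.div_eq h2).symm⟩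
  · rintro ⟨⟨h, h'⟩, e⟩
    have e1 := h₁.rng_div _ _ h
    have e2 := h₂.rng_div _ _ h'
    refine ⟨_, e1, e2.trans (congrArg G.rng e.symm), Prod.ext (h₁.ract_div _ _ h _).symm ?_⟩
    exact (h₂.ract_div _ _ h' e2).symm.trans (P₂.ract_congr rfl e.symm _ _)

/-- The quotient `P₁ ×_G P₂⁻¹`. -/
abbrev diagSpace (h₁ : P₁.IsRightPrincipal) (h₂ : P₂.IsRightPrincipal) : RealSpace.{u} where
  carrier := Quot (diagRel P₁ P₂)
  t2 := by
    refine t2Space_quot (diagRel_equivalence P₁ P₂) (isOpenQuotientMap_diag P₁ P₂) ?_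
    have hP : IsClosed {q : pairs P₁ P₂ × pairs P₁ P₂ |
        P₁.left q.1.1.1 = P₁.left q.2.1.1 ∧ P₂.left q.1.1.2 = P₂.left q.2.1.2} :=
      (isClosed_eq (P₁.continuous_left.comp (by fun_prop))
        (P₁.continuous_left.comp (by fun_prop))).inter
      (isClosed_eq (P₂.continuous_left.comp (by fun_prop))
        (P₂.continuous_left.comp (by fun_prop)))
    have := isClosed_exists_eq hP
      (f := fun q => h₁.div q.1.1.1.1 q.1.2.1.1 q.2.1)
      (g := fun q => h₂.div q.1.1.1.2 q.1.2.1.2 q.2.2)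
      (h₁.continuous_div (by fun_prop) (by fun_prop) _)
      (h₂.continuous_div (by fun_prop) (by fun_prop) _)
    convert this using 3
    rename_i q
    exact diagRel_iff h₁ h₂ q.1 q.2
  lc :=
    have : LocallyCompactSpace {p : P₁.Total × P₂.Total // P₁.right p.1 = P₂.right p.2} :=
      (pairs P₁ P₂).lc
    (isOpenQuotientMap_diag P₁ P₂).locallyCompactSpace
  conj := Quot.map (pairs P₁ P₂).conj (by
    rintro a ⟨b, hb⟩ ⟨g, e, e', rfl⟩
    exact ⟨G.Arr.conj g, by rw [P₁.right_conj, e, G.rng_conj], by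
      rw [P₂.right_conj, e', G.rng_conj],
      Prod.ext (P₁.ract_conj _ _ _).symm (P₂.ract_conj _ _ _).symm⟩)
  continuous_conj := Continuous.quotient_lift (s := ⟨_, diagRel_equivalence P₁ P₂⟩)
    (continuous_quot_mk.comp (pairs P₁ P₂).continuous_conj) _
  conj_conj := by
    rintro ⟨a⟩
    exact congrArg (Quot.mk _) ((pairs P₁ P₂).conj_conj a)

/-- The class `[p, p']` in `P₁ ×_G P₂⁻¹`. -/
abbrev dmk {P₁ : RealBibundle Γ₁ G} {P₂ : RealBibundle Γ₂ G} (p : P₁.Total) (p' : P₂.Total)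
    (h : P₁.right p = P₂.right p') : Quot (diagRel P₁ P₂) :=
  Quot.mk _ ⟨(p, p'), h⟩

variable {P₁ P₂} in
theorem dmk_ract {p : P₁.Total} {p' : P₂.Total} {g : G.Arr} (e e' h h') :
    (dmk (P₁.ract p g e) (P₂.ract p' g e') h' : Quot (diagRel P₁ P₂)) = dmk p p' h :=
  (Quot.sound ⟨g, e, e', rfl⟩).symm

variable {P₁ P₂} in
theorem dmk_congr {p q : P₁.Total} {p' q' : P₂.Total} (hp : p = q) (hp' : p' = q') (h h') :
    (dmk p p' h : Quot (diagRel P₁ P₂)) = dmk q q' h' := by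
  subst hp hp'; rfl

variable {P₁ P₂} in
theorem dmk_eq_iff {p q : P₁.Total} {p' q' : P₂.Total} (h h') :
    (dmk p p' h : Quot (diagRel P₁ P₂)) = dmk q q' h' ↔
      ∃ g e e', (q, q') = (P₁.ract p g e, P₂.ract p' g e') :=
  (diagRel_equivalence P₁ P₂).quot_mk_eq

variable {P₁ P₂}

def diagLeft : Quot (diagRel P₁ P₂) → Y₁ := Quot.lift (fun a => P₁.left a.1.1) (by
  rintro a ⟨b, hb⟩ ⟨g, e, e', rfl⟩
  exact (P₁.left_ract _ _ _).symm)

def diagRight : Quot (diagRel P₁ P₂) → Y₂ := Quot.lift (fun a => P₂.left a.1.2) (by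
  rintro a ⟨b, hb⟩ ⟨g, e, e', rfl⟩
  exact (P₂.left_ract _ _ _).symm)

theorem right_out (z : Quot (diagRel P₁ P₂)) : P₁.right z.out.1.1 = P₂.right z.out.1.2 :=
  z.out.2

theorem dmk_out (z : Quot (diagRel P₁ P₂)) : dmk z.out.1.1 z.out.1.2 (right_out z) = z :=
  Quot.out_eq z

/-- The action `γ [p, p'] = [γ p, p']`. -/
noncomputable def diagLact (γ : Γ₁.Arr) (z : Quot (diagRel P₁ P₂)) (e : Γ₁.src γ = diagLeft z) :
    Quot (diagRel P₁ P₂) :=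
  dmk (P₁.lact γ z.out.1.1 (e.trans (congrArg diagLeft (dmk_out z)).symm)) z.out.1.2
    ((P₁.right_lact _ _ _).trans z.out.2)

/-- Two representatives differ by an arrow of `G`, and the left action commutes with the right
action of `G`. -/
theorem diagLact_mk (γ : Γ₁.Arr) (p : P₁.Total) (p' : P₂.Total) (h e h') :
    diagLact γ (dmk p p' h) e = dmk (P₁.lact γ p e) p' h' := by
  obtain ⟨g, k, k', hg⟩ := (dmk_eq_iff _ h).mp (dmk_out (dmk p p' h))
  have e1 := e.trans (congrArg diagLeft (dmk_out (dmk p p' h))).symm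
  have k1 : P₁.right (P₁.lact γ (dmk p p' h).out.1.1 e1) = G.rng g := (P₁.right_lact _ _ _).trans k
  refine (dmk_ract k1 k' _ ?_).symm.trans (dmk_congr ?_ (congrArg Prod.snd hg).symm _ _)
  · rw [P₁.right_ract, P₂.right_ract]
  · refine (P₁.lact_ract _ _ _ e1 k).symm.trans ?_
    exact P₁.lact_congr rfl (congrArg Prod.fst hg).symm _ _

/-- The action `[p, p'] γ = [p, γ⁻¹ p']`. -/
noncomputable def diagRact (z : Quot (diagRel P₁ P₂)) (γ : Γ₂.Arr) (e : diagRight z = Γ₂.rng γ) :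
    Quot (diagRel P₁ P₂) :=
  dmk z.out.1.1 (P₂.lact (Γ₂.inv γ) z.out.1.2 ((Γ₂.src_inv _).trans (e.symm.trans
    (congrArg diagRight (dmk_out z)).symm))) (z.out.2.trans (P₂.right_lact _ _ _).symm)

theorem diagRact_mk (p : P₁.Total) (p' : P₂.Total) (γ : Γ₂.Arr) (h e e' h') :
    diagRact (dmk p p' h) γ e = dmk p (P₂.lact (Γ₂.inv γ) p' e') h' := by
  obtain ⟨g, k, k', hg⟩ := (dmk_eq_iff _ h).mp (dmk_out (dmk p p' h))
  have e1 := (Γ₂.src_inv _).trans (e.symm.trans (congrArg diagRight (dmk_out (dmk p p' h))).symm)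
  have k1 : P₂.right (P₂.lact (Γ₂.inv γ) (dmk p p' h).out.1.2 e1) = G.rng g :=
    (P₂.right_lact _ _ _).trans k'
  refine (dmk_ract k k1 _ ?_).symm.trans (dmk_congr (congrArg Prod.fst hg).symm ?_ _ _)
  · rw [P₁.right_ract, P₂.right_ract]
  · refine (P₂.lact_ract _ _ _ e1 k').symm.trans ?_
    exact P₂.lact_congr rfl (congrArg Prod.snd hg).symm _ _

theorem diagLact_congr {γ : Γ₁.Arr} {z z' : Quot (diagRel P₁ P₂)} (h : z = z') (e e') :
    diagLact γ z e = diagLact γ z' e' := by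
  subst h; rfl

theorem diagRact_congr {γ : Γ₂.Arr} {z z' : Quot (diagRel P₁ P₂)} (h : z = z') (e e') :
    diagRact z γ e = diagRact z' γ e' := by
  subst h; rfl

theorem exists_dmk (z : Quot (diagRel P₁ P₂)) : ∃ p p' h, dmk p p' h = z := by
  obtain ⟨⟨⟨p, p'⟩, h⟩, rfl⟩ := Quot.exists_rep z
  exact ⟨p, p', h, rfl⟩

theorem continuous_dmk {A : Type*} [TopologicalSpace A] {f : A → P₁.Total} {f' : A → P₂.Total}
    (hf : Continuous f) (hf' : Continuous f') (h : ∀ x, P₁.right (f x) = P₂.right (f' x)) :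
    Continuous fun x => (dmk (f x) (f' x) (h x) : Quot (diagRel P₁ P₂)) :=
  continuous_quot_mk.comp (Continuous.subtype_mk (hf.prodMk hf') h)

theorem continuous_diagLeft : Continuous (diagLeft : Quot (diagRel P₁ P₂) → Y₁) :=
  continuous_quot_lift _ (P₁.continuous_left.comp (by fun_prop))

theorem continuous_diagRight : Continuous (diagRight : Quot (diagRel P₁ P₂) → Y₂) :=
  continuous_quot_lift _ (P₂.continuous_left.comp (by fun_prop))

theorem continuous_diagLact : Continuous fun p : {p : Γ₁.Arr × Quot (diagRel P₁ P₂) //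
    Γ₁.src p.1 = diagLeft p.2} => diagLact p.1.1 p.1.2 p.2 := by
  have hq : IsOpenQuotientMap (Prod.map id (Quot.mk (diagRel P₁ P₂)) :
      Γ₁.Arr × pairs P₁ P₂ → Γ₁.Arr × Quot (diagRel P₁ P₂)) :=
    IsOpenQuotientMap.id.prodMap (isOpenQuotientMap_diag P₁ P₂)
  refine hq.continuous_subtype (P := fun p : Γ₁.Arr × Quot (diagRel P₁ P₂) =>
    Γ₁.src p.1 = diagLeft p.2) (F := fun p => diagLact p.1.1 p.1.2 p.2) ?_
  have : (fun a : {a : Γ₁.Arr × pairs P₁ P₂ // Γ₁.src a.1 = diagLeft (Quot.mk _ a.2)} =>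
      diagLact a.1.1 (Quot.mk _ a.1.2) a.2) = fun a =>
      dmk (P₁.lact a.1.1 a.1.2.1.1 a.2) a.1.2.1.2 ((P₁.right_lact _ _ _).trans a.1.2.2) :=
    funext fun a => diagLact_mk _ _ _ _ _ _
  exact this ▸ continuous_dmk (P₁.continuous_lact' (by fun_prop) (by fun_prop) _) (by fun_prop) _

theorem continuous_diagRact : Continuous fun p : {p : Quot (diagRel P₁ P₂) × Γ₂.Arr //
    diagRight p.1 = Γ₂.rng p.2} => diagRact p.1.1 p.1.2 p.2 := by
  have hq : IsOpenQuotientMap (Prod.map (Quot.mk (diagRel P₁ P₂)) id :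
      pairs P₁ P₂ × Γ₂.Arr → Quot (diagRel P₁ P₂) × Γ₂.Arr) :=
    (isOpenQuotientMap_diag P₁ P₂).prodMap IsOpenQuotientMap.id
  refine hq.continuous_subtype (P := fun p : Quot (diagRel P₁ P₂) × Γ₂.Arr =>
    diagRight p.1 = Γ₂.rng p.2) (F := fun p => diagRact p.1.1 p.1.2 p.2) ?_
  have e : ∀ a : {a : pairs P₁ P₂ × Γ₂.Arr // diagRight (Quot.mk (diagRel P₁ P₂) a.1) = Γ₂.rng a.2},
      Γ₂.src (Γ₂.inv a.1.2) = P₂.left a.1.1.1.2 := fun a => (Γ₂.src_inv _).trans a.2.symm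
  have : (fun a : {a : pairs P₁ P₂ × Γ₂.Arr // diagRight (Quot.mk (diagRel P₁ P₂) a.1) =
      Γ₂.rng a.2} => diagRact (Quot.mk _ a.1.1) a.1.2 a.2) = fun a =>
      dmk a.1.1.1.1 (P₂.lact (Γ₂.inv a.1.2) a.1.1.1.2 (e a))
        (a.1.1.2.trans (P₂.right_lact _ _ _).symm) :=
    funext fun a => diagRact_mk _ _ _ _ _ _ _
  exact this ▸ continuous_dmk (by fun_prop)
    (P₂.continuous_lact' (Γ₂.continuous_inv.comp (by fun_prop)) (by fun_prop) _) _

/-- The bibundle `P₁ ×_G P₂⁻¹` from `Γ₁` to `Γ₂`. -/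
noncomputable abbrev diag (h₁ : P₁.IsRightPrincipal) (h₂ : P₂.IsRightPrincipal) :
    RealBibundle Γ₁ Γ₂ where
  Total := diagSpace P₁ P₂ h₁ h₂
  left := diagLeft
  right := diagRight
  lact := diagLact
  ract := diagRact
  continuous_left := continuous_diagLeft
  continuous_right := continuous_diagRight
  isOpenMap_left := isOpenMap_of_comp_surjective (f := Quot.mk (diagRel P₁ P₂))
    (P₁.isOpenMap_left.comp (P₂.isOpenMap_right.fst_pullback P₁.continuous_right))
    continuous_quot_mk Quot.mk_surjective
  isOpenMap_right := isOpenMap_of_comp_surjective (f := Quot.mk (diagRel P₁ P₂))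
    (P₂.isOpenMap_left.comp (P₁.isOpenMap_right.snd_pullback P₂.continuous_right))
    continuous_quot_mk Quot.mk_surjective
  continuous_lact := continuous_diagLact
  continuous_ract := continuous_diagRact
  left_lact γ z e := by
    obtain ⟨p, p', h, rfl⟩ := exists_dmk z
    exact (congrArg diagLeft (diagLact_mk γ p p' h e ((P₁.right_lact _ _ _).trans h))).trans
      (P₁.left_lact _ _ _)
  right_lact γ z e := by
    obtain ⟨p, p', h, rfl⟩ := exists_dmk z
    exact (congrArg diagRight (diagLact_mk γ p p' h e ((P₁.right_lact _ _ _).trans h))).trans rfl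
  left_ract z γ e := by
    obtain ⟨p, p', h, rfl⟩ := exists_dmk z
    exact (congrArg diagLeft (diagRact_mk p p' γ h e ((Γ₂.src_inv _).trans e.symm)
      (h.trans (P₂.right_lact _ _ _).symm))).trans rfl
  right_ract z γ e := by
    obtain ⟨p, p', h, rfl⟩ := exists_dmk z
    exact (congrArg diagRight (diagRact_mk p p' γ h e ((Γ₂.src_inv _).trans e.symm)
      (h.trans (P₂.right_lact _ _ _).symm))).trans ((P₂.left_lact _ _ _).trans (Γ₂.rng_inv _))
  unit_lact z := by
    obtain ⟨p, p', h, rfl⟩ := exists_dmk z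
    exact (diagLact_mk _ p p' h _ ((P₁.right_lact _ _ _).trans h)).trans
      (dmk_congr (P₁.unit_lact _) rfl _ _)
  ract_unit z := by
    obtain ⟨p, p', h, rfl⟩ := exists_dmk z
    exact (diagRact_mk p p' _ h _ ((Γ₂.src_inv _).trans (Γ₂.rng_unit _))
      (h.trans (P₂.right_lact _ _ _).symm)).trans
      (dmk_congr rfl (P₂.unit_lact' _ (Γ₂.inv_unit _)) _ _)
  mul_lact γ γ' z e e' := by
    obtain ⟨p, p', h, rfl⟩ := exists_dmk z
    have k1 : P₁.right (P₁.lact γ' p e') = P₂.right p' := (P₁.right_lact _ _ _).trans h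
    have k2 : Γ₁.src γ = P₁.left (P₁.lact γ' p e') := e.trans (P₁.left_lact _ _ _).symm
    refine (diagLact_mk _ p p' h _ ((P₁.right_lact _ _ _).trans h)).trans (Eq.symm ?_)
    refine (diagLact_congr (diagLact_mk γ' p p' h e' k1) _ k2).trans ?_
    refine (diagLact_mk γ _ p' k1 k2 ((P₁.right_lact _ _ _).trans k1)).trans ?_
    exact dmk_congr (P₁.mul_lact _ _ _ e e').symm rfl _ _
  ract_mul z γ γ' e e' := by
    obtain ⟨p, p', h, rfl⟩ := exists_dmk z
    have k1 : Γ₂.src (Γ₂.inv γ) = P₂.left p' := (Γ₂.src_inv _).trans e.symm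
    have k2 : P₁.right p = P₂.right (P₂.lact (Γ₂.inv γ) p' k1) := h.trans (P₂.right_lact _ _ _).symm
    have k3 : P₂.left (P₂.lact (Γ₂.inv γ) p' k1) = Γ₂.rng γ' :=
      (P₂.left_lact _ _ _).trans ((Γ₂.rng_inv _).trans e')
    have k4 : Γ₂.src (Γ₂.inv (Γ₂.mul γ γ' e')) = P₂.left p' := by
      rw [Γ₂.src_inv, Γ₂.rng_mul]
      exact e.symm
    have k5 : Γ₂.src (Γ₂.inv γ') = Γ₂.rng (Γ₂.inv γ) := by rw [Γ₂.src_inv, Γ₂.rng_inv, e']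
    refine (diagRact_mk p p' _ h _ k4 (h.trans (P₂.right_lact _ _ _).symm)).trans (Eq.symm ?_)
    refine (diagRact_congr (diagRact_mk p p' γ h e k1 k2) _ k3).trans ?_
    refine (diagRact_mk p _ γ' k2 k3 ((Γ₂.src_inv _).trans k3.symm)
      (k2.trans (P₂.right_lact _ _ _).symm)).trans ?_
    refine dmk_congr rfl ((P₂.mul_lact _ _ _ k5 k1).symm.trans ?_) _ _
    exact P₂.lact_congr (Γ₂.inv_mul_rev e' k5).symm rfl _ _
  lact_ract γ z γ' e e' := by
    obtain ⟨p, p', h, rfl⟩ := exists_dmk z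
    have k1 : Γ₂.src (Γ₂.inv γ') = P₂.left p' := (Γ₂.src_inv _).trans e'.symm
    have k2 : P₁.right p = P₂.right (P₂.lact (Γ₂.inv γ') p' k1) :=
      h.trans (P₂.right_lact _ _ _).symm
    have k3 : P₁.right (P₁.lact γ p e) = P₂.right p' := (P₁.right_lact _ _ _).trans h
    refine (diagLact_congr (diagRact_mk p p' γ' h e' k1 k2) _ e).trans ?_
    refine (diagLact_mk γ p _ k2 e ((P₁.right_lact _ _ _).trans k2)).trans (Eq.symm ?_)
    refine (diagRact_congr (diagLact_mk γ p p' h e k3) _ e').trans ?_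
    exact diagRact_mk _ p' γ' k3 e' k1 _
  left_conj z := by
    obtain ⟨p, p', h, rfl⟩ := exists_dmk z
    exact P₁.left_conj _
  right_conj z := by
    obtain ⟨p, p', h, rfl⟩ := exists_dmk z
    exact P₂.left_conj _
  lact_conj γ z e := by
    obtain ⟨p, p', h, rfl⟩ := exists_dmk z
    have k1 : P₁.right (P₁.lact γ p e) = P₂.right p' := (P₁.right_lact _ _ _).trans h
    have k2 : P₁.right (P₁.Total.conj p) = P₂.right (P₂.Total.conj p') := by
      rw [P₁.right_conj, P₂.right_conj, h]
    have k3 : Γ₁.src (Γ₁.Arr.conj γ) = P₁.left (P₁.Total.conj p) := by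
      rw [Γ₁.src_conj, P₁.left_conj]
      exact congrArg Y₁.conj e
    refine (diagLact_mk _ _ _ k2 k3 ((P₁.right_lact _ _ _).trans k2)).trans (Eq.symm ?_)
    refine (congrArg (diagSpace P₁ P₂ h₁ h₂).conj (diagLact_mk γ p p' h e k1)).trans ?_
    exact dmk_congr (P₁.lact_conj _ _ _).symm rfl _ _
  ract_conj z γ e := by
    obtain ⟨p, p', h, rfl⟩ := exists_dmk z
    have k1 : Γ₂.src (Γ₂.inv γ) = P₂.left p' := (Γ₂.src_inv _).trans e.symm
    have k2 : P₁.right (P₁.Total.conj p) = P₂.right (P₂.Total.conj p') := by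
      rw [P₁.right_conj, P₂.right_conj, h]
    have k3 : P₂.left (P₂.Total.conj p') = Γ₂.rng (Γ₂.Arr.conj γ) := by
      rw [Γ₂.rng_conj, P₂.left_conj]
      exact congrArg Y₂.conj e
    refine (diagRact_mk _ _ _ k2 k3 ((Γ₂.src_inv _).trans k3.symm)
      (k2.trans (P₂.right_lact _ _ _).symm)).trans (Eq.symm ?_)
    refine (congrArg (diagSpace P₁ P₂ h₁ h₂).conj (diagRact_mk p p' γ h e k1
      (h.trans (P₂.right_lact _ _ _).symm))).trans ?_
    refine dmk_congr rfl ((P₂.lact_conj _ _ k1).symm.trans ?_) _ _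
    exact P₂.lact_congr (Γ₂.inv_conj _).symm rfl _ _

/-- For `[p, p']` and `[q, q']` over the same unit of `Γ₁`, write `q = p g`. Then `[q, q'] = [p, q'
g⁻¹]`, and the difference is the arrow of `Γ₂` carrying `q' g⁻¹` to `p'`. -/
theorem isRightPrincipal_diag (h₁ : P₁.IsRightPrincipal) (h₂ : P₂.IsMorita) :
    (diag h₁ h₂.1).IsRightPrincipal := by
  have hs : LocallySplit (diagLeft : Quot (diagRel P₁ P₂) → Y₁) :=
    LocallySplit.of_comp (p := Quot.mk (diagRel P₁ P₂))
      (h₁.1.comp (h₂.2.1.lift P₁.continuous_right (fun x => x) continuous_id fun _ => rfl))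
      continuous_quot_mk
  have free : ∀ (z : Quot (diagRel P₁ P₂)) (γ γ' : Γ₂.Arr) e e',
      diagRact z γ e = diagRact z γ' e' → γ = γ' := by
    intro z γ γ' e e' H
    obtain ⟨p, p', h, rfl⟩ := exists_dmk z
    have k1 : Γ₂.src (Γ₂.inv γ) = P₂.left p' := (Γ₂.src_inv _).trans e.symm
    have k1' : Γ₂.src (Γ₂.inv γ') = P₂.left p' := (Γ₂.src_inv _).trans e'.symm
    have k2 : P₁.right p = P₂.right (P₂.lact (Γ₂.inv γ) p' k1) := h.trans (P₂.right_lact _ _ _).symm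
    have k2' : P₁.right p = P₂.right (P₂.lact (Γ₂.inv γ') p' k1') :=
      h.trans (P₂.right_lact _ _ _).symm
    obtain ⟨g, f, f', hg⟩ := (dmk_eq_iff k2 k2').mp ((diagRact_mk p p' γ h e k1 k2).symm.trans
      (H.trans (diagRact_mk p p' γ' h e' k1' k2')))
    have hg' : g = G.unit (P₁.right p) :=
      h₁.free ((congrArg Prod.fst hg).symm.trans (P₁.ract_unit p).symm)
    have h3 : P₂.lact (Γ₂.inv γ') p' k1' = P₂.lact (Γ₂.inv γ) p' k1 :=
      (congrArg Prod.snd hg).trans (P₂.ract_unit' _ (hg'.trans (congrArg G.unit k2)))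
    have h4 := congrArg Γ₂.inv (h₂.2.free h3)
    rw [Γ₂.inv_inv, Γ₂.inv_inv] at h4
    exact h4.symm
  have k1 : ∀ (a b : pairs P₁ P₂) (e : P₁.left a.1.1 = P₁.left b.1.1),
      P₂.right b.1.2 = G.rng (G.inv (h₁.div _ _ e)) := fun a b e => by
    rw [G.rng_inv, h₁.src_div, b.2]
  have k2 : ∀ (a b : pairs P₁ P₂) (e : P₁.left a.1.1 = P₁.left b.1.1),
      P₂.right a.1.2 = P₂.right (P₂.ract b.1.2 _ (k1 a b e)) := fun a b e => by
    rw [P₂.right_ract, G.src_inv, ← h₁.rng_div, a.2]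
  have hd : ∀ (a b : pairs P₁ P₂) (e : P₁.left a.1.1 = P₁.left b.1.1),
      ∃ e', diagRact (Quot.mk (diagRel P₁ P₂) a) (h₂.2.div _ _ (k2 a b e)) e' = Quot.mk _ b := by
    rintro ⟨⟨p, p'⟩, h⟩ ⟨⟨q, q'⟩, h'⟩ e
    have e1 : P₂.left p' = Γ₂.rng (h₂.2.div _ _ (k2 ⟨(p, p'), h⟩ ⟨(q, q'), h'⟩ e)) :=
      (h₂.2.rng_div _ _ _).symm
    have e2 := (Γ₂.src_inv _).trans e1.symm
    refine ⟨e1, (diagRact_mk p p' _ h e1 e2 (h.trans (P₂.right_lact _ _ _).symm)).trans ?_⟩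
    have e3 := h₂.2.src_div _ _ (k2 ⟨(p, p'), h⟩ ⟨(q, q'), h'⟩ e)
    have e4 : P₂.lact (Γ₂.inv (h₂.2.div _ _ (k2 ⟨(p, p'), h⟩ ⟨(q, q'), h'⟩ e))) p' e2 =
        P₂.ract q' _ (k1 ⟨(p, p'), h⟩ ⟨(q, q'), h'⟩ e) :=
      (P₂.lact_congr rfl (h₂.2.lact_div _ _ _ e3).symm _ ((Γ₂.src_inv _).trans
        (P₂.left_lact _ _ _).symm)).trans (P₂.inv_lact_lact _ _ _ _)
    refine Quot.sound ⟨h₁.div p q e, h₁.rng_div _ _ _, ?_, Prod.ext (h₁.ract_div _ _ _ _).symm ?_⟩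
    · exact (P₂.right_lact _ _ _).trans (h.symm.trans (h₁.rng_div _ _ _))
    · refine ((P₂.ract_congr e4 rfl _ ?_).trans (P₂.ract_inv_ract _ _ _ ?_)).symm
      · exact (P₂.right_ract _ _ _).trans (G.src_inv _)
      · exact (P₂.right_ract _ _ _).trans (G.src_inv _)
  have hd' : ∀ q : {q : Quot (diagRel P₁ P₂) × Quot (diagRel P₁ P₂) //
      diagLeft q.1 = diagLeft q.2}, ∃ γ, ∃ e : diagRight q.1.1 = Γ₂.rng γ,
      diagRact q.1.1 γ e = q.1.2 := by
    rintro ⟨⟨⟨a⟩, ⟨b⟩⟩, e⟩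
    exact ⟨_, hd a b e⟩
  choose d he hact using hd'
  refine isRightPrincipal_of_div hs d ?_ he hact fun z γ e e' => free _ _ _ (he _) e (hact _)
  have hq := (isOpenQuotientMap_diag P₁ P₂).prodMap (isOpenQuotientMap_diag P₁ P₂)
  refine hq.continuous_subtype (P := fun q => diagLeft q.1 = diagLeft q.2) (F := d) ?_
  have : (fun a : {a : pairs P₁ P₂ × pairs P₁ P₂ // diagLeft (Quot.mk (diagRel P₁ P₂) a.1) =
      diagLeft (Quot.mk (diagRel P₁ P₂) a.2)} => d ⟨(Quot.mk _ a.1.1, Quot.mk _ a.1.2), a.2⟩) =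
      fun a => h₂.2.div _ _ (k2 a.1.1 a.1.2 a.2) := funext fun a => by
    obtain ⟨e, h⟩ := hd a.1.1 a.1.2 a.2
    exact free _ _ _ (he _) e ((hact _).trans h.symm)
  exact this ▸ h₂.2.continuous_div (by fun_prop) (P₂.continuous_ract' (by fun_prop)
    (G.continuous_inv.comp (h₁.continuous_div (by fun_prop) (by fun_prop) _)) _) _

/-- For `[q, q']` and `[p, p']` over the same unit of `Γ₂`, write `p' = q' g`. The difference is the
arrow of `Γ₁` carrying `p` to `q g`. -/
theorem isLeftPrincipal_diag (h₁ : P₁.IsMorita) (h₂ : P₂.IsRightPrincipal) :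
    (diag h₁.1 h₂).IsLeftPrincipal := by
  have hs : LocallySplit (diagRight : Quot (diagRel P₁ P₂) → Y₂) :=
    LocallySplit.of_comp (p := Quot.mk (diagRel P₁ P₂))
      (h₂.1.comp (h₁.2.1.lift P₂.continuous_right (fun x => ⟨(x.1.2, x.1.1), x.2.symm⟩)
        (by fun_prop) fun _ => rfl))
      continuous_quot_mk
  have free : ∀ (γ γ' : Γ₁.Arr) (z : Quot (diagRel P₁ P₂)) e e',
      diagLact γ z e = diagLact γ' z e' → γ = γ' := by
    intro γ γ' z e e' H
    obtain ⟨p, p', h, rfl⟩ := exists_dmk z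
    have k2 : P₁.right (P₁.lact γ p e) = P₂.right p' := (P₁.right_lact _ _ _).trans h
    have k2' : P₁.right (P₁.lact γ' p e') = P₂.right p' := (P₁.right_lact _ _ _).trans h
    obtain ⟨g, f, f', hg⟩ := (dmk_eq_iff k2 k2').mp ((diagLact_mk γ p p' h e k2).symm.trans
      (H.trans (diagLact_mk γ' p p' h e' k2')))
    have hg' : g = G.unit (P₂.right p') :=
      h₂.free ((congrArg Prod.snd hg).symm.trans (P₂.ract_unit p').symm)
    exact (h₁.2.free ((congrArg Prod.fst hg).trans
      (P₁.ract_unit' _ (hg'.trans (congrArg G.unit k2.symm))))).symm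
  have k1 : ∀ (a b : pairs P₁ P₂) (e : P₂.left b.1.2 = P₂.left a.1.2),
      P₁.right b.1.1 = G.rng (h₂.div _ _ e) := fun a b e => by
    rw [← h₂.rng_div, b.2]
  have k2 : ∀ (a b : pairs P₁ P₂) (e : P₂.left b.1.2 = P₂.left a.1.2),
      P₁.right (P₁.ract b.1.1 _ (k1 a b e)) = P₁.right a.1.1 := fun a b e => by
    rw [P₁.right_ract, h₂.src_div, a.2]
  have hd : ∀ (a b : pairs P₁ P₂) (e : P₂.left b.1.2 = P₂.left a.1.2),
      ∃ e', diagLact (h₁.2.div _ _ (k2 a b e)) (Quot.mk (diagRel P₁ P₂) a) e' = Quot.mk _ b := by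
    rintro ⟨⟨p, p'⟩, h⟩ ⟨⟨q, q'⟩, h'⟩ e
    have e1 := h₁.2.src_div _ _ (k2 ⟨(p, p'), h⟩ ⟨(q, q'), h'⟩ e)
    refine ⟨e1, (diagLact_mk _ p p' h e1 ((P₁.right_lact _ _ _).trans h)).trans (Eq.symm ?_)⟩
    exact Quot.sound ⟨h₂.div q' p' e, k1 ⟨(p, p'), h⟩ ⟨(q, q'), h'⟩ e, h₂.rng_div _ _ _,
      Prod.ext (h₁.2.lact_div _ _ _ _) (h₂.ract_div _ _ _ _).symm⟩
  have hd' : ∀ q : {q : Quot (diagRel P₁ P₂) × Quot (diagRel P₁ P₂) //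
      diagRight q.1 = diagRight q.2}, ∃ γ, ∃ e : Γ₁.src γ = diagLeft q.1.2,
      diagLact γ q.1.2 e = q.1.1 := by
    rintro ⟨⟨⟨b⟩, ⟨a⟩⟩, e⟩
    exact ⟨_, hd a b e⟩
  choose d he hact using hd'
  refine isLeftPrincipal_of_div hs d ?_ he hact fun γ z e e' => free _ _ _ (he _) e (hact _)
  have hq := (isOpenQuotientMap_diag P₁ P₂).prodMap (isOpenQuotientMap_diag P₁ P₂)
  refine hq.continuous_subtype (P := fun q => diagRight q.1 = diagRight q.2) (F := d) ?_
  have : (fun a : {a : pairs P₁ P₂ × pairs P₁ P₂ // diagRight (Quot.mk (diagRel P₁ P₂) a.1) =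
      diagRight (Quot.mk (diagRel P₁ P₂) a.2)} => d ⟨(Quot.mk _ a.1.1, Quot.mk _ a.1.2), a.2⟩) =
      fun a => h₁.2.div _ _ (k2 a.1.2 a.1.1 a.2) := funext fun a => by
    obtain ⟨e, h⟩ := hd a.1.2 a.1.1 a.2
    exact free _ _ _ (he _) e ((hact _).trans h.symm)
  exact this ▸ h₁.2.continuous_div (P₁.continuous_ract' (by fun_prop)
    (h₂.continuous_div (by fun_prop) (by fun_prop) _) _) (by fun_prop) _

theorem isMorita_diag (h₁ : P₁.IsMorita) (h₂ : P₂.IsMorita) : (diag h₁.1 h₂.1).IsMorita :=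
  ⟨isRightPrincipal_diag h₁.1 h₂, isLeftPrincipal_diag h₁ h₂.1⟩

/-- The composite `P₂ ∘ (P₁ ×_G P₂⁻¹)` is `P₁`. -/
theorem isComposite_diag (h₁ : P₁.IsRightPrincipal) (h₂ : P₂.IsMorita) :
    IsComposite (diag h₁ h₂.1) P₂ P₁ := by
  have k1 : ∀ (p : P₁.Total) (p' x : P₂.Total) (_ : P₁.right p = P₂.right p') e,
      P₁.right p = G.rng (h₂.1.div p' x e) := fun p p' x h e => by rw [← h₂.1.rng_div, h]
  -- The pairing sends `[p, p']` and `x` to `p g`, where `p' g = x`. Moving `p` and `p'` by the same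
  -- arrow of `G` changes `g` inversely and leaves `p g` fixed.
  have ex : ∀ x : {x : Quot (diagRel P₁ P₂) × P₂.Total // diagRight x.1 = P₂.left x.2},
      ∃ y, ∀ p p' h, dmk p p' h = x.1.1 → ∀ e,
        P₁.ract p (h₂.1.div p' x.1.2 e) (k1 _ _ _ h e) = y := by
    rintro ⟨⟨z, x⟩, hx⟩
    obtain ⟨q, q', h', rfl⟩ := exists_dmk z
    refine ⟨P₁.ract q (h₂.1.div q' x hx) (k1 _ _ _ h' hx), fun p p' h H e => ?_⟩
    obtain ⟨g, f, f', hg⟩ := (dmk_eq_iff h h').mp H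
    obtain rfl : q = _ := congrArg Prod.fst hg
    obtain rfl : q' = _ := congrArg Prod.snd hg
    have e1 : G.src g = G.rng (h₂.1.div (P₂.ract p' g f') x hx) :=
      (P₂.right_ract _ _ _).symm.trans (h₂.1.rng_div _ _ _)
    refine Eq.trans ?_ (P₁.ract_mul _ _ _ f e1)
    refine P₁.ract_congr rfl (h₂.1.div_eq (e' := f'.trans (G.rng_mul _ _ _).symm) ?_) _ _
    exact (P₂.ract_mul _ _ _ f' e1).trans (h₂.1.ract_div _ _ _ _)
  choose m hm using ex
  have hm' : ∀ p p' h x e, m ⟨(dmk p p' h, x), e⟩ = P₁.ract p (h₂.1.div p' x e) (k1 _ _ _ h e) :=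
    fun p p' h x e => (hm ⟨(dmk p p' h, x), e⟩ p p' h rfl e).symm
  have hc : Continuous m := by
    have hq : IsOpenQuotientMap (Prod.map (Quot.mk (diagRel P₁ P₂)) id :
        pairs P₁ P₂ × P₂.Total → Quot (diagRel P₁ P₂) × P₂.Total) :=
      (isOpenQuotientMap_diag P₁ P₂).prodMap IsOpenQuotientMap.id
    refine hq.continuous_subtype (P := fun p : Quot (diagRel P₁ P₂) × P₂.Total =>
      diagRight p.1 = P₂.left p.2) (F := m) ?_
    have : (fun a : {a : pairs P₁ P₂ × P₂.Total // diagRight (Quot.mk (diagRel P₁ P₂) a.1) =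
        P₂.left a.2} => m ⟨(Quot.mk _ a.1.1, a.1.2), a.2⟩) = fun a =>
        P₁.ract a.1.1.1.1 (h₂.1.div a.1.1.1.2 a.1.2 a.2) (k1 _ _ _ a.1.1.2 a.2) :=
      funext fun a => hm' _ _ _ _ _
    exact this ▸ P₁.continuous_ract' (by fun_prop) (h₂.1.continuous_div (by fun_prop)
      (by fun_prop) _) _
  refine isComposite_of_pairing (isRightPrincipal_diag h₁ h₂) h₂.1 h₁ m hc ?_ ?_ ?_ ?_ ?_ ?_
  · rintro ⟨⟨z, x⟩, hx⟩
    obtain ⟨p, p', h, rfl⟩ := exists_dmk z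
    rw [hm']
    exact P₁.left_ract _ _ _
  · rintro ⟨⟨z, x⟩, hx⟩
    obtain ⟨p, p', h, rfl⟩ := exists_dmk z
    rw [hm', P₁.right_ract]
    exact h₂.1.src_div _ _ _
  · rintro ⟨⟨z, x⟩, hx⟩ ⟨b, hb⟩ rfl
    obtain ⟨p, p', h, rfl⟩ := exists_dmk z
    have k2 : P₁.right (P₁.Total.conj p) = P₂.right (P₂.Total.conj p') := by
      rw [P₁.right_conj, P₂.right_conj, h]
    rw [hm', ← P₁.ract_conj]
    refine (hm' _ _ k2 _ hb).trans (P₁.ract_congr rfl (h₂.1.div_conj _ _ _ _) _ _)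
  · rintro γ ⟨⟨z, x⟩, hx⟩ ⟨b, hb⟩ e rfl e'
    obtain ⟨p, p', h, rfl⟩ := exists_dmk z
    have k2 : P₁.right (P₁.lact γ p e) = P₂.right p' := (P₁.right_lact _ _ _).trans h
    refine (P₁.lact_congr rfl (hm' p p' h x hx) _ (e.trans (P₁.left_ract _ _ _).symm)).trans ?_
    refine (P₁.lact_ract _ _ _ e (k1 _ _ _ h hx)).trans ((hm' _ p' k2 x hx).symm.trans ?_)
    exact congrArg m (Subtype.ext (Prod.ext (diagLact_mk γ p p' h e k2).symm rfl))
  · rintro ⟨⟨z, x⟩, hx⟩ g ⟨b, hb⟩ e rfl e'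
    obtain ⟨p, p', h, rfl⟩ := exists_dmk z
    have k2 : G.src (h₂.1.div p' x hx) = G.rng g := (h₂.1.src_div _ _ _).trans e
    refine (P₁.ract_congr (hm' p p' h x hx) rfl _ ((P₁.right_ract _ _ _).trans k2)).trans ?_
    refine (P₁.ract_mul _ _ _ (k1 _ _ _ h hx) k2).symm.trans (Eq.trans ?_ (hm' p p' h _ hb).symm)
    refine P₁.ract_congr rfl (h₂.1.div_eq (e' := (h₂.1.rng_div _ _ _).trans
      (G.rng_mul _ _ _).symm) ?_).symm _ _
    exact (P₂.ract_mul _ _ _ (h₂.1.rng_div _ _ _) k2).trans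
      (P₂.ract_congr (h₂.1.ract_div _ _ _ _) rfl _ _)
  · intro z γ x e e' e₁ e₂
    obtain ⟨p, p', h, rfl⟩ := exists_dmk z
    have k2 : Γ₂.src (Γ₂.inv γ) = P₂.left p' := (Γ₂.src_inv _).trans e.symm
    have k3 : P₁.right p = P₂.right (P₂.lact (Γ₂.inv γ) p' k2) := h.trans (P₂.right_lact _ _ _).symm
    have k4 : P₂.left (P₂.lact (Γ₂.inv γ) p' k2) = P₂.left x :=
      (P₂.left_lact _ _ _).trans ((Γ₂.rng_inv _).trans e')
    refine Eq.trans (b := m ⟨(dmk p (P₂.lact (Γ₂.inv γ) p' k2) k3, x), k4⟩)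
      (congrArg m (Subtype.ext (Prod.ext (diagRact_mk p p' γ h e k2 k3) rfl)))
      ((hm' p _ k3 x k4).trans (Eq.trans ?_ (hm' p p' h _ e₂).symm))
    have k5 : P₂.right p' = G.rng (h₂.1.div (P₂.lact (Γ₂.inv γ) p' k2) x k4) := by
      rw [← h₂.1.rng_div, P₂.right_lact]
    have k6 : Γ₂.src γ = P₂.left (P₂.lact (Γ₂.inv γ) p' k2) := e'.trans k4.symm
    have k7 := h₂.1.rng_div _ _ k4
    refine P₁.ract_congr rfl (h₂.1.div_eq (e' := k5) ?_).symm _ _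
    refine (P₂.ract_congr (P₂.lact_inv_lact γ p' k2 k6).symm rfl _
      ((P₂.right_lact _ _ _).trans k7)).trans ?_
    refine (P₂.lact_ract _ _ _ k6 k7).symm.trans ?_
    exact P₂.lact_congr rfl (h₂.1.ract_div _ _ _ _) _ _

end RealBibundle
end Correspondence

/-! ### Tensor products of extensions -/

section TensorProduct

variable {X : RealSpace.{u}} {G : RealGroupoid X} {S : RealAbelianGroup.{u}}

open RealBibundle

section Homomorphisms

variable {Y₁ Y₂ : RealSpace.{u}} {Γ₁ : RealGroupoid Y₁} {Γ₂ : RealGroupoid Y₂}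
  (Z : RealBibundle Γ₁ Γ₂)

/-- The pull-back of `Γ₁` to the total space of a bibundle. -/
abbrev RealBibundle.leftPull : RealGroupoid Z.Total :=
  Γ₁.pull Z.left Z.continuous_left Z.left_conj Z.isOpenMap_left

/-- The projection of the pull-back to `Γ₁`. -/
abbrev RealBibundle.leftHom : RealHom Z.leftPull Γ₁ :=
  Γ₁.pullHom Z.left Z.continuous_left Z.left_conj Z.isOpenMap_left

variable {Z}

/-- The homomorphism `(z, γ, z') ↦ γ'` with `γ z' = z γ'`. -/
noncomputable abbrev RealBibundle.IsRightPrincipal.rightHom (hZ : Z.IsRightPrincipal) :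
    RealHom Z.leftPull Γ₂ where
  obj := Z.right
  arr t := hZ.div t.1.1 (Z.lact t.1.2.1 t.1.2.2 t.2.2) (t.2.1.trans (Z.left_lact _ _ _).symm)
  continuous_obj := Z.continuous_right
  continuous_arr := hZ.continuous_div (by fun_prop) (Z.continuous_lact' (by fun_prop)
    (by fun_prop) _) _
  rng_arr t := (hZ.rng_div _ _ _).symm
  src_arr t := (hZ.src_div _ _ _).trans (Z.right_lact _ _ _)
  unit_arr z := hZ.div_eq (e' := (Γ₂.rng_unit _).symm) ((Z.ract_unit z).trans (Z.unit_lact z).symm)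
  mul_arr t t' e := by
    have k1 := t.2.1.trans (Z.left_lact t.1.2.1 t.1.2.2 t.2.2).symm
    have k2 := t'.2.1.trans (Z.left_lact t'.1.2.1 t'.1.2.2 t'.2.2).symm
    have e1 : Γ₁.src t.1.2.1 = Z.left t'.1.1 := t.2.2.trans (congrArg Z.left e)
    have e2 : Γ₂.src (hZ.div _ _ k1) = Γ₂.rng (hZ.div _ _ k2) := by
      rw [hZ.src_div, Z.right_lact, ← hZ.rng_div]
      exact congrArg Z.right e
    have e3 : Z.right (Z.lact t.1.2.1 t'.1.1 e1) = Γ₂.rng (hZ.div _ _ k2) :=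
      (Z.right_lact _ _ _).trans (hZ.rng_div _ _ _)
    refine hZ.div_eq (e' := (hZ.rng_div _ _ k1).trans (Γ₂.rng_mul _ _ _).symm) ?_
    refine (Z.ract_mul _ _ _ (hZ.rng_div _ _ k1) e2).trans ?_
    refine (Z.ract_congr ((hZ.ract_div _ _ k1 _).trans (Z.lact_congr rfl e _ e1)) rfl _ e3).trans ?_
    refine (Z.lact_ract _ _ _ e1 (hZ.rng_div _ _ k2)).symm.trans ?_
    refine (Z.lact_congr rfl (hZ.ract_div _ _ k2 _) _ (e1.trans k2)).trans ?_
    exact (Z.mul_lact _ _ _ (e1.trans t'.2.1) t'.2.2).symm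
  conj_obj := Z.right_conj
  conj_arr t := by
    have k1 := t.2.1.trans (Z.left_lact t.1.2.1 t.1.2.2 t.2.2).symm
    have k2 : Z.right (Z.Total.conj t.1.1) = Γ₂.rng (Γ₂.Arr.conj (hZ.div _ _ k1)) := by
      rw [Z.right_conj, Γ₂.rng_conj, ← hZ.rng_div]
    refine hZ.div_eq (e' := k2) ((Z.ract_conj _ _ (hZ.rng_div _ _ k1)).trans ?_)
    exact (congrArg Z.Total.conj (hZ.ract_div _ _ k1 _)).trans (Z.lact_conj _ _ t.2.2).symm

theorem RealBibundle.IsRightPrincipal.ract_rightHom (hZ : Z.IsRightPrincipal) (t : Z.leftPull.Arr)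
    (e e') : Z.ract t.1.1 (hZ.rightHom.arr t) e = Z.lact t.1.2.1 t.1.2.2 e' :=
  hZ.ract_div _ _ _ _

end Homomorphisms

variable (E₁ E₂ : RealExtension G S)

noncomputable abbrev RealExtension.corr : RealBibundle E₁.Γ E₂.Γ :=
  diag E₁.morita.1 E₂.morita.1

theorem RealExtension.isMorita_corr : (E₁.corr E₂).IsMorita := isMorita_diag E₁.morita E₂.morita

theorem RealExtension.isEssential_corr : (E₁.corr E₂).leftHom.IsEssential :=
  E₁.Γ.isEssential_pullHom _ _ _ _ (E₁.isMorita_corr E₂).1.1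

/-- The tensor product of two extensions. -/
noncomputable abbrev RealExtension.tensor : RealExtension G S where
  T := _root_.tensor (pullback (E₁.corr E₂).leftHom E₁.T)
    (pullback (E₁.isMorita_corr E₂).1.rightHom E₂.T)
  P := restrict (E₁.corr E₂).leftHom E₁.P
    ((E₁.isEssential_corr E₂).isOpenMap_restrict E₁.morita.2)
  morita := (E₁.isEssential_corr E₂).isMorita_restrict E₁.morita _

theorem RealExtension.isExtTensor_tensor : IsExtTensor E₁ E₂ (E₁.tensor E₂) := by
  refine ⟨E₁.corr E₂, Homeomorph.refl _, (E₁.corr E₂).leftHom, (E₁.isMorita_corr E₂).1.rightHom,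
    _, _, graph (E₁.corr E₂).leftHom (E₁.isEssential_corr E₂).isOpenMap_graph,
    E₁.isMorita_corr E₂, isComposite_diag E₁.morita.1 E₂.morita, fun _ => rfl, fun _ => rfl,
    fun _ => rfl, ⟨Homeomorph.refl _, fun _ => rfl⟩, fun t => ?_, isPullback_pullback _ _,
    isPullback_pullback _ _, isTensor_tensor _ _, isGraph_graph _ _, ?_⟩
  · exact ⟨t.2.2, (E₁.isMorita_corr E₂).1.rng_div _ _ _,
      ((E₁.isMorita_corr E₂).1.ract_rightHom t _ _).symm⟩
  · exact isComposite_of_map _ E₁.morita.1 (E₁.tensor E₂).morita.1 (fun z => z.1.2) (by fun_prop)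
      (fun z => z.2.symm) (fun _ => rfl) (fun _ => rfl) (fun _ _ _ _ => rfl) fun _ _ _ _ => rfl

/-- Over a common cover, sections `s₁` and `s₂` give the section `([s₁, s₂], s₁)` of the bundle of
the tensor product. The homomorphism it induces projects to those of `s₁` and `s₂`, and pull-back
commutes with tensor products of twists. -/
theorem RealExtension.coverTw_tensor :
    (E₁.tensor E₂).coverTw = E₁.coverTw + E₂.coverTw := by
  obtain ⟨V₁, ⟨s₁⟩⟩ := E₁.P.exists_sectionAlong E₁.morita.2
  obtain ⟨V₂, ⟨s₂⟩⟩ := E₂.P.exists_sectionAlong E₂.morita.2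
  rw [E₁.coverTw_eq (s₁.refine (.fst V₁ V₂)), E₂.coverTw_eq (s₂.refine (.snd V₁ V₂))]
  generalize s₁.refine (.fst V₁ V₂) = s₁
  generalize s₂.refine (.snd V₁ V₂) = s₂
  generalize V₁.prod V₂ = V at s₁ s₂
  have hs : ∀ y, E₁.P.right (s₁.toFun y) = E₂.P.right (s₂.toFun y) := fun y =>
    (s₁.right y).trans (s₂.right y).symm
  let s : (E₁.tensor E₂).P.SectionAlong (V.toBase G) :=
    { toFun := fun y => ⟨(dmk (s₁.toFun y) (s₂.toFun y) (hs y), s₁.toFun y), rfl⟩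
      continuous := Continuous.subtype_mk ((continuous_dmk s₁.continuous s₂.continuous _).prodMk
        s₁.continuous) _
      conj := fun y => Subtype.ext (Prod.ext (dmk_congr (s₁.conj y) (s₂.conj y) _ _) (s₁.conj y))
      right := fun y => s₁.right y }
  rw [(E₁.tensor E₂).coverTw_eq s]
  have hσ := (E₁.tensor E₂).morita.2
  have h₁ : ∀ h, (s₁.hom E₁.morita.2).arr h = (E₁.corr E₂).leftHom.arr ((s.hom hσ).arr h) :=
    fun h => s₁.hom_eq E₁.morita.2 (congrArg (fun z => z.1.2)
      (s.lact_hom hσ h ((s.hom hσ).src_arr h) (s.ract_composable h)))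
  -- The projection to `Γ₂` is defined by `γ [s₁, s₂] = [s₁', s₂'] γ'`, primes marking values at the
  -- range. Both sides are identified by moving `s₁'` and `s₂'` along the arrow `h` and using the
  -- equations defining the two induced homomorphisms.
  have h₂ : ∀ h, (s₂.hom E₂.morita.2).arr h =
      (E₁.isMorita_corr E₂).1.rightHom.arr ((s.hom hσ).arr h) := by
    intro h
    have r : ((s.hom hσ).arr h).1.1 = dmk (s₁.toFun _) (s₂.toFun _) (hs _) := (s.hom hσ).rng_arr h
    have r' : ((s.hom hσ).arr h).1.2.2 = dmk (s₁.toFun _) (s₂.toFun _) (hs _) :=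
      (s.hom hσ).src_arr h
    have e1 : E₁.Γ.src ((s.hom hσ).arr h).1.2.1 = E₁.P.left (s₁.toFun ((V.groupoid G).src h)) :=
      ((s.hom hσ).arr h).2.2.trans (congrArg diagLeft r')
    have e2 : E₂.P.left (s₂.toFun ((V.groupoid G).rng h)) =
        E₂.Γ.rng ((s₂.hom E₂.morita.2).arr h) := ((s₂.hom E₂.morita.2).rng_arr h).symm
    have e3 := (E₂.Γ.src_inv ((s₂.hom E₂.morita.2).arr h)).trans e2.symm
    have e4 : E₂.Γ.src ((s₂.hom E₂.morita.2).arr h) = E₂.P.left (s₂.toFun ((V.groupoid G).src h)) :=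
      (s₂.hom E₂.morita.2).src_arr h
    have e5 : E₁.P.right (s₁.toFun ((V.groupoid G).rng h)) = E₂.P.right (E₂.P.lact _ _ e3) :=
      (hs _).trans (E₂.P.right_lact _ _ _).symm
    have e6 := s₁.ract_composable h
    have e7 : E₁.P.right (E₁.P.lact _ _ e1) = E₂.P.right (s₂.toFun ((V.groupoid G).src h)) :=
      (E₁.P.right_lact _ _ _).trans (hs _)
    symm
    refine (E₁.isMorita_corr E₂).1.div_eq (e' := (congrArg diagRight r).trans e2) ?_
    refine (diagRact_congr r ((congrArg diagRight r).trans e2) e2).trans ((diagRact_mk _ _ _ _ _ e3 e5).trans ?_)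
    refine Eq.trans ?_ ((diagLact_mk _ _ _ _ e1 e7).symm.trans (diagLact_congr r'.symm _
      ((s.hom hσ).arr h).2.2))
    refine Eq.trans (dmk_ract e6 (e5.symm.trans e6) _ ?_).symm (dmk_congr ?_ ?_ _ _)
    · rw [E₁.P.right_ract, E₂.P.right_ract]
    · exact (s₁.lact_hom E₁.morita.2 h ((s₁.hom E₁.morita.2).src_arr h) e6).symm.trans
        (E₁.P.lact_congr (h₁ h) rfl _ _)
    · refine (E₂.P.lact_ract _ _ _ e3 (s₂.ract_composable h)).symm.trans ?_
      refine (E₂.P.lact_congr rfl (s₂.lact_hom E₂.morita.2 h e4 _).symm _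
        ((E₂.Γ.src_inv _).trans (E₂.P.left_lact _ _ _).symm)).trans ?_
      exact E₂.P.inv_lact_lact _ _ _ _
  refine (CoverTw.mk_eq_of_twHom_id (pullback_tensor _ _ _)).trans (Eq.trans ?_
    (CoverTw.mk_add_mk _ _).symm)
  refine CoverTw.mk_eq_of_twHom_id (tensor_map
    (((twHom_pullback (s₁.hom E₁.morita.2) E₁.T).to_pullback h₁).to_pullback fun _ => rfl)
    (((twHom_pullback (s₂.hom E₂.morita.2) E₂.T).to_pullback h₂).to_pullback fun _ => rfl))

end TensorProduct

/-- The group laws are transported from `CoverTw`; `RealExtension.coverTw_tensor` then shows that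
this addition is the tensor product of extensions. -/
noncomputable instance {X : RealSpace.{u}} (G : RealGroupoid X) (S : RealAbelianGroup.{u}) :
    AddCommGroup (ExtR G S) :=
  (extREquiv G S).addCommGroup

theorem RealExtension.cls_add_cls {X : RealSpace.{u}} {G : RealGroupoid X}
    {S : RealAbelianGroup.{u}} (E₁ E₂ : RealExtension G S) :
    E₁.cls + E₂.cls = (E₁.tensor E₂).cls := by
  change (extREquiv G S).symm (E₁.coverTw + E₂.coverTw) = _
  rw [← E₁.coverTw_tensor, ← extREquiv_cls, Equiv.symm_apply_apply]

/-- `ExtR(G, S)` is the direct limit of the groups `extR(G[U], S)`. -/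
noncomputable def extRAddEquiv {X : RealSpace.{u}} (G : RealGroupoid X)
    (S : RealAbelianGroup.{u}) : ExtR G S ≃+ CoverLimit G S :=
  AddEquiv.trans { extREquiv G S with
    map_add' := fun _ _ => (extREquiv G S).apply_symm_apply _ } (coverLimitEquiv G S).symm

theorem extRAddEquiv_extension_cls {X : RealSpace.{u}} {G : RealGroupoid X}
    {S : RealAbelianGroup.{u}} {U : RealCover X} (T : RealTwist (U.groupoid G) S) :
    extRAddEquiv G S T.extension.cls = CoverLimit.mk U T := by
  rw [← coverLimitEquiv_symm_mk, ← T.coverTw_extension]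
  rfl

theorem mainTheorem8 {X : RealSpace.{u}} (G : RealGroupoid X) (S : RealAbelianGroup.{u}) :
    ∃ (_ : AddCommGroup (ExtR G S))
      (_ : ∀ U : RealCover X, AddCommGroup (ExtTw (U.groupoid G) S))
      (res : ∀ U V : RealCover X, U.Refinement V →
        (ExtTw (U.groupoid G) S →+ ExtTw (V.groupoid G) S)),
      -- the sum of `ExtR(G, S)` is the tensor product of extensions
      (∀ E₁ E₂ : RealExtension G S, ∃ E, IsExtTensor E₁ E₂ E ∧ E₁.cls + E₂.cls = E.cls) ∧
      -- the sum of `extR(G[U], S)` is the graded Baer sum of twists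
      (∀ (U : RealCover X) (T₁ T₂ : RealTwist (U.groupoid G) S),
        ∃ T, IsTensor T₁ T₂ T ∧ T₁.cls + T₂.cls = T.cls) ∧
      -- the transition maps are the pull-backs along refinements
      (∀ (U V : RealCover X) (θ : U.Refinement V) (T : RealTwist (U.groupoid G) S),
        ∃ T', IsPullback (θ.hom G) T T' ∧ res U V θ T.cls = T'.cls) ∧
      -- the isomorphism; the class of a twist `T` over `G[U]` corresponds to `(T, G[U], G[U] → G)`
      ∃ Φ : ExtR G S ≃+ AbDirectLimit (fun U : RealCover X => ExtTw (U.groupoid G) S) res,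
        ∀ (U : RealCover X) (T : RealTwist (U.groupoid G) S),
          ∃ (P : RealBibundle (U.groupoid G) G) (hP : P.IsMorita),
            RealBibundle.IsGraph (U.toBase G) P ∧
            Φ (RealExtension.mk T P hP).cls =
              AbDirectLimit.of (fun U : RealCover X => ExtTw (U.groupoid G) S) res U T.cls := by
  refine ⟨inferInstance, fun _ => inferInstance, fun _ _ θ => ExtTw.pullback (θ.hom G),
    fun E₁ E₂ => ⟨E₁.tensor E₂, E₁.isExtTensor_tensor E₂, E₁.cls_add_cls E₂⟩,
    fun _ T₁ T₂ => ⟨tensor T₁ T₂, isTensor_tensor T₁ T₂, T₁.cls_add_cls T₂⟩,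
    fun _ _ θ T => ⟨pullback (θ.hom G) T, isPullback_pullback _ _, ExtTw.pullback_cls _ _⟩,
    extRAddEquiv G S, fun U T => ⟨U.baseGraph G, U.isMorita_baseGraph G,
      RealBibundle.isGraph_graph _ _, extRAddEquiv_extension_cls T⟩⟩
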